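/- Let $R$ be a commutative ring and $(Z,z_0)$ a pointed topological space. Let $Q=\mathrm{Sing}^{1\,I}Z$ be the cubical set of singular cubes $I^n\to Z$ that send the $1$-skeleton of $I^n$ to $z_0$, with faces $d^0_i,d^1_i$. For disjoint sets of coordinates write $d^0_Sd^1_T$ for the face on which the coordinates in $S$ are $0$ and those in $T$ are $1$. Let $A=C^*_\square(Z)$ be the dg algebra of normalized cochains of $Q$ with values in $R$, with $$(da)(\sigma)=\sum_{i}(-1)^i\big(a(d^0_i\sigma)-a(d^1_i\sigma)\big),\qquad (ab)(\sigma)=\sum_{S\sqcup T=\{1,\dots,n\}}\mathrm{shuff}(S;T)\,a(d^0_T\sigma)\,b(d^1_S\sigma),$$ where $\mathrm{shuff}(S;T)=\pm1$ is the sign of the shuffle. For $a\in A^{k}$, $k\ge 1$, let $\bar a$ be the desuspension of $a$, of degree $|\bar a|=k-1$; let $BA$ be the tensor module on $\{\bar a: a\in A^{>0}\}$, with elements $[\bar a_1|\cdots|\bar a_n]$, and let $B(A;A)=A\otimes BA$ be the acyclic bar construction. With $\varepsilon_i=|\bar a_1|+\cdots+|\bar a_i|$, the differentials of $BA$ and of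 $B(A;A)$ are $$d[\bar a_1|\cdots|\bar a_n]=-\sum_i(-1)^{\varepsilon_{i-1}}[\cdots|\overline{da_i}|\cdots]-\sum_{i<n}(-1)^{\varepsilon_i}[\cdots|\overline{a_ia_{i+1}}|\cdots],$$ $$d(a_0\otimes[\bar a_1|\cdots|\bar a_n])=da_0\otimes[\bar a_1|\cdots|\bar a_n]+(-1)^{|a_0|}a_0\otimes d[\bar a_1|\cdots|\bar a_n]-(-1)^{|a_0|}a_0a_1\otimes[\bar a_2|\cdots|\bar a_n]$$ (the last term is absent for $n=0$). *Complementary pairs.* For a permutation $x=x_1|\cdots|x_n$ of $\{1,\dots,n\}$ let $u_x$ and $v_x$ be the ordered partitions of $\{1,\dots,n\}$ into the maximal decreasing, respectively increasing, runs of $x$. A complementary pair at $x$ is a pair $(u,v)$ of ordered partitions such that $u$ arises from $u_x=A_1|\cdots|A_p$ by moving successively, for $i=1,\dots,p-1$, a possibly empty proper subset $M$ of the current block $A_i$ with $\min M>\max A_{i+1}$ into $A_{i+1}$, and $v$ arises from $v_x=C_1|\cdots|C_q$ by moving successively, for $j=q,\dots,2$, a possibly empty proper subset $N$ of the current block $C_j$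 with $\min N>\max C_{j-1}$ into $C_{j-1}$. For an ordered partition $w=W_1|\cdots|W_r$ let $\mathrm{psgn}(w)$ be the sign of the permutation obtained by writing each block in increasing order, and put $$\mathrm{sgn}_1(w)=(-1)^{\sum_i (r-i)\#W_i}\,\mathrm{psgn}(w),\quad \mathrm{sgn}_2(w)=(-1)^{\binom{r-1}{2}}\mathrm{sgn}_1(w),\quad \mathrm{rsgn}(w)=(-1)^{\frac12\left(\sum_i(\#W_i)^2-n\right)},$$ $$\mathrm{sgn}(u,v)=(-1)^{\binom q2}\,\mathrm{rsgn}(u_x)\,\mathrm{sgn}_1(v)\,\mathrm{sgn}_2(u)\,\mathrm{sgn}_2(u_x),\qquad q=\#\{\text{blocks of }v\}.$$ *Hirsch operations.* For homogeneous $a_1,\dots,a_p,b_1,\dots,b_q\in A^{>0}$, $p+q>0$, the cochain $E_{p,q}(a_1,\dots,a_p;b_1,\dots,b_q)$ of degree $\sum|a_i|+\sum|b_j|+1-p-q$ has the value $$\sum_{(u,v)}\mathrm{sgn}(u,v)\,a_1(\sigma_1)\cdots a_p(\sigma_p)\,b_1(\sigma'_1)\cdots b_q(\sigma'_q)$$ on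 a nondegenerate $n$-cube $\sigma$, $n$ being this degree. The sum is over all permutations $x$ of $\{1,\dots,n\}$ and all complementary pairs $(u,v)$ at $x$ such that $u$ has exactly $p$ and $v$ exactly $q$ blocks with more than one element; $\sigma_i$ is the face $d^0_{S}d^1_{T}\sigma$, where $S$ is the union of the blocks of $u$ after, and $T$ the union of those before, the $i$-th block of $u$ with more than one element, and $\sigma'_j$ is defined in the same way from $v$. (In particular $E_{1,0}=E_{0,1}=\mathrm{Id}$ and $E_{p,0}=E_{0,p}=0$ for $p>1$.) An operation with $b_1\in A^0$ is $0$, except that $E_{0,1}=\mathrm{Id}$. On $BA$ let $$[\bar a_1|\cdots|\bar a_n]\circ[\bar b_1|\cdots|\bar b_m]=\sum(-1)^{\sum_{i<j}|\beta_i||\alpha_j|}\,\big[\overline{E(\alpha_1;\beta_1)}|\cdots|\overline{E(\alpha_k;\beta_k)}\big],$$ the sum being over all $k$ and all ways to cut $(\bar a_1,\dots,\bar a_n)$ and $(\bar b_1,\dots,\bar b_m)$ into consecutive, possibly empty pieces $\alpha_1,\dots,\alpha_k$ and $\beta_1,\dots,\beta_k$ such that $\alpha_i$ and $\beta_i$ are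 never both empty; $|\alpha|$ is the sum of the degrees $|\bar a_i|$ in $\alpha$, $E$ is the operation $E_{p,q}$ for the lengths of the pieces, and $[\,]\circ[\,]=[\,]$. **Corollary.** The above differential on $B(A;A)=B(C^*_\square(Z);C^*_\square(Z))$ is well defined and of square zero, and there is a well defined bilinear multiplication on $B(A;A)$ such that, for homogeneous $a_0,b_0\in A$ and homogeneous $a_i,b_j\in A^{>0}$ ($1\le i\le n$, $1\le j\le m$), the elements $a=a_0\otimes[\bar a_1|\cdots|\bar a_n]$ and $b=b_0\otimes[\bar b_1|\cdots|\bar b_m]$ have the product $$ab=\sum_{0\le p\le n,\;1\le q\le m+1}(-1)^{\epsilon}\,a_0\,E_{p,q}(a_1,\dots,a_p;\,b_0,b_1,\dots,b_{q-1})\otimes[\bar a_{p+1}|\cdots|\bar a_n]\circ[\bar b_q|\cdots|\bar b_m],$$ $$\epsilon=|\bar a_1|+\cdots+|\bar a_p|+\big(|\bar a_{p+1}|+\cdots+|\bar a_n|\big)\big(|b_0|+|\bar b_1|+\cdots+|\bar b_{q-1}|\big).$$ With it $B(A;A)$ is a (not necessarily associative) dg algebra: $d$ has degree $1$, the multiplication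 has degree $0$ and two-sided unit $1\otimes[\,]$, and $d(ab)=d(a)\,b+(-1)^{|a|}a\,d(b)$. -/

import Mathlib

open scoped TensorProduct DirectSum

noncomputable section

namespace CubicalBar

universe u v

/-! ### Cubical sets -/

/-- A cubical set: cells with faces `d^0_i` (`face false i`), `d^1_i` (`face true i`) and
degeneracies `η_i`.  The coordinates of an `n`-cube are numbered `0, …, n-1`. -/
structure CubicalSet where
  cell : ℕ → Type u
  face : Bool → ∀ {n : ℕ}, Fin (n + 1) → cell (n + 1) → cell n
  degen : ∀ {n : ℕ}, Fin (n + 1) → cell n → cell (n + 1)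
  face_face : ∀ (ε ω : Bool) {n : ℕ} (i j : Fin (n + 1)) (σ : cell (n + 2)), i ≤ j →
    face ε i (face ω j.succ σ) = face ω j (face ε i.castSucc σ)
  face_degen_self : ∀ (ε : Bool) {n : ℕ} (i : Fin (n + 1)) (σ : cell n),
    face ε i (degen i σ) = σ
  face_degen_lt : ∀ (ε : Bool) {n : ℕ} (i j : Fin (n + 1)) (σ : cell (n + 1)), i ≤ j →
    face ε i.castSucc (degen j.succ σ) = degen j (face ε i σ)
  face_degen_gt : ∀ (ε : Bool) {n : ℕ} (i j : Fin (n + 1)) (σ : cell (n + 1)), j ≤ i →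
    face ε i.succ (degen j.castSucc σ) = degen j (face ε i σ)
  degen_degen : ∀ {n : ℕ} (i j : Fin (n + 1)) (σ : cell n), i ≤ j →
    degen i.castSucc (degen j σ) = degen j.succ (degen i σ)

/-- The `1`-skeleton of `I^n`: all coordinates, except possibly one, are `0` or `1`. -/
def oneSkeleton (n : ℕ) : Set (Fin n → unitInterval) :=
  {t | ∀ i j : Fin n, i ≠ j → (t i = 0 ∨ t i = 1) ∨ (t j = 0 ∨ t j = 1)}

/-- The endpoint `0` or `1` of the interval. -/
def endpoint : Bool → unitInterval
  | false => 0
  | true => 1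

theorem endpoint_eq (ε : Bool) : endpoint ε = 0 ∨ endpoint ε = 1 := by
  cases ε <;> simp [endpoint]

theorem insertNth_mem_oneSkeleton {n : ℕ} (i : Fin (n + 1)) (ε : Bool) {t : Fin n → unitInterval}
    (ht : t ∈ oneSkeleton n) :
    (i.insertNth (endpoint ε) t : Fin (n + 1) → unitInterval) ∈ oneSkeleton (n + 1) := by
  intro a b hab
  rcases Fin.eq_self_or_eq_succAbove i a with rfl | ⟨a, rfl⟩
  · left; simpa using endpoint_eq ε
  · rcases Fin.eq_self_or_eq_succAbove i b with rfl | ⟨b, rfl⟩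
    · right; simpa using endpoint_eq ε
    · simpa using ht a b (fun h => hab (by rw [h]))

theorem removeNth_mem_oneSkeleton {n : ℕ} (i : Fin (n + 1)) {t : Fin (n + 1) → unitInterval}
    (ht : t ∈ oneSkeleton (n + 1)) : (fun k => t (i.succAbove k)) ∈ oneSkeleton n := by
  intro a b hab
  exact ht _ _ (fun h => hab (Fin.succAbove_right_injective h))

theorem succAbove_comm {n : ℕ} (i j : Fin (n + 1)) (h : i ≤ j) (k : Fin n) :
    j.succ.succAbove (i.succAbove k) = i.castSucc.succAbove (j.succAbove k) := by
  simp only [Fin.succAbove, Fin.ext_iff, Fin.lt_def, Fin.le_def] at *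
  grind

theorem succ_succAbove_of_le {n : ℕ} (i j : Fin (n + 1)) (h : i ≤ j) :
    j.succ.succAbove i = i.castSucc :=
  Fin.succAbove_of_castSucc_lt _ _ (Fin.castSucc_lt_succ_iff.2 h)

theorem castSucc_succAbove_of_le {n : ℕ} (i j : Fin (n + 1)) (h : i ≤ j) :
    i.castSucc.succAbove j = j.succ :=
  Fin.succAbove_of_le_castSucc _ _ (Fin.castSucc_le_castSucc_iff.2 h)

theorem insertNth_insertNth {n : ℕ} (i j : Fin (n + 1)) (hij : i ≤ j) (x y : unitInterval)
    (t : Fin n → unitInterval) :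
    (j.succ.insertNth y (i.insertNth x t : Fin (n + 1) → unitInterval) :
        Fin (n + 2) → unitInterval) =
      i.castSucc.insertNth x (j.insertNth y t : Fin (n + 1) → unitInterval) := by
  funext k
  rcases Fin.eq_self_or_eq_succAbove i.castSucc k with rfl | ⟨k, rfl⟩
  · rw [Fin.insertNth_apply_same, ← succ_succAbove_of_le i j hij, Fin.insertNth_apply_succAbove,
      Fin.insertNth_apply_same]
  · rw [Fin.insertNth_apply_succAbove]
    rcases Fin.eq_self_or_eq_succAbove j k with rfl | ⟨k, rfl⟩
    · rw [Fin.insertNth_apply_same, castSucc_succAbove_of_le i k hij, Fin.insertNth_apply_same]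
    · rw [← succAbove_comm i j hij, Fin.insertNth_apply_succAbove, Fin.insertNth_apply_succAbove,
        Fin.insertNth_apply_succAbove]

/-- The Eilenberg `1`-subcomplex of the singular cubical complex of the pointed space `(Z, z₀)`:
singular cubes `I^n → Z` that send the `1`-skeleton of `I^n` to the base point. -/
def singOne (Z : Type u) [TopologicalSpace Z] (z₀ : Z) : CubicalSet.{u} where
  cell n := {f : C(Fin n → unitInterval, Z) // ∀ t ∈ oneSkeleton n, f t = z₀}
  face ε _ i f :=
    ⟨⟨fun t => f.1 (i.insertNth (endpoint ε) t), by
      have h : Continuous fun t : Fin _ → unitInterval =>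
          (i.insertNth (endpoint ε) t : Fin _ → unitInterval) :=
        Continuous.finInsertNth i continuous_const continuous_id
      exact f.1.continuous.comp h⟩,
      fun _ ht => f.2 _ (insertNth_mem_oneSkeleton i ε ht)⟩
  degen i f :=
    ⟨⟨fun t => f.1 (fun k => t (i.succAbove k)), by fun_prop⟩,
      fun _ ht => f.2 _ (removeNth_mem_oneSkeleton i ht)⟩
  face_face ε ω n i j f hij := by
    apply Subtype.ext
    ext t
    exact congrArg f.1 (insertNth_insertNth i j hij _ _ t)
  face_degen_self ε n i f := by
    apply Subtype.ext
    ext t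
    exact congrArg f.1 (by funext k; simp)
  face_degen_lt ε n i j f hij := by
    apply Subtype.ext
    ext t
    refine congrArg f.1 ?_
    funext k
    rcases Fin.eq_self_or_eq_succAbove i k with rfl | ⟨k, rfl⟩
    · rw [succ_succAbove_of_le k j hij, Fin.insertNth_apply_same, Fin.insertNth_apply_same]
    · rw [succAbove_comm i j hij, Fin.insertNth_apply_succAbove, Fin.insertNth_apply_succAbove]
  face_degen_gt ε n i j f hij := by
    apply Subtype.ext
    ext t
    refine congrArg f.1 ?_
    funext k
    rcases Fin.eq_self_or_eq_succAbove i k with rfl | ⟨k, rfl⟩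
    · rw [castSucc_succAbove_of_le j k hij, Fin.insertNth_apply_same, Fin.insertNth_apply_same]
    · rw [← succAbove_comm j i hij, Fin.insertNth_apply_succAbove, Fin.insertNth_apply_succAbove]
  degen_degen i j f hij := by
    apply Subtype.ext
    ext t
    refine congrArg f.1 ?_
    funext k
    exact congrArg t (succAbove_comm i j hij k).symm

namespace CubicalSet

variable (Q : CubicalSet.{u})

/-- Cells of all dimensions. -/
abbrev Cell : Type u := Σ n, Q.cell n

variable {Q}

/-- A cell is degenerate if it is in the image of some `η_i`. -/
def IsDegenerate (τ : Q.Cell) : Prop :=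
  ∃ (n : ℕ) (i : Fin (n + 1)) (ρ : Q.cell n), τ = ⟨n + 1, Q.degen i ρ⟩

/-- The face operator `d^ε_i` on cells of all dimensions (used only where `i` is a coordinate of
the cell). -/
def faceAt (ε : Bool) (i : ℕ) : Q.Cell → Q.Cell
  | ⟨0, σ⟩ => ⟨0, σ⟩
  | ⟨n + 1, σ⟩ => if h : i < n + 1 then ⟨n, Q.face ε ⟨i, h⟩ σ⟩ else ⟨n + 1, σ⟩

/-- The iterated face `d^0_S d^1_T σ`, for disjoint sets `S`, `T` of coordinates of `σ`:
the coordinates in `S` are set to `0`, those in `T` to `1`.  Faces are taken from the largest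
coordinate to the smallest, so that the labels of the remaining coordinates stay correct. -/
def iterFace (S T : Finset ℕ) (σ : Q.Cell) : Q.Cell :=
  (List.range σ.1).foldr
    (fun i τ => if i ∈ S then faceAt false i τ else if i ∈ T then faceAt true i τ else τ) σ

end CubicalSet

open CubicalSet

/-! ### Normalized cochains -/

section Cochains

variable (R : Type v) [CommRing R] (Q : CubicalSet.{u})

/-- Normalized cubical `n`-cochains with coefficients in `R`: functions on the basis of the
normalized chains, that is, on the nondegenerate `n`-cells. -/
abbrev Cochain (n : ℕ) : Type (max u v) := {τ : Q.Cell // τ.1 = n ∧ ¬ IsDegenerate τ} → R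

variable {R Q}

open Classical in
/-- The value of an `n`-cochain on an arbitrary cell: `0` on degenerate cells and on cells of
dimension other than `n`. -/
def Cochain.eval {n : ℕ} (a : Cochain R Q n) (τ : Q.Cell) : R :=
  if h : τ.1 = n ∧ ¬ IsDegenerate τ then a ⟨τ, h⟩ else 0

/-- The `n`-cochain with prescribed values on the nondegenerate `n`-cells. -/
def Cochain.ofFun (n : ℕ) (f : Q.Cell → R) : Cochain R Q n := fun τ => f τ.1

/-- The unit cochain in degree `0`. -/
def Cochain.unit : Cochain R Q 0 := fun _ => 1

/-- Number of pairs `s ∈ A`, `t ∈ B` with `t < s`. -/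
def crossings (A B : Finset ℕ) : ℕ := ((A ×ˢ B).filter fun p => p.2 < p.1).card

/-- The coboundary `(δa)(σ) = a(∂σ)` with
`∂σ = ∑_{i=1}^{n} (-1)^i (d^0_i σ - d^1_i σ)` (coordinates being numbered from `0` in the code). -/
def Cochain.coboundary {n : ℕ} (a : Cochain R Q n) : Cochain R Q (n + 1) :=
  Cochain.ofFun (n + 1) fun σ =>
    ∑ i ∈ Finset.range (n + 1),
      (-1) ^ (i + 1) * (a.eval (faceAt false i σ) - a.eval (faceAt true i σ))

/-- The cup product dual to the diagonal
`σ ↦ ∑ shuff(A;B) d^0_B σ ⊗ d^1_A σ`, the sum being over all `A ⊔ B = {coordinates of σ}`. -/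
def Cochain.cup {p q : ℕ} (a : Cochain R Q p) (b : Cochain R Q q) : Cochain R Q (p + q) :=
  Cochain.ofFun (p + q) fun σ =>
    ∑ A ∈ (Finset.range (p + q)).powerset,
      (-1) ^ crossings A (Finset.range (p + q) \ A) *
        (a.eval (iterFace (Finset.range (p + q) \ A) ∅ σ) * b.eval (iterFace ∅ A σ))

end Cochains

/-! ### The diagonal of the permutahedron -/

/-- The maximal runs of consecutive entries of a sequence along which `r` holds, as sets. -/
def runs (r : ℕ → ℕ → Bool) : List ℕ → List (Finset ℕ)
  | [] => []
  | a :: l =>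
    match l, runs r l with
    | b :: _, B :: Bs => if r a b then insert a B :: Bs else {a} :: B :: Bs
    | _, _ => [{a}]

/-- The ordered partition into maximal decreasing runs. -/
def decreasingRuns (x : List ℕ) : List (Finset ℕ) := runs (fun a b => decide (b < a)) x

/-- The ordered partition into maximal increasing runs. -/
def increasingRuns (x : List ℕ) : List (Finset ℕ) := runs (fun a b => decide (a < b)) x

/-- All ordered partitions obtained from `A_1|…|A_p` by successively moving, for `i = 1, …, p-1`,
a (possibly empty) proper subset `M` of the current `i`-th block with `min M > max A_{i+1}` into
the next block. -/
def rightShifts : List (Finset ℕ) → Finset (List (Finset ℕ))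
  | [] => {[]}
  | [A] => {[A]}
  | A :: B :: l =>
    (A.powerset.filter fun M => M ≠ A ∧ ∀ m ∈ M, ∀ b ∈ B, b < m).biUnion fun M =>
      (rightShifts ((B ∪ M) :: l)).image fun w => (A \ M) :: w
  termination_by l => l.length

/-- All ordered partitions obtained from `C_1|…|C_q` by successively moving, for `j = q, …, 2`,
a (possibly empty) proper subset `N` of the current `j`-th block with `min N > max C_{j-1}` into
the preceding block. -/
def leftShifts (w : List (Finset ℕ)) : Finset (List (Finset ℕ)) :=
  (rightShifts w.reverse).image List.reverse

/-- Exponent of `psgn`: the number of inversions of the sequence `A_1|…|A_p`, each block being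
written in increasing order. -/
def inversions : List (Finset ℕ) → ℕ
  | [] => 0
  | A :: l => (l.map (crossings A)).sum + inversions l

/-- `ε_1 = ∑_i i · #A_{p-i}` for a partition into `p` blocks `A_1|…|A_p`. -/
def epsOne : List (Finset ℕ) → ℕ
  | [] => 0
  | A :: l => l.length * A.card + epsOne l

/-- Exponent of the sign `sgn_1`. -/
def sgnOneExp (w : List (Finset ℕ)) : ℕ := epsOne w + inversions w

/-- Exponent of the sign `sgn_2`. -/
def sgnTwoExp (w : List (Finset ℕ)) : ℕ :=
  epsOne w + (w.length - 1).choose 2 + inversions w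

/-- Exponent of the sign `rsgn`, `½ (∑ (#A_i)² - ∑ #A_i)`. -/
def rsgnExp (w : List (Finset ℕ)) : ℕ := (w.map fun A => A.card.choose 2).sum

/-- Exponent of the sign of the complementary pair `(u, v)` at the vertex `x`,
`(-1)^{q(q-1)/2} rsgn(u_x) sgn_1(v) sgn_2(u) sgn_2(u_x)`, where `q` is the number of blocks of `v`
and `u_x` is the partition into decreasing runs of `x`. -/
def pairSgnExp (x : List ℕ) (u v : List (Finset ℕ)) : ℕ :=
  v.length.choose 2 + rsgnExp (decreasingRuns x) + sgnOneExp v + sgnTwoExp u +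
    sgnTwoExp (decreasingRuns x)

/-- The vertex of the permutahedron given by a permutation of the coordinates `0, …, n-1`. -/
def vertex {n : ℕ} (x : Equiv.Perm (Fin n)) : List ℕ := List.ofFn fun i => (x i : ℕ)

/-! ### Hirsch operations and the bar construction -/

section Bar

variable (R : Type v) [CommRing R] (Q : CubicalSet.{u})

/-- Homogeneous elements of the desuspension of the positive degree cochains: a pair `⟨n, a⟩` is
an element `ā` of degree `n` given by a cochain `a` of degree `n + 1`. -/
abbrev BarLetter : Type (max u v) := Σ n, Cochain R Q (n + 1)

/-- The algebra `A = C^*(Q)` of normalized cochains, as a module. -/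
abbrev Cochains : Type (max u v) := ⨁ n, Cochain R Q n

/-- The desuspension of `A^{>0}`, graded so that `A^{n+1}` sits in degree `n`. -/
abbrev BarCochains : Type (max u v) := ⨁ n, Cochain R Q (n + 1)

/-- The bar construction `BA`, as a module. -/
abbrev Bar : Type (max u v) := TensorAlgebra R (BarCochains R Q)

/-- The acyclic bar construction `B(A;A) = A ⊗ BA`, as a module. -/
abbrev AcyclicBar : Type (max u v) := Cochains R Q ⊗[R] Bar R Q

variable {R Q}

/-- The degree `|ā_1| + ⋯ + |ā_p|`. -/
def barDegree (as : List (BarLetter R Q)) : ℕ := (as.map Sigma.fst).sum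

/-- The element `[ā]` of the bar construction. -/
def barι {n : ℕ} (a : Cochain R Q (n + 1)) : Bar R Q :=
  TensorAlgebra.ι R (DirectSum.lof R ℕ (fun k => Cochain R Q (k + 1)) n a)

/-- The element `[ā_1|…|ā_p]` of the bar construction. -/
def barWord (as : List (BarLetter R Q)) : Bar R Q := (as.map fun a => barι a.2).prod

/-- The element `a ⊗ x` of the acyclic bar construction. -/
def acyclicBarMk {n : ℕ} (a : Cochain R Q n) (x : Bar R Q) : AcyclicBar R Q :=
  DirectSum.lof R ℕ (fun k => Cochain R Q k) n a ⊗ₜ[R] x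

/-- The cells `d^0_{A_{i+1} ∪ ⋯ ∪ A_p} d^1_{A_1 ∪ ⋯ ∪ A_{i-1}} σ` for the blocks `A_i` with more
than one element of an ordered partition `A_1|…|A_p` of the coordinates of `σ`; the `1`-dimensional
cells that belong to one-element blocks are omitted.  The first argument is the union of the
blocks that have already been treated. -/
def blockFaces (σ : Q.Cell) : Finset ℕ → List (Finset ℕ) → List Q.Cell
  | _, [] => []
  | T, A :: l =>
    if A.card = 1 then blockFaces σ (T ∪ A) l
    else iterFace (l.foldr (· ∪ ·) ∅) T σ :: blockFaces σ (T ∪ A) l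

/-- `a_1(τ_1) ⋯ a_p(τ_p)` if there are as many cochains as cells, and `0` otherwise. -/
def evalWord : List (BarLetter R Q) → List Q.Cell → R
  | [], [] => 1
  | a :: as, τ :: w => Cochain.eval a.2 τ * evalWord as w
  | _, _ => 0

/-- The value on a cell `σ` of the Hirsch operation `E_{p,q}(a_1,…,a_p; b_1,…,b_q)` on cochains
of positive degree: the sum over the complementary pairs `(u, v)` of the diagonal of the
permutahedron. -/
def hirschValue (as bs : List (BarLetter R Q)) (σ : Q.Cell) : R :=
  ∑ x : Equiv.Perm (Fin σ.1),
    ∑ u ∈ rightShifts (decreasingRuns (vertex x)),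
      ∑ v ∈ leftShifts (increasingRuns (vertex x)),
        (-1) ^ pairSgnExp (vertex x) u v *
          (evalWord as (blockFaces σ ∅ u) * evalWord bs (blockFaces σ ∅ v))

/-- `E_{p,q}(a_1,…,a_p; b_1,…,b_q)` for cochains of positive degree, `p + q > 0`; it is a cochain
of degree `∑ |ā_i| + ∑ |b̄_j| + 1`. -/
def hirsch (as bs : List (BarLetter R Q)) :
    Cochain R Q (barDegree as + barDegree bs + 1) :=
  Cochain.ofFun _ (hirschValue as bs)

/-- `E_{p,q}(a_1,…,a_p; b_0,…,b_{q-1})`, where `b_0` may have degree `0`: operations with an entry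
of degree `0` vanish except for `E_{0,1} = Id`.  It is a cochain of degree
`∑ |ā_i| + |b_0| + ∑_{j>0} |b̄_j|`. -/
def hirschLead (as : List (BarLetter R Q)) : ∀ {m : ℕ}, Cochain R Q m →
    ∀ bs : List (BarLetter R Q), Cochain R Q (barDegree as + m + barDegree bs)
  | 0, b, bs => Cochain.ofFun _ fun σ => if as = [] ∧ bs = [] then b.eval σ else 0
  | k + 1, b, bs => Cochain.ofFun _ (hirschValue as (⟨k, b⟩ :: bs))

/-- The bar differential
`d[ā_1|…|ā_n] = -∑ (-1)^{ε_{i-1}} [ā_1|…|\overline{δa_i}|…|ā_n]`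
`- ∑ (-1)^{ε_i} [ā_1|…|\overline{a_i a_{i+1}}|…|ā_n]`, `ε_i = |ā_1| + ⋯ + |ā_i|`. -/
def barDiff : List (BarLetter R Q) → Bar R Q
  | [] => 0
  | [a] => -barι (Cochain.coboundary a.2)
  | a :: b :: l =>
    -(barι (Cochain.coboundary a.2) * barWord (b :: l))
      - (-1 : R) ^ a.1 • (barι (n := a.1 + 1 + b.1) (Cochain.cup (p := a.1 + 1) (q := b.1 + 1) a.2 b.2) * barWord l)
      + (-1 : R) ^ a.1 • (barι a.2 * barDiff (b :: l))

/-- The differential of the acyclic bar construction: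
`d(a_0 ⊗ [ā_1|…|ā_n]) = δa_0 ⊗ [ā_1|…|ā_n] + (-1)^{|a_0|} a_0 ⊗ d[ā_1|…|ā_n]`
`- (-1)^{|a_0|} a_0 a_1 ⊗ [ā_2|…|ā_n]`. -/
def acyclicBarDiff {n : ℕ} (a₀ : Cochain R Q n) (as : List (BarLetter R Q)) : AcyclicBar R Q :=
  acyclicBarMk a₀.coboundary (barWord as) + (-1 : R) ^ n • acyclicBarMk a₀ (barDiff as) -
    match as with
    | [] => 0
    | a :: l => (-1 : R) ^ n • acyclicBarMk (a₀.cup a.2) (barWord l)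

/-- The product `[ā_1|…|ā_n] ∘ [b̄_1|…|b̄_m]` on the bar construction: the sum of all
`± [E(α_1;β_1)|…|E(α_k;β_k)]` over the ways to cut `(ā_1,…,ā_n)` into `α_1,…,α_k` and
`(b̄_1,…,b̄_m)` into `β_1,…,β_k`, with no `(α_i, β_i)` empty; the sign is `-1` to the power
`∑_{i<j} |β_i||α_j|`. -/
def barProd (as bs : List (BarLetter R Q)) : Bar R Q :=
  if as = [] ∧ bs = [] then 1
  else
    ∑ i : Fin (as.length + 1), ∑ j : Fin (bs.length + 1),
      if _h : 0 < (i : ℕ) + j then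
        (-1 : R) ^ (barDegree (bs.take j) * barDegree (as.drop i)) •
          (barι (hirsch (as.take i) (bs.take j)) * barProd (as.drop i) (bs.drop j))
      else 0
  termination_by as.length + bs.length
  decreasing_by
    have := i.2
    have := j.2
    simp only [List.length_drop]
    omega

variable (R Q)

/-- The degree `k` part of the acyclic bar construction. -/
def acyclicBarDegree (k : ℕ) : Submodule R (AcyclicBar R Q) :=
  Submodule.span R {z | ∃ (n : ℕ) (a₀ : Cochain R Q n) (as : List (BarLetter R Q)),
    n + barDegree as = k ∧ z = acyclicBarMk a₀ (barWord as)}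

end Bar

end CubicalBar

end

open CubicalBar
open scoped TensorProduct

open scoped TensorProduct DirectSum

noncomputable section

namespace CubicalBar

universe u v

open CubicalSet

/-! ### Iterated faces of cells -/

section Faces

variable {Q : CubicalSet.{u}}

/-! The heart of the proof is a twisting (Maurer-Cartan) equation for the diagonals of all
permutahedra at once. A finite set of coordinates together with two words of blocks is a basis
element of `DiagAlgebra`. The product concatenates the words and multiplies the sets as exterior
monomials. The odd derivation `diff` subdivides blocks, which is the cellular boundary of the
permutahedra. The signed sum `diagonal` of all complementary pairs satisfies `dD = D * D`
(`maurerCartan_diagonal`). This expresses that the explicit diagonal is compatible with boundaries,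
the facets of a permutahedron being products of two permutahedra.

The equation is proved by adjoining a largest coordinate `n`. Decreasing runs break before `n` and
increasing runs break after it. Hence a complementary pair at `y n z` is the concatenation of a pair
at `y`, with `n` put into a block of its second partition, and a pair at `z`, with `n` put into a
block of its first partition. So the new diagonal is `D + P T e`, where `e` is an odd exterior
generator and `P`, `T` are the letter `{n}` in one factor plus an insertion derivation applied to
`D` (`diagonal_succ`). Insertion and subdivision commute up to a bracket with the letter `{n}`
(`splitLetter_insLetter`). Therefore `dP = DP - PD` and `dT = DT - TD`, and the induction step is
formal (`maurerCartan_step`).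

Cochains enter by evaluation. On the faces of a fixed cube, indexed by pairs of sets of coordinates,
the cup product is a convolution and the coboundary is the graded commutator with the indicator
`atom` of edges; this gives the dg algebra axioms. When words of cochains are evaluated on words of
blocks, subdivision becomes the bar differential (`splitWord_wordValue`) and the product of
`DiagAlgebra` becomes the sum over cuts of the words (`pairEval_mul`). Since all edges are
degenerate, the diagonal evaluates to the Hirsch operations `E` plus `atom` on the empty pair. Then
`dD = D * D` becomes the structure equation of the Hirsch operations: the mixed terms with `atom`
give the coboundary of `E`, the others give cup products (`hirschCell_maurerCartan`). The operations
have the right degree and vanish on degenerate cubes because the blocks of a complementary pair form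
a tree whose edges are the coordinates (`IsTree`).

The remainder is algebra of words. The structure equation makes the bar differential a derivation of
the product of the bar construction (`diffB_barProd`): the quadratic terms cancel because cutting
into three pieces is associative. The same argument with a distinguished entry `b_0` gives the
Leibniz rule on the acyclic bar construction (`diffA_wordProd`). If `b_0` has positive degree it is
an ordinary letter; in degree zero it is a multiple of the unit, because there is only one vertex.
The unit laws follow from `E_{1,0} = E_{0,1} = Id` and the vanishing of the longer operations with
an empty argument. -/

theorem faceAt_dim (ε : Bool) (i : ℕ) (τ : Q.Cell) (h : i < τ.1) :
    (faceAt ε i τ).1 = τ.1 - 1 := by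
  obtain ⟨n, σ⟩ := τ
  cases n with
  | zero => simp at h
  | succ n => simp only at h; simp [faceAt, h]

theorem faceAt_comm (ε ω : Bool) (i j : ℕ) (τ : Q.Cell) (hij : i ≤ j) (hj : j + 1 < τ.1) :
    faceAt ε j (faceAt ω i τ) = faceAt ω i (faceAt ε (j + 1) τ) := by
  obtain ⟨n, σ⟩ := τ
  obtain _ | _ | n := n
  · simp at hj
  · simp at hj
  · simp only at hj
    have h1 : i < n + 1 + 1 := by omega
    have h2 : j < n + 1 := by omega
    have h3 : i < n + 1 := by omega
    have h4 : j + 1 < n + 1 + 1 := by omega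
    simp only [faceAt, h1, h2, h3, h4, dif_pos]
    have := Q.face_face ω ε (⟨i, h3⟩ : Fin (n + 1)) ⟨j, h2⟩ σ hij
    exact congrArg (Sigma.mk n) this.symm

/-- The face of `σ` obtained by fixing the coordinates in the increasing list `L`, the coordinate
`i` to the value `t i`. -/
def faceWord (t : ℕ → Bool) (L : List ℕ) (σ : Q.Cell) : Q.Cell :=
  L.foldr (fun i τ => faceAt (t i) i τ) σ

/-- The `i`-th natural number that does not belong to the increasing list `L`. -/
def skip : List ℕ → ℕ → ℕ
  | [], i => i
  | a :: L, i => if i < a then i else skip L (i + 1)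

theorem le_skip (L : List ℕ) (i : ℕ) : i ≤ skip L i := by
  induction L generalizing i with
  | nil => simp [skip]
  | cons a L ih =>
    simp only [skip]
    split_ifs
    · rfl
    · exact (Nat.le_succ i).trans (ih _)

theorem skip_strictMono (L : List ℕ) : StrictMono (skip L) := by
  induction L with
  | nil => exact strictMono_id
  | cons a L ih =>
    intro i j hij
    simp only [skip]
    split_ifs with h1 h2
    · exact hij
    · exact hij.trans (Nat.lt_of_lt_of_le (Nat.lt_succ_self j) (le_skip L _))
    · omega
    · exact ih (by omega)

theorem skip_notMem {L : List ℕ} (hL : L.Pairwise (· < ·)) (i : ℕ) : skip L i ∉ L := by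
  induction L generalizing i with
  | nil => simp
  | cons a L ih =>
    rw [List.pairwise_cons] at hL
    simp only [skip]
    split_ifs with h
    · simp only [List.mem_cons, not_or]
      exact ⟨by omega, fun h' => by have := hL.1 _ h'; omega⟩
    · simp only [List.mem_cons, not_or]
      exact ⟨by have := le_skip L (i + 1); omega, ih hL.2 _⟩

theorem skip_lt {L : List ℕ} (hL : L.Pairwise (· < ·)) {n : ℕ} (hn : ∀ a ∈ L, a < n) {i : ℕ}
    (hi : i + L.length < n) : skip L i < n := by
  induction L generalizing i with
  | nil => simpa [skip] using hi
  | cons a L ih =>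
    rw [List.pairwise_cons] at hL
    simp only [List.length_cons] at hi
    simp only [skip]
    split_ifs with h
    · omega
    · exact ih hL.2 (fun b hb => hn b (by simp [hb])) (by omega)

theorem length_le_of_sorted {L : List ℕ} (hL : L.Pairwise (· < ·)) {m n : ℕ}
    (hn : ∀ a ∈ L, m ≤ a ∧ a < n) : L.length ≤ n - m := by
  induction L generalizing m with
  | nil => simp
  | cons a L ih =>
    rw [List.pairwise_cons] at hL
    have ha := hn a (by simp)
    have := ih hL.2 (m := a + 1) (fun b hb => ⟨hL.1 b hb, (hn b (by simp [hb])).2⟩)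
    simp only [List.length_cons]; omega

theorem faceWord_dim (t : ℕ → Bool) {L : List ℕ} (hL : L.Pairwise (· < ·)) (σ : Q.Cell)
    (hn : ∀ a ∈ L, a < σ.1) : (faceWord t L σ).1 = σ.1 - L.length := by
  induction L with
  | nil => simp [faceWord]
  | cons a L ih =>
    rw [List.pairwise_cons] at hL
    have h1 := ih hL.2 (fun b hb => hn b (by simp [hb]))
    have h2 := length_le_of_sorted hL.2 (m := a + 1)
      (fun b hb => ⟨hL.1 b hb, hn b (by simp [hb])⟩)
    have h3 := hn a (by simp)
    have : (faceWord t (a :: L) σ) = faceAt (t a) a (faceWord t L σ) := rfl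
    rw [this, faceAt_dim, h1, List.length_cons]
    · omega
    · rw [h1]; omega

theorem faceWord_congr {t t' : ℕ → Bool} {L : List ℕ} (h : ∀ a ∈ L, t a = t' a) (σ : Q.Cell) :
    faceWord t L σ = faceWord t' L σ := by
  induction L with
  | nil => rfl
  | cons a L ih =>
    show faceAt (t a) a (faceWord t L σ) = faceAt (t' a) a (faceWord t' L σ)
    rw [h a (by simp), ih (fun b hb => h b (by simp [hb]))]

/-- The `i`-th coordinate of the face is the coordinate `skip L i` of `σ`. The cubical identity
moves the new face operator past the smaller fixed coordinates, raising its index by one each time,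
until it reaches its place in the increasing list. -/
theorem faceAt_faceWord (ε : Bool) (t : ℕ → Bool) {L : List ℕ} (hL : L.Pairwise (· < ·))
    (σ : Q.Cell) (hn : ∀ a ∈ L, a < σ.1) (i : ℕ) (hi : i + L.length < σ.1) :
    faceAt ε i (faceWord t L σ) =
      faceWord (Function.update t (skip L i) ε) (L.orderedInsert (· ≤ ·) (skip L i)) σ := by
  induction L generalizing i with
  | nil => simp [faceWord, skip]
  | cons a L ih =>
    have hL' := hL
    rw [List.pairwise_cons] at hL
    have hn' : ∀ b ∈ L, b < σ.1 := fun b hb => hn b (by simp [hb])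
    simp only [List.length_cons] at hi
    by_cases h : i < a
    · have hs : skip (a :: L) i = i := by simp [skip, h]
      have hi' := skip_notMem hL' i
      rw [hs] at hi' ⊢
      rw [List.orderedInsert, if_pos h.le]
      show _ = faceAt (Function.update t i ε i) i (faceWord (Function.update t i ε) (a :: L) σ)
      rw [Function.update_self]
      congr 1
      apply faceWord_congr
      intro b hb
      rw [Function.update_of_ne]
      rintro rfl; exact hi' hb
    · have hs : skip (a :: L) i = skip L (i + 1) := by simp [skip, h]
      have hle := le_skip L (i + 1)
      rw [hs, List.orderedInsert, if_neg (by omega)]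
      show faceAt ε i (faceAt (t a) a (faceWord t L σ)) =
        faceAt (Function.update t (skip L (i + 1)) ε a) a (faceWord _ _ σ)
      rw [Function.update_of_ne (by omega), ← ih hL.2 hn' (i + 1) (by omega)]
      apply faceAt_comm
      · omega
      · rw [faceWord_dim t hL.2 σ hn']; omega

/-- Fixing one more free coordinate does not renumber the free coordinates below it. This is why
iterated faces are taken from the largest coordinate downwards. -/
theorem skip_orderedInsert (L : List ℕ) (i j : ℕ) (hij : j < i) :
    skip (L.orderedInsert (· ≤ ·) (skip L i)) j = skip L j := by
  induction L generalizing i j with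
  | nil => simp [skip, hij]
  | cons a L ih =>
    by_cases h : i < a
    · have hs : skip (a :: L) i = i := by simp [skip, h]
      have : j < a := by omega
      rw [hs, List.orderedInsert, if_pos h.le]
      simp [skip, hij, this]
    · have hs : skip (a :: L) i = skip L (i + 1) := by simp [skip, h]
      have hle := le_skip L (i + 1)
      rw [hs, List.orderedInsert, if_neg (by omega)]
      simp only [skip]
      split_ifs
      · rfl
      · exact ih _ _ (by omega)

/-- The list of the numbers below `n` not in `X`. -/
def coList (n : ℕ) (X : Finset ℕ) : List ℕ := (List.range n).filter fun i => i ∉ X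

theorem mem_coList {n : ℕ} {X : Finset ℕ} {i : ℕ} : i ∈ coList n X ↔ i < n ∧ i ∉ X := by
  simp [coList]

theorem coList_sorted (n : ℕ) (X : Finset ℕ) : (coList n X).Pairwise (· < ·) :=
  List.pairwise_lt_range.filter _

theorem coList_length {n : ℕ} {X : Finset ℕ} (hX : X ⊆ Finset.range n) :
    (coList n X).length + X.card = n := by
  have h1 : (coList n X).toFinset = Finset.range n \ X := by
    ext i; simp [mem_coList]
  have h2 : (coList n X).toFinset.card = (coList n X).length :=
    List.toFinset_card_of_nodup ((coList_sorted n X).imp (fun h => ne_of_lt h))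
  rw [← h2, h1, Finset.card_sdiff_add_card_eq_card hX, Finset.card_range]

theorem orderedInsert_coList {n : ℕ} {X : Finset ℕ} {x : ℕ} (hx : x ∈ X) (hn : x < n) :
    (coList n X).orderedInsert (· ≤ ·) x = coList n (X.erase x) := by
  have hp : ((coList n X).orderedInsert (· ≤ ·) x).Perm (coList n (X.erase x)) := by
    refine (List.perm_orderedInsert _ _ _).trans ?_
    rw [List.perm_ext_iff_of_nodup]
    · intro a
      simp only [List.mem_cons, mem_coList, Finset.mem_erase, not_and, ne_eq]
      constructor
      · rintro (rfl | h)
        · exact ⟨hn, fun h => absurd rfl h⟩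
        · exact ⟨h.1, fun _ => h.2⟩
      · rintro ⟨h1, h2⟩
        by_cases h : a = x
        · exact Or.inl h
        · exact Or.inr ⟨h1, h2 h⟩
    · rw [List.nodup_cons]
      exact ⟨fun h => (mem_coList.1 h).2 hx, (coList_sorted n X).imp (fun h => ne_of_lt h)⟩
    · exact (coList_sorted n _).imp (fun h => ne_of_lt h)
  refine hp.eq_of_pairwise' (r := (· ≤ ·)) ?_ ?_
  · exact List.Pairwise.orderedInsert x _ ((coList_sorted n X).imp le_of_lt)
  · exact (coList_sorted n _).imp le_of_lt

/-- The order embedding onto the complement of the coordinates below `n` that are not in `X`; it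
identifies the coordinates of the face of an `n`-cube in the directions `X` with `X`. -/
def coord (n : ℕ) (X : Finset ℕ) : ℕ → ℕ := skip (coList n X)

theorem coord_strictMono (n : ℕ) (X : Finset ℕ) : StrictMono (coord n X) := skip_strictMono _

theorem coord_mem {n : ℕ} {X : Finset ℕ} (hX : X ⊆ Finset.range n) {i : ℕ} (hi : i < X.card) :
    coord n X i ∈ X := by
  have h1 := skip_lt (coList_sorted n X) (n := n) (fun a ha => (mem_coList.1 ha).1) (i := i)
    (by have := coList_length hX; omega)
  have h2 := skip_notMem (coList_sorted n X) i
  rw [mem_coList] at h2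
  by_contra h
  exact h2 ⟨h1, h⟩

theorem image_coord {n : ℕ} {X : Finset ℕ} (hX : X ⊆ Finset.range n) :
    (Finset.range X.card).image (coord n X) = X := by
  apply Finset.eq_of_subset_of_card_le
  · intro x hx
    obtain ⟨i, hi, rfl⟩ := Finset.mem_image.1 hx
    exact coord_mem hX (Finset.mem_range.1 hi)
  · rw [Finset.card_image_of_injective _ (coord_strictMono n X).injective, Finset.card_range]

/-- The face of `σ` on which the coordinates in `X` are free, those in `T` are `1` and the others
are `0`. -/
def faceOf (σ : Q.Cell) (T X : Finset ℕ) : Q.Cell :=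
  faceWord (fun i => decide (i ∈ T)) (coList σ.1 X) σ

theorem faceOf_dim (σ : Q.Cell) (T : Finset ℕ) {X : Finset ℕ} (hX : X ⊆ Finset.range σ.1) :
    (faceOf σ T X).1 = X.card := by
  rw [faceOf, faceWord_dim _ (coList_sorted _ _) _ (fun a ha => (mem_coList.1 ha).1)]
  have := coList_length hX
  omega

theorem faceOf_range (σ : Q.Cell) (T : Finset ℕ) : faceOf σ T (Finset.range σ.1) = σ := by
  have : coList σ.1 (Finset.range σ.1) = [] := by
    rw [List.eq_nil_iff_forall_not_mem]
    intro a ha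
    rw [mem_coList, Finset.mem_range] at ha
    exact ha.2 ha.1
  simp [faceOf, this, faceWord]

/-- Faces of `faceOf` are again of this form, so all later work on the faces of a cube takes place
on pairs `(T, X)` of disjoint sets of its coordinates. -/
theorem faceAt_faceOf (ε : Bool) (σ : Q.Cell) {T X : Finset ℕ} (hX : X ⊆ Finset.range σ.1)
    (hT : Disjoint T X) {i : ℕ} (hi : i < X.card) :
    faceAt ε i (faceOf σ T X) =
      faceOf σ (if ε then insert (coord σ.1 X i) T else T) (X.erase (coord σ.1 X i)) := by
  have hm := coord_mem hX hi
  have hn : coord σ.1 X i ∉ T := fun h => Finset.disjoint_left.1 hT h hm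
  rw [faceOf, faceAt_faceWord ε _ (coList_sorted _ _) _ (fun a ha => (mem_coList.1 ha).1) _
    (by have := coList_length hX; omega)]
  have := orderedInsert_coList hm (n := σ.1) (Finset.mem_range.1 (hX hm))
  rw [coord] at this
  rw [this, faceOf]
  apply faceWord_congr
  intro a ha
  by_cases h : a = skip (coList σ.1 X) i
  · subst h
    rw [Function.update_self]
    cases ε
    · simpa [coord] using hn
    · simp [coord]
  · rw [Function.update_of_ne h]
    cases ε
    · simp
    · simp [coord, h]

theorem coord_erase {n : ℕ} {X : Finset ℕ} (hX : X ⊆ Finset.range n) {i j : ℕ} (hi : i < X.card)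
    (hij : j < i) : coord n (X.erase (coord n X i)) j = coord n X j := by
  have hm := coord_mem hX hi
  rw [coord, ← orderedInsert_coList hm (Finset.mem_range.1 (hX hm))]
  exact skip_orderedInsert _ _ _ hij

/-- `foldr` over `range (m + 1)` applies the operator of the largest index `m` first; the induction
hypothesis is then needed for the changed sets `T` and `X`. -/
theorem iterFace_foldr_faceOf (σ : Q.Cell) (S T' : Finset ℕ) (hST : Disjoint S T') (m : ℕ) :
    ∀ {T X : Finset ℕ}, X ⊆ Finset.range σ.1 → Disjoint T X → m ≤ X.card →
    (List.range m).foldr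
      (fun i τ => if i ∈ S then faceAt false i τ else if i ∈ T' then faceAt true i τ else τ)
      (faceOf σ T X) =
    faceOf σ (T ∪ (T' ∩ Finset.range m).image (coord σ.1 X))
      (X \ ((S ∪ T') ∩ Finset.range m).image (coord σ.1 X)) := by
  induction m with
  | zero => intro T X _ _ _; simp
  | succ m ih =>
    intro T X hX hT hm
    rw [List.range_succ, List.foldr_append, List.foldr_cons, List.foldr_nil]
    -- The remaining operators have indices below `m`, and removing the `m`-th free coordinate does
    -- not change what these indices refer to.
    have key : ∀ U : Finset ℕ, (U ∩ Finset.range m).image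
        (coord σ.1 (X.erase (coord σ.1 X m))) = (U ∩ Finset.range m).image (coord σ.1 X) := by
      intro U
      apply Finset.image_congr
      intro j hj
      simp only [Finset.coe_inter, Finset.coe_range, Set.mem_inter_iff, Set.mem_Iio] at hj
      exact coord_erase hX (by omega) hj.2
    have hc : m ≤ (X.erase (coord σ.1 X m)).card := by
      rw [Finset.card_erase_of_mem (coord_mem hX hm)]; omega
    have r1 : ∀ U : Finset ℕ, m ∈ U → U ∩ Finset.range (m + 1) = insert m (U ∩ Finset.range m) := by
      intro U hU
      rw [Finset.range_add_one, Finset.inter_insert_of_mem hU]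
    have r2 : ∀ U : Finset ℕ, m ∉ U → U ∩ Finset.range (m + 1) = U ∩ Finset.range m := by
      intro U hU
      rw [Finset.range_add_one, Finset.inter_insert_of_notMem hU]
    have hX' : X.erase (coord σ.1 X m) ⊆ Finset.range σ.1 := (Finset.erase_subset _ _).trans hX
    by_cases h1 : m ∈ S
    · have h2 : m ∉ T' := fun h => Finset.disjoint_left.1 hST h1 h
      rw [if_pos h1, faceAt_faceOf _ _ hX hT hm, if_neg (by simp), ih hX'
        (hT.mono_right (Finset.erase_subset _ _)) hc, key, key, r2 _ h2,
        r1 _ (Finset.mem_union_left _ h1), Finset.image_insert]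
      congr 1
      ext a; simp only [Finset.mem_sdiff, Finset.mem_erase, Finset.mem_insert]; tauto
    · by_cases h2 : m ∈ T'
      · rw [if_neg h1, if_pos h2, faceAt_faceOf _ _ hX hT hm, if_pos rfl, ih hX' _ hc, key, key,
          r1 _ h2, r1 _ (Finset.mem_union_right _ h2), Finset.image_insert, Finset.image_insert]
        · congr 1
          · ext a; simp only [Finset.mem_union, Finset.mem_insert]; tauto
          · ext a; simp only [Finset.mem_sdiff, Finset.mem_erase, Finset.mem_insert]; tauto
        · rw [Finset.disjoint_insert_left]
          exact ⟨by simp, hT.mono_right (Finset.erase_subset _ _)⟩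
      · rw [if_neg h1, if_neg h2, ih hX hT (by omega), r2 _ h2, r2 _ (by simp [h1, h2])]

theorem iterFace_faceOf (σ : Q.Cell) {S T' T X : Finset ℕ} (hX : X ⊆ Finset.range σ.1)
    (hT : Disjoint T X) (hST : Disjoint S T') (hS : S ⊆ Finset.range X.card)
    (hT' : T' ⊆ Finset.range X.card) :
    iterFace S T' (faceOf σ T X) =
      faceOf σ (T ∪ T'.image (coord σ.1 X)) (X \ (S ∪ T').image (coord σ.1 X)) := by
  have := iterFace_foldr_faceOf σ S T' hST X.card hX hT le_rfl
  rw [Finset.inter_eq_left.2 hT', Finset.inter_eq_left.2 (Finset.union_subset hS hT')] at this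
  rw [← this, iterFace, faceOf_dim σ T hX]

theorem coord_range (n : ℕ) : coord n (Finset.range n) = id := by
  have : coList n (Finset.range n) = [] := by
    rw [List.eq_nil_iff_forall_not_mem]
    intro a ha
    rw [mem_coList, Finset.mem_range] at ha
    exact ha.2 ha.1
  funext i
  simp [coord, this, skip]

theorem iterFace_eq_faceOf (σ : Q.Cell) {S T : Finset ℕ} (hST : Disjoint S T)
    (hS : S ⊆ Finset.range σ.1) (hT : T ⊆ Finset.range σ.1) :
    iterFace S T σ = faceOf σ T (Finset.range σ.1 \ (S ∪ T)) := by
  have := iterFace_faceOf σ (T := ∅) (X := Finset.range σ.1) subset_rfl (by simp) hST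
    (by simpa using hS) (by simpa using hT)
  rw [faceOf_range, coord_range] at this
  simpa using this

end Faces

/-! ### Crossings and the incidence convolution -/

theorem crossings_image {e : ℕ → ℕ} (he : StrictMono e) (A B : Finset ℕ) :
    crossings (A.image e) (B.image e) = crossings A B := by
  unfold crossings
  symm
  apply Finset.card_bij (fun p _ => (e p.1, e p.2))
  · rintro ⟨a, b⟩ h
    simp only [Finset.mem_filter, Finset.mem_product] at h ⊢
    exact ⟨⟨Finset.mem_image_of_mem _ h.1.1, Finset.mem_image_of_mem _ h.1.2⟩, he h.2⟩
  · rintro ⟨a, b⟩ _ ⟨a', b'⟩ _ h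
    simp only [Prod.mk.injEq] at h ⊢
    exact ⟨he.injective h.1, he.injective h.2⟩
  · rintro ⟨a, b⟩ h
    simp only [Finset.mem_filter, Finset.mem_product, Finset.mem_image] at h
    obtain ⟨⟨⟨a, ha, rfl⟩, ⟨b, hb, rfl⟩⟩, h2⟩ := h
    exact ⟨(a, b), by simpa [ha, hb] using he.lt_iff_lt.1 h2, rfl⟩

theorem crossings_union_left {A B : Finset ℕ} (h : Disjoint A B) (C : Finset ℕ) :
    crossings (A ∪ B) C = crossings A C + crossings B C := by
  unfold crossings
  rw [Finset.union_product, Finset.filter_union, Finset.card_union_of_disjoint]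
  apply Finset.disjoint_filter_filter
  exact Finset.disjoint_product.2 (Or.inl h)

theorem crossings_union_right {A B : Finset ℕ} (h : Disjoint A B) (C : Finset ℕ) :
    crossings C (A ∪ B) = crossings C A + crossings C B := by
  unfold crossings
  rw [Finset.product_union, Finset.filter_union, Finset.card_union_of_disjoint]
  apply Finset.disjoint_filter_filter
  exact Finset.disjoint_product.2 (Or.inr h)

@[simp] theorem crossings_empty_left (C : Finset ℕ) : crossings ∅ C = 0 := by simp [crossings]

@[simp] theorem crossings_empty_right (C : Finset ℕ) : crossings C ∅ = 0 := by simp [crossings]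

/-- For disjoint sets every pair is inverted in exactly one of the two orders. -/
theorem crossings_add_swap {A B : Finset ℕ} (h : Disjoint A B) :
    crossings A B + crossings B A = A.card * B.card := by
  unfold crossings
  have : ((B ×ˢ A).filter fun p => p.2 < p.1).card = ((A ×ˢ B).filter fun p => ¬ p.2 < p.1).card := by
    apply Finset.card_bij (fun p _ => (p.2, p.1))
    · rintro ⟨a, b⟩ h
      simp only [Finset.mem_filter, Finset.mem_product] at h ⊢
      exact ⟨⟨h.1.2, h.1.1⟩, by omega⟩
    · rintro ⟨a, b⟩ _ ⟨a', b'⟩ _ h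
      simp only [Prod.mk.injEq] at h ⊢
      exact ⟨h.2, h.1⟩
    · rintro ⟨a, b⟩ h'
      simp only [Finset.mem_filter, Finset.mem_product] at h'
      have : a ≠ b := fun e => Finset.disjoint_left.1 h h'.1.1 (e ▸ h'.1.2)
      exact ⟨(b, a), by simp only [Finset.mem_filter, Finset.mem_product]; exact ⟨⟨h'.1.2, h'.1.1⟩, by omega⟩, rfl⟩
  rw [this, Finset.card_filter_add_card_filter_not, Finset.card_product]

theorem crossings_singleton_left (a : ℕ) (B : Finset ℕ) :
    crossings {a} B = (B.filter (· < a)).card := by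
  unfold crossings
  rw [Finset.singleton_product, Finset.filter_map, Finset.card_map]
  rfl

theorem crossings_eq_zero {A B : Finset ℕ} (h : ∀ a ∈ A, ∀ b ∈ B, a ≤ b) : crossings A B = 0 := by
  unfold crossings
  rw [Finset.card_eq_zero, Finset.filter_eq_empty_iff]
  rintro ⟨a, b⟩ hp
  rw [Finset.mem_product] at hp
  exact not_lt.2 (h _ hp.1 _ hp.2)

theorem crossings_eq_mul {A B : Finset ℕ} (h : ∀ a ∈ A, ∀ b ∈ B, b < a) :
    crossings A B = A.card * B.card := by
  unfold crossings
  rw [Finset.filter_true_of_mem, Finset.card_product]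
  rintro ⟨a, b⟩ hp
  rw [Finset.mem_product] at hp
  exact h _ hp.1 _ hp.2

/-- Both sides run over the ordered decompositions of `X` into three disjoint sets; the outer sum
chooses the second cut on the left and the first cut on the right. -/
theorem sum_powerset_powerset {M : Type*} [AddCommMonoid M] (X : Finset ℕ)
    (f : Finset ℕ → Finset ℕ → Finset ℕ → M) :
    ∑ A ∈ X.powerset, ∑ B ∈ A.powerset, f B (A \ B) (X \ A) =
      ∑ A ∈ X.powerset, ∑ B ∈ (X \ A).powerset, f A B ((X \ A) \ B) := by
  rw [Finset.sum_sigma', Finset.sum_sigma']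
  refine Finset.sum_bij' (fun p _ => ⟨p.2, p.1 \ p.2⟩) (fun p _ => ⟨p.1 ∪ p.2, p.1⟩) ?_ ?_ ?_ ?_ ?_
  · rintro ⟨A, B⟩ h
    simp only [Finset.mem_sigma, Finset.mem_powerset] at h ⊢
    exact ⟨h.2.trans h.1, Finset.sdiff_subset_sdiff h.1 subset_rfl⟩
  · rintro ⟨A, B⟩ h
    simp only [Finset.mem_sigma, Finset.mem_powerset] at h ⊢
    exact ⟨Finset.union_subset h.1 (h.2.trans Finset.sdiff_subset), Finset.subset_union_left⟩
  · rintro ⟨A, B⟩ h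
    simp only [Finset.mem_sigma, Finset.mem_powerset] at h
    simp only [Finset.union_sdiff_of_subset h.2]
  · rintro ⟨A, B⟩ h
    simp only [Finset.mem_sigma, Finset.mem_powerset] at h
    have : (A ∪ B) \ A = B := by
      rw [Finset.union_sdiff_left, Finset.sdiff_eq_self_iff_disjoint]
      exact (Finset.subset_sdiff.1 h.2).2
    simp only [this]
  · rintro ⟨A, B⟩ h
    simp only [Finset.mem_sigma, Finset.mem_powerset] at h
    have : (X \ B) \ (A \ B) = X \ A := by
      ext a; simp only [Finset.mem_sdiff]
      have := @h.2 a
      have := @h.1 a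
      tauto
    simp only [this]

/-! ### The convolution algebra on intervals of finite sets. -/

section Incidence

variable {R : Type v} [CommRing R]

/-- The convolution of functions on the intervals `[T, T ∪ X]` of the lattice of finite sets. -/
def conv (F G : Finset ℕ → Finset ℕ → R) (T X : Finset ℕ) : R :=
  ∑ A ∈ X.powerset, (-1) ^ crossings A (X \ A) * (F T A * G (T ∪ A) (X \ A))

theorem conv_congr {F F' G G' : Finset ℕ → Finset ℕ → R} {T X : Finset ℕ}
    (h : ∀ A ⊆ X, F T A = F' T A) (h' : ∀ A ⊆ X, G (T ∪ A) (X \ A) = G' (T ∪ A) (X \ A)) :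
    conv F G T X = conv F' G' T X := by
  unfold conv
  apply Finset.sum_congr rfl
  intro A hA
  rw [Finset.mem_powerset] at hA
  rw [h A hA, h' A hA]

/-- Both bracketings are the sum over ordered decompositions of `X` into three parts, with the
crossings between all three pairs of parts as sign. -/
theorem conv_assoc (F G H : Finset ℕ → Finset ℕ → R) : conv (conv F G) H = conv F (conv G H) := by
  funext T X
  let f (A B C : Finset ℕ) : R := (-1) ^ (crossings A B + crossings A C + crossings B C) *
    (F T A * G (T ∪ A) B * H (T ∪ (A ∪ B)) C)
  have e1 : conv (conv F G) H T X = ∑ A ∈ X.powerset, ∑ B ∈ A.powerset, f B (A \ B) (X \ A) := by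
    simp only [conv, Finset.sum_mul, Finset.mul_sum]
    apply Finset.sum_congr rfl
    intro A hA
    apply Finset.sum_congr rfl
    intro B hB
    rw [Finset.mem_powerset] at hB
    have h1 := crossings_union_left (Finset.disjoint_sdiff (s := B) (t := A)) (X \ A)
    rw [Finset.union_sdiff_of_subset hB] at h1
    simp only [f, h1, Finset.union_sdiff_of_subset hB]
    ring
  have e2 : conv F (conv G H) T X =
      ∑ A ∈ X.powerset, ∑ B ∈ (X \ A).powerset, f A B ((X \ A) \ B) := by
    simp only [conv, Finset.mul_sum]
    apply Finset.sum_congr rfl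
    intro A hA
    apply Finset.sum_congr rfl
    intro B hB
    rw [Finset.mem_powerset] at hB
    have h1 := crossings_union_right (Finset.disjoint_sdiff (s := B) (t := X \ A)) A
    rw [Finset.union_sdiff_of_subset hB] at h1
    simp only [f, h1, Finset.union_assoc]
    ring
  rw [e1, e2, sum_powerset_powerset X f]

/-- Multiplication by the parity of the length of an interval. -/
def parity (F : Finset ℕ → Finset ℕ → R) (T X : Finset ℕ) : R := (-1) ^ X.card * F T X

theorem parity_conv (F G : Finset ℕ → Finset ℕ → R) :
    parity (conv F G) = conv (parity F) (parity G) := by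
  funext T X
  simp only [parity, conv, Finset.mul_sum]
  apply Finset.sum_congr rfl
  intro A hA
  rw [Finset.mem_powerset] at hA
  rw [← Finset.card_sdiff_add_card_eq_card hA, pow_add]
  ring

/-- The indicator function of the intervals of length one. -/
def atom (_ X : Finset ℕ) : R := if X.card = 1 then 1 else 0

theorem parity_atom : parity (atom (R := R)) = -atom := by
  funext T X
  by_cases h : X.card = 1 <;> simp [parity, atom, h]

theorem parity_parity (F : Finset ℕ → Finset ℕ → R) : parity (parity F) = F := by
  funext T X
  simp [parity, ← mul_assoc, ← mul_pow]

theorem conv_add_right (F G H : Finset ℕ → Finset ℕ → R) :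
    conv F (G + H) = conv F G + conv F H := by
  funext T X
  simp [conv, mul_add, Finset.sum_add_distrib]

theorem conv_add_left (F G H : Finset ℕ → Finset ℕ → R) :
    conv (F + G) H = conv F H + conv G H := by
  funext T X
  simp [conv, mul_add, add_mul, Finset.sum_add_distrib]

theorem conv_neg_right (F G : Finset ℕ → Finset ℕ → R) : conv F (-G) = -conv F G := by
  funext T X
  simp [conv]

theorem conv_neg_left (F G : Finset ℕ → Finset ℕ → R) : conv (-F) G = -conv F G := by
  funext T X
  simp [conv]

theorem conv_sub_right (F G H : Finset ℕ → Finset ℕ → R) :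
    conv F (G - H) = conv F G - conv F H := by
  rw [sub_eq_add_neg, conv_add_right, conv_neg_right, sub_eq_add_neg]

theorem conv_sub_left (F G H : Finset ℕ → Finset ℕ → R) :
    conv (F - G) H = conv F H - conv G H := by
  rw [sub_eq_add_neg, conv_add_left, conv_neg_left, sub_eq_add_neg]

theorem sum_powerset_card_one {M : Type*} [AddCommMonoid M] (X : Finset ℕ) (f : Finset ℕ → M) :
    ∑ A ∈ X.powerset, (if A.card = 1 then f A else 0) = ∑ x ∈ X, f {x} := by
  rw [← Finset.sum_filter]
  symm
  apply Finset.sum_bij (fun x _ => {x})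
  · intro x hx; simp [hx]
  · intro x _ y _ h; simpa using h
  · intro A hA
    rw [Finset.mem_filter, Finset.mem_powerset, Finset.card_eq_one] at hA
    obtain ⟨h, x, rfl⟩ := hA
    exact ⟨x, by simpa using h, rfl⟩
  · intros; rfl

theorem sum_powerset_sdiff {M : Type*} [AddCommMonoid M] (X : Finset ℕ)
    (f : Finset ℕ → Finset ℕ → M) :
    ∑ A ∈ X.powerset, f A (X \ A) = ∑ A ∈ X.powerset, f (X \ A) A := by
  refine Finset.sum_bij' (fun A _ => X \ A) (fun A _ => X \ A) ?_ ?_ ?_ ?_ ?_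
  · simp
  · simp
  · intro A hA; simpa using Finset.mem_powerset.1 hA
  · intro A hA; simpa using Finset.mem_powerset.1 hA
  · intro A hA
    rw [Finset.sdiff_sdiff_eq_self (Finset.mem_powerset.1 hA)]

theorem atom_conv (G : Finset ℕ → Finset ℕ → R) (T X : Finset ℕ) :
    conv atom G T X = ∑ x ∈ X, (-1) ^ crossings {x} (X.erase x) * G (insert x T) (X.erase x) := by
  unfold conv
  have : ∀ A ∈ X.powerset, (-1) ^ crossings A (X \ A) * (atom T A * G (T ∪ A) (X \ A)) =
      if A.card = 1 then (-1) ^ crossings A (X \ A) * G (T ∪ A) (X \ A) else 0 := by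
    intro A _
    by_cases h : A.card = 1 <;> simp [atom, h]
  rw [Finset.sum_congr rfl this, sum_powerset_card_one]
  apply Finset.sum_congr rfl
  intro x _
  rw [Finset.sdiff_singleton_eq_erase, Finset.union_comm, Finset.insert_eq]

theorem conv_atom (F : Finset ℕ → Finset ℕ → R) (T X : Finset ℕ) :
    conv F atom T X = ∑ x ∈ X, (-1) ^ crossings (X.erase x) {x} * F T (X.erase x) := by
  unfold conv
  have : ∀ A ∈ X.powerset, (-1) ^ crossings A (X \ A) * (F T A * atom (T ∪ A) (X \ A)) =
      if (X \ A).card = 1 then (-1) ^ crossings A (X \ A) * F T A else 0 := by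
    intro A _
    by_cases h : (X \ A).card = 1 <;> simp [atom, h]
  rw [Finset.sum_congr rfl this, sum_powerset_sdiff X
    (fun A B => if B.card = 1 then (-1) ^ crossings A B * F T A else 0),
    sum_powerset_card_one X (fun A => (-1) ^ crossings (X \ A) A * F T (X \ A))]
  apply Finset.sum_congr rfl
  intro x _
  rw [Finset.sdiff_singleton_eq_erase]

/-- A two-element set has two orderings, with opposite signs. This is the source of `δ² = 0`, and it
also cancels the subdivisions of a block into two single points. -/
theorem atom_conv_atom : conv (atom (R := R)) atom = 0 := by
  funext T X
  rw [atom_conv]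
  by_cases h : X.card = 2
  · obtain ⟨x, y, hxy, rfl⟩ := Finset.card_eq_two.1 h
    rw [Finset.sum_pair hxy]
    have e1 : ({x, y} : Finset ℕ).erase x = {y} := by
      ext a; simp only [Finset.mem_erase, Finset.mem_insert, Finset.mem_singleton]
      constructor
      · tauto
      · rintro rfl; exact ⟨hxy.symm, Or.inr rfl⟩
    have e2 : ({x, y} : Finset ℕ).erase y = {x} := by
      ext a; simp only [Finset.mem_erase, Finset.mem_insert, Finset.mem_singleton]
      constructor
      · tauto
      · rintro rfl; exact ⟨hxy, Or.inl rfl⟩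
    have := crossings_add_swap (Finset.disjoint_singleton.2 hxy)
    rw [e1, e2]
    simp only [atom, Finset.card_singleton, if_true, mul_one, Pi.zero_apply] at this ⊢
    obtain h | h : (crossings {x} {y} = 0 ∧ crossings {y} {x} = 1) ∨
      (crossings {x} {y} = 1 ∧ crossings {y} {x} = 0) := by omega
    · rw [h.1, h.2]; simp
    · rw [h.1, h.2]; simp
  · apply Finset.sum_eq_zero
    intro x hx
    have : (X.erase x).card ≠ 1 := by
      rw [Finset.card_erase_of_mem hx]
      have := Finset.card_pos.2 ⟨x, hx⟩
      omega
    simp [atom, this]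

end Incidence

/-! ### The differential and the product of functions on cells -/

section CellFunctions

variable {R : Type v} [CommRing R] {Q : CubicalSet.{u}}

/-- The cup product of functions on cells. -/
def cellCup (f g : Q.Cell → R) (τ : Q.Cell) : R :=
  ∑ A ∈ (Finset.range τ.1).powerset, (-1) ^ crossings A (Finset.range τ.1 \ A) *
    (f (iterFace (Finset.range τ.1 \ A) ∅ τ) * g (iterFace ∅ A τ))

/-- The coboundary of functions on cells. -/
def cellDelta (f : Q.Cell → R) (τ : Q.Cell) : R :=
  ∑ i ∈ Finset.range τ.1, (-1) ^ (i + 1) * (f (faceAt false i τ) - f (faceAt true i τ))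

/-- Multiplication by the parity of the dimension. -/
def cellParity (f : Q.Cell → R) (τ : Q.Cell) : R := (-1) ^ τ.1 * f τ

/-- Restriction to the faces of one fixed cube turns the cup product into the convolution, so
identities between operations on cochains reduce to computations in an associative algebra. -/
theorem cellCup_faceOf (f g : Q.Cell → R) (σ : Q.Cell) {T X : Finset ℕ}
    (hX : X ⊆ Finset.range σ.1) (hT : Disjoint T X) :
    cellCup f g (faceOf σ T X) =
      conv (fun T X => f (faceOf σ T X)) (fun T X => g (faceOf σ T X)) T X := by
  have he := coord_strictMono σ.1 X
  have hI := image_coord hX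
  have hf : ∀ A ⊆ Finset.range X.card,
      iterFace (Finset.range X.card \ A) ∅ (faceOf σ T X) =
        faceOf σ T (A.image (coord σ.1 X)) ∧
      iterFace ∅ A (faceOf σ T X) =
        faceOf σ (T ∪ A.image (coord σ.1 X)) (X \ A.image (coord σ.1 X)) := by
    intro A hA
    rw [iterFace_faceOf σ hX hT (Finset.disjoint_empty_right _) Finset.sdiff_subset (by simp),
      iterFace_faceOf σ hX hT (Finset.disjoint_empty_left _) (by simp) hA]
    have h1 : X \ (Finset.range X.card \ A).image (coord σ.1 X) = A.image (coord σ.1 X) := by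
      rw [Finset.image_sdiff _ _ he.injective, hI, Finset.sdiff_sdiff_eq_self]
      exact (Finset.image_subset_image hA).trans hI.subset
    simp [h1]
  unfold cellCup conv
  rw [faceOf_dim σ T hX]
  generalize coord σ.1 X = e at he hI hf
  have hinj : Function.Injective (Finset.image e) := Finset.image_injective he.injective
  have hP : X.powerset = (Finset.range X.card).powerset.image (Finset.image e) := by
    conv_lhs => rw [← hI]
    exact Finset.powerset_image
  rw [hP, Finset.sum_image hinj.injOn]
  apply Finset.sum_congr rfl
  intro A hA
  rw [Finset.mem_powerset] at hA
  rw [(hf A hA).1, (hf A hA).2]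
  congr 2
  conv_rhs => rw [← hI]
  rw [← Finset.image_sdiff _ _ he.injective, crossings_image he]

theorem crossings_coord_left {n : ℕ} {X : Finset ℕ} (hX : X ⊆ Finset.range n) {i : ℕ}
    (hi : i < X.card) :
    crossings {coord n X i} (X.erase (coord n X i)) = i := by
  have he := coord_strictMono n X
  have hI := image_coord hX
  generalize coord n X = e at he hI
  have : X.erase (e i) = ((Finset.range X.card).erase i).image e := by
    rw [Finset.image_erase he.injective, hI]
  rw [this, ← Finset.image_singleton, crossings_image he, crossings_singleton_left]
  have : ((Finset.range X.card).erase i).filter (· < i) = Finset.range i := by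
    ext a; simp only [Finset.mem_filter, Finset.mem_erase, Finset.mem_range]; omega
  rw [this, Finset.card_range]

/-- The coboundary is the graded commutator with `atom`. An edge split off first leaves its
coordinate at `1` on the remaining face, an edge split off last leaves it at `0`. -/
theorem cellDelta_faceOf (f : Q.Cell → R) (σ : Q.Cell) {T X : Finset ℕ}
    (hX : X ⊆ Finset.range σ.1) (hT : Disjoint T X) :
    cellDelta f (faceOf σ T X) =
      (conv atom (fun T X => f (faceOf σ T X)) -
        conv (parity fun T X => f (faceOf σ T X)) atom) T X := by
  have he := coord_strictMono σ.1 X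
  unfold cellDelta
  rw [Pi.sub_apply, Pi.sub_apply, atom_conv, conv_atom, ← Finset.sum_sub_distrib,
    faceOf_dim σ T hX]
  have : ∀ g : ℕ → R, ∑ x ∈ X, g x = ∑ i ∈ Finset.range X.card, g (coord σ.1 X i) := by
    intro g
    rw [← Finset.sum_image (g := coord σ.1 X) (f := g) he.injective.injOn, image_coord hX]
  rw [this]
  apply Finset.sum_congr rfl
  intro i hi
  rw [Finset.mem_range] at hi
  have hm := coord_mem hX hi
  -- The position `i` of a free coordinate is the number of free coordinates below it; together with
  -- the number of those above it this is `#X - 1`, which is the parity in the second term.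
  have h1 := crossings_coord_left hX hi
  have h2 := crossings_add_swap (A := {coord σ.1 X i}) (B := X.erase (coord σ.1 X i)) (by simp)
  rw [h1, Finset.card_singleton, one_mul] at h2
  rw [faceAt_faceOf _ _ hX hT hi, faceAt_faceOf _ _ hX hT hi, h1]
  simp only [Bool.false_eq_true, if_false, if_true, parity]
  rw [← h2, pow_add, pow_succ]
  have : ((-1 : R) ^ crossings (X.erase (coord σ.1 X i)) {coord σ.1 X i}) ^ 2 = 1 := by
    rw [← pow_mul, mul_comm, pow_mul]; simp
  linear_combination (-1 : R) ^ i * f (faceOf σ T (X.erase (coord σ.1 X i))) * this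

theorem cellParity_faceOf (f : Q.Cell → R) (σ : Q.Cell) {T X : Finset ℕ}
    (hX : X ⊆ Finset.range σ.1) :
    cellParity f (faceOf σ T X) = parity (fun T X => f (faceOf σ T X)) T X := by
  rw [cellParity, faceOf_dim σ T hX, parity]

theorem disjoint_union_sdiff {T X A : Finset ℕ} (hT : Disjoint T X) : Disjoint (T ∪ A) (X \ A) :=
  Finset.disjoint_union_left.2 ⟨hT.mono_right Finset.sdiff_subset, Finset.disjoint_sdiff⟩

theorem cellCup_assoc (f g h : Q.Cell → R) :
    cellCup (cellCup f g) h = cellCup f (cellCup g h) := by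
  funext σ
  have h0 := Finset.disjoint_empty_left (Finset.range σ.1)
  rw [← faceOf_range σ ∅, cellCup_faceOf _ _ _ subset_rfl h0, cellCup_faceOf _ _ _ subset_rfl h0]
  have e1 := conv_congr (T := ∅) (X := Finset.range σ.1)
    (F := fun T X => cellCup f g (faceOf σ T X)) (G := fun T X => h (faceOf σ T X))
    (G' := fun T X => h (faceOf σ T X))
    (fun A hA => cellCup_faceOf f g σ hA (Finset.disjoint_empty_left _)) (fun _ _ => rfl)
  have e2 := conv_congr (T := ∅) (X := Finset.range σ.1)
    (F := fun T X => f (faceOf σ T X))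
    (F' := fun T X => f (faceOf σ T X)) (G := fun T X => cellCup g h (faceOf σ T X))
    (fun _ _ => rfl) (fun A hA => cellCup_faceOf g h σ Finset.sdiff_subset
      (disjoint_union_sdiff (Finset.disjoint_empty_left _)))
  rw [e1, e2, ← conv_assoc]

/-- A graded commutator is a graded derivation; this needs only associativity of the convolution and
multiplicativity of `parity`. -/
theorem cellDelta_cellCup (f g : Q.Cell → R) :
    cellDelta (cellCup f g) = cellCup (cellDelta f) g + cellCup (cellParity f) (cellDelta g) := by
  funext σ
  have h0 := Finset.disjoint_empty_left (Finset.range σ.1)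
  rw [Pi.add_apply, ← faceOf_range σ ∅, cellDelta_faceOf _ _ subset_rfl h0,
    cellCup_faceOf _ _ _ subset_rfl h0, cellCup_faceOf _ _ _ subset_rfl h0, Pi.sub_apply,
    Pi.sub_apply]
  set F := fun T X => f (faceOf σ T X) with hF
  set G := fun T X => g (faceOf σ T X) with hG
  have e1 := conv_congr (T := ∅) (X := Finset.range σ.1) (F := atom)
    (G := fun T X => cellCup f g (faceOf σ T X)) (fun _ _ => rfl)
    (fun A hA => cellCup_faceOf f g σ Finset.sdiff_subset
      (disjoint_union_sdiff (Finset.disjoint_empty_left _)))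
  have e2 := conv_congr (T := ∅) (X := Finset.range σ.1)
    (F := parity fun T X => cellCup f g (faceOf σ T X)) (F' := parity (conv F G)) (G := atom)
    (fun A hA => by simp only [parity]; rw [cellCup_faceOf f g σ hA (Finset.disjoint_empty_left _)])
    (fun _ _ => rfl)
  have e3 := conv_congr (T := ∅) (X := Finset.range σ.1)
    (F := fun T X => cellDelta f (faceOf σ T X)) (G := G) (G' := G)
    (fun A hA => cellDelta_faceOf f σ hA (Finset.disjoint_empty_left _)) (fun _ _ => rfl)
  have e4 := conv_congr (T := ∅) (X := Finset.range σ.1)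
    (F := fun T X => cellParity f (faceOf σ T X)) (F' := parity F)
    (G := fun T X => cellDelta g (faceOf σ T X))
    (fun A hA => cellParity_faceOf f σ hA) (fun A hA => cellDelta_faceOf g σ Finset.sdiff_subset
      (disjoint_union_sdiff (Finset.disjoint_empty_left _)))
  rw [e1, e2, e3, e4, parity_conv, conv_sub_left, conv_sub_right]
  simp only [Pi.sub_apply, conv_assoc]
  ring

/-- The square of the commutator with the odd element `atom` is the commutator with its square,
which vanishes. -/
theorem cellDelta_cellDelta (f : Q.Cell → R) : cellDelta (cellDelta f) = 0 := by
  funext σ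
  have h0 := Finset.disjoint_empty_left (Finset.range σ.1)
  rw [← faceOf_range σ ∅, cellDelta_faceOf _ _ subset_rfl h0, Pi.sub_apply, Pi.sub_apply]
  set F := fun T X => f (faceOf σ T X) with hF
  have e1 := conv_congr (T := ∅) (X := Finset.range σ.1) (F := atom)
    (G := fun T X => cellDelta f (faceOf σ T X)) (fun _ _ => rfl)
    (fun A hA => cellDelta_faceOf f σ Finset.sdiff_subset
      (disjoint_union_sdiff (Finset.disjoint_empty_left _)))
  have e2 := conv_congr (T := ∅) (X := Finset.range σ.1)
    (F := parity fun T X => cellDelta f (faceOf σ T X))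
    (F' := parity (conv atom F - conv (parity F) atom)) (G := atom)
    (fun A hA => by simp only [parity]; rw [cellDelta_faceOf f σ hA (Finset.disjoint_empty_left _)])
    (fun _ _ => rfl)
  have e3 : parity (conv atom F - conv (parity F) atom) =
      -conv atom (parity F) + conv F atom := by
    have : parity (conv atom F - conv (parity F) atom) =
        parity (conv atom F) - parity (conv (parity F) atom) := by
      funext T X; simp [parity, mul_sub]
    rw [this, parity_conv, parity_conv, parity_atom, parity_parity, conv_neg_left,
      conv_neg_right, sub_neg_eq_add]
  have z : conv (0 : Finset ℕ → Finset ℕ → R) F = 0 := by funext T X; simp [conv]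
  have z' : conv F (0 : Finset ℕ → Finset ℕ → R) = 0 := by funext T X; simp [conv]
  rw [e1, e2, e3, conv_sub_right, conv_add_left, conv_neg_left, conv_assoc, conv_assoc,
    atom_conv_atom, z', ← conv_assoc atom atom, atom_conv_atom, z]
  simp only [Pi.sub_apply, Pi.add_apply, Pi.neg_apply, Pi.zero_apply, ← hF]
  ring

end CellFunctions

/-! ### The algebra of pairs of words in finite sets -/

theorem neg_one_pow_congr {R : Type v} [CommRing R] {m n : ℕ} (h : (m : ZMod 2) = n) :
    (-1 : R) ^ m = (-1) ^ n := by
  rw [neg_one_pow_eq_pow_mod_two, neg_one_pow_eq_pow_mod_two (n := n)]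
  congr 1
  exact (ZMod.natCast_eq_natCast_iff' _ _ _).1 h

theorem zmod_two_two : (2 : ZMod 2) = 0 := rfl

section DiagAlgebra

/-- The index set of the basis of `DiagAlgebra`: a finite set together with two words in finite
sets. -/
abbrev DiagIndex : Type := Finset ℕ × List (Finset ℕ) × List (Finset ℕ)

variable (R : Type v) [CommRing R]

/-- The free module on `DiagIndex`.  It carries the product of the graded tensor product of two
free algebras on finite sets `A` (of parity `#A + 1`), extended by an exterior algebra. -/
def DiagAlgebra : Type v := DiagIndex →₀ R

instance : AddCommGroup (DiagAlgebra R) := inferInstanceAs (AddCommGroup (DiagIndex →₀ R))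
instance : Module R (DiagAlgebra R) := inferInstanceAs (Module R (DiagIndex →₀ R))

/-- The parity of a word. -/
def wordParity (u : List (Finset ℕ)) : ℕ := (u.map fun A => A.card + 1).sum

@[simp] theorem wordParity_nil : wordParity [] = 0 := rfl
@[simp] theorem wordParity_cons (A : Finset ℕ) (u : List (Finset ℕ)) :
    wordParity (A :: u) = A.card + 1 + wordParity u := rfl
@[simp] theorem wordParity_append (u v : List (Finset ℕ)) :
    wordParity (u ++ v) = wordParity u + wordParity v := by simp [wordParity]

namespace DiagAlgebra

/-- The basis elements. -/
def basis (g : DiagIndex) : DiagAlgebra R := Finsupp.single g 1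

variable {R} in
/-- The linear map with prescribed values on the basis. -/
def extend {M : Type*} [AddCommGroup M] [Module R M] (f : DiagIndex → M) : DiagAlgebra R →ₗ[R] M :=
  Finsupp.linearCombination R f

variable {R} in
@[simp] theorem extend_basis {M : Type*} [AddCommGroup M] [Module R M] (f : DiagIndex → M)
    (g : DiagIndex) : extend f (basis R g) = f g :=
  (Finsupp.linearCombination_single R (1 : R) g).trans (one_smul R (f g))

variable {R} in
theorem induction {p : DiagAlgebra R → Prop} (x : DiagAlgebra R) (zero : p 0)
    (add : ∀ x y, p x → p y → p (x + y)) (basis_mem : ∀ (r : R) g, p (r • basis R g)) : p x := by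
  refine Finsupp.induction_linear x zero add fun g r => ?_
  have h : r • basis R g = (Finsupp.single g r : DiagIndex →₀ R) := Finsupp.smul_single_one g r
  exact h ▸ basis_mem r g

variable {R} in
theorem hom_ext {M : Type*} [AddCommGroup M] [Module R M] {f g : DiagAlgebra R →ₗ[R] M}
    (h : ∀ i, f (basis R i) = g (basis R i)) : f = g := by
  apply Finsupp.lhom_ext'
  intro i
  apply LinearMap.ext_ring
  exact h i

/-- The exponent of the sign of the product of two basis elements. -/
def mulExp (g h : DiagIndex) : ℕ :=
  g.1.card * (wordParity h.2.1 + wordParity h.2.2) + crossings h.1 g.1 +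
    wordParity g.2.2 * wordParity h.2.1

/-- The product of two basis elements. -/
def mulBasis (g h : DiagIndex) : DiagAlgebra R :=
  if Disjoint g.1 h.1 then
    (-1 : R) ^ mulExp g h • basis R (g.1 ∪ h.1, g.2.1 ++ h.2.1, g.2.2 ++ h.2.2)
  else 0

/-- The product as a bilinear map. -/
def mulLin : DiagAlgebra R →ₗ[R] DiagAlgebra R →ₗ[R] DiagAlgebra R :=
  extend fun g => extend fun h => mulBasis R g h

instance : Mul (DiagAlgebra R) := ⟨fun x y => mulLin R x y⟩
instance : One (DiagAlgebra R) := ⟨basis R (∅, [], [])⟩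

theorem mul_def (x y : DiagAlgebra R) : x * y = mulLin R x y := rfl

theorem basis_mul_basis (g h : DiagIndex) : basis R g * basis R h = mulBasis R g h := by
  simp [mul_def, mulLin]

/-- If the three sets are pairwise disjoint, both exponents are the same sum over pairs of factors,
because cardinality, parity and crossings are additive. Otherwise both sides vanish. -/
theorem mulBasis_assoc (g h k : DiagIndex) :
    mulLin R (mulLin R (basis R g) (basis R h)) (basis R k) =
      mulLin R (basis R g) (mulLin R (basis R h) (basis R k)) := by
  simp only [mulLin, extend_basis, mulBasis]
  by_cases h1 : Disjoint g.1 h.1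
  · by_cases h2 : Disjoint h.1 k.1
    · rw [if_pos h1, if_pos h2]
      simp only [map_smul, LinearMap.smul_apply, extend_basis]
      by_cases h3 : Disjoint g.1 k.1
      · rw [if_pos (Finset.disjoint_union_left.2 ⟨h3, h2⟩),
          if_pos (Finset.disjoint_union_right.2 ⟨h1, h3⟩), smul_smul, smul_smul, ← pow_add,
          ← pow_add, Finset.union_assoc, List.append_assoc, List.append_assoc]
        congr 1
        apply neg_one_pow_congr
        simp only [mulExp, wordParity_append, crossings_union_left h2, crossings_union_right h1,
          Finset.card_union_of_disjoint h1]
        push_cast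
        ring
      · rw [if_neg (fun h => h3 (Finset.disjoint_union_left.1 h).1),
          if_neg (fun h => h3 (Finset.disjoint_union_right.1 h).2)]
        simp
    · rw [if_neg h2, if_pos h1]
      simp only [map_smul, LinearMap.smul_apply, extend_basis, map_zero]
      rw [if_neg (fun h => h2 (Finset.disjoint_union_left.1 h).2), smul_zero]
  · rw [if_neg h1]
    by_cases h2 : Disjoint h.1 k.1
    · rw [if_pos h2]
      simp only [map_smul, LinearMap.zero_apply, extend_basis, map_zero]
      rw [if_neg (fun h => h1 (Finset.disjoint_union_right.1 h).1), smul_zero]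
    · rw [if_neg h2]; simp

instance : Ring (DiagAlgebra R) :=
  { (inferInstance : AddCommGroup (DiagAlgebra R)) with
    mul := fun x y => mulLin R x y
    one := basis R (∅, [], [])
    left_distrib := fun x y z => (mulLin R x).map_add y z
    right_distrib := fun x y z => LinearMap.map_add₂ (mulLin R) x y z
    zero_mul := fun x => LinearMap.map_zero₂ (mulLin R) x
    mul_zero := fun x => (mulLin R x).map_zero
    mul_assoc := fun x y z => by
      change mulLin R (mulLin R x y) z = mulLin R x (mulLin R y z)
      induction x using induction with
      | zero => simp
      | add a b ha hb => simp only [map_add, LinearMap.add_apply, ha, hb]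
      | basis_mem r g =>
        induction y using induction with
        | zero => simp
        | add a b ha hb => simp only [map_add, LinearMap.add_apply, ha, hb]
        | basis_mem s h =>
          induction z using induction with
          | zero => simp
          | add a b ha hb => simp only [map_add, ha, hb]
          | basis_mem t k =>
            simp only [map_smul, LinearMap.smul_apply, mulBasis_assoc]
    one_mul := fun x => by
      have : mulLin R (basis R (∅, [], [])) = LinearMap.id := by
        apply hom_ext
        intro g
        simp [mulLin, mulBasis, mulExp]
      exact congrArg (fun f => f x) this
    mul_one := fun x => by
      have : (mulLin R).flip (basis R (∅, [], [])) = LinearMap.id := by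
        apply hom_ext
        intro g
        simp [mulLin, mulBasis, mulExp]
      exact congrArg (fun f => f x) this }

theorem one_def : (1 : DiagAlgebra R) = basis R (∅, [], []) := rfl

instance : IsScalarTower R (DiagAlgebra R) (DiagAlgebra R) :=
  ⟨fun r x y => LinearMap.map_smul₂ (mulLin R) r x y⟩

instance : SMulCommClass R (DiagAlgebra R) (DiagAlgebra R) :=
  ⟨fun r x y => ((mulLin R x).map_smul r y).symm⟩

/-! #### Generators -/

/-- The word `u` in the first factor. -/
def fst (u : List (Finset ℕ)) : DiagAlgebra R := basis R (∅, u, [])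
/-- The word `v` in the second factor. -/
def snd (v : List (Finset ℕ)) : DiagAlgebra R := basis R (∅, [], v)
/-- The exterior monomial of `X`. -/
def ext (X : Finset ℕ) : DiagAlgebra R := basis R (X, [], [])

variable {R}

theorem mul_basis_of {g h : DiagIndex} (hd : Disjoint g.1 h.1) :
    basis R g * basis R h =
      (-1 : R) ^ mulExp g h • basis R (g.1 ∪ h.1, g.2.1 ++ h.2.1, g.2.2 ++ h.2.2) := by
  rw [basis_mul_basis, mulBasis, if_pos hd]

theorem fst_mul_basis (u : List (Finset ℕ)) (g : DiagIndex) :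
    fst R u * basis R g = basis R (g.1, u ++ g.2.1, g.2.2) := by
  rw [fst, mul_basis_of (by simp)]
  simp [mulExp]

theorem snd_mul_basis (v : List (Finset ℕ)) (g : DiagIndex) :
    snd R v * basis R g =
      (-1 : R) ^ (wordParity v * wordParity g.2.1) • basis R (g.1, g.2.1, v ++ g.2.2) := by
  rw [snd, mul_basis_of (by simp)]
  simp [mulExp]

theorem fst_append (u v : List (Finset ℕ)) : fst R (u ++ v) = fst R u * fst R v := by
  conv_rhs => rw [fst.eq_def R v, fst_mul_basis]
  rfl

theorem snd_append (u v : List (Finset ℕ)) : snd R (u ++ v) = snd R u * snd R v := by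
  conv_rhs => rw [snd.eq_def R v, snd_mul_basis]
  simp [snd]

theorem fst_nil : fst R [] = 1 := rfl
theorem snd_nil : snd R [] = 1 := rfl

theorem snd_mul_fst (v u : List (Finset ℕ)) :
    snd R v * fst R u = (-1 : R) ^ (wordParity v * wordParity u) • (fst R u * snd R v) := by
  rw [fst, snd_mul_basis, ← fst.eq_def R u, snd, fst_mul_basis]
  simp

theorem ext_mul_fst (X : Finset ℕ) (u : List (Finset ℕ)) :
    ext R X * fst R u = (-1 : R) ^ (X.card * wordParity u) • (fst R u * ext R X) := by
  conv_rhs => rw [ext, fst_mul_basis]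
  rw [ext, fst, mul_basis_of (by simp)]
  simp [mulExp]

theorem ext_mul_snd (X : Finset ℕ) (u : List (Finset ℕ)) :
    ext R X * snd R u = (-1 : R) ^ (X.card * wordParity u) • (snd R u * ext R X) := by
  conv_rhs => rw [ext, snd_mul_basis]
  rw [ext, snd, mul_basis_of (by simp)]
  simp [mulExp]

theorem basis_eq (g : DiagIndex) : basis R g = fst R g.2.1 * snd R g.2.2 * ext R g.1 := by
  rw [mul_assoc, ext, snd_mul_basis]
  simp [fst_mul_basis]

theorem ext_mul_basis (X : Finset ℕ) (g : DiagIndex) :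
    ext R X * basis R g = (-1 : R) ^ (X.card * (wordParity g.2.1 + wordParity g.2.2)) •
      (fst R g.2.1 * snd R g.2.2 * (ext R X * ext R g.1)) := by
  rw [basis_eq, ← mul_assoc, ← mul_assoc, ext_mul_fst, smul_mul_assoc, mul_assoc (fst R _),
    ext_mul_snd]
  simp only [smul_mul_assoc, mul_smul_comm, smul_smul, mul_assoc, mul_add, pow_add]

/-! #### Parity and derivations -/

/-- The parity of a basis element. -/
def indexParity (g : DiagIndex) : ℕ := g.1.card + wordParity g.2.1 + wordParity g.2.2

variable (R) in
/-- The parity involution. -/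
def invol : DiagAlgebra R →ₗ[R] DiagAlgebra R :=
  extend fun g => (-1 : R) ^ indexParity g • basis R g

theorem invol_basis (g : DiagIndex) : invol R (basis R g) = (-1 : R) ^ indexParity g • basis R g :=
  extend_basis _ _

theorem invol_mul (x y : DiagAlgebra R) : invol R (x * y) = invol R x * invol R y := by
  induction x using induction with
  | zero => simp
  | add a b ha hb => simp only [map_add, add_mul, ha, hb]
  | basis_mem r g =>
    induction y using induction with
    | zero => simp
    | add a b ha hb => simp only [map_add, mul_add, ha, hb]
    | basis_mem s h =>
      simp only [map_smul, smul_mul_assoc, mul_smul_comm]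
      congr 2
      simp only [invol_basis, smul_mul_assoc, mul_smul_comm, smul_smul]
      by_cases hd : Disjoint g.1 h.1
      · rw [mul_basis_of hd, map_smul, invol_basis, smul_smul, smul_smul, ← pow_add, ← pow_add,
          ← pow_add]
        congr 1
        apply neg_one_pow_congr
        simp only [indexParity, Finset.card_union_of_disjoint hd, wordParity_append]
        push_cast
        ring
      · rw [basis_mul_basis, mulBasis, if_neg hd]; simp

theorem invol_invol (x : DiagAlgebra R) : invol R (invol R x) = x := by
  have : invol R ∘ₗ invol R = LinearMap.id := by
    apply hom_ext
    intro g
    simp [invol_basis, smul_smul, ← mul_pow]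
  exact congrArg (fun f => f x) this

/-- Linear combinations of words in the first factor of given parity. -/
def FstHom (p : ℕ) (x : DiagAlgebra R) : Prop :=
  x ∈ Submodule.span R {y | ∃ u, (wordParity u : ZMod 2) = p ∧ y = fst R u}

/-- Linear combinations of words in the second factor of given parity. -/
def SndHom (p : ℕ) (x : DiagAlgebra R) : Prop :=
  x ∈ Submodule.span R {y | ∃ u, (wordParity u : ZMod 2) = p ∧ y = snd R u}

theorem FstHom.mem {p : ℕ} {x : DiagAlgebra R} (h : FstHom p x) (S : Submodule R (DiagAlgebra R))
    (hS : ∀ u, (wordParity u : ZMod 2) = p → fst R u ∈ S) : x ∈ S :=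
  Submodule.span_le.2 (by rintro _ ⟨u, hu, rfl⟩; exact hS u hu) h

theorem SndHom.mem {p : ℕ} {x : DiagAlgebra R} (h : SndHom p x) (S : Submodule R (DiagAlgebra R))
    (hS : ∀ u, (wordParity u : ZMod 2) = p → snd R u ∈ S) : x ∈ S :=
  Submodule.span_le.2 (by rintro _ ⟨u, hu, rfl⟩; exact hS u hu) h

theorem FstHom.snd_mul {p : ℕ} {x : DiagAlgebra R} (h : FstHom p x) (v : List (Finset ℕ)) :
    snd R v * x = (-1 : R) ^ (wordParity v * p) • (x * snd R v) := by
  refine h.mem (LinearMap.eqLocus (LinearMap.mulLeft R (snd R v))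
    ((-1 : R) ^ (wordParity v * p) • LinearMap.mulRight R (snd R v))) fun u hu => ?_
  simp only [LinearMap.mem_eqLocus, LinearMap.mulLeft_apply, LinearMap.smul_apply,
    LinearMap.mulRight_apply, snd_mul_fst]
  congr 1
  apply neg_one_pow_congr
  push_cast; rw [hu]

theorem FstHom.ext_mul {p : ℕ} {x : DiagAlgebra R} (h : FstHom p x) (X : Finset ℕ) :
    ext R X * x = (-1 : R) ^ (X.card * p) • (x * ext R X) := by
  refine h.mem (LinearMap.eqLocus (LinearMap.mulLeft R (ext R X))
    ((-1 : R) ^ (X.card * p) • LinearMap.mulRight R (ext R X))) fun u hu => ?_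
  simp only [LinearMap.mem_eqLocus, LinearMap.mulLeft_apply, LinearMap.smul_apply,
    LinearMap.mulRight_apply, ext_mul_fst]
  congr 1
  apply neg_one_pow_congr
  push_cast; rw [hu]

theorem SndHom.mul_fst {p : ℕ} {x : DiagAlgebra R} (h : SndHom p x) (u : List (Finset ℕ)) :
    x * fst R u = (-1 : R) ^ (wordParity u * p) • (fst R u * x) := by
  refine h.mem (LinearMap.eqLocus (LinearMap.mulRight R (fst R u))
    ((-1 : R) ^ (wordParity u * p) • LinearMap.mulLeft R (fst R u))) fun v hv => ?_
  simp only [LinearMap.mem_eqLocus, LinearMap.mulLeft_apply, LinearMap.smul_apply,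
    LinearMap.mulRight_apply, snd_mul_fst]
  congr 1
  apply neg_one_pow_congr
  push_cast; rw [hv, mul_comm]

theorem SndHom.ext_mul {p : ℕ} {x : DiagAlgebra R} (h : SndHom p x) (X : Finset ℕ) :
    ext R X * x = (-1 : R) ^ (X.card * p) • (x * ext R X) := by
  refine h.mem (LinearMap.eqLocus (LinearMap.mulLeft R (ext R X))
    ((-1 : R) ^ (X.card * p) • LinearMap.mulRight R (ext R X))) fun u hu => ?_
  simp only [LinearMap.mem_eqLocus, LinearMap.mulLeft_apply, LinearMap.smul_apply,
    LinearMap.mulRight_apply, ext_mul_snd]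
  congr 1
  apply neg_one_pow_congr
  push_cast; rw [hu]

variable (R) in
/-- Values on letters of an odd derivation. -/
structure LetterMap where
  onFst : Finset ℕ → DiagAlgebra R
  onSnd : Finset ℕ → DiagAlgebra R
  fst_hom : ∀ A, FstHom A.card (onFst A)
  snd_hom : ∀ A, SndHom A.card (onSnd A)

namespace LetterMap

variable (L : LetterMap R)

/-- The derivation on words in the first factor. -/
def derFst : List (Finset ℕ) → DiagAlgebra R
  | [] => 0
  | A :: u => L.onFst A * fst R u + (-1 : R) ^ (A.card + 1) • (fst R [A] * derFst u)

/-- The derivation on words in the second factor. -/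
def derSnd : List (Finset ℕ) → DiagAlgebra R
  | [] => 0
  | A :: u => L.onSnd A * snd R u + (-1 : R) ^ (A.card + 1) • (snd R [A] * derSnd u)

/-- The odd derivation with given values on letters. -/
def der : DiagAlgebra R →ₗ[R] DiagAlgebra R :=
  extend fun g => (L.derFst g.2.1 * snd R g.2.2 +
    (-1 : R) ^ wordParity g.2.1 • (fst R g.2.1 * L.derSnd g.2.2)) * ext R g.1

theorem der_basis (g : DiagIndex) : L.der (basis R g) = (L.derFst g.2.1 * snd R g.2.2 +
    (-1 : R) ^ wordParity g.2.1 • (fst R g.2.1 * L.derSnd g.2.2)) * ext R g.1 := extend_basis _ _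

/-- The derivation shifts the parity of a word by one, so its value is passed with this shifted
parity in the sign. This and the two analogues for exterior monomials yield the Leibniz rule across
the factors. -/
theorem snd_mul_derFst (v u : List (Finset ℕ)) :
    snd R v * L.derFst u =
      (-1 : R) ^ (wordParity v * (wordParity u + 1)) • (L.derFst u * snd R v) := by
  induction u with
  | nil => simp [derFst]
  | cons A u ih =>
    rw [derFst, mul_add, ← mul_assoc, (L.fst_hom A).snd_mul, smul_mul_assoc, mul_assoc (L.onFst A),
      snd_mul_fst, mul_smul_comm, ← mul_assoc, mul_smul_comm, ← mul_assoc, snd_mul_fst, smul_mul_assoc,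
      mul_assoc (fst R [A]), ih]
    simp only [add_mul, smul_mul_assoc, mul_smul_comm, smul_add, smul_smul, mul_assoc, ← pow_add]
    congr 2
    · apply neg_one_pow_congr
      simp only [wordParity_cons]; push_cast
      linear_combination (-(wordParity v : ZMod 2)) * zmod_two_two
    · apply neg_one_pow_congr
      simp only [wordParity_cons, wordParity_nil]; push_cast
      ring

theorem ext_mul_derFst (X : Finset ℕ) (u : List (Finset ℕ)) :
    ext R X * L.derFst u =
      (-1 : R) ^ (X.card * (wordParity u + 1)) • (L.derFst u * ext R X) := by
  induction u with
  | nil => simp [derFst]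
  | cons A u ih =>
    rw [derFst, mul_add, ← mul_assoc, (L.fst_hom A).ext_mul, smul_mul_assoc, mul_assoc (L.onFst A),
      ext_mul_fst, mul_smul_comm, ← mul_assoc, mul_smul_comm, ← mul_assoc, ext_mul_fst, smul_mul_assoc,
      mul_assoc (fst R [A]), ih]
    simp only [add_mul, smul_mul_assoc, mul_smul_comm, smul_add, smul_smul, mul_assoc, ← pow_add]
    congr 2
    · apply neg_one_pow_congr
      simp only [wordParity_cons]; push_cast
      linear_combination (-(X.card : ZMod 2)) * zmod_two_two
    · apply neg_one_pow_congr
      simp only [wordParity_cons, wordParity_nil]; push_cast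
      ring

theorem ext_mul_derSnd (X : Finset ℕ) (u : List (Finset ℕ)) :
    ext R X * L.derSnd u =
      (-1 : R) ^ (X.card * (wordParity u + 1)) • (L.derSnd u * ext R X) := by
  induction u with
  | nil => simp [derSnd]
  | cons A u ih =>
    rw [derSnd, mul_add, ← mul_assoc, (L.snd_hom A).ext_mul, smul_mul_assoc, mul_assoc (L.onSnd A),
      ext_mul_snd, mul_smul_comm, ← mul_assoc, mul_smul_comm, ← mul_assoc, ext_mul_snd, smul_mul_assoc,
      mul_assoc (snd R [A]), ih]
    simp only [add_mul, smul_mul_assoc, mul_smul_comm, smul_add, smul_smul, mul_assoc, ← pow_add]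
    congr 2
    · apply neg_one_pow_congr
      simp only [wordParity_cons]; push_cast
      linear_combination (-(X.card : ZMod 2)) * zmod_two_two
    · apply neg_one_pow_congr
      simp only [wordParity_cons, wordParity_nil]; push_cast
      ring

theorem der_fst_mul (A : Finset ℕ) (y : DiagAlgebra R) :
    L.der (fst R [A] * y) = L.onFst A * y + (-1 : R) ^ (A.card + 1) • (fst R [A] * L.der y) := by
  induction y using induction with
  | zero => simp
  | add a b ha hb => simp only [map_add, mul_add, ha, hb, smul_add]; abel
  | basis_mem r g =>
    simp only [map_smul, mul_smul_comm, smul_comm _ r, ← smul_add]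
    congr 1
    rw [fst_mul_basis, der_basis, der_basis, basis_eq]
    have hA : fst R (A :: g.2.1) = fst R [A] * fst R g.2.1 := fst_append [A] g.2.1
    simp only [List.singleton_append, derFst, wordParity_cons, hA, add_mul, mul_add, smul_add,
      smul_mul_assoc, mul_smul_comm, smul_smul, mul_assoc, pow_add]
    abel

theorem der_snd_mul (A : Finset ℕ) (y : DiagAlgebra R) :
    L.der (snd R [A] * y) = L.onSnd A * y + (-1 : R) ^ (A.card + 1) • (snd R [A] * L.der y) := by
  induction y using induction with
  | zero => simp
  | add a b ha hb => simp only [map_add, mul_add, ha, hb, smul_add]; abel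
  | basis_mem r g =>
    simp only [map_smul, mul_smul_comm, smul_comm _ r, ← smul_add]
    congr 1
    rw [snd_mul_basis, map_smul, der_basis, der_basis, basis_eq]
    have hA : snd R (A :: g.2.2) = snd R [A] * snd R g.2.2 := snd_append [A] g.2.2
    simp only [List.singleton_append, derSnd, wordParity_cons, wordParity_nil, hA]
    rw [← mul_assoc (snd R [A]), mul_add (snd R [A]), ← mul_assoc (snd R [A]), snd_mul_derFst,
      mul_smul_comm, ← mul_assoc (snd R [A]), snd_mul_fst, ← mul_assoc (L.onSnd A),
      ← mul_assoc (L.onSnd A), (L.snd_hom A).mul_fst]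
    simp only [add_mul, mul_add, smul_add,
      smul_mul_assoc, mul_smul_comm, smul_smul, mul_assoc, ← pow_add, ← add_assoc,
      wordParity_cons, wordParity_nil]
    have comb : ∀ (a b c a' b' c' : R) (x y z : DiagAlgebra R), a = a' → b = b' → c = c' →
        a • x + b • y + c • z = b' • y + a' • x + c' • z := by
      rintro a b c _ _ _ x y z rfl rfl rfl
      abel
    apply comb <;> apply neg_one_pow_congr <;> push_cast
    · linear_combination (-(A.card + 1) : ZMod 2) * zmod_two_two
    · linear_combination (wordParity g.2.1 : ZMod 2) * zmod_two_two
    · ring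

/-- Exterior monomials are constants of the derivation, which passes them with the sign of an odd
operator. -/
theorem der_ext_mul (X : Finset ℕ) (y : DiagAlgebra R) :
    L.der (ext R X * y) = (-1 : R) ^ X.card • (ext R X * L.der y) := by
  induction y using induction with
  | zero => simp
  | add a b ha hb => simp only [map_add, mul_add, ha, hb, smul_add]
  | basis_mem r g =>
    simp only [map_smul, mul_smul_comm, smul_comm _ r]
    congr 1
    have key : ∀ Y, L.der (fst R g.2.1 * snd R g.2.2 * ext R Y) = (L.derFst g.2.1 * snd R g.2.2 +
        (-1 : R) ^ wordParity g.2.1 • (fst R g.2.1 * L.derSnd g.2.2)) * ext R Y := by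
      intro Y
      rw [← der_basis L (Y, g.2.1, g.2.2), basis_eq]
    have key' : L.der (fst R g.2.1 * snd R g.2.2 * (ext R X * ext R g.1)) =
        (L.derFst g.2.1 * snd R g.2.2 +
        (-1 : R) ^ wordParity g.2.1 • (fst R g.2.1 * L.derSnd g.2.2)) * (ext R X * ext R g.1) := by
      rw [ext, ext, basis_mul_basis, mulBasis]
      split_ifs
      · rw [mul_smul_comm, map_smul, mul_smul_comm]
        congr 1
        exact key _
      · simp
    rw [ext_mul_basis, map_smul, key', der_basis, ← mul_assoc (ext R X), mul_add (ext R X),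
      ← mul_assoc (ext R X), mul_smul_comm, ← mul_assoc (ext R X), ext_mul_derFst, ext_mul_fst]
    simp only [smul_mul_assoc, mul_assoc, ext_mul_derSnd, ext_mul_snd]
    simp only [add_mul, smul_add, smul_mul_assoc, mul_smul_comm, smul_smul, mul_assoc, ← pow_add]
    congr 2
    · apply neg_one_pow_congr
      push_cast
      linear_combination (-(X.card) : ZMod 2) * zmod_two_two
    · apply neg_one_pow_congr
      push_cast
      linear_combination (-(X.card) : ZMod 2) * zmod_two_two

/-- An element on which `der` satisfies the Leibniz rule. -/
def IsLeibniz (x : DiagAlgebra R) : Prop :=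
  ∀ y, L.der (x * y) = L.der x * y + invol R x * L.der y

theorem der_one : L.der 1 = 0 := by
  rw [one_def, der_basis]; simp [derFst, derSnd]

theorem IsLeibniz.mul {x y : DiagAlgebra R} (hx : L.IsLeibniz x) (hy : L.IsLeibniz y) :
    L.IsLeibniz (x * y) := by
  intro z
  rw [mul_assoc, hx, hx, hy, invol_mul]
  noncomm_ring

theorem isLeibniz_fst (u : List (Finset ℕ)) : L.IsLeibniz (fst R u) := by
  induction u with
  | nil =>
    intro y
    rw [fst_nil, der_one, one_def, invol_basis]
    simp [indexParity, ← one_def]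
  | cons A u ih =>
    rw [show A :: u = [A] ++ u from rfl, fst_append]
    refine IsLeibniz.mul L ?_ ih
    intro y
    have h1 := L.der_fst_mul A 1
    rw [der_one, mul_zero, smul_zero, mul_one, mul_one, add_zero] at h1
    rw [der_fst_mul, h1, fst, invol_basis]
    simp [indexParity, smul_mul_assoc]

theorem isLeibniz_snd (u : List (Finset ℕ)) : L.IsLeibniz (snd R u) := by
  induction u with
  | nil =>
    intro y
    rw [snd_nil, der_one, one_def, invol_basis]
    simp [indexParity, ← one_def]
  | cons A u ih =>
    rw [show A :: u = [A] ++ u from rfl, snd_append]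
    refine IsLeibniz.mul L ?_ ih
    intro y
    have h1 := L.der_snd_mul A 1
    rw [der_one, mul_zero, smul_zero, mul_one, mul_one, add_zero] at h1
    rw [der_snd_mul, h1, snd, invol_basis]
    simp [indexParity, smul_mul_assoc]

theorem isLeibniz_ext (X : Finset ℕ) : L.IsLeibniz (ext R X) := by
  intro y
  have h1 := L.der_ext_mul X 1
  rw [der_one, mul_zero, smul_zero, mul_one] at h1
  rw [der_ext_mul, h1, zero_mul, zero_add, ext, invol_basis]
  simp [indexParity, smul_mul_assoc]

/-- Elements that satisfy the Leibniz rule as left factors are closed under products, and every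
basis element is a product of a word in each factor and an exterior monomial. -/
theorem der_mul (x y : DiagAlgebra R) :
    L.der (x * y) = L.der x * y + invol R x * L.der y := by
  induction x using induction with
  | zero => simp
  | add a b ha hb => simp only [map_add, add_mul, ha, hb]; abel
  | basis_mem r g =>
    have : L.IsLeibniz (basis R g) := by
      rw [basis_eq]
      exact .mul L (.mul L (L.isLeibniz_fst _) (L.isLeibniz_snd _)) (L.isLeibniz_ext _)
    simp only [map_smul, smul_mul_assoc, this y, smul_add]

theorem der_fst_singleton (A : Finset ℕ) : L.der (fst R [A]) = L.onFst A := by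
  simpa [der_one] using L.der_fst_mul A 1

theorem der_snd_singleton (A : Finset ℕ) : L.der (snd R [A]) = L.onSnd A := by
  simpa [der_one] using L.der_snd_mul A 1

theorem der_ext (X : Finset ℕ) : L.der (ext R X) = 0 := by
  simpa [der_one] using L.der_ext_mul X 1

end LetterMap

end DiagAlgebra
end DiagAlgebra

/-! ### Subdivision and insertion derivations and their graded commutators. -/

namespace DiagAlgebra

variable {R : Type v} [CommRing R]

theorem fstHom_fst {p : ℕ} {u : List (Finset ℕ)} (h : (wordParity u : ZMod 2) = p) :
    FstHom p (fst R u) := Submodule.subset_span ⟨u, h, rfl⟩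

theorem sndHom_snd {p : ℕ} {u : List (Finset ℕ)} (h : (wordParity u : ZMod 2) = p) :
    SndHom p (snd R u) := Submodule.subset_span ⟨u, h, rfl⟩

theorem FstHom.congr {p q : ℕ} (h : (p : ZMod 2) = q) {x : DiagAlgebra R} (hx : FstHom p x) :
    FstHom q x := by
  unfold FstHom at *; rwa [← h]

theorem SndHom.congr {p q : ℕ} (h : (p : ZMod 2) = q) {x : DiagAlgebra R} (hx : SndHom p x) :
    SndHom q x := by
  unfold SndHom at *; rwa [← h]

theorem FstHom.mul {p q : ℕ} {x y : DiagAlgebra R} (hx : FstHom p x) (hy : FstHom q y) :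
    FstHom (p + q) (x * y) := by
  refine hx.mem ((Submodule.span R _).comap (LinearMap.mulRight R y)) fun u hu => ?_
  refine hy.mem ((Submodule.span R _).comap (LinearMap.mulLeft R (fst R u))) fun v hv => ?_
  apply Submodule.subset_span
  exact ⟨u ++ v, by rw [wordParity_append]; push_cast; rw [hu, hv], (fst_append u v).symm⟩

theorem SndHom.mul {p q : ℕ} {x y : DiagAlgebra R} (hx : SndHom p x) (hy : SndHom q y) :
    SndHom (p + q) (x * y) := by
  refine hx.mem ((Submodule.span R _).comap (LinearMap.mulRight R y)) fun u hu => ?_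
  refine hy.mem ((Submodule.span R _).comap (LinearMap.mulLeft R (snd R u))) fun v hv => ?_
  apply Submodule.subset_span
  exact ⟨u ++ v, by rw [wordParity_append]; push_cast; rw [hu, hv], (snd_append u v).symm⟩

theorem FstHom.invol {p : ℕ} {x : DiagAlgebra R} (hx : FstHom p x) :
    invol R x = (-1 : R) ^ p • x := by
  refine hx.mem (LinearMap.eqLocus (DiagAlgebra.invol R) ((-1 : R) ^ p • LinearMap.id)) fun u hu => ?_
  simp only [LinearMap.mem_eqLocus, fst, invol_basis, LinearMap.smul_apply, LinearMap.id_apply]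
  congr 1
  apply neg_one_pow_congr
  simp [indexParity, hu]

theorem SndHom.invol {p : ℕ} {x : DiagAlgebra R} (hx : SndHom p x) :
    invol R x = (-1 : R) ^ p • x := by
  refine hx.mem (LinearMap.eqLocus (DiagAlgebra.invol R) ((-1 : R) ^ p • LinearMap.id)) fun u hu => ?_
  simp only [LinearMap.mem_eqLocus, snd, invol_basis, LinearMap.smul_apply, LinearMap.id_apply]
  congr 1
  apply neg_one_pow_congr
  simp [indexParity, hu]

namespace LetterMap

variable (L : LetterMap R)

theorem derFst_hom (u : List (Finset ℕ)) : FstHom (wordParity u + 1) (L.derFst u) := by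
  induction u with
  | nil => exact Submodule.zero_mem _
  | cons A u ih =>
    rw [derFst]
    refine Submodule.add_mem _ ?_ (Submodule.smul_mem _ _ ?_)
    · refine ((L.fst_hom A).mul (fstHom_fst (u := u) rfl)).congr ?_
      rw [wordParity_cons]; push_cast
      linear_combination (-1 : ZMod 2) * zmod_two_two
    · refine ((fstHom_fst (u := [A]) rfl).mul ih).congr ?_
      simp only [wordParity_cons, wordParity_nil]; push_cast; ring

theorem derSnd_hom (u : List (Finset ℕ)) : SndHom (wordParity u + 1) (L.derSnd u) := by
  induction u with
  | nil => exact Submodule.zero_mem _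
  | cons A u ih =>
    rw [derSnd]
    refine Submodule.add_mem _ ?_ (Submodule.smul_mem _ _ ?_)
    · refine ((L.snd_hom A).mul (sndHom_snd (u := u) rfl)).congr ?_
      rw [wordParity_cons]; push_cast
      linear_combination (-1 : ZMod 2) * zmod_two_two
    · refine ((sndHom_snd (u := [A]) rfl).mul ih).congr ?_
      simp only [wordParity_cons, wordParity_nil]; push_cast; ring

theorem invol_der (x : DiagAlgebra R) : invol R (L.der x) = -L.der (invol R x) := by
  have : invol R ∘ₗ L.der = -(L.der ∘ₗ invol R) := by
    apply hom_ext
    intro g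
    simp only [LinearMap.comp_apply, LinearMap.neg_apply]
    rw [invol_basis, map_smul, der_basis, invol_mul, map_add, map_smul, invol_mul, invol_mul,
      (L.derFst_hom _).invol, (L.derSnd_hom _).invol, (fstHom_fst rfl).invol,
      (sndHom_snd rfl).invol, ext, invol_basis, ← neg_smul]
    simp only [add_mul, smul_mul_assoc, mul_smul_comm, smul_add, smul_smul, indexParity,
      wordParity_nil, add_zero]
    congr 2 <;> ring
  exact congrArg (fun f => f x) this

/-- The graded commutator of two odd derivations. -/
def comm (L L' : LetterMap R) : DiagAlgebra R →ₗ[R] DiagAlgebra R :=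
  L.der ∘ₗ L'.der + L'.der ∘ₗ L.der

theorem comm_apply (L L' : LetterMap R) (x : DiagAlgebra R) :
    comm L L' x = L.der (L'.der x) + L'.der (L.der x) := rfl

/-- The mixed terms cancel because the parity involution anticommutes with odd derivations. Thus the
commutator is an ordinary derivation and is determined by its values on generators. -/
theorem comm_mul (L L' : LetterMap R) (x y : DiagAlgebra R) :
    comm L L' (x * y) = comm L L' x * y + x * comm L L' y := by
  simp only [comm_apply, der_mul, map_add, invol_der, invol_invol]
  noncomm_ring

theorem der_of_fstHom {p : ℕ} {x : DiagAlgebra R} (hx : FstHom p x) (h : ∀ A, L.onFst A = 0) :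
    L.der x = 0 := by
  refine hx.mem (LinearMap.ker L.der) fun u hu => ?_
  clear hu
  rw [LinearMap.mem_ker]
  induction u with
  | nil => rw [fst_nil, der_one]
  | cons A u ih =>
    rw [show fst R (A :: u) = fst R [A] * fst R u from fst_append [A] u, der_fst_mul, h, ih]
    simp

theorem der_of_sndHom {p : ℕ} {x : DiagAlgebra R} (hx : SndHom p x) (h : ∀ A, L.onSnd A = 0) :
    L.der x = 0 := by
  refine hx.mem (LinearMap.ker L.der) fun u hu => ?_
  clear hu
  rw [LinearMap.mem_ker]
  induction u with
  | nil => rw [snd_nil, der_one]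
  | cons A u ih =>
    rw [show snd R (A :: u) = snd R [A] * snd R u from snd_append [A] u, der_snd_mul, h, ih]
    simp

end LetterMap

/-- The subdivisions of a letter, for a multiplicative family of words. -/
def splitLetter (w : List (Finset ℕ) → DiagAlgebra R) (A : Finset ℕ) : DiagAlgebra R :=
  ∑ M ∈ A.powerset, if M = ∅ ∨ M = A then 0 else
    (-1 : R) ^ (crossings M (A \ M) + M.card) • w [M, A \ M]

theorem wordParity_split {A M : Finset ℕ} (h : M ∈ A.powerset) :
    (wordParity [M, A \ M] : ZMod 2) = (A.card : ℕ) := by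
  rw [Finset.mem_powerset] at h
  rw [← Finset.card_sdiff_add_card_eq_card h]
  simp only [wordParity_cons, wordParity_nil]
  push_cast
  linear_combination zmod_two_two

/-- The insertion of `n` into a letter, for a multiplicative family of words. -/
def insLetter (n : ℕ) (w : List (Finset ℕ) → DiagAlgebra R) (A : Finset ℕ) : DiagAlgebra R :=
  if n ∈ A then 0 else (-1 : R) ^ A.card • w [insert n A]

theorem wordParity_ins {n : ℕ} {A : Finset ℕ} (h : n ∉ A) :
    (wordParity [insert n A] : ZMod 2) = (A.card : ℕ) := by
  simp only [wordParity_cons, wordParity_nil, Finset.card_insert_of_notMem h]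
  push_cast
  linear_combination zmod_two_two

variable (R) in
/-- The cellular differential of the permutahedra. -/
def diff : LetterMap R where
  onFst := splitLetter (fst R)
  onSnd := splitLetter (snd R)
  fst_hom A := by
    refine Submodule.sum_mem _ fun M hM => ?_
    split_ifs
    · exact Submodule.zero_mem _
    · exact Submodule.smul_mem _ _ (fstHom_fst (wordParity_split hM))
  snd_hom A := by
    refine Submodule.sum_mem _ fun M hM => ?_
    split_ifs
    · exact Submodule.zero_mem _
    · exact Submodule.smul_mem _ _ (sndHom_snd (wordParity_split hM))

variable (R) in
/-- The insertion of `n` into the letters of the first word. -/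
def insFst (n : ℕ) : LetterMap R where
  onFst := insLetter n (fst R)
  onSnd _ := 0
  fst_hom A := by
    unfold insLetter
    split_ifs with h
    · exact Submodule.zero_mem _
    · exact Submodule.smul_mem _ _ (fstHom_fst (wordParity_ins h))
  snd_hom A := Submodule.zero_mem _

variable (R) in
/-- The insertion of `n` into the letters of the second word. -/
def insSnd (n : ℕ) : LetterMap R where
  onFst _ := 0
  onSnd := insLetter n (snd R)
  snd_hom A := by
    unfold insLetter
    split_ifs with h
    · exact Submodule.zero_mem _
    · exact Submodule.smul_mem _ _ (sndHom_snd (wordParity_ins h))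
  fst_hom A := Submodule.zero_mem _

/-- Since `n` exceeds all elements of `A`, a subdivision of `A ∪ {n}` is a decomposition of `A` with
`n` added to one part. The ones that come from proper subdivisions of `A` cancel against insertion
after subdivision. What survives is `A|n` and `n|A`, with opposite signs. -/
theorem splitLetter_insLetter {w : List (Finset ℕ) → DiagAlgebra R}
    (happ : ∀ u v, w (u ++ v) = w u * w v) {L L' : LetterMap R}
    (h1 : ∀ A, L.der (w [A]) = splitLetter w A) (h2 : ∀ A, L'.der (w [A]) = insLetter n w A)
    (h3 : ∀ A, invol R (w [A]) = (-1 : R) ^ (A.card + 1) • w [A])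
    {A : Finset ℕ} (hA : A ⊆ Finset.range n) (hne : A.Nonempty) :
    LetterMap.comm L L' (w [A]) = w [A] * w [{n}] - w [{n}] * w [A] := by
  have hn : ∀ B ⊆ A, n ∉ B := fun B hB h => by simpa using hA (hB h)
  have hlt : ∀ B ⊆ A, ∀ b ∈ B, b < n := fun B hB b hb => Finset.mem_range.1 (hA (hB hb))
  -- The subsets of `A ∪ {n}` are grouped by their trace `M` on `A`. Only `∅` and `A ∪ {n}` are
  -- improper, so each of `M = ∅` and `M = A` still keeps one of its two terms.
  have e1 : L.der (L'.der (w [A])) = ∑ M ∈ A.powerset,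
      ((if M = ∅ then 0 else (-1 : R) ^ (A.card + crossings M (A \ M) + M.card) •
          w [M, insert n (A \ M)]) +
        (if M = A then 0 else (-1 : R) ^ (A.card + crossings M (A \ M) + (A \ M).card + M.card + 1) •
          w [insert n M, A \ M])) := by
    rw [h2, insLetter, if_neg (hn A subset_rfl), map_smul, h1, splitLetter,
      Finset.sum_powerset_insert (hn A subset_rfl), ← Finset.sum_add_distrib, Finset.smul_sum]
    apply Finset.sum_congr rfl
    intro M hM
    rw [Finset.mem_powerset] at hM
    have hM' := hn M hM
    have c1 : M ≠ insert n A := fun h => hM' (h ▸ Finset.mem_insert_self n A)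
    have c2 : insert n M = insert n A ↔ M = A := by
      constructor
      · intro h
        rw [← Finset.erase_insert hM', h, Finset.erase_insert (hn A subset_rfl)]
      · rintro rfl; rfl
    have c3 : insert n A \ M = insert n (A \ M) := Finset.insert_sdiff_of_notMem _ hM'
    have c4 : insert n A \ insert n M = A \ M := by
      rw [Finset.insert_sdiff_insert]
      ext a
      simp only [Finset.mem_sdiff, Finset.mem_insert, not_or]
      constructor
      · tauto
      · rintro ⟨h, h'⟩
        exact ⟨h, fun e => hn A subset_rfl (e ▸ h), h'⟩
    have hd : n ∉ A \ M := hn _ Finset.sdiff_subset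
    have c5 : crossings M (insert n (A \ M)) = crossings M (A \ M) := by
      rw [Finset.insert_eq, crossings_union_right (by simpa using hd),
        crossings_eq_zero (A := M), zero_add]
      intro a ha b hb
      rw [Finset.mem_singleton.1 hb]
      exact (hlt M hM a ha).le
    have c6 : crossings (insert n M) (A \ M) = (A \ M).card + crossings M (A \ M) := by
      rw [Finset.insert_eq, crossings_union_left (by simpa using hM'),
        crossings_eq_mul (A := {n}), Finset.card_singleton, one_mul]
      intro a ha b hb
      rw [Finset.mem_singleton.1 ha]
      exact hlt _ Finset.sdiff_subset b hb
    simp only [c1, or_false, c2, c3, c4, c5, c6, Finset.insert_ne_empty, false_or, smul_add,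
      smul_ite, smul_zero, smul_smul, ← pow_add, Finset.card_insert_of_notMem hM']
    congr 3
    · ring_nf
    · ring_nf
  have e2 : L'.der (L.der (w [A])) = ∑ M ∈ A.powerset, if M = ∅ ∨ M = A then 0 else
      ((-1 : R) ^ (crossings M (A \ M)) • w [insert n M, A \ M] +
        (-1 : R) ^ (crossings M (A \ M) + 1 + (A \ M).card) • w [M, insert n (A \ M)]) := by
    rw [h1, splitLetter, map_sum]
    apply Finset.sum_congr rfl
    intro M hM
    rw [Finset.mem_powerset] at hM
    split_ifs with h
    · simp
    · have hM' := hn M hM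
      have hd : n ∉ A \ M := hn _ Finset.sdiff_subset
      have app : ∀ B C : Finset ℕ, w [B, C] = w [B] * w [C] := fun B C => happ [B] [C]
      rw [map_smul, app, LetterMap.der_mul, h2, h2, insLetter, insLetter, if_neg hM', if_neg hd, h3]
      simp only [smul_mul_assoc, mul_smul_comm, ← app, smul_add, smul_smul, ← pow_add]
      congr 2
      · apply neg_one_pow_congr
        push_cast
        linear_combination (M.card : ZMod 2) * zmod_two_two
      · apply neg_one_pow_congr
        push_cast
        linear_combination (M.card : ZMod 2) * zmod_two_two
  rw [LetterMap.comm_apply, e1, e2, ← Finset.sum_add_distrib]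
  have e3 : ∀ M ∈ A.powerset, (((if M = ∅ then 0 else
        (-1 : R) ^ (A.card + crossings M (A \ M) + M.card) • w [M, insert n (A \ M)]) +
      (if M = A then 0 else (-1 : R) ^ (A.card + crossings M (A \ M) + (A \ M).card + M.card + 1) •
          w [insert n M, A \ M])) +
      if M = ∅ ∨ M = A then 0 else
      ((-1 : R) ^ (crossings M (A \ M)) • w [insert n M, A \ M] +
        (-1 : R) ^ (crossings M (A \ M) + 1 + (A \ M).card) • w [M, insert n (A \ M)])) =
      (if M = A then w [A] * w [{n}] else 0) + (if M = ∅ then - (w [{n}] * w [A]) else 0) := by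
    intro M hM
    rw [Finset.mem_powerset] at hM
    have hcard := Finset.card_sdiff_add_card_eq_card hM
    have app : ∀ B C : Finset ℕ, w [B, C] = w [B] * w [C] := fun B C => happ [B] [C]
    by_cases m1 : M = ∅
    · subst m1
      have : ∅ ≠ A := hne.ne_empty.symm
      simp only [if_true, this, if_false, true_or, Finset.sdiff_empty, crossings_empty_left,
        Finset.card_empty, zero_add, add_zero, ← two_mul, pow_succ, pow_mul]
      simp [app]
    · by_cases m2 : M = A
      · subst m2
        simp only [m1, if_true, if_false, or_true, Finset.sdiff_self, crossings_empty_right,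
          add_zero, ← two_mul, pow_mul]
        simp [app]
      · simp only [m1, m2, if_false, or_self, add_zero]
        have s1 : (-1 : R) ^ (A.card + crossings M (A \ M) + M.card) =
            -(-1 : R) ^ (crossings M (A \ M) + 1 + (A \ M).card) := by
          rw [← hcard]
          trans (-1 : R) ^ (crossings M (A \ M) + 1 + (A \ M).card + 1)
          · apply neg_one_pow_congr
            push_cast
            linear_combination (M.card - 1 : ZMod 2) * zmod_two_two
          · ring
        have s2 : (-1 : R) ^ (A.card + crossings M (A \ M) + (A \ M).card + M.card + 1) =
            -(-1 : R) ^ (crossings M (A \ M)) := by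
          rw [← hcard]
          trans (-1 : R) ^ (crossings M (A \ M) + 1)
          · apply neg_one_pow_congr
            push_cast
            linear_combination (M.card + (A \ M).card : ZMod 2) * zmod_two_two
          · ring
        rw [s1, s2, neg_smul, neg_smul]
        abel
  rw [Finset.sum_congr rfl e3, Finset.sum_add_distrib, Finset.sum_ite_eq', Finset.sum_ite_eq']
  simp [sub_eq_add_neg]

/-- A word in nonempty subsets of `{0, …, n - 1}`. -/
def WordBelow (n : ℕ) (u : List (Finset ℕ)) : Prop :=
  ∀ A ∈ u, A.Nonempty ∧ A ⊆ Finset.range n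

/-- A bracket with an element commutes with the formation of words. -/
theorem comm_word {w : List (Finset ℕ) → DiagAlgebra R} (hnil : w [] = 1)
    (happ : ∀ u v, w (u ++ v) = w u * w v) {L L' : LetterMap R} {N : DiagAlgebra R}
    {u : List (Finset ℕ)} (h : ∀ A ∈ u, LetterMap.comm L L' (w [A]) = w [A] * N - N * w [A]) :
    LetterMap.comm L L' (w u) = w u * N - N * w u := by
  induction u with
  | nil => rw [hnil, LetterMap.comm_apply, LetterMap.der_one, LetterMap.der_one]; simp
  | cons A u ih =>
    rw [show w (A :: u) = w [A] * w u from happ [A] u, LetterMap.comm_mul,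
      h A (by simp), ih (fun B hB => h B (by simp [hB]))]
    noncomm_ring

theorem comm_ext (L L' : LetterMap R) (X : Finset ℕ) : LetterMap.comm L L' (ext R X) = 0 := by
  rw [LetterMap.comm_apply, LetterMap.der_ext, LetterMap.der_ext]; simp

theorem sq_neg_one_pow (k : ℕ) : ((-1 : R) ^ k) ^ 2 = 1 := by rw [← pow_mul, mul_comm, pow_mul]; simp

/-- On the first factor this is the computation for letters. Words of the second factor and exterior
monomials are killed by the commutator, and they commute with the letter `{n}`, which has even
parity. -/
theorem comm_insFst {n : ℕ} {g : DiagIndex} (h : WordBelow n g.2.1) :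
    LetterMap.comm (diff R) (insFst R n) (basis R g) =
      basis R g * fst R [{n}] - fst R [{n}] * basis R g := by
  have h1 : LetterMap.comm (diff R) (insFst R n) (fst R g.2.1) =
      fst R g.2.1 * fst R [{n}] - fst R [{n}] * fst R g.2.1 := by
    refine comm_word fst_nil fst_append fun A hA => ?_
    refine splitLetter_insLetter fst_append (fun B => (diff R).der_fst_singleton B)
      (fun B => (insFst R n).der_fst_singleton B) (fun B => ?_) (h A hA).2 (h A hA).1
    exact (fstHom_fst rfl).invol
  have h2 : LetterMap.comm (diff R) (insFst R n) (snd R g.2.2) =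
      snd R g.2.2 * fst R [{n}] - fst R [{n}] * snd R g.2.2 := by
    refine comm_word snd_nil snd_append fun A hA => ?_
    rw [LetterMap.comm_apply, LetterMap.der_of_sndHom (insFst R n) (sndHom_snd rfl) (fun _ => rfl),
      LetterMap.der_snd_singleton,
      LetterMap.der_of_sndHom (insFst R n) ((diff R).snd_hom A) (fun _ => rfl), snd_mul_fst]
    simp [pow_mul, sq_neg_one_pow]
  have h3 : ext R g.1 * fst R [{n}] = fst R [{n}] * ext R g.1 := by
    rw [ext_mul_fst]; simp [pow_mul, sq_neg_one_pow]
  rw [basis_eq, LetterMap.comm_mul, LetterMap.comm_mul, h1, h2, comm_ext, mul_assoc _ (ext R g.1), h3]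
  noncomm_ring

theorem comm_insSnd {n : ℕ} {g : DiagIndex} (h : WordBelow n g.2.2) :
    LetterMap.comm (diff R) (insSnd R n) (basis R g) =
      basis R g * snd R [{n}] - snd R [{n}] * basis R g := by
  have h1 : LetterMap.comm (diff R) (insSnd R n) (snd R g.2.2) =
      snd R g.2.2 * snd R [{n}] - snd R [{n}] * snd R g.2.2 := by
    refine comm_word snd_nil snd_append fun A hA => ?_
    refine splitLetter_insLetter snd_append (fun B => (diff R).der_snd_singleton B)
      (fun B => (insSnd R n).der_snd_singleton B) (fun B => ?_) (h A hA).2 (h A hA).1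
    exact (sndHom_snd rfl).invol
  have h2 : LetterMap.comm (diff R) (insSnd R n) (fst R g.2.1) =
      fst R g.2.1 * snd R [{n}] - snd R [{n}] * fst R g.2.1 := by
    refine comm_word fst_nil fst_append fun A hA => ?_
    rw [LetterMap.comm_apply, LetterMap.der_of_fstHom (insSnd R n) (fstHom_fst rfl) (fun _ => rfl),
      LetterMap.der_fst_singleton,
      LetterMap.der_of_fstHom (insSnd R n) ((diff R).fst_hom A) (fun _ => rfl), snd_mul_fst]
    simp [pow_mul]
  have h3 : ext R g.1 * snd R [{n}] = snd R [{n}] * ext R g.1 := by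
    rw [ext_mul_snd]; simp [pow_mul, sq_neg_one_pow]
  rw [basis_eq, LetterMap.comm_mul, LetterMap.comm_mul, h1, h2, comm_ext, mul_assoc _ (ext R g.1), h3]
  noncomm_ring

/-! #### Adjoining a new largest element -/

variable (R) in
/-- The operation that adjoins `n` to the exterior monomials in elements below `n`. -/
def insExt (n : ℕ) : DiagAlgebra R →ₗ[R] DiagAlgebra R :=
  extend fun g => if g.1 ⊆ Finset.range n then
    (-1 : R) ^ g.1.card • basis R (insert n g.1, g.2.1, g.2.2) else 0

theorem insExt_basis (n : ℕ) (g : DiagIndex) : insExt R n (basis R g) =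
    if g.1 ⊆ Finset.range n then
      (-1 : R) ^ g.1.card • basis R (insert n g.1, g.2.1, g.2.2) else 0 := extend_basis _ _

variable (R) in
/-- The elements whose left multiplications commute with `insExt`. -/
def insExtCommutant (n : ℕ) : Submodule R (DiagAlgebra R) where
  carrier := {w | ∀ y, insExt R n (w * y) = w * insExt R n y}
  add_mem' := by
    intro a b ha hb y
    rw [add_mul, map_add, ha, hb, add_mul]
  zero_mem' := by intro y; simp
  smul_mem' := by
    intro r a ha y
    rw [smul_mul_assoc, map_smul, ha, smul_mul_assoc]

theorem mem_insExtCommutant {n : ℕ} {w : DiagAlgebra R} :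
    w ∈ insExtCommutant R n ↔ ∀ y, insExt R n (w * y) = w * insExt R n y := Iff.rfl

theorem insExtCommutant_mul {n : ℕ} {x y : DiagAlgebra R} (hx : x ∈ insExtCommutant R n)
    (hy : y ∈ insExtCommutant R n) : x * y ∈ insExtCommutant R n := by
  intro z
  rw [mul_assoc, hx, hy, mul_assoc]

theorem mem_insExtCommutant_of_basis {n : ℕ} {x : DiagAlgebra R}
    (h : ∀ g, insExt R n (x * basis R g) = x * insExt R n (basis R g)) :
    x ∈ insExtCommutant R n := by
  intro y
  induction y using induction with
  | zero => simp
  | add a b ha hb => simp only [map_add, mul_add, ha, hb]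
  | basis_mem r g => simp only [map_smul, mul_smul_comm, h]

theorem fst_mem_insExtCommutant (n : ℕ) (u : List (Finset ℕ)) : fst R u ∈ insExtCommutant R n := by
  apply mem_insExtCommutant_of_basis
  intro g
  rw [fst_mul_basis, insExt_basis, insExt_basis]
  simp only
  split_ifs
  · rw [mul_smul_comm, fst_mul_basis]
  · simp

theorem snd_mem_insExtCommutant (n : ℕ) (u : List (Finset ℕ)) : snd R u ∈ insExtCommutant R n := by
  apply mem_insExtCommutant_of_basis
  intro g
  rw [snd_mul_basis, map_smul, insExt_basis, insExt_basis]
  simp only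
  split_ifs
  · rw [mul_smul_comm, snd_mul_basis, smul_comm]
  · simp

/-- The derivation kills exterior monomials and sends words to combinations of words, whose left
multiplication does not see the adjoined element. -/
theorem der_insExt (L : LetterMap R) (n : ℕ) (x : DiagAlgebra R) :
    L.der (insExt R n x) = insExt R n (L.der x) := by
  induction x using induction with
  | zero => simp
  | add a b ha hb => simp only [map_add, ha, hb]
  | basis_mem r g =>
    rw [map_smul, map_smul, map_smul, map_smul]
    refine congrArg (r • ·) ?_
    have h1 : L.derFst g.2.1 ∈ insExtCommutant R n :=
      (L.derFst_hom _).mem _ fun u _ => fst_mem_insExtCommutant n u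
    have h2 : L.derSnd g.2.2 ∈ insExtCommutant R n :=
      (L.derSnd_hom _).mem _ fun u _ => snd_mem_insExtCommutant n u
    have hw : L.derFst g.2.1 * snd R g.2.2 +
        (-1 : R) ^ wordParity g.2.1 • (fst R g.2.1 * L.derSnd g.2.2) ∈ insExtCommutant R n :=
      Submodule.add_mem _ (insExtCommutant_mul h1 (snd_mem_insExtCommutant _ _))
        (Submodule.smul_mem _ _ (insExtCommutant_mul (fst_mem_insExtCommutant _ _) h2))
    have hw' := (mem_insExtCommutant.1 hw) (ext R g.1)
    have hb := L.der_basis (insert n g.1, g.2.1, g.2.2)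
    rw [LetterMap.der_basis, hw', ext, insExt_basis, insExt_basis]
    simp only at hb ⊢
    split_ifs
    · rw [map_smul, hb, mul_smul_comm, ext]
    · rw [map_zero, mul_zero]

variable (R) in
/-- Combinations of basis elements satisfying `p`. -/
def spanBasis (p : DiagIndex → Prop) : Submodule R (DiagAlgebra R) :=
  Submodule.span R {y | ∃ g, p g ∧ y = basis R g}

theorem spanBasis_induction {p : DiagIndex → Prop} {x : DiagAlgebra R} (hx : x ∈ spanBasis R p)
    (S : Submodule R (DiagAlgebra R)) (h : ∀ g, p g → basis R g ∈ S) : x ∈ S :=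
  Submodule.span_le.2 (by rintro _ ⟨g, hg, rfl⟩; exact h g hg) hx

/-- On monomials in elements below `n`, `insExt` is right multiplication by an odd exterior
generator of square zero. This lemma and the next three are the corresponding rules for products and
parity. -/
theorem mul_insExt {n : ℕ} {x : DiagAlgebra R} (hx : x ∈ spanBasis R fun g => g.1 ⊆ Finset.range n)
    (y : DiagAlgebra R) : x * insExt R n y = insExt R n (x * y) := by
  suffices x ∈ insExtCommutant R n from (this y).symm
  refine spanBasis_induction hx _ fun g hg => mem_insExtCommutant_of_basis fun h => ?_
  have hn : n ∉ g.1 := fun h => by simpa using hg h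
  rw [insExt_basis, basis_mul_basis, mulBasis]
  by_cases hh : h.1 ⊆ Finset.range n
  · have hn' : n ∉ h.1 := fun h => by simpa using hh h
    rw [if_pos hh, mul_smul_comm]
    by_cases hd : Disjoint g.1 h.1
    · have hd' : Disjoint g.1 (insert n h.1) := Finset.disjoint_insert_right.2 ⟨hn, hd⟩
      rw [if_pos hd, map_smul, insExt_basis, if_pos (Finset.union_subset hg hh), mul_basis_of hd',
        smul_smul, smul_smul, ← pow_add, ← pow_add, Finset.union_insert]
      congr 1
      apply neg_one_pow_congr
      have c : crossings (insert n h.1) g.1 = g.1.card + crossings h.1 g.1 := by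
        rw [Finset.insert_eq, crossings_union_left (by simpa using hn'),
          crossings_eq_mul (A := {n}), Finset.card_singleton, one_mul]
        intro a ha b hb
        rw [Finset.mem_singleton.1 ha]
        exact Finset.mem_range.1 (hg hb)
      simp only [mulExp, c, Finset.card_union_of_disjoint hd]
      push_cast
      ring
    · have hd' : ¬ Disjoint g.1 (insert n h.1) :=
        fun h => hd (Finset.disjoint_insert_right.1 h).2
      rw [if_neg hd, basis_mul_basis, mulBasis, if_neg hd']
      simp
  · rw [if_neg hh]
    split_ifs
    · rw [map_smul, insExt_basis, if_neg (fun h => hh (Finset.union_subset_iff.1 h).2)]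
      simp
    · simp

theorem insExt_mul {n : ℕ} {y : DiagAlgebra R} (hy : y ∈ spanBasis R fun g => g.1 ⊆ Finset.range n)
    (x : DiagAlgebra R) : insExt R n x * y = insExt R n (x * invol R y) := by
  refine spanBasis_induction hy (LinearMap.eqLocus (LinearMap.mulLeft R (insExt R n x))
    (insExt R n ∘ₗ LinearMap.mulLeft R x ∘ₗ invol R)) fun h hh => ?_
  simp only [LinearMap.mem_eqLocus, LinearMap.mulLeft_apply, LinearMap.comp_apply]
  have hn' : n ∉ h.1 := fun h => by simpa using hh h
  induction x using induction with
  | zero => simp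
  | add a b ha hb => simp only [map_add, add_mul, ha, hb]
  | basis_mem r g =>
    simp only [map_smul, smul_mul_assoc]
    congr 1
    rw [insExt_basis, invol_basis, mul_smul_comm, map_smul, basis_mul_basis, mulBasis]
    by_cases hg : g.1 ⊆ Finset.range n
    · have hn : n ∉ g.1 := fun h => by simpa using hg h
      rw [if_pos hg, smul_mul_assoc]
      by_cases hd : Disjoint g.1 h.1
      · have hd' : Disjoint (insert n g.1) h.1 := Finset.disjoint_insert_left.2 ⟨hn', hd⟩
        rw [if_pos hd, map_smul, insExt_basis, if_pos (Finset.union_subset hg hh), mul_basis_of hd',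
          smul_smul, smul_smul, smul_smul, ← pow_add, ← pow_add, ← pow_add, Finset.insert_union]
        congr 1
        apply neg_one_pow_congr
        have c : crossings h.1 (insert n g.1) = crossings h.1 g.1 := by
          rw [Finset.insert_eq, crossings_union_right (by simpa using hn),
            crossings_eq_zero (A := h.1) (B := {n}), zero_add]
          intro a ha b hb
          rw [Finset.mem_singleton.1 hb]
          exact (Finset.mem_range.1 (hh ha)).le
        simp only [mulExp, c, Finset.card_union_of_disjoint hd, indexParity,
          Finset.card_insert_of_notMem hn]
        push_cast
        linear_combination (-(h.1.card : ZMod 2)) * zmod_two_two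
      · have hd' : ¬ Disjoint (insert n g.1) h.1 :=
          fun h => hd (Finset.disjoint_insert_left.1 h).2
        rw [if_neg hd, basis_mul_basis, mulBasis, if_neg hd']
        simp
    · rw [if_neg hg]
      split_ifs
      · rw [map_smul, insExt_basis, if_neg (fun h => hg (Finset.union_subset_iff.1 h).1)]
        simp
      · simp

theorem insExt_mul_insExt (n : ℕ) (x y : DiagAlgebra R) : insExt R n x * insExt R n y = 0 := by
  induction x using induction with
  | zero => simp
  | add a b ha hb => simp only [map_add, add_mul, ha, hb, add_zero]
  | basis_mem r g =>
    induction y using induction with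
    | zero => simp
    | add a b ha hb => simp only [map_add, mul_add, ha, hb, add_zero]
    | basis_mem s h =>
      simp only [map_smul, smul_mul_assoc, mul_smul_comm, insExt_basis]
      split_ifs
      · simp [smul_mul_assoc, mul_smul_comm, basis_mul_basis, mulBasis]
      · simp
      · simp
      · simp

theorem invol_insExt (n : ℕ) (x : DiagAlgebra R) :
    invol R (insExt R n x) = -insExt R n (invol R x) := by
  induction x using induction with
  | zero => simp
  | add a b ha hb => simp only [map_add, ha, hb, neg_add]
  | basis_mem r g =>
    simp only [map_smul, ← smul_neg]
    congr 1
    rw [invol_basis, map_smul, insExt_basis]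
    split_ifs with h
    · have hn : n ∉ g.1 := fun h' => by simpa using h h'
      rw [map_smul, invol_basis, smul_smul, smul_smul, ← neg_smul]
      simp only [indexParity, Finset.card_insert_of_notMem hn]
      congr 1
      ring
    · simp

/-- The passage from the diagonals of the permutahedra on subsets of `{0, …, n - 1}` to those on
subsets of `{0, …, n}`. -/
def diagStep (n : ℕ) (D : DiagAlgebra R) : DiagAlgebra R :=
  D + insExt R n ((snd R [{n}] + (insSnd R n).der D) * (fst R [{n}] + (insFst R n).der D))

theorem splitLetter_singleton (w : List (Finset ℕ) → DiagAlgebra R) (n : ℕ) :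
    splitLetter w {n} = 0 := by
  apply Finset.sum_eq_zero
  intro M hM
  rw [Finset.mem_powerset, Finset.subset_singleton_iff] at hM
  rw [if_pos hM]

/-- Write the new element as `D + P T e` with `e` the adjoined exterior generator. The bracket
formulas for the insertions and `dD = D²` give `dP = DP - PD` and `dT = DT - TD`, hence `d(PT) =
D(PT) - (PT)D`. On the other side `(D + PTe)² = D² + (D(PT) - (PT)D)e`, because `e² = 0` and `e`
anticommutes with the odd element `D`. -/
theorem maurerCartan_step {n : ℕ} {D : DiagAlgebra R}
    (hD : D ∈ spanBasis R fun g => g.1 ⊆ Finset.range n ∧ WordBelow n g.2.1 ∧ WordBelow n g.2.2)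
    (hodd : invol R D = -D) (hMC : (diff R).der D = D * D) :
    invol R (diagStep n D) = -diagStep n D ∧
      (diff R).der (diagStep n D) = diagStep n D * diagStep n D := by
  have hX : D ∈ spanBasis R fun g => g.1 ⊆ Finset.range n :=
    Submodule.span_mono (by rintro _ ⟨g, hg, rfl⟩; exact ⟨g, hg.1, rfl⟩) hD
  have c1 : LetterMap.comm (diff R) (insFst R n) D = D * fst R [{n}] - fst R [{n}] * D :=
    spanBasis_induction hD (LinearMap.eqLocus _
      (LinearMap.mulRight R (fst R [{n}]) - LinearMap.mulLeft R (fst R [{n}])))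
      fun g hg => comm_insFst hg.2.1
  have c2 : LetterMap.comm (diff R) (insSnd R n) D = D * snd R [{n}] - snd R [{n}] * D :=
    spanBasis_induction hD (LinearMap.eqLocus _
      (LinearMap.mulRight R (snd R [{n}]) - LinearMap.mulLeft R (snd R [{n}])))
      fun g hg => comm_insSnd hg.2.2
  -- The second half of each commutator is an insertion applied to `dD = D * D`; the Leibniz rule
  -- and the oddness of `D` turn it into a commutator with `D`.
  rw [LetterMap.comm_apply, hMC, LetterMap.der_mul, hodd] at c1 c2
  have n1 : (diff R).der (fst R [{n}]) = 0 :=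
    ((diff R).der_fst_singleton _).trans (splitLetter_singleton _ n)
  have n2 : (diff R).der (snd R [{n}]) = 0 :=
    ((diff R).der_snd_singleton _).trans (splitLetter_singleton _ n)
  have p1 : invol R (fst R [{n}]) = fst R [{n}] := by
    rw [(fstHom_fst (u := [{n}]) (p := 0) (by simp; rfl)).invol]; simp
  have p2 : invol R (snd R [{n}]) = snd R [{n}] := by
    rw [(sndHom_snd (u := [{n}]) (p := 0) (by simp; rfl)).invol]; simp
  unfold diagStep
  set P := snd R [{n}] + (insSnd R n).der D with hP
  set T := fst R [{n}] + (insFst R n).der D with hT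
  have dP : (diff R).der P = D * P - P * D := by
    rw [hP, map_add, n2, zero_add, eq_sub_of_add_eq c2]
    noncomm_ring
  have dT : (diff R).der T = D * T - T * D := by
    rw [hT, map_add, n1, zero_add, eq_sub_of_add_eq c1]
    noncomm_ring
  have iP : invol R P = P := by
    rw [hP, map_add, p2, LetterMap.invol_der, hodd, map_neg, neg_neg]
  have iT : invol R T = T := by
    rw [hT, map_add, p1, LetterMap.invol_der, hodd, map_neg, neg_neg]
  clear_value P T
  constructor
  · rw [map_add, hodd, invol_insExt, invol_mul, iP, iT, neg_add]
  · rw [map_add, hMC, der_insExt, LetterMap.der_mul, iP, dP, dT, mul_add, add_mul, add_mul,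
      insExt_mul_insExt, mul_insExt hX, insExt_mul hX, hodd, add_zero, add_assoc, ← map_add]
    congr 2
    noncomm_ring

end DiagAlgebra

/-! ### Ordered partitions and shifts -/

/-- The union of a list of sets. -/
def unions (l : List (Finset ℕ)) : Finset ℕ := l.foldr (· ∪ ·) ∅

@[simp] theorem unions_nil : unions [] = ∅ := rfl
@[simp] theorem unions_cons (A : Finset ℕ) (l : List (Finset ℕ)) :
    unions (A :: l) = A ∪ unions l := rfl
@[simp] theorem unions_append (l m : List (Finset ℕ)) : unions (l ++ m) = unions l ∪ unions m := by
  induction l with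
  | nil => simp
  | cons A l ih => simp [ih, Finset.union_assoc]

theorem mem_unions {l : List (Finset ℕ)} {a : ℕ} : a ∈ unions l ↔ ∃ A ∈ l, a ∈ A := by
  induction l with
  | nil => simp
  | cons A l ih => simp [ih]

theorem unions_reverse (l : List (Finset ℕ)) : unions l.reverse = unions l := by
  ext a; simp [mem_unions]

/-- `l` is an ordered partition of `X`. -/
structure IsPart (X : Finset ℕ) (l : List (Finset ℕ)) : Prop where
  nonempty : ∀ A ∈ l, A.Nonempty
  disj : l.Pairwise Disjoint
  union : unions l = X

theorem isPart_nil : IsPart ∅ [] := ⟨by simp, by simp, rfl⟩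

theorem isPart_cons {X A : Finset ℕ} {l : List (Finset ℕ)} :
    IsPart X (A :: l) ↔ A.Nonempty ∧ Disjoint A (unions l) ∧ IsPart (unions l) l ∧
      A ∪ unions l = X := by
  constructor
  · rintro ⟨h1, h2, h3⟩
    rw [List.pairwise_cons] at h2
    refine ⟨h1 A (by simp), ?_, ⟨fun B hB => h1 B (by simp [hB]), h2.2, rfl⟩, h3⟩
    rw [Finset.disjoint_left]
    intro a ha ha'
    obtain ⟨B, hB, haB⟩ := mem_unions.1 ha'
    exact Finset.disjoint_left.1 (h2.1 B hB) ha haB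
  · rintro ⟨h1, h2, h3, h4⟩
    refine ⟨?_, ?_, h4⟩
    · intro B hB
      rcases List.mem_cons.1 hB with rfl | hB
      · exact h1
      · exact h3.nonempty B hB
    · rw [List.pairwise_cons]
      refine ⟨fun B hB => h2.mono_right ?_, h3.disj⟩
      intro a ha
      exact mem_unions.2 ⟨B, hB, ha⟩

theorem IsPart.reverse {X : Finset ℕ} {l : List (Finset ℕ)} (h : IsPart X l) :
    IsPart X l.reverse :=
  ⟨fun A hA => h.nonempty A (by simpa using hA),
    List.pairwise_reverse.2 (h.disj.imp fun hab => hab.symm), by rw [unions_reverse, h.union]⟩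

theorem IsPart.subset {X A : Finset ℕ} {l : List (Finset ℕ)} (h : IsPart X l) (hA : A ∈ l) :
    A ⊆ X := fun _ ha => h.union ▸ mem_unions.2 ⟨A, hA, ha⟩

/-- The total number of elements of the blocks. -/
def cardSum (l : List (Finset ℕ)) : ℕ := (l.map Finset.card).sum

@[simp] theorem cardSum_nil : cardSum [] = 0 := rfl
@[simp] theorem cardSum_cons (A : Finset ℕ) (l : List (Finset ℕ)) :
    cardSum (A :: l) = A.card + cardSum l := rfl

theorem IsPart.cardSum {X : Finset ℕ} {l : List (Finset ℕ)} (h : IsPart X l) :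
    cardSum l = X.card := by
  induction l generalizing X with
  | nil => rw [← h.union]; rfl
  | cons A l ih =>
    obtain ⟨-, h2, h3, h4⟩ := isPart_cons.1 h
    rw [cardSum_cons, ih h3, ← h4, Finset.card_union_of_disjoint h2]

theorem wordParity_eq (u : List (Finset ℕ)) : wordParity u = cardSum u + u.length := by
  induction u with
  | nil => rfl
  | cons A u ih => simp [ih]; omega

theorem sum_crossings_right {A X : Finset ℕ} {l : List (Finset ℕ)} (h : IsPart X l) :
    (l.map (crossings A)).sum = crossings A X := by
  induction l generalizing X with
  | nil => rw [← h.union]; simp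
  | cons B l ih =>
    obtain ⟨-, h2, h3, h4⟩ := isPart_cons.1 h
    rw [List.map_cons, List.sum_cons, ih h3, ← h4, crossings_union_right h2]

theorem epsOne_append (l m : List (Finset ℕ)) :
    epsOne (l ++ m) = epsOne l + m.length * cardSum l + epsOne m := by
  induction l with
  | nil => simp [epsOne]
  | cons A l ih => simp only [List.cons_append, epsOne, ih, List.length_append, cardSum_cons]; ring

theorem inversions_append {X Y : Finset ℕ} {l m : List (Finset ℕ)} (hl : IsPart X l)
    (hm : IsPart Y m) : inversions (l ++ m) = inversions l + crossings X Y + inversions m := by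
  induction l generalizing X with
  | nil => rw [← hl.union]; simp [inversions]
  | cons A l ih =>
    obtain ⟨-, h2, h3, h4⟩ := isPart_cons.1 hl
    rw [List.cons_append, inversions, inversions, ih h3, List.map_append, List.sum_append,
      sum_crossings_right hm, ← h4, crossings_union_left h2]
    ring

theorem sgnOneExp_append {X Y : Finset ℕ} {l m : List (Finset ℕ)} (hl : IsPart X l)
    (hm : IsPart Y m) : sgnOneExp (l ++ m) =
      sgnOneExp l + sgnOneExp m + m.length * X.card + crossings X Y := by
  rw [sgnOneExp, epsOne_append, inversions_append hl hm, hl.cardSum, sgnOneExp, sgnOneExp]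
  ring

/-! #### Runs -/

section Runs

variable (r : ℕ → ℕ → Bool)

/-- Excludes the fallback branch of `runs`: a nonempty sequence has a first run, and this run
contains its first entry. -/
theorem runs_cons_cons (a b : ℕ) (l : List ℕ) :
    ∃ B Bs, runs r (b :: l) = B :: Bs ∧ b ∈ B ∧
      runs r (a :: b :: l) = if r a b then insert a B :: Bs else {a} :: B :: Bs := by
  have step : ∀ (a b : ℕ) (l : List ℕ) (B : Finset ℕ) (Bs : List (Finset ℕ)),
      runs r (b :: l) = B :: Bs →
      runs r (a :: b :: l) = if r a b then insert a B :: Bs else {a} :: B :: Bs := by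
    intro a b l B Bs h
    rw [runs.eq_def]
    simp only [h]
  have hne : ∃ B Bs, runs r (b :: l) = B :: Bs ∧ b ∈ B := by
    induction l generalizing b with
    | nil => exact ⟨{b}, [], by simp [runs], by simp⟩
    | cons c l ih =>
      obtain ⟨C, Cs, h, -⟩ := ih c
      rw [step b c l C Cs h]
      split_ifs
      · exact ⟨_, _, rfl, by simp⟩
      · exact ⟨_, _, rfl, by simp⟩
  obtain ⟨B, Bs, h1, h2⟩ := hne
  exact ⟨B, Bs, h1, h2, step a b l B Bs h1⟩

theorem runs_singleton (a : ℕ) : runs r [a] = [{a}] := by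
  simp [runs]

theorem runs_ne_nil {x : List ℕ} (h : x ≠ []) : runs r x ≠ [] := by
  obtain _ | ⟨a, _ | ⟨b, l⟩⟩ := x
  · exact absurd rfl h
  · simp [runs_singleton]
  · obtain ⟨B, Bs, -, -, h⟩ := runs_cons_cons r a b l
    rw [h]; split_ifs <;> simp

theorem runs_isPart {x : List ℕ} (h : x.Nodup) : IsPart x.toFinset (runs r x) := by
  induction x with
  | nil => exact isPart_nil
  | cons a l ih =>
    obtain _ | ⟨b, l⟩ := l
    · rw [runs_singleton]
      exact ⟨by simp, by simp, by simp⟩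
    · obtain ⟨B, Bs, h1, h2, h3⟩ := runs_cons_cons r a b l
      rw [List.nodup_cons] at h
      have ih' := ih h.2
      rw [h1, isPart_cons] at ih'
      obtain ⟨i1, i2, i3, i4⟩ := ih'
      have ha : a ∉ B ∪ unions Bs := by rw [i4]; simpa using h.1
      rw [Finset.mem_union, not_or] at ha
      rw [h3]
      split_ifs
      · rw [isPart_cons]
        refine ⟨by simp, Finset.disjoint_insert_left.2 ⟨ha.2, i2⟩, i3, ?_⟩
        rw [List.toFinset_cons, ← i4, Finset.insert_union]
      · rw [isPart_cons, isPart_cons]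
        refine ⟨by simp, by simpa using ha, ⟨i1, i2, i3, rfl⟩, ?_⟩
        rw [List.toFinset_cons, ← i4, unions_cons, Finset.insert_eq]

/-- A block ends where the relation between neighbours fails. These neighbours are later the reason
why a block can never be moved as a whole into the next one. -/
theorem runs_isChain (x : List ℕ) :
    (runs r x).IsChain fun A B => ∃ a ∈ A, ∃ b ∈ B, r a b = false := by
  induction x with
  | nil => simp [runs]
  | cons a l ih =>
    obtain _ | ⟨b, l⟩ := l
    · simp [runs_singleton]
    · obtain ⟨B, Bs, h1, h2, h3⟩ := runs_cons_cons r a b l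
      rw [h1] at ih
      rw [h3]
      split_ifs with hr
      · obtain _ | ⟨C, Cs⟩ := Bs
        · simp
        · rw [List.isChain_cons_cons] at ih ⊢
          obtain ⟨⟨x, hx, hx'⟩, ih⟩ := ih
          exact ⟨⟨x, Finset.mem_insert_of_mem hx, hx'⟩, ih⟩
      · rw [List.isChain_cons_cons]
        exact ⟨⟨a, by simp, b, h2, by simpa using hr⟩, ih⟩

end Runs

/-- The ascent to the maximum `n` ends a decreasing run. -/
theorem decreasingRuns_append {n : ℕ} (y z : List ℕ) (hy : ∀ a ∈ y, a < n) :
    decreasingRuns (y ++ n :: z) = decreasingRuns y ++ decreasingRuns (n :: z) := by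
  unfold decreasingRuns
  induction y with
  | nil => simp [runs]
  | cons a l ih =>
    have ih := ih (fun b hb => hy b (by simp [hb]))
    have ha := hy a (by simp)
    obtain _ | ⟨b, l⟩ := l
    · obtain ⟨B, Bs, h1, h2, h3⟩ := runs_cons_cons (fun a b => decide (b < a)) a n z
      rw [runs_singleton, List.singleton_append, h3, h1, if_neg (by simpa using ha.le)]
      rfl
    · obtain ⟨B, Bs, h1, h2, h3⟩ := runs_cons_cons (fun a b => decide (b < a)) a b l
      obtain ⟨C, Cs, k1, k2, k3⟩ := runs_cons_cons (fun a b => decide (b < a)) a b (l ++ n :: z)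
      rw [List.cons_append, k1, h1, List.cons_append, List.cons.injEq] at ih
      rw [h3, List.cons_append, List.cons_append, k3, ih.1, ih.2]
      split_ifs <;> simp

theorem decreasingRuns_cons_max {n : ℕ} {z : List ℕ} (hz : ∀ a ∈ z, a < n) {B : Finset ℕ}
    {l : List (Finset ℕ)} (h : decreasingRuns z = B :: l) :
    decreasingRuns (n :: z) = insert n B :: l := by
  unfold decreasingRuns at *
  obtain _ | ⟨b, z⟩ := z
  · simp [runs] at h
  · obtain ⟨C, Cs, k1, k2, k3⟩ := runs_cons_cons (fun a b => decide (b < a)) n b z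
    rw [k1, List.cons.injEq] at h
    rw [k3, if_pos (by simpa using hz b (by simp)), h.1, h.2]

/-- The maximum joins the increasing run before it, and the descent after it ends this run. -/
theorem increasingRuns_snoc_max {n : ℕ} {y : List ℕ} (hy : ∀ a ∈ y, a < n) (z : List ℕ)
    (hz : ∀ a ∈ z, a < n) {w : List (Finset ℕ)} {C : Finset ℕ} (h : increasingRuns y = w ++ [C]) :
    increasingRuns (y ++ n :: z) = w ++ insert n C :: increasingRuns z := by
  unfold increasingRuns at *
  have h0 : runs (fun a b => decide (a < b)) (n :: z) =
      {n} :: runs (fun a b => decide (a < b)) z := by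
    obtain _ | ⟨b, z⟩ := z
    · simp [runs]
    · obtain ⟨B, Bs, h1, h2, h3⟩ := runs_cons_cons (fun a b => decide (a < b)) n b z
      rw [h3, if_neg (by simpa using (hz b (by simp)).le), h1]
  induction y generalizing w C with
  | nil => simp [runs] at h
  | cons a l ih =>
    have ih := @ih (fun b hb => hy b (by simp [hb]))
    have ha := hy a (by simp)
    obtain _ | ⟨b, l⟩ := l
    · rw [runs_singleton] at h
      have hw : w = [] := by
        have := congrArg List.length h
        simp only [List.length_append, List.length_singleton] at this
        exact List.length_eq_zero_iff.1 (by omega)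
      subst hw
      obtain ⟨B, Bs, h1, h2, h3⟩ := runs_cons_cons (fun a b => decide (a < b)) a n z
      rw [h0, List.cons.injEq] at h1
      simp only [List.nil_append, List.cons.injEq, and_true] at h
      rw [List.singleton_append, h3, if_pos (by simpa using ha), ← h1.1, ← h1.2, ← h,
        Finset.pair_comm]
      rfl
    · obtain ⟨B, Bs, h1, h2, h3⟩ := runs_cons_cons (fun a b => decide (a < b)) a b l
      obtain ⟨D, Ds, k1, k2, k3⟩ := runs_cons_cons (fun a b => decide (a < b)) a b (l ++ n :: z)
      rw [h3] at h
      rw [List.cons_append, List.cons_append, k3]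
      rw [List.cons_append, k1, h1] at ih
      by_cases hr : (decide (a < b)) = true
      · rw [if_pos hr] at h ⊢
        obtain _ | ⟨W, ws⟩ := w
        · simp only [List.nil_append, List.cons.injEq] at h
          have := ih (w := []) (C := B) (by simp [h.2])
          simp only [List.nil_append, List.cons.injEq] at this
          rw [this.1, this.2, ← h.1, Finset.insert_comm]
          rfl
        · simp only [List.cons_append, List.cons.injEq] at h
          have := ih (w := B :: ws) (C := C) (by simp [h.2])
          simp only [List.cons_append, List.cons.injEq] at this
          simp [this.1, this.2, h.1]
      · rw [if_neg hr] at h ⊢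
        obtain _ | ⟨W, ws⟩ := w
        · simp at h
        · simp only [List.cons_append, List.cons.injEq] at h
          rw [ih h.2, h.1]
          rfl

/-! #### Shifts -/

section Shifts

variable {M : Type*} [AddCommMonoid M]

/-- The sets that may be moved from a block `A` to the next block `B`. -/
def shiftSets (A B : Finset ℕ) : Finset (Finset ℕ) :=
  A.powerset.filter fun M => M ≠ A ∧ ∀ m ∈ M, ∀ b ∈ B, b < m

theorem mem_shiftSets {A B S : Finset ℕ} :
    S ∈ shiftSets A B ↔ S ⊆ A ∧ S ≠ A ∧ ∀ m ∈ S, ∀ b ∈ B, b < m := by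
  simp [shiftSets]

@[simp] theorem rightShifts_nil : rightShifts [] = {[]} := by rw [rightShifts]
@[simp] theorem rightShifts_singleton (A : Finset ℕ) : rightShifts [A] = {[A]} := by
  rw [rightShifts]

theorem rightShifts_cons_cons (A B : Finset ℕ) (l : List (Finset ℕ)) :
    rightShifts (A :: B :: l) = (shiftSets A B).biUnion fun S =>
      (rightShifts ((B ∪ S) :: l)).image fun w => (A \ S) :: w := by
  rw [rightShifts]; rfl

/-- The moved set is recovered from the first block of the result as its complement in `A`, so the
union over the moved sets is disjoint. -/
theorem sum_rightShifts_cons_cons (A B : Finset ℕ) (l : List (Finset ℕ))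
    (f : List (Finset ℕ) → M) :
    ∑ u ∈ rightShifts (A :: B :: l), f u =
      ∑ S ∈ shiftSets A B, ∑ w ∈ rightShifts ((B ∪ S) :: l), f ((A \ S) :: w) := by
  rw [rightShifts_cons_cons, Finset.sum_biUnion]
  · apply Finset.sum_congr rfl
    intro S _
    rw [Finset.sum_image]
    intro w _ w' _ h
    exact (List.cons.inj h).2
  · intro S hS S' hS' hne
    rw [Function.onFun, Finset.disjoint_left]
    intro u hu hu'
    rw [Finset.mem_image] at hu hu'
    obtain ⟨w, -, rfl⟩ := hu
    obtain ⟨w', -, h⟩ := hu'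
    have h1 := (List.cons.inj h).1
    have hS1 := (mem_shiftSets.1 (Finset.mem_coe.1 hS)).1
    have hS2 := (mem_shiftSets.1 (Finset.mem_coe.1 hS')).1
    apply hne
    rw [← Finset.sdiff_sdiff_eq_self hS1, ← h1, Finset.sdiff_sdiff_eq_self hS2]

theorem rightShifts_spec {l u : List (Finset ℕ)} (hu : u ∈ rightShifts l) :
    u.length = l.length ∧ ∀ X, IsPart X l → IsPart X u := by
  -- The recursion enlarges the second block, so the induction is on the length and not on the list.
  obtain ⟨k, hk⟩ : ∃ k, l.length = k := ⟨_, rfl⟩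
  induction k generalizing l u with
  | zero =>
    obtain rfl := List.length_eq_zero_iff.1 hk
    rw [rightShifts_nil, Finset.mem_singleton] at hu
    subst hu
    exact ⟨rfl, fun _ h => h⟩
  | succ k ih =>
    obtain _ | ⟨A, _ | ⟨B, l⟩⟩ := l
    · simp at hk
    · rw [rightShifts_singleton, Finset.mem_singleton] at hu
      subst hu
      exact ⟨rfl, fun _ h => h⟩
    · rw [rightShifts_cons_cons, Finset.mem_biUnion] at hu
      obtain ⟨S, hS, hu⟩ := hu
      rw [Finset.mem_image] at hu
      obtain ⟨w, hw, rfl⟩ := hu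
      obtain ⟨hS1, hS2, -⟩ := mem_shiftSets.1 hS
      obtain ⟨i1, i2⟩ := ih hw (by simpa using hk)
      refine ⟨by simpa using i1, fun X hX => ?_⟩
      obtain ⟨h1, h2, h3, h4⟩ := isPart_cons.1 hX
      obtain ⟨k1, k2, k3, k4⟩ := isPart_cons.1 h3
      rw [unions_cons, Finset.disjoint_union_right] at h2
      have hd : Disjoint S (unions l) := h2.2.mono_left hS1
      have hw' := i2 (B ∪ S ∪ unions l) (isPart_cons.2
        ⟨k1.mono Finset.subset_union_left, Finset.disjoint_union_left.2 ⟨k2, hd⟩, k3, rfl⟩)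
      rw [isPart_cons, hw'.union]
      refine ⟨?_, ?_, hw', ?_⟩
      · rw [Finset.sdiff_nonempty]
        exact fun h => hS2 (Finset.Subset.antisymm hS1 h)
      · rw [Finset.disjoint_union_right, Finset.disjoint_union_right]
        exact ⟨⟨h2.1.mono_left Finset.sdiff_subset, Finset.sdiff_disjoint⟩,
          h2.2.mono_left Finset.sdiff_subset⟩
      · rw [← h4, unions_cons]
        ext a
        have := @hS1 a
        simp only [Finset.mem_union, Finset.mem_sdiff]
        tauto

/-- Nothing can be moved into the block that contains `n`, since everything to its left is smaller.
The two parts are therefore shifted independently. -/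
theorem sum_rightShifts_append {n : ℕ} {C : Finset ℕ} (hC : n ∈ C) (l : List (Finset ℕ))
    {l₁ : List (Finset ℕ)} (h : ∀ A ∈ l₁, A.Nonempty ∧ A ⊆ Finset.range n)
    (f : List (Finset ℕ) → M) :
    ∑ u ∈ rightShifts (l₁ ++ C :: l), f u =
      ∑ u ∈ rightShifts l₁, ∑ w ∈ rightShifts (C :: l), f (u ++ w) := by
  obtain ⟨k, hk⟩ : ∃ k, l₁.length = k := ⟨_, rfl⟩
  induction k generalizing l₁ f with
  | zero =>
    obtain rfl := List.length_eq_zero_iff.1 hk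
    simp
  | succ k ih =>
    obtain _ | ⟨A, _ | ⟨B, l'⟩⟩ := l₁
    · simp at hk
    · obtain ⟨hA, hA'⟩ := h A (by simp)
      have : shiftSets A C = {∅} := by
        ext S
        rw [mem_shiftSets, Finset.mem_singleton]
        constructor
        · rintro ⟨h1, -, h3⟩
          rw [Finset.eq_empty_iff_forall_notMem]
          intro s hs
          have := h3 s hs n hC
          have := Finset.mem_range.1 (hA' (h1 hs))
          omega
        · rintro rfl
          exact ⟨by simp, hA.ne_empty.symm, by simp⟩
      rw [List.singleton_append, sum_rightShifts_cons_cons, this]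
      simp
    · rw [List.cons_append, List.cons_append, sum_rightShifts_cons_cons,
        sum_rightShifts_cons_cons]
      apply Finset.sum_congr rfl
      intro S hS
      have hS1 := (mem_shiftSets.1 hS).1
      rw [← List.cons_append, ih]
      · rfl
      · intro D hD
        rcases List.mem_cons.1 hD with rfl | hD
        · exact ⟨(h B (by simp)).1.mono Finset.subset_union_left,
            Finset.union_subset (h B (by simp)).2 (hS1.trans (h A (by simp)).2)⟩
        · exact h D (by simp [hD])
      · simpa using hk

/-- The insertion of `n` into the `j`-th block. -/
def insAt (n j : ℕ) (w : List (Finset ℕ)) : List (Finset ℕ) := w.modify j (insert n)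

@[simp] theorem insAt_zero (n : ℕ) (A : Finset ℕ) (w : List (Finset ℕ)) :
    insAt n 0 (A :: w) = insert n A :: w := rfl
@[simp] theorem insAt_succ (n j : ℕ) (A : Finset ℕ) (w : List (Finset ℕ)) :
    insAt n (j + 1) (A :: w) = A :: insAt n j w := rfl

/-- An element above all others does not obstruct any move and may itself travel any number of
blocks to the right. So a shift with `n` is a shift without `n` together with the block where `n`
stops. The chain condition is needed because `n` makes the whole old block a proper subset. -/
theorem sum_rightShifts_insert {n : ℕ} {B : Finset ℕ} {l : List (Finset ℕ)}
    (h : ∀ A ∈ B :: l, A ⊆ Finset.range n)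
    (hc : (B :: l).IsChain fun A B => ∃ a ∈ A, ∃ b ∈ B, a ≤ b) (f : List (Finset ℕ) → M) :
    ∑ u ∈ rightShifts (insert n B :: l), f u =
      ∑ w ∈ rightShifts (B :: l), ∑ j ∈ Finset.range w.length, f (insAt n j w) := by
  induction l generalizing B f with
  | nil => simp
  | cons C l ih =>
    rw [sum_rightShifts_cons_cons, sum_rightShifts_cons_cons]
    have hB : n ∉ B := fun hn => by simpa using h B (by simp) hn
    have hC : ∀ c ∈ C, c < n := fun c hc => Finset.mem_range.1 (h C (by simp) hc)
    rw [List.isChain_cons_cons] at hc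
    obtain ⟨⟨b, hb, c, hcC, hbc⟩, hc⟩ := hc
    unfold shiftSets
    rw [Finset.sum_filter, Finset.sum_filter, Finset.sum_powerset_insert hB,
      ← Finset.sum_add_distrib]
    apply Finset.sum_congr rfl
    intro S hS
    rw [Finset.mem_powerset] at hS
    have hnS : n ∉ S := fun h => hB (hS h)
    -- `S = B` is now proper, but the pair `b ≤ c` still forbids moving all of `B`.
    have c1 : (S ≠ insert n B ∧ ∀ m ∈ S, ∀ b ∈ C, b < m) ↔ S ≠ B ∧ ∀ m ∈ S, ∀ b ∈ C, b < m := by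
      constructor
      · rintro ⟨-, h2⟩
        refine ⟨?_, h2⟩
        rintro rfl
        exact absurd (h2 b hb c hcC) (by omega)
      · rintro ⟨-, h2⟩
        exact ⟨fun e => hnS (e ▸ Finset.mem_insert_self n B), h2⟩
    have c2 : (insert n S ≠ insert n B ∧ ∀ m ∈ insert n S, ∀ b ∈ C, b < m) ↔
        S ≠ B ∧ ∀ m ∈ S, ∀ b ∈ C, b < m := by
      constructor
      · rintro ⟨h1, h2⟩
        exact ⟨fun e => h1 (by rw [e]), fun m hm => h2 m (Finset.mem_insert_of_mem hm)⟩
      · rintro ⟨h1, h2⟩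
        refine ⟨fun e => h1 ?_, ?_⟩
        · rw [← Finset.erase_insert hnS, e, Finset.erase_insert hB]
        · intro m hm
          rcases Finset.mem_insert.1 hm with rfl | hm
          · exact hC
          · exact h2 m hm
    simp only [c1, c2]
    by_cases hcond : S ≠ B ∧ ∀ m ∈ S, ∀ b ∈ C, b < m
    · simp only [if_pos hcond]
      have e1 : insert n B \ S = insert n (B \ S) := Finset.insert_sdiff_of_notMem _ hnS
      have e2 : insert n B \ insert n S = B \ S := by
        rw [Finset.insert_sdiff_insert]
        ext a
        simp only [Finset.mem_sdiff, Finset.mem_insert, not_or]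
        constructor
        · tauto
        · rintro ⟨h, h'⟩
          exact ⟨h, fun e => hB (e ▸ h), h'⟩
      rw [e1, e2, Finset.union_insert, ih]
      · rw [← Finset.sum_add_distrib]
        apply Finset.sum_congr rfl
        intro w _
        -- The index `0` is the case where `n` stays in the first block; the indices `j + 1` come
        -- from moving it on together with `S`.
        rw [List.length_cons, Finset.sum_range_succ', add_comm]
        rfl
      · intro A hA
        rcases List.mem_cons.1 hA with rfl | hA
        · exact Finset.union_subset (h C (by simp)) (hS.trans (h B (by simp)))
        · exact h A (by simp [hA])
      · obtain _ | ⟨D, l⟩ := l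
        · simp
        · rw [List.isChain_cons_cons] at hc ⊢
          obtain ⟨⟨x, hx, hx'⟩, hc⟩ := hc
          exact ⟨⟨x, Finset.mem_union_left _ hx, hx'⟩, hc⟩
    · simp only [if_neg hcond, add_zero]

theorem sum_leftShifts (l : List (Finset ℕ)) (f : List (Finset ℕ) → M) :
    ∑ v ∈ leftShifts l, f v = ∑ v ∈ rightShifts l.reverse, f v.reverse := by
  rw [leftShifts, Finset.sum_image]
  intro a _ b _ h
  exact List.reverse_injective h

theorem leftShifts_spec {l u : List (Finset ℕ)} (hu : u ∈ leftShifts l) :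
    u.length = l.length ∧ ∀ X, IsPart X l → IsPart X u := by
  rw [leftShifts, Finset.mem_image] at hu
  obtain ⟨w, hw, rfl⟩ := hu
  obtain ⟨h1, h2⟩ := rightShifts_spec hw
  exact ⟨by simpa using h1, fun X hX => (h2 X hX.reverse).reverse⟩

theorem sum_leftShifts_append {n : ℕ} {C : Finset ℕ} (hC : n ∈ C) (l : List (Finset ℕ))
    {l₁ : List (Finset ℕ)} (h : ∀ A ∈ l₁, A.Nonempty ∧ A ⊆ Finset.range n)
    (f : List (Finset ℕ) → M) :
    ∑ u ∈ leftShifts (l ++ C :: l₁), f u =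
      ∑ u ∈ leftShifts (l ++ [C]), ∑ w ∈ leftShifts l₁, f (u ++ w) := by
  rw [sum_leftShifts, sum_leftShifts, List.reverse_append, List.reverse_cons, List.append_assoc,
    List.singleton_append, sum_rightShifts_append hC _ (fun A hA => h A (by simpa using hA)),
    Finset.sum_comm, List.reverse_append, List.reverse_singleton, List.singleton_append]
  apply Finset.sum_congr rfl
  intro u _
  rw [sum_leftShifts]
  simp

theorem insAt_reverse (n j : ℕ) (w : List (Finset ℕ)) (hj : j < w.length) :
    (insAt n j w).reverse = insAt n (w.length - 1 - j) w.reverse := by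
  apply List.ext_getElem?
  intro i
  by_cases hi : i < w.length
  · rw [List.getElem?_reverse (by simpa [insAt] using hi)]
    simp only [insAt, List.getElem?_modify, List.length_modify]
    rw [List.getElem?_reverse hi]
    congr 1
    by_cases h : j = w.length - 1 - i
    · have h1 : w.length - 1 - j = i := by omega
      funext a; rw [if_pos h, if_pos h1]
    · have h1 : w.length - 1 - j ≠ i := by omega
      funext a; rw [if_neg h, if_neg h1]
  · rw [List.getElem?_eq_none (by simpa [insAt] using hi),
      List.getElem?_eq_none (by simpa [insAt] using hi)]

/-- Reversing the list turns left shifts into right shifts and the condition on neighbouring blocks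
into its mirror image; the position of `n` is counted from the other end. -/
theorem sum_leftShifts_insert {n : ℕ} {B : Finset ℕ} {l : List (Finset ℕ)}
    (h : ∀ A ∈ l ++ [B], A ⊆ Finset.range n)
    (hc : (l ++ [B]).IsChain fun A B => ∃ a ∈ A, ∃ b ∈ B, b ≤ a) (f : List (Finset ℕ) → M) :
    ∑ u ∈ leftShifts (l ++ [insert n B]), f u =
      ∑ w ∈ leftShifts (l ++ [B]), ∑ j ∈ Finset.range w.length, f (insAt n j w) := by
  rw [sum_leftShifts, sum_leftShifts, List.reverse_append, List.reverse_append,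
    List.reverse_singleton, List.reverse_singleton, List.singleton_append, List.singleton_append,
    sum_rightShifts_insert]
  · apply Finset.sum_congr rfl
    intro w _
    rw [List.length_reverse, ← Finset.sum_range_reflect]
    apply Finset.sum_congr rfl
    intro j hj
    rw [Finset.mem_range] at hj
    rw [insAt_reverse _ _ _ (by omega)]
    congr 2
    omega
  · intro A hA
    exact h A (by simpa [or_comm] using hA)
  · have : (l ++ [B]).reverse.IsChain fun A B => ∃ a ∈ A, ∃ b ∈ B, a ≤ b :=
      List.isChain_reverse.2 (hc.imp fun A B ⟨a, ha, b, hb, hab⟩ => ⟨b, hb, a, ha, hab⟩)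
    simpa using this

end Shifts

/-! #### The explicit diagonal -/

section Diagonal

theorem sgnOneExp_cons (A : Finset ℕ) (l : List (Finset ℕ)) :
    sgnOneExp (A :: l) = l.length * A.card + (l.map (crossings A)).sum + sgnOneExp l := by
  simp only [sgnOneExp, epsOne, inversions]; ring

theorem sgnTwoExp_eq (w : List (Finset ℕ)) :
    sgnTwoExp w = sgnOneExp w + (w.length - 1).choose 2 := by
  simp only [sgnOneExp, sgnTwoExp]; ring

theorem length_insAt (n j : ℕ) (w : List (Finset ℕ)) : (insAt n j w).length = w.length := by
  simp [insAt]

theorem sum_crossings_insAt {n : ℕ} {A : Finset ℕ} (hA : ∀ a ∈ A, a < n) (j : ℕ)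
    (w : List (Finset ℕ)) (hw : ∀ B ∈ w, n ∉ B) :
    ((insAt n j w).map (crossings A)).sum = (w.map (crossings A)).sum := by
  induction w generalizing j with
  | nil => simp [insAt]
  | cons B w ih =>
    cases j with
    | zero =>
      have hB : n ∉ B := hw B (by simp)
      rw [insAt_zero, List.map_cons, List.map_cons, List.sum_cons, List.sum_cons, Finset.insert_eq,
        crossings_union_right (by simpa using hB), crossings_eq_zero (A := A), zero_add]
      intro a ha b hb
      rw [Finset.mem_singleton.1 hb]
      exact (hA a ha).le
    | succ j =>
      rw [insAt_succ, List.map_cons, List.map_cons, List.sum_cons, List.sum_cons,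
        ih j fun B hB => hw B (by simp [hB])]

theorem sum_crossings_insert {n : ℕ} {A : Finset ℕ} (hA : n ∉ A) (w : List (Finset ℕ))
    (hw : ∀ B ∈ w, ∀ b ∈ B, b < n) :
    (w.map (crossings (insert n A))).sum = cardSum w + (w.map (crossings A)).sum := by
  induction w with
  | nil => simp
  | cons B w ih =>
    rw [List.map_cons, List.map_cons, List.sum_cons, List.sum_cons, cardSum_cons,
      ih fun C hC => hw C (by simp [hC]), Finset.insert_eq,
      crossings_union_left (by simpa using hA), crossings_eq_mul (A := {n}), Finset.card_singleton]
    · ring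
    · intro a ha b hb
      rw [Finset.mem_singleton.1 ha]
      exact hw B (by simp) b hb

theorem sgnOneExp_insert {n : ℕ} {A : Finset ℕ} (w : List (Finset ℕ))
    (h : ∀ B ∈ A :: w, ∀ b ∈ B, b < n) :
    sgnOneExp (insert n A :: w) = sgnOneExp (A :: w) + w.length + cardSum w := by
  have hA : n ∉ A := fun hn => (h A (by simp) n hn).false
  rw [sgnOneExp_cons, sgnOneExp_cons, sum_crossings_insert hA w fun B hB => h B (by simp [hB]),
    Finset.card_insert_of_notMem hA]
  ring

variable {R : Type v} [CommRing R]

open DiagAlgebra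

/-- The derivation inserts `n` at every position. The sign picked up on the way is the change of
`sgn_1`, up to a factor that depends only on the size and the length of the word. -/
theorem derivation_insLetter {n : ℕ} {w D : List (Finset ℕ) → DiagAlgebra R}
    (hw : ∀ u v, w (u ++ v) = w u * w v) (h0 : D [] = 0)
    (h1 : ∀ A u, D (A :: u) = insLetter n w A * w u + (-1 : R) ^ (A.card + 1) • (w [A] * D u))
    (u : List (Finset ℕ)) (hu : ∀ A ∈ u, ∀ a ∈ A, a < n) :
    D u = ∑ j ∈ Finset.range u.length,
      (-1 : R) ^ (sgnOneExp (insAt n j u) + sgnOneExp u + cardSum u + u.length + 1) •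
        w (insAt n j u) := by
  induction u with
  | nil => simp [h0]
  | cons A u ih =>
    have hA : n ∉ A := fun hn => (hu A (by simp) n hn).false
    have hu' : ∀ A ∈ u, ∀ a ∈ A, a < n := fun B hB => hu B (by simp [hB])
    have hcons : ∀ B v, w (B :: v) = w [B] * w v := fun B v => hw [B] v
    rw [h1, ih hu', List.length_cons, Finset.sum_range_succ', add_comm, insAt_zero,
      sgnOneExp_insert u hu, insLetter, if_neg hA]
    simp only [insAt_succ]
    rw [Finset.mul_sum, Finset.smul_sum, hcons (insert n A) u, smul_mul_assoc]
    refine congrArg₂ (· + ·) ?_ (congrArg (fun r : R => r • (w [insert n A] * w u)) ?_)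
    · apply Finset.sum_congr rfl
      intro j _
      rw [mul_smul_comm, smul_smul, ← pow_add, hcons A (insAt n j u), sgnOneExp_cons, sgnOneExp_cons,
        sum_crossings_insAt (hu A (by simp)) j u fun B hB hn => (hu' B hB n hn).false, length_insAt]
      refine congrArg (fun r : R => r • (w [A] * w (insAt n j u))) ?_
      apply neg_one_pow_congr
      simp only [cardSum_cons]
      generalize (List.map (crossings A) u).sum = k
      push_cast
      linear_combination (-(u.length * A.card + k) : ZMod 2) * zmod_two_two
    · apply neg_one_pow_congr
      simp only [cardSum_cons]
      push_cast
      linear_combination (-(sgnOneExp (A :: u) + u.length + cardSum u + 1) : ZMod 2) * zmod_two_two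

end Diagonal

/-! ### The recursion of the explicit diagonal by the position of the largest entry. -/

section Diagonal

/-- Injective words in `{0, …, n - 1}`. -/
def arrangements : ℕ → Finset (List ℕ)
  | 0 => {[]}
  | n + 1 => arrangements n ∪ ((arrangements n ×ˢ arrangements n).filter
      fun p => Disjoint p.1.toFinset p.2.toFinset).image fun p => p.1 ++ n :: p.2

theorem mem_arrangements {n : ℕ} {x : List ℕ} :
    x ∈ arrangements n ↔ x.Nodup ∧ ∀ a ∈ x, a < n := by
  induction n generalizing x with
  | zero =>
    simp only [arrangements, Finset.mem_singleton, Nat.not_lt_zero]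
    constructor
    · rintro rfl; simp
    · rintro ⟨-, h⟩
      exact List.eq_nil_iff_forall_not_mem.2 h
  | succ n ih =>
    simp only [arrangements, Finset.mem_union, Finset.mem_image, Finset.mem_filter,
      Finset.mem_product, ih, Prod.exists]
    constructor
    · rintro (⟨h1, h2⟩ | ⟨y, z, ⟨⟨⟨h1, h2⟩, h3, h4⟩, h5⟩, rfl⟩)
      · exact ⟨h1, fun a ha => (h2 a ha).trans n.lt_succ_self⟩
      · rw [List.disjoint_toFinset_iff_disjoint] at h5
        constructor
        · rw [List.nodup_append, List.nodup_cons]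
          refine ⟨h1, ⟨fun h => (h4 n h).false, h3⟩, fun a ha b hb e => ?_⟩
          subst e
          rcases List.mem_cons.1 hb with rfl | hb
          · exact (h2 a ha).false
          · exact h5 ha hb
        · intro a ha
          rcases List.mem_append.1 ha with ha | ha
          · have := h2 a ha; omega
          · rcases List.mem_cons.1 ha with rfl | ha
            · omega
            · have := h4 a ha; omega
    · rintro ⟨h1, h2⟩
      by_cases hn : n ∈ x
      · right
        obtain ⟨y, z, rfl⟩ := List.append_of_mem hn
        rw [List.nodup_append, List.nodup_cons] at h1
        obtain ⟨k1, ⟨k2, k3⟩, k4⟩ := h1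
        refine ⟨y, z, ⟨⟨⟨k1, fun a ha => ?_⟩, k3, fun a ha => ?_⟩, ?_⟩, rfl⟩
        · have := h2 a (by simp [ha])
          have : a ≠ n := k4 a ha n (by simp)
          omega
        · have := h2 a (by simp [ha])
          have : a ≠ n := fun e => k2 (e ▸ ha)
          omega
        · rw [List.disjoint_toFinset_iff_disjoint]
          exact fun a ha hb => k4 a ha a (by simp [hb]) rfl
      · left
        refine ⟨h1, fun a ha => ?_⟩
        have := h2 a ha
        have : a ≠ n := fun e => hn (e ▸ ha)
        omega

/-- A word that contains the maximum is `y n z` for unique `y` and `z`, and these are disjoint. -/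
theorem sum_arrangements_succ {M : Type*} [AddCommMonoid M] (n : ℕ) (f : List ℕ → M) :
    ∑ x ∈ arrangements (n + 1), f x = ∑ x ∈ arrangements n, f x +
      ∑ y ∈ arrangements n, ∑ z ∈ arrangements n,
        if Disjoint y.toFinset z.toFinset then f (y ++ n :: z) else 0 := by
  rw [arrangements, Finset.sum_union, Finset.sum_image, Finset.sum_filter, Finset.sum_product]
  · intro p hp q hq h
    simp only [Finset.coe_filter, Finset.mem_product, Set.mem_ofPred_eq, mem_arrangements] at hp hq
    obtain ⟨h1, -, h2⟩ := (List.append_cons_inj_of_notMem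
      (fun h => (hp.1.1.2 n h).false) (fun h => (hp.1.2.2 n h).false)).1 h
    exact Prod.ext h1 h2
  · rw [Finset.disjoint_left]
    intro x hx hx'
    rw [Finset.mem_image] at hx'
    obtain ⟨p, -, rfl⟩ := hx'
    exact ((mem_arrangements.1 hx).2 n (by simp)).false

/-- Two neighbours form either an ascent or a descent, and so begin a new block in exactly one of
the two run decompositions. -/
theorem length_runs (x : List ℕ) (hx : x.Nodup) (hne : x ≠ []) :
    (decreasingRuns x).length + (increasingRuns x).length = x.length + 1 := by
  unfold decreasingRuns increasingRuns
  induction x with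
  | nil => exact absurd rfl hne
  | cons a l ih =>
    obtain _ | ⟨b, l⟩ := l
    · simp [runs_singleton]
    · obtain ⟨B, Bs, h1, h2, h3⟩ := runs_cons_cons (fun a b => decide (b < a)) a b l
      obtain ⟨C, Cs, k1, k2, k3⟩ := runs_cons_cons (fun a b => decide (a < b)) a b l
      have ih := ih hx.of_cons (by simp)
      have hab : a ≠ b := by rintro rfl; simp at hx
      rw [h1, k1] at ih
      rw [h3, k3]
      simp only [List.length_cons] at ih
      rcases lt_or_gt_of_ne hab with h | h
      · rw [if_neg (by simpa using h.le), if_pos (by simpa using h)]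
        simp only [List.length_cons]; omega
      · rw [if_pos (by simpa using h), if_neg (by simpa using h.le)]
        simp only [List.length_cons]; omega

/-- The insertion of a largest entry on the left of an increasing part. -/
theorem increasingRuns_append {n : ℕ} {y : List ℕ} (hy : ∀ a ∈ y, a < n) (z : List ℕ)
    (hz : ∀ a ∈ z, a < n) : ∃ l C, n ∈ C ∧ increasingRuns (y ++ [n]) = l ++ [C] ∧
      increasingRuns (y ++ n :: z) = l ++ C :: increasingRuns z := by
  rcases List.eq_nil_or_concat y with rfl | ⟨y', b, rfl⟩
  · refine ⟨[], {n}, by simp, by simp [increasingRuns, runs], ?_⟩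
    obtain _ | ⟨b, z⟩ := z
    · simp [increasingRuns, runs]
    · unfold increasingRuns
      obtain ⟨B, Bs, h1, h2, h3⟩ := runs_cons_cons (fun a b => decide (a < b)) n b z
      rw [List.nil_append, h3, if_neg (by simpa using (hz b (by simp)).le), h1]
      rfl
  · have hne : increasingRuns (y' ++ [b]) ≠ [] := runs_ne_nil _ (by simp)
    obtain ⟨w, C, h⟩ := (List.eq_nil_or_concat (increasingRuns (y' ++ [b]))).resolve_left hne
    rw [List.concat_eq_append] at h hy ⊢
    refine ⟨w, insert n C, by simp, ?_, increasingRuns_snoc_max hy z hz h⟩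
    exact increasingRuns_snoc_max hy [] (by simp) h

theorem choose_two_add (p q : ℕ) : (p + q).choose 2 = p.choose 2 + q.choose 2 + p * q := by
  induction q with
  | zero => simp
  | succ q ih =>
    rw [← add_assoc, Nat.choose_succ_succ' (p + q), Nat.choose_succ_succ' q, ih]
    simp
    ring

theorem rsgnExp_append (l m : List (Finset ℕ)) : rsgnExp (l ++ m) = rsgnExp l + rsgnExp m := by
  simp [rsgnExp]

open DiagAlgebra

variable (R : Type v) [CommRing R]

/-- The part of the diagonal that belongs to one vertex. -/
def diagTerm (x : List ℕ) : DiagAlgebra R :=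
  ∑ u ∈ rightShifts (decreasingRuns x), ∑ v ∈ leftShifts (increasingRuns x),
    (-1 : R) ^ pairSgnExp x u v • basis R (x.toFinset, u, v)

/-- The diagonals of all permutahedra on nonempty subsets of `{0, …, n - 1}`. -/
def diagonal (n : ℕ) : DiagAlgebra R :=
  ∑ x ∈ arrangements n, if x = [] then 0 else diagTerm R x

variable {R}

theorem dR_isPart {x : List ℕ} (hx : x.Nodup) {u : List (Finset ℕ)}
    (hu : u ∈ rightShifts (decreasingRuns x)) : IsPart x.toFinset u :=
  (rightShifts_spec hu).2 _ (runs_isPart _ hx)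

theorem iR_isPart {x : List ℕ} (hx : x.Nodup) {v : List (Finset ℕ)}
    (hv : v ∈ leftShifts (increasingRuns x)) : IsPart x.toFinset v :=
  (leftShifts_spec hv).2 _ (runs_isPart _ hx)

theorem pairSgnExp_zmod {x : List ℕ} {u v : List (Finset ℕ)}
    (hu : u.length = (decreasingRuns x).length) :
    (pairSgnExp x u v : ZMod 2) = (v.length.choose 2 + rsgnExp (decreasingRuns x) + sgnOneExp v +
      sgnOneExp u + sgnOneExp (decreasingRuns x) : ℕ) := by
  rw [pairSgnExp, sgnTwoExp_eq, sgnTwoExp_eq, hu]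
  push_cast
  linear_combination (((decreasingRuns x).length - 1).choose 2 : ZMod 2) * zmod_two_two

theorem mem_toFinset_lt {n : ℕ} {y : List ℕ} (hy : ∀ a ∈ y, a < n) {X : Finset ℕ}
    {u : List (Finset ℕ)} (hX : y.toFinset = X) (hu : IsPart X u) : ∀ A ∈ u, ∀ a ∈ A, a < n :=
  fun A hA a ha => hy a (by simpa [← hX] using hu.subset hA ha)

/-- The left factor of the recursion. -/
theorem insSnd_diagTerm {n : ℕ} {y : List ℕ} (hy : y.Nodup) (hyn : ∀ a ∈ y, a < n) :
    (if y = [] then snd R [{n}] else (insSnd R n).der (diagTerm R y)) =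
      ∑ u ∈ rightShifts (decreasingRuns y), ∑ v ∈ leftShifts (increasingRuns (y ++ [n])),
        (-1 : R) ^ (v.length.choose 2 + rsgnExp (decreasingRuns y) + sgnOneExp u +
          sgnOneExp (decreasingRuns y) + sgnOneExp v + y.length) • basis R (y.toFinset, u, v) := by
  split_ifs with h0
  -- For the empty word the right side consists of the single pair with `v = {n}`; the letter thus
  -- takes the place of the missing vertex term.
  · subst h0
    simp [decreasingRuns, increasingRuns, runs, leftShifts, snd, sgnOneExp, epsOne, inversions,
      rsgnExp]
  · have hne : increasingRuns y ≠ [] := runs_ne_nil _ h0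
    obtain ⟨w, C, h⟩ := (List.eq_nil_or_concat (increasingRuns y)).resolve_left hne
    rw [List.concat_eq_append] at h
    have h' : increasingRuns (y ++ [n]) = w ++ [insert n C] := by
      have := increasingRuns_snoc_max hyn [] (by simp) h
      simpa [increasingRuns, runs] using this
    rw [diagTerm, map_sum]
    apply Finset.sum_congr rfl
    intro u hu
    rw [map_sum, h', sum_leftShifts_insert, ← h]
    · apply Finset.sum_congr rfl
      intro v hv
      have hvp := iR_isPart hy hv
      have hup := dR_isPart hy hu
      rw [map_smul, LetterMap.der_basis, derivation_insLetter (w := snd R)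
        (D := (insSnd R n).derSnd) snd_append rfl (fun _ _ => rfl) v (mem_toFinset_lt hyn rfl hvp),
        (show (insSnd R n).derFst u = 0 from ?_), zero_mul, zero_add, Finset.mul_sum,
        Finset.smul_sum, Finset.sum_mul, Finset.smul_sum]
      · apply Finset.sum_congr rfl
        intro j _
        rw [mul_smul_comm, smul_smul, smul_mul_assoc, smul_smul, ← pow_add, ← pow_add,
          basis_eq (y.toFinset, u, insAt n j v)]
        refine congrArg (fun r : R => r • (fst R u * snd R (insAt n j v) * ext R y.toFinset)) ?_
        apply neg_one_pow_congr
        have e1 := (rightShifts_spec hu).1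
        have e2 := (leftShifts_spec hv).1
        -- The two run partitions of `y` have `y.length + 1` blocks together; this relates the
        -- parity of `u`, passed by the derivation, to the sign of `v`.
        have e3 := length_runs y hy h0
        rw [← e1, ← e2] at e3
        have e3' := congrArg (Nat.cast : ℕ → ZMod 2) e3
        push_cast at e3'
        have e4 := hvp.cardSum
        have e5 := hup.cardSum
        rw [List.toFinset_card_of_nodup hy] at e4 e5
        simp only [Nat.cast_add, pairSgnExp_zmod (rightShifts_spec hu).1, wordParity_eq, length_insAt, e4, e5]
        push_cast
        linear_combination e3' + (sgnOneExp v + y.length + 1 : ZMod 2) * zmod_two_two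
      · clear hup hvp hu hv
        induction u with
        | nil => rfl
        | cons A u ih => rw [LetterMap.derFst, ih]; simp [insSnd]
    · intro A hA
      rw [← h] at hA
      intro a ha
      exact Finset.mem_range.2 (hyn a (by simpa using (runs_isPart _ hy).subset hA ha))
    · rw [← h]
      exact (runs_isChain _ y).imp fun A B ⟨a, ha, b, hb, hab⟩ => ⟨a, ha, b, hb, by simpa using hab⟩

/-- The right factor of the recursion. -/
theorem insFst_diagTerm {n : ℕ} {z : List ℕ} (hz : z.Nodup) (hzn : ∀ a ∈ z, a < n) :
    (if z = [] then fst R [{n}] else (insFst R n).der (diagTerm R z)) =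
      ∑ u ∈ rightShifts (decreasingRuns (n :: z)), ∑ v ∈ leftShifts (increasingRuns z),
        (-1 : R) ^ (v.length.choose 2 + rsgnExp (decreasingRuns (n :: z)) + sgnOneExp u +
          sgnOneExp (decreasingRuns (n :: z)) + sgnOneExp v) • basis R (z.toFinset, u, v) := by
  split_ifs with h0
  · subst h0
    simp [decreasingRuns, increasingRuns, runs, leftShifts, fst, sgnOneExp, epsOne, inversions,
      rsgnExp]
  · have hne : decreasingRuns z ≠ [] := runs_ne_nil _ h0
    obtain ⟨C, w, h⟩ := List.exists_cons_of_ne_nil hne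
    have h' := decreasingRuns_cons_max hzn h
    have hp : IsPart z.toFinset (decreasingRuns z) := runs_isPart _ hz
    rw [diagTerm, map_sum, h', sum_rightShifts_insert, ← h]
    · apply Finset.sum_congr rfl
      intro u hu
      rw [map_sum, Finset.sum_comm]
      apply Finset.sum_congr rfl
      intro v hv
      have hvp := iR_isPart hz hv
      have hup := dR_isPart hz hu
      rw [map_smul, LetterMap.der_basis, derivation_insLetter (w := fst R)
        (D := (insFst R n).derFst) fst_append rfl (fun _ _ => rfl) u (mem_toFinset_lt hzn rfl hup),
        (show (insFst R n).derSnd v = 0 from ?_), mul_zero, smul_zero, add_zero,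
        Finset.sum_mul, Finset.sum_mul, Finset.smul_sum]
      · apply Finset.sum_congr rfl
        intro j _
        rw [smul_mul_assoc, smul_mul_assoc, smul_smul, ← pow_add,
          basis_eq (z.toFinset, insAt n j u, v)]
        refine congrArg (fun r : R => r • (fst R (insAt n j u) * snd R v * ext R z.toFinset)) ?_
        apply neg_one_pow_congr
        have e1 := (rightShifts_spec hu).1
        have e5 := hup.cardSum
        have e6 : sgnOneExp (insert n C :: w) = sgnOneExp (decreasingRuns z) + w.length + cardSum w := by
          rw [h]
          exact sgnOneExp_insert w fun B hB b hb => hzn b (by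
            rw [← h] at hB
            simpa using hp.subset hB hb)
        have e7 := hp.cardSum
        have hC : n ∉ C := fun hn => (hzn n (by
            simpa using hp.subset (A := C) (by simp [h]) hn)).false
        -- `n` enlarges the first decreasing run `C`, which changes the exponent of `rsgn` by `#C`.
        have e8 : rsgnExp (insert n C :: w) = rsgnExp (decreasingRuns z) + C.card := by
          rw [h]
          simp [rsgnExp, Finset.card_insert_of_notMem hC, Nat.choose_succ_succ']
          ring
        rw [h, cardSum_cons] at e7
        rw [h, List.length_cons] at e1
        have e7' := congrArg (Nat.cast : ℕ → ZMod 2) e7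
        have e1' := congrArg (Nat.cast : ℕ → ZMod 2) e1
        push_cast at e7' e1'
        simp only [Nat.cast_add, pairSgnExp_zmod (rightShifts_spec hu).1, e5, e6, e8]
        push_cast
        linear_combination e1' - e7' + (sgnOneExp u + 1 : ZMod 2) * zmod_two_two
      · clear hup hvp hu hv
        induction v with
        | nil => rfl
        | cons A u ih => rw [LetterMap.derSnd, ih]; simp [insFst]
    · intro A hA
      rw [← h] at hA
      intro a ha
      exact Finset.mem_range.2 (hzn a (by simpa using hp.subset hA ha))
    · rw [← h]
      exact (runs_isChain _ z).imp fun A B ⟨a, ha, b, hb, hab⟩ => ⟨a, ha, b, hb, by simpa using hab⟩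

/-- The complementary pairs at `y n z` are the concatenations of the pairs produced by the two
factors: on the left `n` sits in the second partition, on the right in the first. If `y` and `z`
share an entry, the exterior product vanishes. -/
theorem insExt_mul_eq_diagTerm {n : ℕ} {y z : List ℕ} (hy : y.Nodup) (hyn : ∀ a ∈ y, a < n)
    (hz : z.Nodup) (hzn : ∀ a ∈ z, a < n) :
    insExt R n ((if y = [] then snd R [{n}] else (insSnd R n).der (diagTerm R y)) *
      (if z = [] then fst R [{n}] else (insFst R n).der (diagTerm R z))) =
      if Disjoint y.toFinset z.toFinset then diagTerm R (y ++ n :: z) else 0 := by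
  rw [insSnd_diagTerm hy hyn, insFst_diagTerm hz hzn]
  simp only [Finset.sum_mul, Finset.mul_sum, map_sum, smul_mul_assoc, mul_smul_comm, map_smul]
  split_ifs with hd
  · obtain ⟨l, C, hC, i1, i2⟩ := increasingRuns_append hyn z hzn
    have hx : (y ++ [n]).Nodup := by
      rw [List.nodup_append]
      refine ⟨hy, by simp, fun a ha b hb e => ?_⟩
      rw [List.mem_singleton] at hb
      have := hyn a ha
      omega
    have hx' : (n :: z).Nodup := List.nodup_cons.2 ⟨fun h => (hzn n h).false, hz⟩
    have below : ∀ {x : List ℕ} {w : List (Finset ℕ)}, (∀ a ∈ x, a < n) → IsPart x.toFinset w →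
        ∀ A ∈ w, A.Nonempty ∧ A ⊆ Finset.range n := fun hxn hw A hA =>
      ⟨hw.nonempty A hA, fun a ha => Finset.mem_range.2 (hxn a (by simpa using hw.subset hA ha))⟩
    obtain ⟨D, l', hl'⟩ : ∃ D l', decreasingRuns (n :: z) = D :: l' :=
      List.exists_cons_of_ne_nil (runs_ne_nil _ (by simp))
    have hD : n ∈ D := by
      obtain _ | ⟨b, z⟩ := z
      · simp only [decreasingRuns, runs, List.cons.injEq] at hl'
        simp [← hl'.1]
      · obtain ⟨B, Bs, h1, h2, h3⟩ := runs_cons_cons (fun a b => decide (b < a)) n b z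
        unfold decreasingRuns at hl'
        rw [h3, if_pos (by simpa using hzn b (by simp)), List.cons.injEq] at hl'
        simp [← hl'.1]
    -- The first partition is cut before `n` and the second one after `n`; no element is moved
    -- across either cut, because the block there contains the maximum.
    have key : diagTerm R (y ++ n :: z) = ∑ u' ∈ rightShifts (decreasingRuns (n :: z)),
        ∑ v' ∈ leftShifts (increasingRuns z), ∑ u ∈ rightShifts (decreasingRuns y),
        ∑ v ∈ leftShifts (increasingRuns (y ++ [n])),
        (-1 : R) ^ pairSgnExp (y ++ n :: z) (u ++ u') (v ++ v') •
          basis R ((y ++ n :: z).toFinset, u ++ u', v ++ v') := by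
      rw [diagTerm, i2, decreasingRuns_append y z hyn, hl',
        sum_rightShifts_append hD _ (l₁ := decreasingRuns y) (below hyn (runs_isPart _ hy)), i1,
        Finset.sum_comm]
      refine Finset.sum_congr rfl fun u' _ => ?_
      refine Eq.trans ?_ Finset.sum_comm
      refine Finset.sum_congr rfl fun u _ => ?_
      rw [sum_leftShifts_append hC _ (l₁ := increasingRuns z) (below hzn (runs_isPart _ hz)),
        Finset.sum_comm]
    rw [key]
    refine Finset.sum_congr rfl fun u' hu' => Finset.sum_congr rfl fun v' hv' => ?_
    rw [Finset.smul_sum]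
    refine Finset.sum_congr rfl fun u hu => ?_
    rw [Finset.smul_sum]
    refine Finset.sum_congr rfl fun v hv => ?_
    have pu := dR_isPart hy hu
    have pv := iR_isPart hx hv
    have pu' := dR_isPart hx' hu'
    have pv' := iR_isPart hz hv'
    have hlen : (u ++ u').length = (decreasingRuns (y ++ n :: z)).length := by
      rw [decreasingRuns_append y z hyn, List.length_append, List.length_append,
        (rightShifts_spec hu).1, (rightShifts_spec hu').1]
    have e1 := length_runs (n :: z) hx' (by simp)
    have e2 := (rightShifts_spec hu').1
    have e3 := (leftShifts_spec hv').1
    have e4 : increasingRuns (n :: z) = {n} :: increasingRuns z := by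
      obtain ⟨l, C, k1, k2, k3⟩ := increasingRuns_append (y := []) (n := n) (by simp) z hzn
      simp only [List.nil_append] at k2 k3
      rw [k3]
      have : increasingRuns [n] = [{n}] := by simp [increasingRuns, runs]
      rw [this] at k2
      obtain _ | ⟨L, l⟩ := l
      · simp only [List.nil_append, List.cons.injEq, and_true] at k2
        simp [← k2]
      · simp at k2
    -- `u'` and `v'` have `z.length + 1` blocks together; the number of blocks of `v'` enters the
    -- sign of the concatenated pair through `(-1)^{q(q-1)/2}`.
    rw [e4, List.length_cons, List.length_cons, ← e2, ← e3] at e1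
    have hset : (y ++ n :: z).toFinset = insert n (y.toFinset ∪ z.toFinset) := by
      ext a; simp
    have hsub : y.toFinset ∪ z.toFinset ⊆ Finset.range n := by
      intro a ha
      rw [Finset.mem_union, List.mem_toFinset, List.mem_toFinset] at ha
      exact Finset.mem_range.2 (ha.elim (hyn a) (hzn a))
    rw [mul_basis_of hd, map_smul, insExt_basis, if_pos hsub, smul_smul, smul_smul, smul_smul,
      ← pow_add, ← pow_add, ← pow_add, hset]
    refine congrArg (fun r : R => r • basis R (insert n (y.toFinset ∪ z.toFinset), u ++ u', v ++ v')) ?_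
    apply neg_one_pow_congr
    have c1 := sgnOneExp_append pu pu'
    have c2 := sgnOneExp_append pv pv'
    have c3 := sgnOneExp_append (runs_isPart (fun a b => decide (b < a)) hy)
      (runs_isPart (fun a b => decide (b < a)) hx')
    have c4 : crossings (y ++ [n]).toFinset z.toFinset =
        z.toFinset.card + crossings y.toFinset z.toFinset := by
      rw [List.toFinset_append, crossings_union_left
        (List.disjoint_toFinset_iff_disjoint.2 (List.disjoint_of_nodup_append hx)), add_comm,
        List.toFinset_cons, List.toFinset_nil, insert_empty_eq, crossings_eq_mul (A := {n})]
      · simp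
      · intro a ha b hb
        rw [Finset.mem_singleton.1 ha]
        exact hzn b (by simpa using hb)
    have c4' : crossings y.toFinset (n :: z).toFinset = crossings y.toFinset z.toFinset := by
      rw [List.toFinset_cons, Finset.insert_eq, crossings_union_right, crossings_eq_zero (B := {n}),
        zero_add]
      · intro a ha b hb
        rw [Finset.mem_singleton.1 hb]
        exact (hyn a (by simpa using ha)).le
      · rw [Finset.disjoint_singleton_left, List.mem_toFinset]
        exact fun h => (hzn n h).false
    have c5 := crossings_add_swap hd
    have c6 := choose_two_add v.length v'.length
    have c7 := pv.cardSum
    have c8 := pu'.cardSum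
    have c9 := pv'.cardSum
    simp only [List.toFinset_card_of_nodup, hx, hx', hy, hz, c4, c4', List.length_append, List.length_cons,
      List.length_nil] at c1 c2 c3 c5 c7 c8 c9
    change sgnOneExp (decreasingRuns y ++ decreasingRuns (n :: z)) = sgnOneExp (decreasingRuns y) +
      sgnOneExp (decreasingRuns (n :: z)) + (decreasingRuns (n :: z)).length * _ + _ at c3
    rw [← e2] at c3
    simp only [Nat.cast_add, pairSgnExp_zmod hlen, decreasingRuns_append y z hyn, c1, c2, c3,
      List.length_append, c6, rsgnExp_append, mulExp, wordParity_eq, c7, c8, c9,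
      Finset.card_union_of_disjoint hd, List.toFinset_card_of_nodup hy,
      List.toFinset_card_of_nodup hz]
    have e1' := congrArg (Nat.cast : ℕ → ZMod 2) e1
    have c5' := congrArg (Nat.cast : ℕ → ZMod 2) c5
    push_cast at e1' c5' ⊢
    linear_combination (y.length + (y.length + 1 + v.length) : ZMod 2) * e1' + c5' +
      (2 * y.length + 2 * y.length * z.length - 2 * crossings y.toFinset z.toFinset +
        (y.length + 1 + v.length) * (z.length + 1) - (y.length + 1 + v.length) * v'.length -
        u'.length * y.length : ZMod 2) * zmod_two_two
  · refine Finset.sum_eq_zero fun u' _ => Finset.sum_eq_zero fun v' _ => ?_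
    rw [Finset.sum_eq_zero, smul_zero]
    refine fun u _ => Finset.sum_eq_zero fun v _ => ?_
    rw [basis_mul_basis, mulBasis, if_neg hd, map_zero, smul_zero]

/-- Words without `n` give the previous diagonal and words `y n z` give the product term. The empty
word, which is left out of the diagonal, accounts for the letter `{n}` in each factor. -/
theorem diagonal_succ (n : ℕ) : diagonal R (n + 1) = diagStep n (diagonal R n) := by
  have h : ∀ (L : LetterMap R) (N : DiagAlgebra R), N + L.der (diagonal R n) =
      ∑ y ∈ arrangements n, if y = [] then N else L.der (diagTerm R y) := by
    intro L N
    have h0 : ([] : List ℕ) ∈ arrangements n := mem_arrangements.2 (by simp)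
    rw [diagonal, map_sum, ← Finset.add_sum_erase _ _ h0, ← Finset.add_sum_erase _ _ h0, if_pos rfl,
      if_pos rfl, map_zero, zero_add]
    refine congrArg (N + ·) (Finset.sum_congr rfl fun y hy => ?_)
    rw [if_neg (Finset.ne_of_mem_erase hy), if_neg (Finset.ne_of_mem_erase hy)]
  rw [diagStep, h, h, Finset.sum_mul, map_sum, diagonal, sum_arrangements_succ, diagonal]
  refine congrArg _ (Finset.sum_congr rfl fun y hy => ?_)
  rw [Finset.mul_sum, map_sum]
  refine Finset.sum_congr rfl fun z hz => ?_
  rw [mem_arrangements] at hy hz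
  rw [insExt_mul_eq_diagTerm hy.1 hy.2 hz.1 hz.2, if_neg (c := y ++ n :: z = []) (by simp)]

theorem diagonal_mem (n : ℕ) : diagonal R n ∈
    spanBasis R fun g => g.1 ⊆ Finset.range n ∧ IsPart g.1 g.2.1 ∧ IsPart g.1 g.2.2 := by
  refine Submodule.sum_mem _ fun x hx => ?_
  rw [mem_arrangements] at hx
  split_ifs
  · exact Submodule.zero_mem _
  · refine Submodule.sum_mem _ fun u hu => Submodule.sum_mem _ fun v hv =>
      Submodule.smul_mem _ _ (Submodule.subset_span ⟨_, ⟨?_, dR_isPart hx.1 hu, iR_isPart hx.1 hv⟩, rfl⟩)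
    intro a ha
    exact Finset.mem_range.2 (hx.2 a (by simpa using ha))

/-- The diagonals of the permutahedra form a twisting element. -/
theorem maurerCartan_diagonal (n : ℕ) : invol R (diagonal R n) = -diagonal R n ∧
    (diff R).der (diagonal R n) = diagonal R n * diagonal R n := by
  induction n with
  | zero => simp [diagonal, arrangements]
  | succ n ih =>
    rw [diagonal_succ]
    refine maurerCartan_step ?_ ih.1 ih.2
    refine Submodule.span_mono ?_ (diagonal_mem n)
    rintro _ ⟨g, ⟨h1, h2, h3⟩, rfl⟩
    exact ⟨g, ⟨h1, fun A hA => ⟨h2.nonempty A hA, (h2.subset hA).trans h1⟩,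
      fun A hA => ⟨h3.nonempty A hA, (h3.subset hA).trans h1⟩⟩, rfl⟩

end Diagonal

/-! ### Evaluation of cochains on all cells -/

section Degenerate

variable {Q : CubicalSet.{u}}

/-- The cell `τ` is degenerate in the direction `j`. -/
def DegenAt (j : ℕ) (τ : Q.Cell) : Prop :=
  ∃ (n : ℕ) (i : Fin (n + 1)) (ρ : Q.cell n), (i : ℕ) = j ∧ τ = ⟨n + 1, Q.degen i ρ⟩

theorem DegenAt.isDegenerate {j : ℕ} {τ : Q.Cell} (h : DegenAt j τ) : IsDegenerate τ := by
  obtain ⟨n, i, ρ, -, h⟩ := h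
  exact ⟨n, i, ρ, h⟩

theorem exists_degenAt {τ : Q.Cell} (h : IsDegenerate τ) : ∃ j < τ.1, DegenAt j τ := by
  obtain ⟨n, i, ρ, rfl⟩ := h
  exact ⟨i, i.2, n, i, ρ, rfl, rfl⟩

theorem DegenAt.faceAt_of_lt {j a : ℕ} {τ : Q.Cell} (h : DegenAt j τ) (ha : a < j) (ε : Bool) :
    DegenAt (j - 1) (faceAt ε a τ) := by
  obtain ⟨n, i, ρ, rfl, rfl⟩ := h
  obtain _ | n := n
  · omega
  · have h1 : a < n + 1 + 1 := by omega
    have h2 : a < n + 1 := by omega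
    have h3 : (i : ℕ) - 1 < n + 1 := by omega
    refine ⟨n, ⟨i - 1, h3⟩, Q.face ε ⟨a, h2⟩ ρ, rfl, ?_⟩
    simp only [faceAt, h1, dif_pos]
    have := Q.face_degen_lt ε ⟨a, h2⟩ ⟨i - 1, h3⟩ ρ (by rw [Fin.le_def]; simp only; omega)
    have e : (⟨(i : ℕ) - 1, h3⟩ : Fin (n + 1)).succ = i := by
      ext; simp only [Fin.val_succ]; omega
    rw [e] at this
    exact congrArg (Sigma.mk (n + 1)) this

theorem DegenAt.faceAt_of_gt {j a : ℕ} {τ : Q.Cell} (h : DegenAt j τ) (ha : j < a) (ha' : a < τ.1)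
    (ε : Bool) : DegenAt j (faceAt ε a τ) := by
  obtain ⟨n, i, ρ, rfl, rfl⟩ := h
  simp only at ha'
  obtain _ | n := n
  · omega
  · have h2 : a - 1 < n + 1 := by omega
    have h3 : (i : ℕ) < n + 1 := by omega
    refine ⟨n, ⟨i, h3⟩, Q.face ε ⟨a - 1, h2⟩ ρ, rfl, ?_⟩
    simp only [faceAt, ha', dif_pos]
    have := Q.face_degen_gt ε ⟨a - 1, h2⟩ ⟨i, h3⟩ ρ (by rw [Fin.le_def]; simp only; omega)
    have e : (⟨a - 1, h2⟩ : Fin (n + 1)).succ = ⟨a, ha'⟩ := by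
      ext; simp only [Fin.val_succ]; omega
    rw [e] at this
    exact congrArg (Sigma.mk (n + 1)) this

theorem DegenAt.faceAt_self {j : ℕ} {τ : Q.Cell} (h : DegenAt j τ) :
    faceAt false j τ = faceAt true j τ := by
  obtain ⟨n, i, ρ, rfl, rfl⟩ := h
  simp only [faceAt, i.2, dif_pos, Fin.eta, Q.face_degen_self]

/-- Each fixed coordinate below `i` lowers the degenerate direction by one, those above `i` leave it
alone. The last clause keeps the direction above the coordinates still to be fixed and is needed for
the induction. -/
theorem DegenAt.faceWord {i : ℕ} {τ : Q.Cell} (h : DegenAt i τ) (t : ℕ → Bool) {L : List ℕ}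
    (hL : L.Pairwise (· < ·)) (hn : ∀ a ∈ L, a < τ.1) (hi : i ∉ L) :
    ∃ j ≤ i, DegenAt j (faceWord t L τ) ∧ ∀ m ≤ i, (∀ a ∈ L, m ≤ a) → m ≤ j := by
  induction L with
  | nil => exact ⟨i, le_rfl, h, fun m hm _ => hm⟩
  | cons a L ih =>
    have hL' := hL
    rw [List.pairwise_cons] at hL
    rw [List.mem_cons, not_or] at hi
    obtain ⟨j, h1, h2, h3⟩ := ih hL.2 (fun b hb => hn b (by simp [hb])) hi.2
    rcases lt_or_gt_of_ne hi.1 with hlt | hlt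
    · refine ⟨j, h1, h2.faceAt_of_gt (a := a) (by omega) ?_ (t a), fun m hm _ => h3 m hm ?_⟩
      · rw [faceWord_dim t hL.2 τ fun b hb => hn b (by simp [hb])]
        have := length_le_of_sorted hL.2 (m := a + 1)
          (fun b hb => ⟨hL.1 b hb, hn b (by simp [hb])⟩)
        have := hn a (by simp)
        omega
      · intro b hb
        have := hL.1 b hb
        omega
    · have := h3 (a + 1) hlt (fun b hb => hL.1 b hb)
      refine ⟨j - 1, by omega, h2.faceAt_of_lt (a := a) (by omega) (t a), fun m hm hm' => ?_⟩
      have := hm' a (by simp)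
      omega

theorem DegenAt.faceOf {i : ℕ} {τ : Q.Cell} (h : DegenAt i τ) (T : Finset ℕ) {X : Finset ℕ}
    (hi : i ∈ X) : IsDegenerate (faceOf τ T X) := by
  obtain ⟨j, -, h, -⟩ := h.faceWord (fun i => decide (i ∈ T)) (coList_sorted τ.1 X)
    (fun a ha => (mem_coList.1 ha).1) (fun h => (mem_coList.1 h).2 hi)
  exact h.isDegenerate

end Degenerate

/-! ### Cochains as functions on all cells, and the bar differential on functions of words. -/

section Eval

variable {R : Type v} [CommRing R] {Q : CubicalSet.{u}}

theorem Cochain.eval_of_dim {n : ℕ} (a : Cochain R Q n) {τ : Q.Cell} (h : τ.1 ≠ n) :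
    a.eval τ = 0 := dif_neg fun h' => h h'.1

theorem Cochain.eval_of_isDegenerate {n : ℕ} (a : Cochain R Q n) {τ : Q.Cell}
    (h : IsDegenerate τ) : a.eval τ = 0 := dif_neg fun h' => h'.2 h

/-- A cochain only stores values on nondegenerate cells of one dimension. A formula may be used on
every cell once it is known to vanish on the others; each operation below is brought into this form.
-/
theorem Cochain.eval_ofFun {n : ℕ} {f : Q.Cell → R} (hd : ∀ τ, τ.1 ≠ n → f τ = 0)
    (hf : ∀ τ, IsDegenerate τ → f τ = 0) : (Cochain.ofFun (R := R) n f).eval = f := by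
  funext τ
  by_cases h : τ.1 = n ∧ ¬ IsDegenerate τ
  · rw [Cochain.eval, dif_pos h]; rfl
  · rw [Cochain.eval, dif_neg h]
    by_cases h1 : τ.1 = n
    · exact (hf τ (not_not.1 fun h2 => h ⟨h1, h2⟩)).symm
    · exact (hd τ h1).symm

theorem Cochain.eval_apply {n : ℕ} (a : Cochain R Q n) (τ) : a.eval τ.1 = a τ := dif_pos τ.2

/-- On a cell degenerate in direction `j` the two faces in that direction agree and cancel, and the
other faces are degenerate. -/
theorem Cochain.eval_coboundary {n : ℕ} (a : Cochain R Q n) :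
    a.coboundary.eval = cellDelta a.eval := by
  have : a.coboundary = Cochain.ofFun (n + 1) (cellDelta a.eval) := by
    funext τ
    simp only [Cochain.coboundary, Cochain.ofFun, cellDelta, τ.2.1]
  rw [this, Cochain.eval_ofFun]
  · intro τ hτ
    refine Finset.sum_eq_zero fun i hi => ?_
    rw [Finset.mem_range] at hi
    rw [a.eval_of_dim, a.eval_of_dim, sub_zero, mul_zero]
    · rw [faceAt_dim _ _ _ hi]; omega
    · rw [faceAt_dim _ _ _ hi]; omega
  · intro τ hτ
    obtain ⟨j, hj, h⟩ := exists_degenAt hτ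
    refine Finset.sum_eq_zero fun i hi => ?_
    rw [Finset.mem_range] at hi
    rcases lt_trichotomy i j with hij | rfl | hij
    · rw [a.eval_of_isDegenerate (h.faceAt_of_lt hij _).isDegenerate,
        a.eval_of_isDegenerate (h.faceAt_of_lt hij _).isDegenerate, sub_zero, mul_zero]
    · rw [h.faceAt_self, sub_self, mul_zero]
    · rw [a.eval_of_isDegenerate (h.faceAt_of_gt hij hi _).isDegenerate,
        a.eval_of_isDegenerate (h.faceAt_of_gt hij hi _).isDegenerate, sub_zero, mul_zero]

/-- A degenerate direction is free in exactly one of the two faces, and the corresponding factor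
vanishes. -/
theorem Cochain.eval_cup {p q : ℕ} (a : Cochain R Q p) (b : Cochain R Q q) :
    (a.cup b).eval = cellCup a.eval b.eval := by
  have : a.cup b = Cochain.ofFun (p + q) (cellCup a.eval b.eval) := by
    funext τ
    simp only [Cochain.cup, Cochain.ofFun, cellCup, τ.2.1]
  have hf : ∀ (τ : Q.Cell) (A), A ∈ (Finset.range τ.1).powerset →
      iterFace (Finset.range τ.1 \ A) ∅ τ = faceOf τ ∅ A ∧
      iterFace ∅ A τ = faceOf τ A (Finset.range τ.1 \ A) := by
    intro τ A hA
    rw [Finset.mem_powerset] at hA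
    rw [iterFace_eq_faceOf τ (Finset.disjoint_empty_right _) Finset.sdiff_subset (by simp),
      iterFace_eq_faceOf τ (Finset.disjoint_empty_left _) (by simp) hA]
    simp [Finset.inter_eq_right.2 hA]
  rw [this, Cochain.eval_ofFun]
  · intro τ hτ
    refine Finset.sum_eq_zero fun A hA => ?_
    rw [(hf τ A hA).1, (hf τ A hA).2]
    rw [Finset.mem_powerset] at hA
    have hc := Finset.card_sdiff_add_card_eq_card hA
    rw [Finset.card_range] at hc
    by_cases h : A.card = p
    · rw [b.eval_of_dim, mul_zero, mul_zero]
      rw [faceOf_dim _ _ Finset.sdiff_subset]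
      omega
    · rw [a.eval_of_dim, zero_mul, mul_zero]
      rwa [faceOf_dim _ _ hA]
  · intro τ hτ
    obtain ⟨j, hj, h⟩ := exists_degenAt hτ
    refine Finset.sum_eq_zero fun A hA => ?_
    rw [(hf τ A hA).1, (hf τ A hA).2]
    by_cases hjA : j ∈ A
    · rw [a.eval_of_isDegenerate (h.faceOf _ hjA), zero_mul, mul_zero]
    · rw [b.eval_of_isDegenerate (h.faceOf _ (by simp [hj, hjA])), mul_zero, mul_zero]

/-! ### The differential on functions of words -/

/-- The letter of the coboundary. -/
def BarLetter.coboundary (a : BarLetter R Q) : BarLetter R Q := ⟨a.1 + 1, a.2.coboundary⟩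

/-- The letter of the cup product. -/
def BarLetter.cup (a b : BarLetter R Q) : BarLetter R Q :=
  ⟨a.1 + 1 + b.1, Cochain.cup (p := a.1 + 1) (q := b.1 + 1) a.2 b.2⟩

/-- The bar differential on functions of words. -/
def listDiff {M : Type*} [AddCommGroup M] [Module R M] :
    (List (BarLetter R Q) → M) → List (BarLetter R Q) → M
  | _, [] => 0
  | F, [a] => -F [a.coboundary]
  | F, a :: b :: l => -F (a.coboundary :: b :: l) - (-1 : R) ^ a.1 • F (a.cup b :: l) +
      (-1 : R) ^ a.1 • listDiff (fun x => F (a :: x)) (b :: l)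

section ListDiff

variable {M N : Type*} [AddCommGroup M] [Module R M] [AddCommGroup N] [Module R N]

theorem map_listDiff (g : M →ₗ[R] N) (F : List (BarLetter R Q) → M) (l : List (BarLetter R Q)) :
    g (listDiff F l) = listDiff (fun x => g (F x)) l := by
  induction l generalizing F with
  | nil => simp [listDiff]
  | cons a l ih =>
    obtain _ | ⟨b, l⟩ := l
    · simp [listDiff]
    · simp only [listDiff, map_add, map_sub, map_neg, map_smul, ih]

/-- The differential never evaluates its function at the empty word. This matters because the
evaluated diagonal differs from the Hirsch operations on the empty pair. -/
theorem listDiff_congr {F G : List (BarLetter R Q) → M} (h : ∀ l, l ≠ [] → F l = G l)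
    (l : List (BarLetter R Q)) : listDiff F l = listDiff G l := by
  induction l generalizing F G with
  | nil => rfl
  | cons a l ih =>
    obtain _ | ⟨b, l⟩ := l
    · simp [listDiff, h]
    · rw [listDiff, listDiff, h _ (by simp), h _ (by simp),
        ih (F := fun x => F (a :: x)) (G := fun x => G (a :: x)) fun l _ => h _ (by simp)]

theorem listDiff_add (F G : List (BarLetter R Q) → M) (l : List (BarLetter R Q)) :
    listDiff (fun x => F x + G x) l = listDiff F l + listDiff G l := by
  induction l generalizing F G with
  | nil => simp [listDiff]
  | cons a l ih =>
    obtain _ | ⟨b, l⟩ := l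
    · simp only [listDiff]; abel
    · simp only [listDiff, ih, smul_add]; abel

theorem listDiff_smul (r : R) (F : List (BarLetter R Q) → M) (l : List (BarLetter R Q)) :
    listDiff (fun x => r • F x) l = r • listDiff F l :=
  (map_listDiff (r • (LinearMap.id : M →ₗ[R] M)) F l).symm

theorem listDiff_zero (l : List (BarLetter R Q)) :
    listDiff (fun _ : List (BarLetter R Q) => (0 : M)) l = 0 := by
  simpa using (map_listDiff (0 : M →ₗ[R] M) (fun _ => 0) l).symm

theorem barDiff_eq (l : List (BarLetter R Q)) : barDiff l = listDiff barWord l := by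
  induction l with
  | nil => rfl
  | cons a l ih =>
    obtain _ | ⟨b, l⟩ := l
    · simp [barDiff, listDiff, barWord, BarLetter.coboundary]
    · rw [barDiff, listDiff, ih]
      have := map_listDiff (LinearMap.mulLeft R (barι a.2)) barWord (b :: l)
      rw [LinearMap.mulLeft_apply] at this
      rw [this]
      rfl

end ListDiff

end Eval

/-! ### Evaluation of the diagonal -/

section DiagonalEval

open DiagAlgebra

variable {R : Type v} [CommRing R]

/-- The sum over the subdivisions of the letters of a word. -/
def splitWord {M : Type*} [AddCommGroup M] [Module R M] :
    (List (Finset ℕ) → M) → List (Finset ℕ) → M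
  | _, [] => 0
  | f, A :: u => ∑ M ∈ A.powerset, (if M = ∅ ∨ M = A then 0 else
      (-1 : R) ^ (crossings M (A \ M) + M.card) • f (M :: (A \ M) :: u)) +
      (-1 : R) ^ (A.card + 1) • splitWord (fun w => f (A :: w)) u

theorem map_splitWord {M N : Type*} [AddCommGroup M] [Module R M] [AddCommGroup N] [Module R N]
    (g : M →ₗ[R] N) (f : List (Finset ℕ) → M) (u : List (Finset ℕ)) :
    g (splitWord (R := R) f u) = splitWord (R := R) (fun w => g (f w)) u := by
  induction u generalizing f with
  | nil => simp [splitWord]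
  | cons A u ih =>
    simp only [splitWord, map_add, map_sum, map_smul, ih]
    refine congrArg (· + _) (Finset.sum_congr rfl fun M _ => ?_)
    split_ifs <;> simp

theorem derivation_splitLetter {w D : List (Finset ℕ) → DiagAlgebra R}
    (hw : ∀ u v, w (u ++ v) = w u * w v) (h0 : D [] = 0)
    (h1 : ∀ A u, D (A :: u) = splitLetter w A * w u + (-1 : R) ^ (A.card + 1) • (w [A] * D u))
    (u : List (Finset ℕ)) : D u = splitWord (R := R) w u := by
  induction u with
  | nil => rw [h0, splitWord]
  | cons A u ih =>
    rw [h1, ih, splitWord, splitLetter, Finset.sum_mul]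
    refine congrArg₂ (· + ·) (Finset.sum_congr rfl fun M _ => ?_) (congrArg _ ?_)
    · split_ifs
      · rw [zero_mul]
      · rw [smul_mul_assoc, ← hw]; rfl
    · have := map_splitWord (LinearMap.mulLeft R (w [A])) w u
      rw [LinearMap.mulLeft_apply] at this
      rw [this]
      refine congrFun (congrArg _ ?_) u
      funext v
      rw [LinearMap.mulLeft_apply, ← hw]; rfl

theorem der_diff_basis (X : Finset ℕ) (u v : List (Finset ℕ)) : (diff R).der (basis R (X, u, v)) =
    splitWord (R := R) (fun w => basis R (X, w, v)) u +
      (-1 : R) ^ wordParity u • splitWord (R := R) (fun w => basis R (X, u, w)) v := by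
  rw [LetterMap.der_basis, derivation_splitLetter (w := fst R) (D := (diff R).derFst) fst_append rfl
    (fun _ _ => rfl), derivation_splitLetter (w := snd R) (D := (diff R).derSnd) snd_append rfl
    (fun _ _ => rfl), add_mul, smul_mul_assoc, mul_assoc, mul_assoc]
  have h1 := map_splitWord (LinearMap.mulRight R (snd R v * ext R X)) (fst R) u
  have h2 := map_splitWord (LinearMap.mulLeft R (fst R u) ∘ₗ LinearMap.mulRight R (ext R X))
    (snd R) v
  simp only [LinearMap.comp_apply, LinearMap.mulRight_apply, LinearMap.mulLeft_apply,
    ← mul_assoc] at h1 h2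
  simp only [← mul_assoc]
  rw [h1, h2]
  simp only [basis_eq]

end DiagonalEval

section BarDegree

variable {R : Type v} {Q : CubicalSet.{u}}

theorem barDegree_cons (a : BarLetter R Q) (l : List (BarLetter R Q)) :
    barDegree (a :: l) = a.1 + barDegree l := by simp [barDegree]

theorem barDegree_append (l m : List (BarLetter R Q)) :
    barDegree (l ++ m) = barDegree l + barDegree m := by simp [barDegree]

@[simp] theorem barDegree_nil : barDegree ([] : List (BarLetter R Q)) = 0 := rfl

end BarDegree

/-! ### Words of cochains evaluated on words of blocks. -/

section WordEval

variable {R : Type v} [CommRing R] {Q : CubicalSet.{u}}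

/-- The faces of `σ` that belong to the blocks with more than one element of a word in disjoint
sets of coordinates, if the coordinates in `T` are `1` at the beginning. -/
def wordFaces (σ : Q.Cell) : Finset ℕ → List (Finset ℕ) → List Q.Cell
  | _, [] => []
  | T, A :: l =>
    if A.card = 1 then wordFaces σ (T ∪ A) l else faceOf σ T A :: wordFaces σ (T ∪ A) l

/-- The value of a word in cochains on a word in sets of coordinates. -/
def wordValue (σ : Q.Cell) (as : List (BarLetter R Q)) (T : Finset ℕ) (u : List (Finset ℕ)) : R :=
  evalWord as (wordFaces σ T u)

theorem wordValue_nil_right (σ : Q.Cell) (as : List (BarLetter R Q)) (T : Finset ℕ) :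
    wordValue σ as T [] = if as = [] then 1 else 0 := by
  cases as <;> simp [wordValue, wordFaces, evalWord]

theorem wordValue_of_card_one (σ : Q.Cell) (as : List (BarLetter R Q)) (T : Finset ℕ)
    {A : Finset ℕ} (hA : A.card = 1) (u : List (Finset ℕ)) :
    wordValue σ as T (A :: u) = wordValue σ as (T ∪ A) u := by
  rw [wordValue, wordFaces, if_pos hA]; rfl

theorem wordValue_nil_of_card_ne_one (σ : Q.Cell) (T : Finset ℕ)
    {A : Finset ℕ} (hA : A.card ≠ 1) (u : List (Finset ℕ)) :
    wordValue (R := R) σ [] T (A :: u) = 0 := by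
  rw [wordValue, wordFaces, if_neg hA]; rfl

theorem wordValue_cons_of_card_ne_one (σ : Q.Cell) (a : BarLetter R Q) (l : List (BarLetter R Q))
    (T : Finset ℕ) {A : Finset ℕ} (hA : A.card ≠ 1) (u : List (Finset ℕ)) :
    wordValue σ (a :: l) T (A :: u) =
      a.2.eval (faceOf σ T A) * wordValue σ l (T ∪ A) u := by
  rw [wordValue, wordFaces, if_neg hA]; rfl

/-- Nonzero values occur only for words of the right degree. -/
theorem card_of_wordValue_ne_zero {σ : Q.Cell} {as : List (BarLetter R Q)} {T : Finset ℕ}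
    {u : List (Finset ℕ)} (hu : ∀ A ∈ u, A ⊆ Finset.range σ.1) (h : wordValue σ as T u ≠ 0) :
    cardSum u = barDegree as + u.length := by
  induction u generalizing as T with
  | nil =>
    rw [wordValue_nil_right] at h
    have : as = [] := by by_contra h'; simp [h'] at h
    simp [this]
  | cons A u ih =>
    have ih := @ih
    by_cases hA : A.card = 1
    · rw [wordValue_of_card_one _ _ _ hA] at h
      have := ih (fun B hB => hu B (by simp [hB])) h
      rw [cardSum_cons, hA, this, List.length_cons]; ring
    · obtain _ | ⟨a, l⟩ := as
      · rw [wordValue_nil_of_card_ne_one _ _ hA] at h; exact absurd rfl h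
      · rw [wordValue_cons_of_card_ne_one _ _ _ _ hA] at h
        have := ih (fun B hB => hu B (by simp [hB])) (right_ne_zero_of_mul h)
        have hd : A.card = a.1 + 1 := by
          by_contra h'
          apply left_ne_zero_of_mul h
          rw [a.2.eval_of_dim]
          rwa [faceOf_dim _ _ (hu A (by simp))]
        rw [cardSum_cons, hd, this, List.length_cons, barDegree_cons]; ring

/-- Where the value is nonzero, the parity of the word of blocks is the degree of the word of
cochains, the number of blocks being counted twice. This converts signs of `DiagAlgebra` into signs
of the bar construction. -/
theorem wordParity_mul_wordValue {σ : Q.Cell} (as : List (BarLetter R Q)) (T : Finset ℕ)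
    {u : List (Finset ℕ)} (hu : ∀ A ∈ u, A ⊆ Finset.range σ.1) (k : ℕ) :
    (-1) ^ (k * wordParity u) * wordValue σ as T u =
      (-1) ^ (k * barDegree as) * wordValue σ as T u := by
  by_cases h : wordValue σ as T u = 0
  · rw [h, mul_zero, mul_zero]
  · rw [neg_one_pow_congr (R := R) (n := k * barDegree as)]
    rw [wordParity_eq, card_of_wordValue_ne_zero hu h]
    push_cast
    linear_combination (k * u.length : ZMod 2) * zmod_two_two

end WordEval

/-! ### Sums over the ways to cut a list -/

section SplitSum

variable {α β : Type*} {M N : Type*} [AddCommMonoid M] [AddCommMonoid N]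

/-- The sum of `F x y` over all ways to write a list as `x ++ y`. -/
def splitSum : (List α → List α → M) → List α → M
  | F, [] => F [] []
  | F, a :: l => F [] (a :: l) + splitSum (fun x y => F (a :: x) y) l

theorem splitSum_congr {F G : List α → List α → M} {l : List α}
    (h : ∀ x y, x ++ y = l → F x y = G x y) : splitSum F l = splitSum G l := by
  induction l generalizing F G with
  | nil => exact h [] [] rfl
  | cons a l ih =>
    rw [splitSum, splitSum, h [] _ rfl, ih fun x y hxy => h (a :: x) y (by rw [← hxy]; rfl)]

theorem splitSum_zero (l : List α) : splitSum (fun _ _ => (0 : M)) l = 0 := by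
  induction l with
  | nil => rfl
  | cons a l ih => rw [splitSum, ih, add_zero]

theorem splitSum_add (F G : List α → List α → M) (l : List α) :
    splitSum (fun x y => F x y + G x y) l = splitSum F l + splitSum G l := by
  induction l generalizing F G with
  | nil => rfl
  | cons a l ih => rw [splitSum, splitSum, splitSum, ih]; abel

theorem map_splitSum {Φ : Type*} [FunLike Φ M N] [AddMonoidHomClass Φ M N] (g : Φ)
    (F : List α → List α → M) (l : List α) :
    g (splitSum F l) = splitSum (fun x y => g (F x y)) l := by
  induction l generalizing F with
  | nil => rfl
  | cons a l ih => rw [splitSum, splitSum, map_add, ih]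

/-- Both sides sum over the ways to cut a list into three pieces. -/
theorem splitSum_assoc (F : List α → List α → List α → M) (l : List α) :
    splitSum (fun x y => splitSum (fun p q => F p q y) x) l =
      splitSum (fun x y => splitSum (fun p q => F x p q) y) l := by
  induction l generalizing F with
  | nil => rfl
  | cons a l ih =>
    simp only [splitSum, splitSum_add, ih]
    rw [add_assoc]

theorem splitSum_comm (F : List α → List α → List β → List β → M) (l : List α) (m : List β) :
    splitSum (fun x y => splitSum (fun z w => F x y z w) m) l =
      splitSum (fun z w => splitSum (fun x y => F x y z w) l) m := by
  induction l generalizing F with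
  | nil => rfl
  | cons a l ih => simp only [splitSum, splitSum_add, ih]

theorem splitSum_eq_left {F : List α → List α → M} (h : ∀ a x y, F (a :: x) y = 0) (l : List α) :
    splitSum F l = F [] l := by
  cases l with
  | nil => rfl
  | cons a l => simp only [splitSum, h, splitSum_zero, add_zero]

theorem splitSum_eq_right {F : List α → List α → M} (h : ∀ x a y, F x (a :: y) = 0) (l : List α) :
    splitSum F l = F l [] := by
  induction l generalizing F with
  | nil => rfl
  | cons a l ih => rw [splitSum, h, zero_add, ih fun x b y => h (a :: x) b y]

theorem splitSum_eq_sum (F : List α → List α → M) (l : List α) :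
    splitSum F l = ∑ i ∈ Finset.range (l.length + 1), F (l.take i) (l.drop i) := by
  induction l generalizing F with
  | nil => simp [splitSum]
  | cons a l ih =>
    rw [splitSum, ih, List.length_cons, Finset.sum_range_succ' _ (l.length + 1), add_comm]
    rfl

theorem splitSum_neg {M : Type*} [AddCommGroup M] (F : List α → List α → M) (l : List α) :
    splitSum (fun x y => -F x y) l = -splitSum F l := (map_splitSum (-AddMonoidHom.id M) F l).symm

theorem splitSum_smul {R M : Type*} [Ring R] [AddCommGroup M] [Module R M] (r : R)
    (F : List α → List α → M) (l : List α) :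
    splitSum (fun x y => r • F x y) l = r • splitSum F l :=
  (map_splitSum (DistribSMul.toAddMonoidHom M r) F l).symm

theorem splitSum_mul_left {R : Type*} [Ring R] (r : R)
    (F : List α → List α → R) (l : List α) :
    splitSum (fun x y => r * F x y) l = r * splitSum F l :=
  (map_splitSum (AddMonoidHom.mulLeft r) F l).symm

theorem splitSum_mul_right {R : Type*} [Ring R] (r : R)
    (F : List α → List α → R) (l : List α) :
    splitSum (fun x y => F x y * r) l = splitSum F l * r :=
  (map_splitSum (AddMonoidHom.mulRight r) F l).symm

end SplitSum

/-- The unique vertex and the absence of nondegenerate edges. -/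
class OneReduced (Q : CubicalSet.{u}) : Prop where
  eq_of_dim_zero : ∀ σ τ : Q.cell 0, σ = τ
  isDegenerate_of_dim_one : ∀ τ : Q.Cell, τ.1 = 1 → IsDegenerate τ

/-! ### Subdivision of blocks and the bar differential. -/

section WordEval

variable {R : Type v} [CommRing R]

theorem splitWord_add (f g : List (Finset ℕ) → R) (u : List (Finset ℕ)) :
    splitWord (R := R) (fun w => f w + g w) u =
      splitWord (R := R) f u + splitWord (R := R) g u := by
  induction u generalizing f g with
  | nil => simp [splitWord]
  | cons A u ih =>
    simp only [splitWord, ih, smul_add]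
    rw [add_add_add_comm, ← Finset.sum_add_distrib]
    refine congrArg (· + _) (Finset.sum_congr rfl fun M _ => ?_)
    split_ifs <;> simp

theorem splitWord_mul (r : R) (g : List (Finset ℕ) → R) (u : List (Finset ℕ)) :
    splitWord (R := R) (fun w => r * g w) u = r * splitWord (R := R) g u :=
  (map_splitWord (LinearMap.mulLeft R r) g u).symm

/-- The letters evaluated on `u` form an initial piece of the word of cochains; on the blocks of `v`
the coordinates of `u` are set to `1`. -/
theorem wordValue_append {Q : CubicalSet.{u}} (σ : Q.Cell) (as : List (BarLetter R Q)) (T : Finset ℕ)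
    (u v : List (Finset ℕ)) : wordValue σ as T (u ++ v) =
      splitSum (fun x y => wordValue σ x T u * wordValue σ y (T ∪ unions u) v) as := by
  induction u generalizing as T with
  | nil =>
    rw [splitSum_eq_left]
    · simp [wordValue_nil_right]
    · intro a x y; simp [wordValue_nil_right]
  | cons A u ih =>
    by_cases hA : A.card = 1
    · simp only [List.cons_append, wordValue_of_card_one _ _ _ hA, ih, unions_cons,
        Finset.union_assoc]
    · obtain _ | ⟨a, l⟩ := as
      · simp [splitSum, wordValue_nil_of_card_ne_one _ _ hA]
      · simp only [splitSum, List.cons_append, wordValue_nil_of_card_ne_one _ _ hA,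
          wordValue_cons_of_card_ne_one _ _ _ _ hA, ih, unions_cons, Finset.union_assoc, zero_mul,
          zero_add, mul_assoc, splitSum_mul_left]

variable {Q : CubicalSet.{u}} [OneReduced Q]

theorem eval_letter (a : BarLetter R Q) {τ : Q.Cell} (h : τ.1 ≤ 1) : a.2.eval τ = 0 := by
  by_cases h0 : τ.1 = 1
  · exact a.2.eval_of_isDegenerate (OneReduced.isDegenerate_of_dim_one τ h0)
  · exact a.2.eval_of_dim (by omega)

/-- The first letter of a word, as a function on faces. -/
def headValue (σ : Q.Cell) (as : List (BarLetter R Q)) (T X : Finset ℕ) : R :=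
  match as with
  | [] => 0
  | a :: _ => a.2.eval (faceOf σ T X)

theorem headValue_of_card_le_one (σ : Q.Cell) (as : List (BarLetter R Q)) (T : Finset ℕ)
    {A : Finset ℕ} (hA : A ⊆ Finset.range σ.1) (h : A.card ≤ 1) : headValue σ as T A = 0 := by
  obtain _ | ⟨a, l⟩ := as
  · rfl
  · exact eval_letter a (by rwa [faceOf_dim _ _ hA])

/-- Since letters vanish on edges, the case distinction by the size of the block becomes a sum in
which at most one term is nonzero. -/
theorem wordValue_cons (σ : Q.Cell) (as : List (BarLetter R Q)) (T : Finset ℕ)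
    {A : Finset ℕ} (hA : A ⊆ Finset.range σ.1) (u : List (Finset ℕ)) :
    wordValue σ as T (A :: u) = atom T A * wordValue σ as (T ∪ A) u +
      headValue σ as T A * wordValue σ as.tail (T ∪ A) u := by
  by_cases h : A.card = 1
  · rw [wordValue_of_card_one _ _ _ h, headValue_of_card_le_one _ _ _ hA h.le]
    simp [atom, h]
  · obtain _ | ⟨a, l⟩ := as
    · rw [wordValue_nil_of_card_ne_one _ _ h]; simp [atom, h, headValue]
    · rw [wordValue_cons_of_card_ne_one _ _ _ _ h]; simp [atom, h, headValue]

/-- When a block is split in two, each part is an edge or receives a letter. Two edges cancel, an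
edge and a letter give the coboundary of the letter, and two letters give their cup product. These
are the terms of the bar differential. -/
theorem splitWord_wordValue (σ : Q.Cell) (as : List (BarLetter R Q)) {T X : Finset ℕ}
    {u : List (Finset ℕ)} (hu : IsPart X u) (hX : X ⊆ Finset.range σ.1) (hT : Disjoint T X) :
    splitWord (R := R) (fun w => wordValue σ as T w) u =
      listDiff (fun x => wordValue σ x T u) as := by
  induction u generalizing as T X with
  | nil =>
    rw [splitWord]
    obtain _ | ⟨a, _ | ⟨b, l⟩⟩ := as
    · rfl
    · simp [listDiff, wordValue_nil_right]
    · simp only [listDiff, wordValue_nil_right]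
      simp [listDiff_zero]
  | cons A u ih =>
    obtain ⟨k1, k2, k3, k4⟩ := isPart_cons.1 hu
    have hA : A ⊆ Finset.range σ.1 := (Finset.subset_union_left.trans k4.subset).trans hX
    have hTA : Disjoint T A := hT.mono_right (Finset.subset_union_left.trans k4.subset)
    have hu' : unions u ⊆ Finset.range σ.1 := (Finset.subset_union_right.trans k4.subset).trans hX
    have hTu : Disjoint (T ∪ A) (unions u) := Finset.disjoint_union_left.2
      ⟨hT.mono_right (Finset.subset_union_right.trans k4.subset), k2⟩
    have ih := fun as => ih as k3 hu' hTu
    -- The improper subsets may be added to complete the convolutions, because letters and `atom`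
    -- vanish on the empty set.
    have first : ∑ M ∈ A.powerset, (if M = ∅ ∨ M = A then 0 else
        (-1 : R) ^ (crossings M (A \ M) + M.card) • wordValue σ as T (M :: (A \ M) :: u)) =
        (conv (parity (headValue σ as)) atom T A - conv atom (headValue σ as) T A) *
          wordValue σ as.tail (T ∪ A) u +
        conv (parity (headValue σ as)) (headValue σ as.tail) T A *
          wordValue σ as.tail.tail (T ∪ A) u := by
      have hat : conv (atom (R := R)) atom T A = 0 := congrFun (congrFun atom_conv_atom T) A
      trans (conv (parity (headValue σ as)) atom T A - conv atom (headValue σ as) T A) *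
          wordValue σ as.tail (T ∪ A) u +
        conv (parity (headValue σ as)) (headValue σ as.tail) T A *
          wordValue σ as.tail.tail (T ∪ A) u - conv atom atom T A * wordValue σ as (T ∪ A) u
      swap
      · rw [hat, zero_mul, sub_zero]
      simp only [conv, Finset.sum_mul, ← Finset.sum_sub_distrib, ← Finset.sum_add_distrib]
      refine Finset.sum_congr rfl fun M hM => ?_
      rw [Finset.mem_powerset] at hM
      have hMr := hM.trans hA
      have hNr : A \ M ⊆ Finset.range σ.1 := Finset.sdiff_subset.trans hA
      rw [wordValue_cons _ _ _ hMr, wordValue_cons _ _ _ hNr, wordValue_cons _ _ _ hNr,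
        Finset.union_assoc, Finset.union_sdiff_of_subset hM]
      have hat' : (-1) ^ M.card * atom (R := R) T M = -atom T M :=
        congrFun (congrFun parity_atom T) M
      split_ifs with h
      · rcases h with rfl | rfl
        · rw [parity, headValue_of_card_le_one σ as T (A := ∅) (by simp) (by simp)]
          simp [atom]
        · rw [Finset.sdiff_self, headValue_of_card_le_one σ as _ (A := ∅) (by simp) (by simp),
            headValue_of_card_le_one σ as.tail _ (A := ∅) (by simp) (by simp)]
          simp [atom]
      · simp only [parity, smul_eq_mul, pow_add]
        linear_combination (-1 : R) ^ crossings M (A \ M) *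
          (atom (T ∪ M) (A \ M) * wordValue σ as (T ∪ A) u +
            headValue σ as (T ∪ M) (A \ M) * wordValue σ as.tail (T ∪ A) u) * hat'
    rw [splitWord, first]
    simp only [wordValue_cons σ _ T hA, splitWord_add, splitWord_mul, ih]
    have at1 : (-1) ^ (A.card + 1) * atom (R := R) T A = atom T A := by
      by_cases h : A.card = 1 <;> simp [atom, h]
    have e2 : ∀ F : List (BarLetter R Q) → R, listDiff (fun x => atom T A * F x) as =
        atom T A * listDiff F as := fun F => listDiff_smul (atom T A) F as
    rw [listDiff_add, e2]
    obtain _ | ⟨a, l⟩ := as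
    · simp [headValue, listDiff, conv, parity]
    -- A nonzero value forces the block to have one element more than the degree of the letter, so
    -- the sign of the block is the sign of the letter.
    · have ha : (-1) ^ (A.card + 1) * headValue σ (a :: l) T A =
          (-1) ^ a.1 * headValue σ (a :: l) T A := by
        by_cases h : A.card = a.1 + 1
        · rw [h, pow_succ, pow_succ]; ring
        · rw [show headValue σ (a :: l) T A = 0 from
            a.2.eval_of_dim (by rwa [faceOf_dim _ _ hA])]
          simp
      have hd : a.coboundary.2.eval (faceOf σ T A) =
          (conv atom (headValue σ (a :: l)) - conv (parity (headValue σ (a :: l))) atom) T A := by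
        have := cellDelta_faceOf a.2.eval σ hA hTA
        rw [← Cochain.eval_coboundary] at this
        exact this
      rw [Pi.sub_apply, Pi.sub_apply] at hd
      obtain _ | ⟨b, l⟩ := l
      · simp only [listDiff, List.tail_cons, List.tail_nil]
        have z : conv (parity (headValue σ [a])) (headValue σ ([] : List (BarLetter R Q))) T A
            = 0 := by simp [conv, headValue]
        rw [show ∀ l, headValue σ (a.coboundary :: l) T A = a.coboundary.2.eval (faceOf σ T A) from
          fun _ => rfl, hd, z]
        simp only [smul_eq_mul]
        linear_combination (-wordValue σ [a.coboundary] (T ∪ A) u) * at1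
      · have hc : (a.cup b).2.eval (faceOf σ T A) =
            conv (headValue σ (a :: b :: l)) (headValue σ (b :: l)) T A := by
          have := cellCup_faceOf a.2.eval b.2.eval σ hA hTA
          rw [← Cochain.eval_cup] at this
          exact this
        have hp : conv (parity (headValue σ (a :: b :: l))) (headValue σ (b :: l)) T A =
            -(-1) ^ a.1 * conv (headValue σ (a :: b :: l)) (headValue σ (b :: l)) T A := by
          simp only [conv, Finset.mul_sum]
          refine Finset.sum_congr rfl fun M hM => ?_
          rw [Finset.mem_powerset] at hM
          have : parity (headValue σ (a :: b :: l)) T M =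
              -(-1) ^ a.1 * headValue σ (a :: b :: l) T M := by
            by_cases h : M.card = a.1 + 1
            · rw [parity, h, pow_succ]; ring
            · rw [parity, show headValue σ (a :: b :: l) T M = 0 from
                a.2.eval_of_dim (by rwa [faceOf_dim _ _ (hM.trans hA)])]
              simp
          rw [this]; ring
        simp only [List.tail_cons]
        rw [hp, ← hc]
        simp only [listDiff, List.tail_cons]
        rw [show ∀ l, headValue σ (a.coboundary :: l) T A = a.coboundary.2.eval (faceOf σ T A) from
          fun _ => rfl, hd, show ∀ l, headValue σ (a.cup b :: l) T A =
            (a.cup b).2.eval (faceOf σ T A) from fun _ => rfl]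
        have e3 : listDiff (fun x => headValue σ (a :: x) T A * wordValue σ x (T ∪ A) u) (b :: l) =
            headValue σ (a :: b :: l) T A *
              listDiff (fun x => wordValue σ x (T ∪ A) u) (b :: l) :=
          listDiff_smul (a.2.eval (faceOf σ T A)) (fun x => wordValue σ x (T ∪ A) u) (b :: l)
        rw [e3]
        simp only [smul_eq_mul]
        linear_combination (-wordValue σ (a.coboundary :: b :: l) (T ∪ A) u -
            (-1) ^ a.1 * wordValue σ (a.cup b :: l) (T ∪ A) u +
            (-1) ^ a.1 * listDiff (fun x => wordValue σ (a :: x) (T ∪ A) u) (b :: l)) * at1 +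
          listDiff (fun x => wordValue σ x (T ∪ A) u) (b :: l) * ha

end WordEval

/-! ### Evaluation of pairs of words on the algebra of the diagonal. -/

section PairEval

open DiagAlgebra

variable {R : Type v} [CommRing R] {Q : CubicalSet.{u}}

/-- The evaluation of pairs of words in cochains on a face of `σ`. -/
def pairEval (σ : Q.Cell) (T X : Finset ℕ) (as bs : List (BarLetter R Q)) : DiagAlgebra R →ₗ[R] R :=
  extend fun g => if g.1 = X then wordValue σ as T g.2.1 * wordValue σ bs T g.2.2 else 0

theorem pairEval_basis (σ : Q.Cell) (T X : Finset ℕ) (as bs : List (BarLetter R Q)) (g : DiagIndex) :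
    pairEval σ T X as bs (basis R g) =
      if g.1 = X then wordValue σ as T g.2.1 * wordValue σ bs T g.2.2 else 0 := extend_basis _ _

/-- A basis element that consists of a set of coordinates below `n` and two partitions of it. -/
def IsPartPair (n : ℕ) (g : DiagIndex) : Prop :=
  g.1 ⊆ Finset.range n ∧ IsPart g.1 g.2.1 ∧ IsPart g.1 g.2.2

/-- Concatenation of the words of blocks cuts the words of cochains, and the exterior product cuts
the set `X`. On the second part the coordinates of the first part are already `1`. -/
theorem pairEval_mul (σ : Q.Cell) {T X : Finset ℕ} (as bs : List (BarLetter R Q))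
    {x y : DiagAlgebra R} (hx : x ∈ spanBasis R (IsPartPair σ.1))
    (hy : y ∈ spanBasis R (IsPartPair σ.1)) :
    pairEval σ T X as bs (x * y) =
      splitSum (fun as₁ as₂ => splitSum (fun bs₁ bs₂ => ∑ A ∈ X.powerset,
        (-1) ^ (A.card * (barDegree as₂ + barDegree bs₂) + crossings (X \ A) A +
          barDegree bs₁ * barDegree as₂) *
        (pairEval σ T A as₁ bs₁ x * pairEval σ (T ∪ A) (X \ A) as₂ bs₂ y)) bs) as := by
  let F (x y : DiagAlgebra R) : R :=
    splitSum (fun as₁ as₂ => splitSum (fun bs₁ bs₂ => ∑ A ∈ X.powerset,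
        (-1) ^ (A.card * (barDegree as₂ + barDegree bs₂) + crossings (X \ A) A +
          barDegree bs₁ * barDegree as₂) *
        (pairEval σ T A as₁ bs₁ x * pairEval σ (T ∪ A) (X \ A) as₂ bs₂ y)) bs) as
  refine Submodule.span_induction (p := fun x _ => pairEval σ T X as bs (x * y) = F x y)
    ?_ ?_ ?_ ?_ hx <;> simp only [F]
  · rintro _ ⟨g, hg, rfl⟩
    refine Submodule.span_induction
      (p := fun y _ => pairEval σ T X as bs (basis R g * y) = F (basis R g) y)
      ?_ ?_ ?_ ?_ hy <;> simp only [F]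
    · rintro _ ⟨h, hh, rfl⟩
      have term : ∀ as₁ as₂ bs₁ bs₂ : List (BarLetter R Q), ∑ A ∈ X.powerset,
          (-1) ^ (A.card * (barDegree as₂ + barDegree bs₂) + crossings (X \ A) A +
            barDegree bs₁ * barDegree as₂) *
          (pairEval σ T A as₁ bs₁ (basis R g) * pairEval σ (T ∪ A) (X \ A) as₂ bs₂ (basis R h)) =
          if Disjoint g.1 h.1 ∧ g.1 ∪ h.1 = X then (-1) ^ mulExp g h *
            ((wordValue σ as₁ T g.2.1 * wordValue σ as₂ (T ∪ g.1) h.2.1) *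
            (wordValue σ bs₁ T g.2.2 * wordValue σ bs₂ (T ∪ g.1) h.2.2)) else 0 := by
        intro as₁ as₂ bs₁ bs₂
        simp only [pairEval_basis]
        by_cases hgX : g.1 ⊆ X
        swap
        · rw [if_neg fun hd : Disjoint g.1 h.1 ∧ g.1 ∪ h.1 = X => hgX (hd.2 ▸ Finset.subset_union_left)]
          refine Finset.sum_eq_zero fun A hA => ?_
          rw [if_neg fun h : g.1 = A => hgX (h ▸ Finset.mem_powerset.1 hA), zero_mul, mul_zero]
        rw [Finset.sum_eq_single_of_mem g.1 (Finset.mem_powerset.2 hgX)]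
        · rw [if_pos rfl]
          by_cases hd : Disjoint g.1 h.1 ∧ g.1 ∪ h.1 = X
          · obtain ⟨hd, rfl⟩ := hd
            have hs : (g.1 ∪ h.1) \ g.1 = h.1 := by
              rw [Finset.union_sdiff_left, Finset.sdiff_eq_self_iff_disjoint]
              exact hd.symm
            rw [if_pos (c := Disjoint g.1 h.1 ∧ g.1 ∪ h.1 = g.1 ∪ h.1) ⟨hd, rfl⟩, hs, if_pos rfl, mulExp]
            -- The three relations replace the parities of words of blocks by the degrees of the
            -- cochains evaluated on them.
            have e1 := wordParity_mul_wordValue as₂ (T ∪ g.1) (u := h.2.1)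
              (fun A hA => (hh.2.1.subset hA).trans hh.1) (g.1.card + wordParity g.2.2)
            have e2 := wordParity_mul_wordValue bs₂ (T ∪ g.1) (u := h.2.2)
              (fun A hA => (hh.2.2.subset hA).trans hh.1) g.1.card
            have e3 := wordParity_mul_wordValue bs₁ T (u := g.2.2)
              (fun A hA => (hg.2.2.subset hA).trans hg.1) (barDegree as₂)
            have f1 : (-1 : R) ^ (g.1.card * (wordParity h.2.1 + wordParity h.2.2) +
                crossings h.1 g.1 + wordParity g.2.2 * wordParity h.2.1) =
                (-1) ^ crossings h.1 g.1 * (-1) ^ ((g.1.card + wordParity g.2.2) * wordParity h.2.1) *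
                (-1) ^ (g.1.card * wordParity h.2.2) := by
              rw [← pow_add, ← pow_add]; congr 1; ring
            have f2 : (-1 : R) ^ (g.1.card * (barDegree as₂ + barDegree bs₂) +
                crossings h.1 g.1 + barDegree bs₁ * barDegree as₂) =
                (-1) ^ crossings h.1 g.1 * (-1) ^ (g.1.card * barDegree as₂) *
                (-1) ^ (barDegree as₂ * barDegree bs₁) *
                (-1) ^ (g.1.card * barDegree bs₂) := by
              rw [← pow_add, ← pow_add, ← pow_add]; congr 1; ring
            have f3 : (-1 : R) ^ ((g.1.card + wordParity g.2.2) * barDegree as₂) =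
                (-1) ^ (g.1.card * barDegree as₂) * (-1) ^ (barDegree as₂ * wordParity g.2.2) := by
              rw [← pow_add]; congr 1; ring
            rw [f3] at e1
            rw [f1, f2]
            generalize wordValue σ as₂ (T ∪ g.1) h.2.1 = w1 at *
            generalize wordValue σ bs₂ (T ∪ g.1) h.2.2 = w2 at *
            generalize wordValue σ bs₁ T g.2.2 = w3 at *
            generalize wordValue σ as₁ T g.2.1 = w4 at *
            calc _ = (-1) ^ crossings h.1 g.1 * w4 * ((-1) ^ (g.1.card * barDegree as₂) * w1) *
                  ((-1) ^ (barDegree as₂ * barDegree bs₁) * w3) *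
                  ((-1) ^ (g.1.card * barDegree bs₂) * w2) := by ring
              _ = (-1) ^ crossings h.1 g.1 * w4 * ((-1) ^ (g.1.card * barDegree as₂) *
                  (-1) ^ (barDegree as₂ * wordParity g.2.2) * w1) * w3 *
                  ((-1) ^ (g.1.card * wordParity h.2.2) * w2) := by rw [← e2, ← e3]; ring
              _ = _ := by rw [← e1]; ring
          · by_cases hs : h.1 = X \ g.1
            · rw [if_neg hd, if_pos hs]
              exact absurd ⟨hs ▸ Finset.disjoint_sdiff, by rw [hs, Finset.union_sdiff_of_subset hgX]⟩ hd
            · rw [if_neg hd, if_neg hs, mul_zero, mul_zero]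
        · intro A _ hA
          rw [if_neg hA.symm, zero_mul, mul_zero]
      simp only [term]
      rw [basis_mul_basis, mulBasis]
      by_cases hd : Disjoint g.1 h.1
      · rw [if_pos hd, map_smul, pairEval_basis]
        by_cases hX : g.1 ∪ h.1 = X
        · simp only [hd, hX, if_true, and_self, wordValue_append, hg.2.1.union, hg.2.2.union,
            splitSum_mul_left, splitSum_mul_right, smul_eq_mul]
        · simp [hd, hX, splitSum_zero]
      · simp [hd, splitSum_zero]
    · simp [splitSum_zero]
    · intro a b _ _ ha hb
      simp only [mul_add, map_add, ha, hb, Finset.sum_add_distrib, splitSum_add]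
    · intro r a _ ha
      rw [mul_smul_comm, map_smul, ha, ← splitSum_smul]
      refine splitSum_congr fun _ _ _ => ?_
      rw [← splitSum_smul]
      refine splitSum_congr fun _ _ _ => ?_
      rw [Finset.smul_sum]
      refine Finset.sum_congr rfl fun _ _ => ?_
      rw [map_smul, smul_eq_mul, smul_eq_mul]; ring
  · simp [splitSum_zero]
  · intro a b _ _ ha hb
    simp only [add_mul, map_add, ha, hb, mul_add, Finset.sum_add_distrib, splitSum_add]
  · intro r a _ ha
    rw [smul_mul_assoc, map_smul, ha, ← splitSum_smul]
    refine splitSum_congr fun _ _ _ => ?_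
    rw [← splitSum_smul]
    refine splitSum_congr fun _ _ _ => ?_
    rw [Finset.smul_sum]
    refine Finset.sum_congr rfl fun _ _ => ?_
    rw [map_smul, smul_eq_mul, smul_eq_mul]; ring

/-- `splitWord_wordValue` applies to each factor; the sign with which the derivation passes the
first word of blocks becomes the degree of `as`. -/
theorem pairEval_diff [OneReduced Q] (σ : Q.Cell) {T X : Finset ℕ} (hT : Disjoint T X)
    (as bs : List (BarLetter R Q)) {x : DiagAlgebra R} (hx : x ∈ spanBasis R (IsPartPair σ.1)) :
    pairEval σ T X as bs ((diff R).der x) =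
      listDiff (fun l => pairEval σ T X l bs x) as +
        (-1) ^ barDegree as * listDiff (fun l => pairEval σ T X as l x) bs := by
  have e1 := map_listDiff (LinearMap.applyₗ (R := R) x) (fun l => pairEval σ T X l bs) as
  have e2 := map_listDiff (LinearMap.applyₗ (R := R) x) (fun l => pairEval σ T X as l) bs
  simp only [LinearMap.applyₗ_apply_apply] at e1 e2
  rw [← e1, ← e2]
  refine spanBasis_induction hx (LinearMap.eqLocus (pairEval σ T X as bs ∘ₗ (diff R).der)
    (listDiff (fun l => pairEval σ T X l bs) as +
      (-1 : R) ^ barDegree as • listDiff (fun l => pairEval σ T X as l) bs)) fun g hg => ?_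
  have e1 := map_listDiff (LinearMap.applyₗ (R := R) (basis R g)) (fun l => pairEval σ T X l bs) as
  have e2 := map_listDiff (LinearMap.applyₗ (R := R) (basis R g)) (fun l => pairEval σ T X as l) bs
  simp only [LinearMap.applyₗ_apply_apply, pairEval_basis] at e1 e2
  simp only [LinearMap.mem_eqLocus, LinearMap.comp_apply, LinearMap.smul_apply,
    LinearMap.add_apply, e1, e2]
  obtain ⟨Y, u, v⟩ := g
  obtain ⟨h1, h2, h3⟩ := hg
  simp only at h1 h2 h3 ⊢
  rw [der_diff_basis, map_add, map_smul, map_splitWord, map_splitWord]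
  simp only [pairEval_basis]
  split_ifs with h
  · subst h
    have f1 : splitWord (R := R) (fun w => wordValue σ as T w * wordValue σ bs T v) u =
        splitWord (R := R) (fun w => wordValue σ as T w) u * wordValue σ bs T v :=
      (map_splitWord (LinearMap.mulRight R (wordValue σ bs T v)) (fun w => wordValue σ as T w) u).symm
    have f2 : listDiff (fun l => wordValue σ l T u * wordValue σ bs T v) as =
        listDiff (fun l => wordValue σ l T u) as * wordValue σ bs T v :=
      (map_listDiff (LinearMap.mulRight R (wordValue σ bs T v)) (fun l => wordValue σ l T u) as).symm
    have f3 : listDiff (fun l => wordValue σ as T u * wordValue σ l T v) bs =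
        wordValue σ as T u * listDiff (fun l => wordValue σ l T v) bs :=
      (map_listDiff (LinearMap.mulLeft R (wordValue σ as T u)) (fun l => wordValue σ l T v) bs).symm
    have e4 := wordParity_mul_wordValue as T (u := u) (fun A hA => (h2.subset hA).trans h1) 1
    simp only [one_mul] at e4
    rw [f1, f2, f3, splitWord_mul, splitWord_wordValue σ as h2 h1 hT,
      splitWord_wordValue σ bs h3 h1 hT]
    simp only [smul_eq_mul]
    linear_combination listDiff (fun l => wordValue σ l T v) bs * e4
  · have z : ∀ w, splitWord (R := R) (fun _ => (0 : R)) w = 0 := fun w => by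
      simpa using splitWord_mul (R := R) 0 (fun _ => 0) w
    simp [listDiff_zero, z]

end PairEval

/-! ### Relabelling -/

section Relabel

variable {e : ℕ → ℕ}

theorem runs_map {r : ℕ → ℕ → Bool} (he : ∀ a b, r (e a) (e b) = r a b) (x : List ℕ) :
    runs r (x.map e) = (runs r x).map (Finset.image e) := by
  induction x with
  | nil => simp [runs]
  | cons a l ih =>
    obtain _ | ⟨b, l⟩ := l
    · simp [runs]
    · obtain ⟨B, Bs, h1, h2, h3⟩ := runs_cons_cons r a b l
      obtain ⟨C, Cs, k1, k2, k3⟩ := runs_cons_cons r (e a) (e b) (l.map e)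
      rw [List.map_cons, h1, k1, List.map_cons, List.cons.injEq] at ih
      rw [List.map_cons, List.map_cons, k3, h3, ih.1, ih.2, he]
      split_ifs <;> simp

theorem sum_shiftSets_image (he : StrictMono e) {M : Type*} [AddCommMonoid M] (A B : Finset ℕ)
    (f : Finset ℕ → M) :
    ∑ S ∈ shiftSets (A.image e) (B.image e), f S = ∑ S ∈ shiftSets A B, f (S.image e) := by
  unfold shiftSets
  rw [Finset.powerset_image, Finset.sum_filter, Finset.sum_image, Finset.sum_filter]
  · refine Finset.sum_congr rfl fun S _ => ?_
    simp only [ne_eq, (Finset.image_injective he.injective).eq_iff, Finset.forall_mem_image,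
      he.lt_iff_lt]
  · exact (Finset.image_injective he.injective).injOn

theorem sum_rightShifts_map (he : StrictMono e) {M : Type*} [AddCommMonoid M]
    (l : List (Finset ℕ)) (f : List (Finset ℕ) → M) :
    ∑ u ∈ rightShifts (l.map (Finset.image e)), f u =
      ∑ u ∈ rightShifts l, f (u.map (Finset.image e)) := by
  obtain ⟨k, hk⟩ : ∃ k, l.length = k := ⟨_, rfl⟩
  induction k generalizing l f with
  | zero =>
    obtain rfl := List.length_eq_zero_iff.1 hk
    simp
  | succ k ih =>
    obtain _ | ⟨A, _ | ⟨B, l⟩⟩ := l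
    · simp at hk
    · simp
    · rw [List.map_cons, List.map_cons, sum_rightShifts_cons_cons, sum_rightShifts_cons_cons,
        sum_shiftSets_image he]
      refine Finset.sum_congr rfl fun S hS => ?_
      have := ih ((B ∪ S) :: l) (fun w => f ((A.image e \ S.image e) :: w)) (by simpa using hk)
      rw [List.map_cons, Finset.image_union] at this
      rw [this]
      refine Finset.sum_congr rfl fun w _ => ?_
      rw [List.map_cons, Finset.image_sdiff _ _ he.injective]

theorem sum_leftShifts_map (he : StrictMono e) {M : Type*} [AddCommMonoid M]
    (l : List (Finset ℕ)) (f : List (Finset ℕ) → M) :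
    ∑ u ∈ leftShifts (l.map (Finset.image e)), f u =
      ∑ u ∈ leftShifts l, f (u.map (Finset.image e)) := by
  rw [sum_leftShifts, sum_leftShifts, ← List.map_reverse, sum_rightShifts_map he]
  refine Finset.sum_congr rfl fun u _ => ?_
  rw [List.map_reverse]

theorem sgnOneExp_map (he : StrictMono e) (l : List (Finset ℕ)) :
    sgnOneExp (l.map (Finset.image e)) = sgnOneExp l := by
  induction l with
  | nil => rfl
  | cons A l ih =>
    rw [List.map_cons, sgnOneExp_cons, sgnOneExp_cons, ih, List.length_map, List.map_map,
      Finset.card_image_of_injective _ he.injective]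
    have : crossings (A.image e) ∘ Finset.image e = crossings A :=
      funext fun B => crossings_image he A B
    rw [this]

theorem rsgnExp_map (he : StrictMono e) (l : List (Finset ℕ)) :
    rsgnExp (l.map (Finset.image e)) = rsgnExp l := by
  rw [rsgnExp, rsgnExp, List.map_map]
  congr 2
  funext A
  simp [Finset.card_image_of_injective _ he.injective]

theorem decreasingRuns_map (he : StrictMono e) (x : List ℕ) :
    decreasingRuns (x.map e) = (decreasingRuns x).map (Finset.image e) :=
  runs_map (fun a b => by simp [he.lt_iff_lt]) x

theorem increasingRuns_map (he : StrictMono e) (x : List ℕ) :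
    increasingRuns (x.map e) = (increasingRuns x).map (Finset.image e) :=
  runs_map (fun a b => by simp [he.lt_iff_lt]) x

theorem pairSgnExp_map (he : StrictMono e) (x : List ℕ) (u v : List (Finset ℕ)) :
    pairSgnExp (x.map e) (u.map (Finset.image e)) (v.map (Finset.image e)) = pairSgnExp x u v := by
  simp only [pairSgnExp, decreasingRuns_map he, sgnTwoExp_eq, sgnOneExp_map he, rsgnExp_map he,
    List.length_map]

theorem vertex_nodup {m : ℕ} (p : Equiv.Perm (Fin m)) : (vertex p).Nodup :=
  List.nodup_ofFn.2 (Fin.val_injective.comp p.injective)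

theorem vertex_toFinset {m : ℕ} (p : Equiv.Perm (Fin m)) : (vertex p).toFinset = Finset.range m := by
  ext a
  simp only [vertex, List.mem_toFinset, List.mem_ofFn, Finset.mem_range]
  constructor
  · rintro ⟨i, rfl⟩; exact (p i).2
  · intro ha; exact ⟨p.symm ⟨a, ha⟩, by simp⟩

theorem exists_vertex {m : ℕ} {x : List ℕ} (h : x.Nodup) (hx : x.toFinset = Finset.range m) :
    ∃ p : Equiv.Perm (Fin m), vertex p = x := by
  have hl : x.length = m := by
    rw [← List.toFinset_card_of_nodup h, hx, Finset.card_range]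
  subst hl
  have hlt : ∀ i : Fin x.length, x.get i < x.length := fun i => by
    have : x.get i ∈ x.toFinset := by simp
    rw [hx] at this
    exact Finset.mem_range.1 this
  have hinj : Function.Injective fun i : Fin x.length => (⟨x.get i, hlt i⟩ : Fin x.length) := by
    intro i j hij
    exact h.injective_get (congrArg Fin.val hij)
  refine ⟨Equiv.ofBijective _ (Finite.injective_iff_bijective.1 hinj), ?_⟩
  exact List.ofFn_get x

theorem vertex_injective {m : ℕ} : Function.Injective (vertex (n := m)) := by
  intro p q h
  ext i
  exact congrFun (List.ofFn_injective h) i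

/-- The embedding `e` identifies the coordinates of a face with the set `X` of its free directions,
so permutations of these coordinates become injective words with support `X`. -/
theorem sum_perm_eq {M : Type*} [AddCommMonoid M] {m n : ℕ} (he : StrictMono e) {X : Finset ℕ}
    (hX : X ⊆ Finset.range n) (hI : (Finset.range m).image e = X) (f : List ℕ → M) :
    ∑ p : Equiv.Perm (Fin m), f ((vertex p).map e) =
      ∑ x ∈ (arrangements n).filter fun x => x.toFinset = X, f x := by
  refine Finset.sum_bij (fun p _ => (vertex p).map e) ?_ ?_ ?_ (fun _ _ => rfl)
  · intro p _
    have h : ((vertex p).map e).toFinset = X := by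
      rw [← hI, ← vertex_toFinset p]
      ext a; simp
    rw [Finset.mem_filter, mem_arrangements]
    refine ⟨⟨(vertex_nodup p).map he.injective, fun a ha => ?_⟩, h⟩
    rw [← List.mem_toFinset, h] at ha
    exact Finset.mem_range.1 (hX ha)
  · intro p _ q _ h
    exact vertex_injective (he.injective.list_map h)
  · intro x hx
    rw [Finset.mem_filter, mem_arrangements] at hx
    obtain ⟨⟨h1, h2⟩, h3⟩ := hx
    obtain ⟨y, rfl⟩ : ∃ y : List ℕ, y.map e = x := by
      have : ∀ a ∈ x, a ∈ Set.range e := by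
        intro a ha
        rw [← List.mem_toFinset, h3, ← hI, Finset.mem_image] at ha
        obtain ⟨b, -, hb⟩ := ha
        exact ⟨b, hb⟩
      rw [← Set.mem_range (f := List.map e), Set.range_list_map]
      exact this
    have hy : y.toFinset = Finset.range m := by
      apply Finset.image_injective he.injective
      rw [hI, ← h3]
      ext a; simp
    obtain ⟨p, rfl⟩ := exists_vertex (List.Nodup.of_map e h1) hy
    exact ⟨p, Finset.mem_univ _, rfl⟩

end Relabel

/-! ### The Hirsch operations on the faces of a fixed cube. -/

section HirschValue

open DiagAlgebra

variable {R : Type v} [CommRing R] {Q : CubicalSet.{u}}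

/-- Translates from the intrinsic numbering of the coordinates of a face to those of the ambient
cube. `T'` collects the blocks already treated, which with the remaining ones exhaust the
coordinates of the face. -/
theorem blockFaces_faceOf (σ : Q.Cell) {T X : Finset ℕ} (hX : X ⊆ Finset.range σ.1)
    (hT : Disjoint T X) {u : List (Finset ℕ)} {Y T' : Finset ℕ} (hu : IsPart Y u)
    (hT' : Disjoint T' Y) (hY : T' ∪ Y = Finset.range X.card) :
    blockFaces (faceOf σ T X) T' u =
      wordFaces σ (T ∪ T'.image (coord σ.1 X)) (u.map (Finset.image (coord σ.1 X))) := by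
  have he := coord_strictMono σ.1 X
  induction u generalizing T' Y with
  | nil => rfl
  | cons A u ih =>
    obtain ⟨k1, k2, k3, k4⟩ := isPart_cons.1 hu
    rw [← k4, Finset.disjoint_union_right] at hT'
    have ih := ih k3 (T' := T' ∪ A) (Finset.disjoint_union_left.2 ⟨hT'.2, k2⟩)
      (by rw [Finset.union_assoc, k4, hY])
    rw [Finset.image_union, ← Finset.union_assoc] at ih
    rw [blockFaces, ih, List.map_cons, wordFaces, Finset.card_image_of_injective _ he.injective]
    split_ifs
    · rfl
    · rw [← unions, iterFace_faceOf σ hX hT hT'.2.symm]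
      · congr 2
        have hXe : (T' ∪ (A ∪ unions u)).image (coord σ.1 X) = X := by
          rw [k4, hY, image_coord hX]
        generalize coord σ.1 X = e at he hXe
        rw [← hXe, ← Finset.image_sdiff _ _ he.injective]
        congr 1
        ext a
        have d1 : a ∈ T' → a ∉ A := fun h => Finset.disjoint_left.1 hT'.1 h
        have d3 : a ∈ A → a ∉ unions u := fun h => Finset.disjoint_left.1 k2 h
        simp only [Finset.mem_sdiff, Finset.mem_union]
        tauto
      · rw [← hY, ← k4]
        exact Finset.subset_union_right.trans Finset.subset_union_right
      · rw [← hY]; exact Finset.subset_union_left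

/-- The Hirsch operations in terms of the diagonal. -/
theorem hirschValue_faceOf (σ : Q.Cell) {T X : Finset ℕ} (hX : X ⊆ Finset.range σ.1)
    (hT : Disjoint T X) (hne : X.Nonempty) (as bs : List (BarLetter R Q)) :
    hirschValue as bs (faceOf σ T X) = pairEval σ T X as bs (diagonal R σ.1) := by
  have he := coord_strictMono σ.1 X
  have hI := image_coord hX
  have hdim := faceOf_dim σ T hX
  have e1 : pairEval σ T X as bs (diagonal R σ.1) =
      ∑ x ∈ (arrangements σ.1).filter fun x => x.toFinset = X,
        ∑ u ∈ rightShifts (decreasingRuns x), ∑ v ∈ leftShifts (increasingRuns x),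
        (-1) ^ pairSgnExp x u v * (wordValue σ as T u * wordValue σ bs T v) := by
    rw [diagonal, map_sum, Finset.sum_filter]
    refine Finset.sum_congr rfl fun x _ => ?_
    by_cases hx : x = []
    · rw [if_pos hx, map_zero, if_neg]
      rintro rfl
      simp [hx] at hne
    · rw [if_neg hx, diagTerm]
      simp only [map_sum, map_smul, pairEval_basis, smul_eq_mul]
      split_ifs with h
      · rfl
      · simp
  rw [hirschValue, e1, ← sum_perm_eq he (m := (faceOf σ T X).1) hX (by rw [hdim, hI])]
  refine Finset.sum_congr rfl fun p _ => ?_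
  have hp : (vertex p).toFinset = Finset.range X.card := (vertex_toFinset p).trans (by rw [hdim])
  rw [decreasingRuns_map he, increasingRuns_map he, sum_rightShifts_map he]
  refine Finset.sum_congr rfl fun u hu => ?_
  rw [sum_leftShifts_map he]
  refine Finset.sum_congr rfl fun v hv => ?_
  have pu := dR_isPart (vertex_nodup p) hu
  have pv := iR_isPart (vertex_nodup p) hv
  rw [pairSgnExp_map he, wordValue, wordValue,
    blockFaces_faceOf σ hX hT pu (Finset.disjoint_empty_left _) (by simp [hp]),
    blockFaces_faceOf σ hX hT pv (Finset.disjoint_empty_left _) (by simp [hp])]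
  simp

end HirschValue

/-! ### Indecomposability of the complementary pairs -/

section GoodPair

open DiagAlgebra

variable {R : Type v} [CommRing R]

/-- `S` is a union of blocks of `u`. -/
def Saturated (S : Finset ℕ) (u : List (Finset ℕ)) : Prop := ∀ A ∈ u, A ⊆ S ∨ Disjoint A S

/-- The bipartite graph of the blocks of `u` and `v`, with edges the elements of `X`, is a tree. -/
structure IsTree (X Y Z : Finset ℕ) (u v : List (Finset ℕ)) : Prop where
  fst : IsPart Y u
  snd : IsPart Z v
  length : u.length + v.length = X.card + 1
  connected : ∀ S ⊆ Y ∪ Z, Saturated S u → Saturated S v → S = ∅ ∨ S = Y ∪ Z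

theorem insAt_getElem {n j : ℕ} {w : List (Finset ℕ)} (hj : j < w.length) :
    insert n w[j] ∈ insAt n j w := by
  rw [List.mem_iff_getElem]
  exact ⟨j, by rwa [length_insAt], by simp [insAt]⟩

theorem mem_insAt_or_insert {n j : ℕ} {w : List (Finset ℕ)} {A : Finset ℕ} (h : A ∈ w) :
    A ∈ insAt n j w ∨ insert n A ∈ insAt n j w := by
  induction w generalizing j with
  | nil => simp at h
  | cons B w ih =>
    cases j with
    | zero =>
      rw [insAt_zero]
      rcases List.mem_cons.1 h with rfl | h
      · exact Or.inr (by simp)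
      · exact Or.inl (by simp [h])
    | succ j =>
      rw [insAt_succ]
      rcases List.mem_cons.1 h with rfl | h
      · exact Or.inl (by simp)
      · rcases ih (j := j) h with h | h
        · exact Or.inl (by simp [h])
        · exact Or.inr (by simp [h])

theorem IsPart.insAt {n j : ℕ} {X : Finset ℕ} {w : List (Finset ℕ)} (h : IsPart X w) (hn : n ∉ X)
    (hj : j < w.length) : IsPart (insert n X) (insAt n j w) := by
  induction w generalizing j X with
  | nil => simp at hj
  | cons B w ih =>
    obtain ⟨k1, k2, k3, k4⟩ := isPart_cons.1 h
    rw [← k4, Finset.mem_union, not_or] at hn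
    cases j with
    | zero =>
      rw [insAt_zero, isPart_cons]
      exact ⟨by simp, Finset.disjoint_insert_left.2 ⟨hn.2, k2⟩, k3, by rw [Finset.insert_union, k4]⟩
    | succ j =>
      have ih := ih k3 hn.2 (j := j) (by simpa using hj)
      rw [insAt_succ, isPart_cons, ih.union]
      refine ⟨k1, Finset.disjoint_insert_right.2 ⟨hn.1, k2⟩, ih, ?_⟩
      rw [Finset.union_insert, k4]

theorem IsPart.append {X Y : Finset ℕ} {u v : List (Finset ℕ)} (hu : IsPart X u) (hv : IsPart Y v)
    (h : Disjoint X Y) : IsPart (X ∪ Y) (u ++ v) := by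
  refine ⟨fun A hA => ?_, ?_, by rw [unions_append, hu.union, hv.union]⟩
  · exact (List.mem_append.1 hA).elim (hu.nonempty A) (hv.nonempty A)
  · rw [List.pairwise_append]
    exact ⟨hu.disj, hv.disj, fun A hA B hB => Disjoint.mono (hu.subset hA) (hv.subset hB) h⟩

theorem IsTree.symm {X Y Z : Finset ℕ} {u v : List (Finset ℕ)} (h : IsTree X Y Z u v) :
    IsTree X Z Y v u :=
  ⟨h.snd, h.fst, by rw [add_comm, h.length], fun S hS h1 h2 => by
    rw [Finset.union_comm] at hS ⊢
    exact h.connected S hS h2 h1⟩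

/-- The new element joins a block of `v` only, as a loose end at which another tree can be attached.
A saturated set without `n` is saturated for the old tree. -/
theorem IsTree.insAt {n j : ℕ} {X : Finset ℕ} {u v : List (Finset ℕ)} (h : IsTree X X X u v)
    (hn : n ∉ X) (hj : j < v.length) : IsTree X X (insert n X) u (insAt n j v) := by
  refine ⟨h.fst, h.snd.insAt hn hj, by rw [length_insAt, h.length], fun S hS h1 h2 => ?_⟩
  have hX : X ∪ insert n X = insert n X := Finset.union_eq_right.2 (Finset.subset_insert _ _)
  rw [hX] at hS ⊢
  have sub : ∀ {w : List (Finset ℕ)} {A : Finset ℕ}, IsPart X w → A ∈ w → n ∉ A :=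
    fun hw hA h => hn (hw.subset hA h)
  have e1 : Saturated (S.erase n) u := by
    intro A hA
    rcases h1 A hA with h' | h'
    · exact Or.inl fun a ha => Finset.mem_erase.2 ⟨fun e => sub h.fst hA (e ▸ ha), h' ha⟩
    · exact Or.inr (h'.mono_right (Finset.erase_subset _ _))
  have e2 : Saturated (S.erase n) v := by
    intro A hA
    have hnA := sub h.snd hA
    rcases mem_insAt_or_insert (n := n) (j := j) hA with hA' | hA'
    · rcases h2 A hA' with h' | h'
      · exact Or.inl fun a ha => Finset.mem_erase.2 ⟨fun e => hnA (e ▸ ha), h' ha⟩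
      · exact Or.inr (h'.mono_right (Finset.erase_subset _ _))
    · rcases h2 _ hA' with h' | h'
      · exact Or.inl fun a ha => Finset.mem_erase.2 ⟨fun e => hnA (e ▸ ha),
          h' (Finset.mem_insert_of_mem ha)⟩
      · exact Or.inr ((h'.mono_left (Finset.subset_insert _ _)).mono_right (Finset.erase_subset _ _))
  have e3 : S.erase n ⊆ X := fun a ha => by
    rw [Finset.mem_erase] at ha
    exact (Finset.mem_insert.1 (hS ha.2)).resolve_left ha.1
  have hB : v[j] ∈ v := List.getElem_mem hj
  obtain ⟨b, hb⟩ := h.snd.nonempty _ hB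
  have hbX := h.snd.subset hB hb
  have hbn : b ≠ n := fun e => hn (e ▸ hbX)
  -- The block that receives `n` also has an old element `b`, so `n` and `b` belong to `S` together
  -- or not at all.
  have h3 := h2 _ (insAt_getElem (n := n) hj)
  rcases h.connected (S.erase n) (by simpa using e3) e1 e2 with h4 | h4
  · left
    have hnS : n ∉ S := by
      intro hnS
      rcases h3 with h3 | h3
      · have : b ∈ S.erase n := Finset.mem_erase.2 ⟨hbn, h3 (Finset.mem_insert_of_mem hb)⟩
        simp [h4] at this
      · exact Finset.disjoint_left.1 h3 (Finset.mem_insert_self _ _) hnS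
    rwa [Finset.erase_eq_of_notMem hnS] at h4
  · right
    rw [Finset.union_self] at h4
    have hbS : b ∈ S := Finset.mem_of_mem_erase (h4 ▸ hbX)
    have hnS : n ∈ S := by
      rcases h3 with h3 | h3
      · exact h3 (Finset.mem_insert_self _ _)
      · exact absurd hbS (Finset.disjoint_left.1 h3 (Finset.mem_insert_of_mem hb))
    rw [← h4, Finset.insert_erase hnS]

/-- Two trees with a loose end at `n` on opposite sides are joined along the edge `n`. A saturated
set contains all or nothing of each of them, and whether it contains `n` decides this for both. -/
theorem IsTree.append {n : ℕ} {X Y : Finset ℕ} {u v u' v' : List (Finset ℕ)}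
    (h : IsTree X X (insert n X) u v) (h' : IsTree Y (insert n Y) Y u' v')
    (hX : n ∉ X) (hY : n ∉ Y) (hd : Disjoint X Y) :
    IsTree (insert n (X ∪ Y)) (insert n (X ∪ Y)) (insert n (X ∪ Y)) (u ++ u') (v ++ v') := by
  have u1 : X ∪ insert n X = insert n X := Finset.union_eq_right.2 (Finset.subset_insert _ _)
  have u2 : insert n Y ∪ Y = insert n Y := Finset.union_eq_left.2 (Finset.subset_insert _ _)
  have p1 := h.fst.append h'.fst (Finset.disjoint_insert_right.2 ⟨hX, hd⟩)
  have p2 := h.snd.append h'.snd (Finset.disjoint_insert_left.2 ⟨hY, hd⟩)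
  rw [Finset.union_insert] at p1
  rw [Finset.insert_union] at p2
  refine ⟨p1, p2, ?_, fun S hS h1 h2 => ?_⟩
  · rw [List.length_append, List.length_append, Finset.card_insert_of_notMem (by simp [hX, hY]),
      Finset.card_union_of_disjoint hd]
    have := h.length
    have := h'.length
    omega
  · rw [Finset.union_self] at hS ⊢
    have sat : ∀ {w : List (Finset ℕ)} {U : Finset ℕ}, Saturated S w → (∀ A ∈ w, A ⊆ U) →
        Saturated (S ∩ U) w := by
      intro w U hw hU A hA
      rcases hw A hA with h3 | h3
      · exact Or.inl (Finset.subset_inter h3 (hU A hA))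
      · exact Or.inr (h3.mono_right Finset.inter_subset_left)
    have left : ∀ {w w' : List (Finset ℕ)}, Saturated S (w ++ w') → Saturated S w :=
      fun hw A hA => hw A (by simp [hA])
    have right : ∀ {w w' : List (Finset ℕ)}, Saturated S (w ++ w') → Saturated S w' :=
      fun hw A hA => hw A (by simp [hA])
    have c1 := h.connected (S ∩ insert n X) (by rw [u1]; exact Finset.inter_subset_right)
      (sat (left h1) fun A hA => (h.fst.subset hA).trans (Finset.subset_insert _ _))
      (sat (left h2) fun A hA => h.snd.subset hA)
    have c2 := h'.connected (S ∩ insert n Y) (by rw [u2]; exact Finset.inter_subset_right)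
      (sat (right h1) fun A hA => h'.fst.subset hA)
      (sat (right h2) fun A hA => (h'.snd.subset hA).trans (Finset.subset_insert _ _))
    rw [u1] at c1
    rw [u2] at c2
    by_cases hnS : n ∈ S
    · right
      have d1 : S ∩ insert n X = insert n X := c1.resolve_left fun e => by
        have : n ∈ S ∩ insert n X := by simp [hnS]
        simp [e] at this
      have d2 : S ∩ insert n Y = insert n Y := c2.resolve_left fun e => by
        have : n ∈ S ∩ insert n Y := by simp [hnS]
        simp [e] at this
      apply Finset.Subset.antisymm hS
      rw [Finset.insert_union_distrib]
      exact Finset.union_subset (Finset.inter_eq_right.1 d1) (Finset.inter_eq_right.1 d2)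
    · left
      have d1 : S ∩ insert n X = ∅ := c1.resolve_right fun e => by
        have : n ∈ S ∩ insert n X := by simp [e]
        exact hnS (Finset.mem_inter.1 this).1
      have d2 : S ∩ insert n Y = ∅ := c2.resolve_right fun e => by
        have : n ∈ S ∩ insert n Y := by simp [e]
        exact hnS (Finset.mem_inter.1 this).1
      rw [← Finset.inter_eq_left.2 hS, Finset.insert_union_distrib, Finset.inter_union_distrib_left,
        d1, d2, Finset.union_empty]

/-- The index of a term of the diagonal. -/
def IsTreePair (n : ℕ) (g : DiagIndex) : Prop :=
  g.1 ⊆ Finset.range n ∧ g.1.Nonempty ∧ IsTree g.1 g.1 g.1 g.2.1 g.2.2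

theorem IsTreePair.isPartPair {n : ℕ} {g : DiagIndex} (h : IsTreePair n g) : IsPartPair n g :=
  ⟨h.1, h.2.2.fst, h.2.2.snd⟩

/-- The recursion of the diagonal preserves trees: the insertion derivations attach a loose end at
`n` on one side, and the product joins two such trees there. -/
theorem diagonal_mem_isTreePair (n : ℕ) : diagonal R n ∈ spanBasis R (IsTreePair n) := by
  induction n with
  | zero => simp [diagonal, arrangements]
  | succ n ih =>
    rw [diagonal_succ, diagStep]
    have below : ∀ {X : Finset ℕ}, X ⊆ Finset.range n → n ∉ X := fun hX h => by simpa using hX h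
    refine Submodule.add_mem _ (Submodule.span_mono ?_ ih) ?_
    · rintro _ ⟨g, hg, rfl⟩
      exact ⟨g, ⟨hg.1.trans (by simp), hg.2⟩, rfl⟩
    have hP : snd R [{n}] + (insSnd R n).der (diagonal R n) ∈ spanBasis R fun g =>
        g.1 ⊆ Finset.range n ∧ IsTree g.1 g.1 (insert n g.1) g.2.1 g.2.2 := by
      refine Submodule.add_mem _ (Submodule.subset_span ⟨(∅, [], [{n}]), ⟨by simp, isPart_nil,
        ⟨by simp, by simp, by simp⟩, by simp, fun S hS _ _ => ?_⟩, rfl⟩) ?_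
      · simpa [Finset.subset_singleton_iff] using hS
      · refine spanBasis_induction ih ((spanBasis R _).comap (insSnd R n).der) fun g hg => ?_
        rw [Submodule.mem_comap, LetterMap.der_basis, derivation_insLetter (w := snd R)
          (D := (insSnd R n).derSnd) snd_append rfl (fun _ _ => rfl) g.2.2 fun A hA a ha =>
            Finset.mem_range.1 (hg.1 (hg.2.2.snd.subset hA ha)),
          (show (insSnd R n).derFst g.2.1 = 0 from ?_), zero_mul, zero_add, Finset.mul_sum,
          Finset.smul_sum, Finset.sum_mul]
        · refine Submodule.sum_mem _ fun j hj => ?_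
          rw [mul_smul_comm, smul_smul, smul_mul_assoc]
          refine Submodule.smul_mem _ _ (Submodule.subset_span ⟨(g.1, g.2.1, insAt n j g.2.2),
            ⟨hg.1, hg.2.2.insAt (below hg.1) (Finset.mem_range.1 hj)⟩, ?_⟩)
          rw [basis_eq]
        · generalize g.2.1 = u
          induction u with
          | nil => rfl
          | cons A u ih => rw [LetterMap.derFst, ih]; simp [insSnd]
    have hQ : fst R [{n}] + (insFst R n).der (diagonal R n) ∈ spanBasis R fun g =>
        g.1 ⊆ Finset.range n ∧ IsTree g.1 (insert n g.1) g.1 g.2.1 g.2.2 := by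
      refine Submodule.add_mem _ (Submodule.subset_span ⟨(∅, [{n}], []), ⟨by simp,
        ⟨by simp, by simp, by simp⟩, isPart_nil, by simp, fun S hS _ _ => ?_⟩, rfl⟩) ?_
      · simpa [Finset.subset_singleton_iff] using hS
      · refine spanBasis_induction ih ((spanBasis R _).comap (insFst R n).der) fun g hg => ?_
        rw [Submodule.mem_comap, LetterMap.der_basis, derivation_insLetter (w := fst R)
          (D := (insFst R n).derFst) fst_append rfl (fun _ _ => rfl) g.2.1 fun A hA a ha =>
            Finset.mem_range.1 (hg.1 (hg.2.2.fst.subset hA ha)),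
          (show (insFst R n).derSnd g.2.2 = 0 from ?_), mul_zero, smul_zero, add_zero,
          Finset.sum_mul, Finset.sum_mul]
        · refine Submodule.sum_mem _ fun j hj => ?_
          rw [smul_mul_assoc, smul_mul_assoc]
          refine Submodule.smul_mem _ _ (Submodule.subset_span ⟨(g.1, insAt n j g.2.1, g.2.2),
            ⟨hg.1, (hg.2.2.symm.insAt (below hg.1) (Finset.mem_range.1 hj)).symm⟩, ?_⟩)
          rw [basis_eq]
        · generalize g.2.2 = u
          induction u with
          | nil => rfl
          | cons A u ih => rw [LetterMap.derSnd, ih]; simp [insFst]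
    generalize snd R [{n}] + (insSnd R n).der (diagonal R n) = P at hP
    generalize fst R [{n}] + (insFst R n).der (diagonal R n) = T at hQ
    refine spanBasis_induction hP ((spanBasis R _).comap (insExt R n ∘ₗ LinearMap.mulRight R T))
      fun g hg => ?_
    rw [Submodule.mem_comap, LinearMap.comp_apply, LinearMap.mulRight_apply]
    refine spanBasis_induction hQ ((spanBasis R _).comap
      (insExt R n ∘ₗ LinearMap.mulLeft R (basis R g))) fun h hh => ?_
    rw [Submodule.mem_comap, LinearMap.comp_apply, LinearMap.mulLeft_apply, basis_mul_basis, mulBasis]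
    split_ifs with hd
    · have hs := Finset.union_subset hg.1 hh.1
      rw [map_smul, insExt_basis, if_pos hs, smul_smul]
      refine Submodule.smul_mem _ _ (Submodule.subset_span ⟨_, ⟨?_, by simp,
        hg.2.append hh.2 (below hg.1) (below hh.1) hd⟩, rfl⟩)
      rw [Finset.range_add_one]
      exact Finset.insert_subset_insert _ hs
    · rw [map_zero]; exact Submodule.zero_mem _

end GoodPair

/-! ### The Maurer-Cartan equation for the Hirsch operations -/

section HirschEval

open DiagAlgebra

variable {R : Type v} [CommRing R] {Q : CubicalSet.{u}}

theorem wordValue_of_forall_card_one (σ : Q.Cell) (as : List (BarLetter R Q)) (T : Finset ℕ)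
    {u : List (Finset ℕ)} (hu : ∀ A ∈ u, A.card = 1) :
    wordValue σ as T u = if as = [] then 1 else 0 := by
  induction u generalizing T with
  | nil => exact wordValue_nil_right σ as T
  | cons A u ih =>
    rw [wordValue_of_card_one _ _ _ (hu A (by simp)), ih _ fun B hB => hu B (by simp [hB])]

theorem length_le_of_wordValue_ne_zero {σ : Q.Cell} {as : List (BarLetter R Q)} {T : Finset ℕ}
    {u : List (Finset ℕ)} (h : wordValue σ as T u ≠ 0) : as.length ≤ u.length := by
  induction u generalizing as T with
  | nil =>
    rw [wordValue_nil_right] at h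
    have : as = [] := by by_contra h'; exact h (if_neg h')
    simp [this]
  | cons A u ih =>
    by_cases hA : A.card = 1
    · rw [wordValue_of_card_one _ _ _ hA] at h
      exact (ih h).trans (by simp)
    · obtain _ | ⟨a, l⟩ := as
      · simp
      · rw [wordValue_cons_of_card_ne_one _ _ _ _ hA] at h
        simpa using ih (right_ne_zero_of_mul h)

/-- A letter evaluated on a block that contains a degenerate direction vanishes, so such a direction
can only be in a block that receives no letter. -/
theorem card_eq_one_of_wordValue_ne_zero {σ : Q.Cell} {i : ℕ} (hi : DegenAt i σ)
    {as : List (BarLetter R Q)} {T : Finset ℕ} {u : List (Finset ℕ)}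
    (h : wordValue σ as T u ≠ 0) : ∀ A ∈ u, i ∈ A → A.card = 1 := by
  induction u generalizing as T with
  | nil => simp
  | cons B u ih =>
    by_cases hB : B.card = 1
    · rw [wordValue_of_card_one _ _ _ hB] at h
      intro A hA hiA
      rcases List.mem_cons.1 hA with rfl | hA
      · exact hB
      · exact ih h A hA hiA
    · obtain _ | ⟨a, l⟩ := as
      · exact absurd (wordValue_nil_of_card_ne_one _ _ hB _) h
      · rw [wordValue_cons_of_card_ne_one _ _ _ _ hB] at h
        intro A hA hiA
        rcases List.mem_cons.1 hA with rfl | hA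
        · exact absurd (a.2.eval_of_isDegenerate (hi.faceOf T hiA)) (left_ne_zero_of_mul h)
        · exact ih (right_ne_zero_of_mul h) A hA hiA

theorem saturated_singleton {i : ℕ} {u : List (Finset ℕ)} (h : ∀ A ∈ u, i ∈ A → A.card = 1) :
    Saturated {i} u := by
  intro A hA
  by_cases hi : i ∈ A
  · obtain ⟨j, rfl⟩ := Finset.card_eq_one.1 (h A hA hi)
    rw [Finset.mem_singleton] at hi
    exact Or.inl (by rw [hi])
  · exact Or.inr (Finset.disjoint_singleton_right.2 hi)

/-- To show that `pairEval` vanishes on the diagonal it suffices to look at its terms. -/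
theorem pairEval_diagonal_eq_zero (σ : Q.Cell) (T X : Finset ℕ) (as bs : List (BarLetter R Q))
    (h : ∀ u v, X ⊆ Finset.range σ.1 → X.Nonempty → IsTree X X X u v →
      wordValue σ as T u ≠ 0 → wordValue σ bs T v ≠ 0 → False) :
    pairEval σ T X as bs (diagonal R σ.1) = 0 := by
  refine spanBasis_induction (diagonal_mem_isTreePair σ.1) (LinearMap.ker (pairEval σ T X as bs))
    fun g hg => ?_
  rw [LinearMap.mem_ker, pairEval_basis]
  split_ifs with hX
  · subst hX
    by_contra h0
    exact h _ _ hg.1 hg.2.1 hg.2.2 (left_ne_zero_of_mul h0) (right_ne_zero_of_mul h0)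
  · rfl

/-- A letter of bar degree `k` occupies a block of `k + 1` elements, and the edge count of the tree
determines the total number of blocks. -/
theorem IsTree.cardSum_eq {X : Finset ℕ} {u v : List (Finset ℕ)} (h : IsTree X X X u v) {σ : Q.Cell}
    (hX : X ⊆ Finset.range σ.1) {as bs : List (BarLetter R Q)} {T : Finset ℕ}
    (h1 : wordValue σ as T u ≠ 0) (h2 : wordValue σ bs T v ≠ 0) :
    X.card = barDegree as + u.length ∧ X.card = barDegree bs + v.length ∧
      X.card = barDegree as + barDegree bs + 1 := by
  have e1 := card_of_wordValue_ne_zero (fun A hA => (h.fst.subset hA).trans hX) h1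
  have e2 := card_of_wordValue_ne_zero (fun A hA => (h.snd.subset hA).trans hX) h2
  rw [h.fst.cardSum] at e1
  rw [h.snd.cardSum] at e2
  have := h.length
  omega

theorem IsPart.eq_of_length_one {X : Finset ℕ} {u : List (Finset ℕ)} (h : IsPart X u)
    (hl : u.length = 1) : u = [X] := by
  obtain ⟨A, rfl⟩ := List.length_eq_one_iff.1 hl
  have := h.union
  simp only [unions_cons, unions_nil, Finset.union_empty] at this
  rw [this]

theorem pairEval_diagonal_empty (σ : Q.Cell) (T : Finset ℕ) (as bs : List (BarLetter R Q)) :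
    pairEval σ T ∅ as bs (diagonal R σ.1) = 0 :=
  pairEval_diagonal_eq_zero σ T ∅ as bs fun _ _ _ h => by simp at h

theorem pairEval_diagonal_of_card (σ : Q.Cell) (T : Finset ℕ) {X : Finset ℕ}
    (as bs : List (BarLetter R Q)) (h : X.card ≠ barDegree as + barDegree bs + 1) :
    pairEval σ T X as bs (diagonal R σ.1) = 0 :=
  pairEval_diagonal_eq_zero σ T X as bs fun _ _ hX _ ht h1 h2 => h (ht.cardSum_eq hX h1 h2).2.2

/-- A degenerate direction `i` has to form a one-element block in both partitions. Then `{i}` is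
saturated, hence everything by connectedness, and no block remains on which a letter could be
evaluated. -/
theorem pairEval_diagonal_of_isDegenerate (σ : Q.Cell) (hσ : IsDegenerate σ)
    (as bs : List (BarLetter R Q)) (hab : ¬(as = [] ∧ bs = [])) :
    pairEval σ ∅ (Finset.range σ.1) as bs (diagonal R σ.1) = 0 := by
  obtain ⟨i, hi, h⟩ := exists_degenAt hσ
  refine pairEval_diagonal_eq_zero σ _ _ as bs fun u v hX _ ht h1 h2 => ?_
  have k1 := card_eq_one_of_wordValue_ne_zero h h1
  have k2 := card_eq_one_of_wordValue_ne_zero h h2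
  rcases ht.connected {i} (by simpa using hi) (saturated_singleton k1) (saturated_singleton k2)
    with h0 | h0
  · simp at h0
  · rw [Finset.union_idempotent] at h0
    have key : ∀ (cs : List (BarLetter R Q)) (w : List (Finset ℕ)), IsPart (Finset.range σ.1) w →
        (∀ A ∈ w, i ∈ A → A.card = 1) → wordValue σ cs ∅ w ≠ 0 → cs = [] := by
      intro cs w hw hw1 hne
      rw [wordValue_of_forall_card_one] at hne
      · by_contra hc; exact hne (if_neg hc)
      · intro A hA
        have hs := hw.subset hA
        obtain ⟨j, hj⟩ := hw.nonempty A hA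
        have : j ∈ ({i} : Finset ℕ) := h0 ▸ hs hj
        rw [Finset.mem_singleton] at this
        exact hw1 A hA (this ▸ hj)
    exact hab ⟨key _ _ ht.fst k1 h1, key _ _ ht.snd k2 h2⟩

theorem pairEval_diagonal_parity (σ : Q.Cell) (T X : Finset ℕ) (as bs : List (BarLetter R Q)) :
    (-1) ^ X.card * pairEval σ T X as bs (diagonal R σ.1) =
      -(-1) ^ (barDegree as + barDegree bs) * pairEval σ T X as bs (diagonal R σ.1) := by
  by_cases h : X.card = barDegree as + barDegree bs + 1
  · rw [h, pow_succ]; ring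
  · rw [pairEval_diagonal_of_card σ T as bs h, mul_zero, mul_zero]

theorem pairEval_diagonal_eq_sum (σ : Q.Cell) (T X : Finset ℕ) (hne : X.Nonempty)
    (as bs : List (BarLetter R Q)) : pairEval σ T X as bs (diagonal R σ.1) =
      ∑ x ∈ (arrangements σ.1).filter fun x => x.toFinset = X,
        ∑ u ∈ rightShifts (decreasingRuns x), ∑ v ∈ leftShifts (increasingRuns x),
        (-1) ^ pairSgnExp x u v * (wordValue σ as T u * wordValue σ bs T v) := by
  rw [diagonal, map_sum, Finset.sum_filter]
  refine Finset.sum_congr rfl fun x _ => ?_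
  by_cases hx : x = []
  · rw [if_pos hx, map_zero, if_neg]
    rintro rfl
    simp [hx] at hne
  · rw [if_neg hx, diagTerm]
    simp only [map_sum, map_smul, pairEval_basis, smul_eq_mul]
    split_ifs with h
    · rfl
    · simp

theorem leftShifts_singleton (A : Finset ℕ) : leftShifts [A] = {[A]} := by
  rw [leftShifts, List.reverse_singleton, rightShifts_singleton]; simp

/-- The degree count leaves only sets with one element, and the only term there has sign `+1`. -/
theorem pairEval_diagonal_nil_nil (σ : Q.Cell) (T : Finset ℕ) {X : Finset ℕ}
    (hX : X ⊆ Finset.range σ.1) :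
    pairEval (R := R) σ T X [] [] (diagonal R σ.1) = atom T X := by
  by_cases h : X.card = 1
  · obtain ⟨a, rfl⟩ := Finset.card_eq_one.1 h
    rw [pairEval_diagonal_eq_sum σ T _ (by simp)]
    have : (arrangements σ.1).filter (fun x => x.toFinset = {a}) = {[a]} := by
      ext x
      rw [Finset.mem_filter, mem_arrangements, Finset.mem_singleton]
      constructor
      · rintro ⟨⟨h1, -⟩, h2⟩
        have hl : x.length = 1 := by rw [← List.toFinset_card_of_nodup h1, h2]; rfl
        obtain ⟨b, rfl⟩ := List.length_eq_one_iff.1 hl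
        simpa using h2
      · rintro rfl
        simpa using hX
    rw [this, Finset.sum_singleton]
    have e1 : decreasingRuns [a] = [{a}] := rfl
    have e2 : increasingRuns [a] = [{a}] := rfl
    rw [e1, e2, rightShifts_singleton, leftShifts_singleton, Finset.sum_singleton,
      Finset.sum_singleton, pairSgnExp, e1]
    rw [wordValue_of_forall_card_one σ [] T (u := [{a}]) (by simp)]
    simp [sgnOneExp, sgnTwoExp, rsgnExp, epsOne, inversions, atom]
  · rw [atom, if_neg h, pairEval_diagonal_of_card]
    simpa using h

theorem hirschValue_of_dim_zero {σ : Q.Cell} (hσ : σ.1 = 0) {as bs : List (BarLetter R Q)}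
    (hab : ¬(as = [] ∧ bs = [])) : hirschValue as bs σ = 0 := by
  obtain ⟨n, σ⟩ := σ
  subst hσ
  refine Finset.sum_eq_zero fun x _ => ?_
  have : vertex x = [] := by simp [vertex]
  have e1 : rightShifts (decreasingRuns []) = {[]} := by
    rw [show decreasingRuns [] = [] from rfl, rightShifts]
  have e2 : leftShifts (increasingRuns []) = {[]} := by
    rw [show increasingRuns [] = [] from rfl, leftShifts, List.reverse_nil, rightShifts]; simp
  rw [this, e1, e2, Finset.sum_singleton, Finset.sum_singleton]
  obtain _ | ⟨a, as⟩ := as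
  · obtain _ | ⟨b, bs⟩ := bs
    · simp at hab
    · simp [blockFaces, evalWord]
  · simp [blockFaces, evalWord]

theorem Cochain.eval_zero {n : ℕ} : (0 : Cochain R Q n).eval = 0 := by
  funext τ
  simp [Cochain.eval]

theorem hirschValue_faceOf' (σ : Q.Cell) {T X : Finset ℕ} (hX : X ⊆ Finset.range σ.1)
    (hT : Disjoint T X) {as bs : List (BarLetter R Q)} (hab : ¬(as = [] ∧ bs = [])) :
    hirschValue as bs (faceOf σ T X) = pairEval σ T X as bs (diagonal R σ.1) := by
  obtain rfl | hne := X.eq_empty_or_nonempty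
  · rw [hirschValue_of_dim_zero (by rw [faceOf_dim _ _ hX]; rfl) hab, pairEval_diagonal_empty]
  · exact hirschValue_faceOf σ hX hT hne as bs

theorem hirschValue_eq (σ : Q.Cell) {as bs : List (BarLetter R Q)} (hab : ¬(as = [] ∧ bs = [])) :
    hirschValue as bs σ = pairEval σ ∅ (Finset.range σ.1) as bs (diagonal R σ.1) := by
  rw [← hirschValue_faceOf' σ subset_rfl (Finset.disjoint_empty_left _) hab, faceOf_range]

theorem eval_hirsch {as bs : List (BarLetter R Q)} (hab : ¬(as = [] ∧ bs = [])) :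
    (hirsch as bs).eval = hirschValue as bs := by
  refine Cochain.eval_ofFun (fun τ hτ => ?_) (fun τ hτ => ?_)
  · rw [hirschValue_eq τ hab, pairEval_diagonal_of_card]
    rwa [Finset.card_range]
  · rw [hirschValue_eq τ hab, pairEval_diagonal_of_isDegenerate τ hτ as bs hab]

/-- The Hirsch operations as functions on cells. -/
def hirschCell (as bs : List (BarLetter R Q)) : Q.Cell → R := (hirsch as bs).eval

theorem cellParity_hirschCell (as bs : List (BarLetter R Q)) :
    cellParity (hirschCell as bs) = -(-1 : R) ^ (barDegree as + barDegree bs) • hirschCell as bs := by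
  funext σ
  rw [cellParity, Pi.smul_apply, smul_eq_mul]
  by_cases h : σ.1 = barDegree as + barDegree bs + 1
  · rw [h, pow_succ]; ring
  · rw [hirschCell, Cochain.eval_of_dim _ h, mul_zero, mul_zero]

theorem hirschCell_of_ne {as bs : List (BarLetter R Q)} (hab : ¬(as = [] ∧ bs = [])) :
    hirschCell as bs = hirschValue as bs := eval_hirsch hab

variable [OneReduced Q]

/-- `E_{0,0}` is formally a cochain of degree one, and all edges are degenerate. -/
theorem hirsch_nil_nil : hirsch (R := R) (Q := Q) [] [] = 0 := by
  funext τ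
  exact absurd (OneReduced.isDegenerate_of_dim_one τ.1 τ.2.1) τ.2.2

theorem hirschCell_nil_nil : hirschCell (R := R) (Q := Q) [] [] = 0 := by
  rw [hirschCell, hirsch_nil_nil, Cochain.eval_zero]

/-- The diagonal evaluates to the Hirsch operations except on the empty pair, where it gives `atom`.
This correction produces the coboundary in the structure equation. -/
theorem pairEval_eq_hirschCell (σ : Q.Cell) {T X : Finset ℕ} (hX : X ⊆ Finset.range σ.1)
    (hT : Disjoint T X) (as bs : List (BarLetter R Q)) :
    pairEval σ T X as bs (diagonal R σ.1) = hirschCell as bs (faceOf σ T X) +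
      if as = [] ∧ bs = [] then atom T X else 0 := by
  split_ifs with h
  · obtain ⟨rfl, rfl⟩ := h
    rw [hirschCell_nil_nil, pairEval_diagonal_nil_nil _ _ hX]; simp
  · rw [hirschCell_of_ne h, hirschValue_faceOf' σ hX hT h, add_zero]

/-- Evaluate `dD = D * D` on the top face. The left side becomes the bar differential in both
arguments. On the right side `D` becomes `E + atom`: products of two values of `E` are cup products,
and the mixed terms form the graded commutator of `E` with `atom`, which is its coboundary. -/
theorem hirschCell_maurerCartan (as bs : List (BarLetter R Q)) :
    listDiff (fun l => hirschCell l bs) as +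
        (-1 : R) ^ barDegree as • listDiff (fun l => hirschCell as l) bs =
      -cellDelta (hirschCell as bs) -
        splitSum (fun as₁ as₂ => splitSum (fun bs₁ bs₂ =>
          (-1 : R) ^ (barDegree as₁ + barDegree bs₁ + barDegree bs₁ * barDegree as₂) •
            cellCup (hirschCell as₁ bs₁) (hirschCell as₂ bs₂)) bs) as := by
  by_cases hab : as = [] ∧ bs = []
  · obtain ⟨rfl, rfl⟩ := hab
    have : cellDelta (0 : Q.Cell → R) = 0 := by funext τ; simp [cellDelta]
    have h2 : cellCup (0 : Q.Cell → R) 0 = 0 := by funext τ; simp [cellCup]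
    simp [listDiff, splitSum, hirschCell_nil_nil, this, h2]
  funext σ
  set D := diagonal R σ.1
  let P (as bs : List (BarLetter R Q)) (T X : Finset ℕ) : R := pairEval σ T X as bs D
  let E (as bs : List (BarLetter R Q)) (T X : Finset ℕ) : R := hirschCell as bs (faceOf σ T X)
  have h0 := Finset.disjoint_empty_left (Finset.range σ.1)
  have hD : D ∈ spanBasis R (IsPartPair σ.1) :=
    Submodule.span_mono (by rintro _ ⟨g, hg, rfl⟩; exact ⟨g, hg.isPartPair, rfl⟩)
      (diagonal_mem_isTreePair σ.1)
  have key := pairEval_diff σ h0 as bs hD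
  rw [(maurerCartan_diagonal σ.1).2, pairEval_mul σ as bs hD hD] at key
  have e1 : listDiff (fun l => hirschCell l bs) as σ =
      listDiff (fun l => pairEval σ ∅ (Finset.range σ.1) l bs D) as := by
    have := map_listDiff (LinearMap.proj σ : (Q.Cell → R) →ₗ[R] R) (fun l => hirschCell l bs) as
    rw [LinearMap.proj_apply] at this
    rw [this]
    refine listDiff_congr (fun l hl => ?_) as
    rw [LinearMap.proj_apply, hirschCell_of_ne (by simp [hl]), hirschValue_eq _ (by simp [hl])]
  have e2 : listDiff (fun l => hirschCell as l) bs σ =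
      listDiff (fun l => pairEval σ ∅ (Finset.range σ.1) as l D) bs := by
    have := map_listDiff (LinearMap.proj σ : (Q.Cell → R) →ₗ[R] R) (fun l => hirschCell as l) bs
    rw [LinearMap.proj_apply] at this
    rw [this]
    refine listDiff_congr (fun l hl => ?_) bs
    rw [LinearMap.proj_apply, hirschCell_of_ne (by simp [hl]), hirschValue_eq _ (by simp [hl])]
  rw [Pi.add_apply, Pi.smul_apply, smul_eq_mul, e1, e2, ← key]
  -- Turns the sign of the exterior product into the sign of the convolution. Wherever a value of
  -- the diagonal is nonzero, the size of its set is the degree plus one.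
  have split : ∀ as₁ as₂ bs₁ bs₂ : List (BarLetter R Q), ∑ A ∈ (Finset.range σ.1).powerset,
        (-1) ^ (A.card * (barDegree as₂ + barDegree bs₂) + crossings (Finset.range σ.1 \ A) A +
          barDegree bs₁ * barDegree as₂) * (pairEval σ ∅ A as₁ bs₁ D *
            pairEval σ (∅ ∪ A) (Finset.range σ.1 \ A) as₂ bs₂ D) =
      -((-1) ^ (barDegree as₁ + barDegree bs₁ + barDegree bs₁ * barDegree as₂) *
        conv (P as₁ bs₁) (P as₂ bs₂) ∅ (Finset.range σ.1)) := by
    intro as₁ as₂ bs₁ bs₂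
    rw [conv, Finset.mul_sum, ← Finset.sum_neg_distrib]
    refine Finset.sum_congr rfl fun A hA => ?_
    rw [Finset.mem_powerset] at hA
    have c := crossings_add_swap (A := A) (B := Finset.range σ.1 \ A) Finset.disjoint_sdiff
    have s2 := pairEval_diagonal_parity σ (∅ ∪ A) (Finset.range σ.1 \ A) as₂ bs₂
    have s1 := pairEval_diagonal_parity σ ∅ A as₁ bs₁
    simp only [P]
    set p := pairEval σ ∅ A as₁ bs₁ D
    set q := pairEval σ (∅ ∪ A) (Finset.range σ.1 \ A) as₂ bs₂ D
    have s2' : (-1) ^ (A.card * (barDegree as₂ + barDegree bs₂) +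
        A.card * (Finset.range σ.1 \ A).card) * q = (-1) ^ A.card * q := by
      by_cases hq : (Finset.range σ.1 \ A).card = barDegree as₂ + barDegree bs₂ + 1
      · rw [hq]
        congr 1
        refine neg_one_pow_congr ?_
        push_cast
        linear_combination ((A.card : ZMod 2) * (barDegree as₂ + barDegree bs₂)) * zmod_two_two
      · rw [show q = 0 from pairEval_diagonal_of_card σ _ _ _ hq, mul_zero, mul_zero]
    have s3 : (-1 : R) ^ (A.card * (barDegree as₂ + barDegree bs₂) +
        crossings (Finset.range σ.1 \ A) A + barDegree bs₁ * barDegree as₂) =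
        (-1) ^ (A.card * (barDegree as₂ + barDegree bs₂) +
        A.card * (Finset.range σ.1 \ A).card) * (-1) ^ (crossings A (Finset.range σ.1 \ A) +
          barDegree bs₁ * barDegree as₂) := by
      rw [← pow_add]
      refine neg_one_pow_congr ?_
      rw [← c]
      push_cast
      linear_combination (-(crossings A (Finset.range σ.1 \ A) : ZMod 2)) * zmod_two_two
    rw [s3]
    simp only [pow_add] at s1 s2' ⊢
    linear_combination (-1) ^ crossings A (Finset.range σ.1 \ A) *
      (-1) ^ (barDegree bs₁ * barDegree as₂) * p * s2' +
      (-1) ^ crossings A (Finset.range σ.1 \ A) *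
      (-1) ^ (barDegree bs₁ * barDegree as₂) * q * s1
  simp only [split]
  -- The product of the two `atom` parts is contained in the second summand; it disappears in `z1`,
  -- because `as` and `bs` are not both empty.
  have expand : ∀ as₁ as₂ bs₁ bs₂ : List (BarLetter R Q),
      conv (P as₁ bs₁) (P as₂ bs₂) ∅ (Finset.range σ.1) =
      cellCup (hirschCell as₁ bs₁) (hirschCell as₂ bs₂) σ +
      (if as₁ = [] ∧ bs₁ = [] then conv atom (P as₂ bs₂) ∅ (Finset.range σ.1) else 0) +
      (if as₂ = [] ∧ bs₂ = [] then conv (E as₁ bs₁) atom ∅ (Finset.range σ.1) else 0) := by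
    intro as₁ as₂ bs₁ bs₂
    have : cellCup (hirschCell as₁ bs₁) (hirschCell as₂ bs₂) σ =
        conv (E as₁ bs₁) (E as₂ bs₂) ∅ (Finset.range σ.1) := by
      rw [← cellCup_faceOf _ _ _ subset_rfl h0, faceOf_range]
    have t1 : conv (P as₁ bs₁) (P as₂ bs₂) ∅ (Finset.range σ.1) =
        conv (E as₁ bs₁ + fun T X => if as₁ = [] ∧ bs₁ = [] then atom T X else 0) (P as₂ bs₂) ∅
          (Finset.range σ.1) :=
      conv_congr (fun A hA => pairEval_eq_hirschCell σ hA (Finset.disjoint_empty_left _) as₁ bs₁)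
        fun A hA => rfl
    have t2 : conv (E as₁ bs₁) (P as₂ bs₂) ∅ (Finset.range σ.1) =
        conv (E as₁ bs₁) (E as₂ bs₂ + fun T X => if as₂ = [] ∧ bs₂ = [] then atom T X else 0) ∅
          (Finset.range σ.1) :=
      conv_congr (fun A hA => rfl) fun A hA => pairEval_eq_hirschCell σ Finset.sdiff_subset
        (by rw [Finset.empty_union]; exact Finset.disjoint_sdiff) as₂ bs₂
    rw [this, t1, conv_add_left, Pi.add_apply, Pi.add_apply, t2, conv_add_right, Pi.add_apply,
      Pi.add_apply]
    split_ifs <;> simp [conv] <;> ring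
  simp only [expand, mul_add, splitSum_neg, splitSum_add]
  have z1 : splitSum (fun as₁ as₂ => splitSum (fun bs₁ bs₂ =>
      (-1) ^ (barDegree as₁ + barDegree bs₁ + barDegree bs₁ * barDegree as₂) *
        (if as₁ = [] ∧ bs₁ = [] then conv atom (P as₂ bs₂) ∅ (Finset.range σ.1) else 0)) bs) as =
      conv atom (E as bs) ∅ (Finset.range σ.1) := by
    rw [splitSum_eq_left, splitSum_eq_left]
    · simp only [and_self, if_true, barDegree_nil, zero_mul, add_zero, pow_zero, one_mul]
      refine conv_congr (fun A hA => rfl) fun A hA => ?_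
      refine (pairEval_eq_hirschCell σ Finset.sdiff_subset
        (by rw [Finset.empty_union]; exact Finset.disjoint_sdiff) as bs).trans ?_
      rw [if_neg hab, add_zero]
    · intro b x y; simp
    · intro a x y; simp [splitSum_zero]
  have z2 : splitSum (fun as₁ as₂ => splitSum (fun bs₁ bs₂ =>
      (-1) ^ (barDegree as₁ + barDegree bs₁ + barDegree bs₁ * barDegree as₂) *
        (if as₂ = [] ∧ bs₂ = [] then conv (E as₁ bs₁) atom ∅ (Finset.range σ.1) else 0)) bs) as =
      (-1) ^ (barDegree as + barDegree bs) * conv (E as bs) atom ∅ (Finset.range σ.1) := by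
    rw [splitSum_eq_right, splitSum_eq_right]
    · simp
    · intro x b y; simp
    · intro x a y; simp [splitSum_zero]
  rw [z1, z2]
  have d : cellDelta (hirschCell as bs) σ = conv atom (E as bs) ∅ (Finset.range σ.1) -
      conv (parity (E as bs)) atom ∅ (Finset.range σ.1) := by
    rw [← Pi.sub_apply, ← Pi.sub_apply, ← cellDelta_faceOf _ _ subset_rfl h0, faceOf_range]
  have d2 : conv (parity (E as bs)) atom ∅ (Finset.range σ.1) =
      -(-1) ^ (barDegree as + barDegree bs) * conv (E as bs) atom ∅ (Finset.range σ.1) := by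
    rw [conv, conv, Finset.mul_sum]
    refine Finset.sum_congr rfl fun A hA => ?_
    have := congrFun (cellParity_hirschCell as bs) (faceOf σ ∅ A)
    rw [cellParity_faceOf _ _ (Finset.mem_powerset.1 hA), Pi.smul_apply, smul_eq_mul] at this
    rw [show parity (E as bs) ∅ A = _ from this]
    ring
  have proj : splitSum (fun as₁ as₂ => splitSum (fun bs₁ bs₂ =>
          (-1 : R) ^ (barDegree as₁ + barDegree bs₁ + barDegree bs₁ * barDegree as₂) •
            cellCup (hirschCell as₁ bs₁) (hirschCell as₂ bs₂)) bs) as σ =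
      splitSum (fun as₁ as₂ => splitSum (fun bs₁ bs₂ =>
          (-1 : R) ^ (barDegree as₁ + barDegree bs₁ + barDegree bs₁ * barDegree as₂) *
            cellCup (hirschCell as₁ bs₁) (hirschCell as₂ bs₂) σ) bs) as := by
    have h1 := fun F : List (BarLetter R Q) → List (BarLetter R Q) → Q.Cell → R =>
      map_splitSum (LinearMap.proj σ : (Q.Cell → R) →ₗ[R] R) F
    simp only [LinearMap.proj_apply] at h1
    simp only [h1, Pi.smul_apply, smul_eq_mul]
  rw [Pi.sub_apply, Pi.neg_apply, d, d2, proj]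
  ring

end HirschEval

/-! ### Hirsch operations with an empty argument -/

theorem runs_of_forall {r : ℕ → ℕ → Bool} {x : List ℕ} (h : x.Pairwise fun a b => r a b = false) :
    runs r x = x.map fun a => {a} := by
  induction x with
  | nil => rfl
  | cons a l ih =>
    rw [List.pairwise_cons] at h
    obtain _ | ⟨b, l⟩ := l
    · rfl
    · obtain ⟨B, Bs, h1, -, h2⟩ := runs_cons_cons (r := r) a b l
      rw [h2, h.1 b (by simp), ← h1, ih h.2]
      rfl

theorem isChain_of_length_runs {r : ℕ → ℕ → Bool} {x : List ℕ} (h : (runs r x).length = 1) :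
    x.IsChain fun a b => r a b = true := by
  induction x with
  | nil => simp
  | cons a l ih =>
    obtain _ | ⟨b, l⟩ := l
    · simp
    · obtain ⟨B, Bs, hB, -, h2⟩ := runs_cons_cons (r := r) a b l
      rw [hB] at ih
      rw [h2] at h
      split_ifs at h with hr
      · exact List.isChain_cons_cons.2 ⟨hr, ih h⟩
      · simp at h

theorem rightShifts_map_singleton (x : List ℕ) :
    rightShifts (x.map fun a => {a}) = {x.map fun a => {a}} := by
  induction x with
  | nil => simp
  | cons a l ih =>
    obtain _ | ⟨b, l⟩ := l
    · simp
    · simp only [List.map_cons] at ih ⊢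
      rw [rightShifts]
      ext w
      simp only [Finset.mem_biUnion, Finset.mem_filter, Finset.mem_powerset,
        Finset.subset_singleton_iff, Finset.mem_image]
      constructor
      · rintro ⟨M, ⟨hM | hM, h1, -⟩, w, h2, rfl⟩
        · subst hM
          rw [Finset.union_empty, ih, Finset.mem_singleton] at h2
          subst h2
          simp
        · exact absurd hM h1
      · intro h
        rw [Finset.mem_singleton] at h
        subst h
        exact ⟨∅, ⟨Or.inl rfl, (Finset.singleton_ne_empty a).symm, by simp⟩, _,
          by rw [Finset.union_empty, ih]; exact Finset.mem_singleton_self _, by simp⟩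

theorem leftShifts_map_singleton (x : List ℕ) :
    leftShifts (x.map fun a => {a}) = {x.map fun a => {a}} := by
  rw [leftShifts, ← List.map_reverse, rightShifts_map_singleton]
  simp

/-- Each entry contributes the number of its successors twice, once through `epsOne` and once
through the inversions. -/
theorem sgnOneExp_of_decreasing {x : List ℕ} (h : x.Pairwise fun a b => b < a) :
    (-1 : ℤ) ^ sgnOneExp (x.map fun a => {a}) = 1 := by
  induction x with
  | nil => rfl
  | cons a l ih =>
    rw [List.pairwise_cons] at h
    have : ((l.map fun a => ({a} : Finset ℕ)).map (crossings {a})).sum = l.length := by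
      rw [List.map_map]
      have : l.map (crossings {a} ∘ fun a => {a}) = l.map fun _ => 1 := by
        refine List.map_congr_left fun b hb => ?_
        rw [Function.comp, crossings_singleton_left, Finset.filter_singleton, if_pos (h.1 b hb)]
        rfl
      rw [this]; simp
    have e : sgnOneExp ((a :: l).map fun a => {a}) =
        2 * l.length + sgnOneExp (l.map fun a => {a}) := by
      rw [List.map_cons, sgnOneExp, sgnOneExp, epsOne, inversions, this]
      simp; ring
    rw [e, pow_add, pow_mul, ih h.2]; simp

theorem rsgnExp_map_singleton (x : List ℕ) : rsgnExp (x.map fun a => {a}) = 0 := by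
  induction x with
  | nil => rfl
  | cons a l ih =>
    simp only [rsgnExp, List.map_cons, List.sum_cons] at ih ⊢
    rw [ih]; simp

theorem sgnOneExp_singleton (A : Finset ℕ) : sgnOneExp [A] = 0 := by
  simp [sgnOneExp, epsOne, inversions]

section Identity

open DiagAlgebra

variable {R : Type v} [CommRing R] {Q : CubicalSet.{u}}

/-- With `n` increasing runs, the count in `length_runs` leaves a single decreasing run. -/
theorem arrangement_decreasing {n : ℕ} (hn : 0 < n) {x : List ℕ} (hx : x ∈ arrangements n)
    (hX : x.toFinset = Finset.range n) (h : (increasingRuns x).length = n) :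
    x.Pairwise fun a b => b < a := by
  rw [mem_arrangements] at hx
  have hl : x.length = n := by
    rw [← List.toFinset_card_of_nodup hx.1, hX, Finset.card_range]
  have := length_runs x hx.1 (by rintro rfl; simp at hl; omega)
  have := isChain_of_length_runs (r := fun a b => decide (b < a)) (x := x)
    (show (decreasingRuns x).length = 1 by omega)
  have t : (fun a b => b < a : ℕ → ℕ → Prop) = fun a b => decide (b < a) = true := by simp
  rw [← t] at this
  have hc := this
  have : IsTrans ℕ (fun a b => b < a) := ⟨fun _ _ _ h h' => h'.trans h⟩
  exact List.isChain_iff_pairwise.1 hc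

theorem arrangement_increasing {n : ℕ} (hn : 0 < n) {x : List ℕ} (hx : x ∈ arrangements n)
    (hX : x.toFinset = Finset.range n) (h : (decreasingRuns x).length = n) :
    x.Pairwise fun a b => a < b := by
  rw [mem_arrangements] at hx
  have hl : x.length = n := by
    rw [← List.toFinset_card_of_nodup hx.1, hX, Finset.card_range]
  have := length_runs x hx.1 (by rintro rfl; simp at hl; omega)
  have := isChain_of_length_runs (r := fun a b => decide (a < b)) (x := x)
    (show (increasingRuns x).length = 1 by omega)
  simp only [decide_eq_true_eq] at this
  exact List.isChain_iff_pairwise.1 this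

theorem length_eq_of_wordValue_nil {σ : Q.Cell} {X T : Finset ℕ} {v : List (Finset ℕ)}
    (hX : X ⊆ Finset.range σ.1) (hv : IsPart X v)
    (h : wordValue (R := R) σ [] T v ≠ 0) : v.length = X.card := by
  have := card_of_wordValue_ne_zero (fun A hA => (hv.subset hA).trans hX) h
  rw [hv.cardSum, barDegree_nil, zero_add] at this
  exact this.symm

theorem isPart_singleton_runs {n : ℕ} {x : List ℕ} (hX : x.toFinset = Finset.range n)
    {r : ℕ → ℕ → Bool} (h : (runs r x).length = 1) (hx : x.Nodup) : runs r x = [Finset.range n] :=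
  hX ▸ (runs_isPart r hx).eq_of_length_one h

theorem eq_of_pairwise_of_toFinset_eq {r : ℕ → ℕ → Prop} (hr : ∀ a b, r a b → r b a → a = b)
    {x y : List ℕ} (hx : x.Pairwise r) (hy : y.Pairwise r) (hxn : x.Nodup) (hyn : y.Nodup)
    (h : x.toFinset = y.toFinset) : x = y :=
  (List.perm_of_nodup_nodup_toFinset_eq hxn hyn h).eq_of_pairwise (fun a b _ _ => hr a b) hx hy

theorem evalWord_single (σ : Q.Cell) (a : BarLetter R Q) (h : 1 < σ.1) :
    wordValue σ [a] ∅ [Finset.range σ.1] = a.2.eval σ := by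
  rw [wordValue_cons_of_card_ne_one _ _ _ _ (by rw [Finset.card_range]; omega), faceOf_range,
    wordValue_nil_right]
  simp

/-- An empty second argument makes every block of `v` a single point. The tree count then leaves one
block for `u`, which takes at most one letter. -/
theorem hirschCell_nil_right {as : List (BarLetter R Q)} (h : 1 < as.length) :
    hirschCell as [] = 0 := by
  have hab : ¬(as = [] ∧ ([] : List (BarLetter R Q)) = []) := by rintro ⟨rfl, -⟩; simp at h
  funext σ
  rw [hirschCell_of_ne hab, hirschValue_eq _ hab]
  refine pairEval_diagonal_eq_zero σ _ _ _ _ fun u v hX _ ht h1 h2 => ?_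
  have := length_le_of_wordValue_ne_zero h1
  have := length_eq_of_wordValue_nil hX ht.snd h2
  have := ht.length
  omega

theorem hirschCell_nil_left {bs : List (BarLetter R Q)} (h : 1 < bs.length) :
    hirschCell [] bs = 0 := by
  have hab : ¬(([] : List (BarLetter R Q)) = [] ∧ bs = []) := by rintro ⟨-, rfl⟩; simp at h
  funext σ
  rw [hirschCell_of_ne hab, hirschValue_eq _ hab]
  refine pairEval_diagonal_eq_zero σ _ _ _ _ fun u v hX _ ht h1 h2 => ?_
  have := length_le_of_wordValue_ne_zero h2
  have := length_eq_of_wordValue_nil hX ht.fst h1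
  have := ht.length
  omega

variable [OneReduced Q]

/-- The second partition must consist of single points, which leaves only the decreasing
permutation. Its first partition is the whole set of coordinates and its sign is `+1`. -/
theorem hirschCell_singleton_left (a : BarLetter R Q) : hirschCell [a] [] = a.2.eval := by
  funext σ
  rw [hirschCell_of_ne (by simp), hirschValue_eq _ (by simp)]
  by_cases hn : σ.1 ≤ 1
  · rw [eval_letter a hn]
    obtain h0 | h1 : σ.1 = 0 ∨ σ.1 = 1 := by omega
    · rw [h0, Finset.range_zero]; rw [← h0, pairEval_diagonal_empty]
    · exact pairEval_diagonal_of_isDegenerate σ (OneReduced.isDegenerate_of_dim_one σ h1) _ _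
        (by simp)
  rw [not_le] at hn
  have hne : (Finset.range σ.1).Nonempty := Finset.nonempty_range_iff.2 (by omega)
  rw [pairEval_diagonal_eq_sum σ _ _ hne]
  have p0 : (List.range σ.1).reverse.Pairwise fun a b => b < a :=
    List.pairwise_reverse.2 List.pairwise_lt_range
  have t0 : (List.range σ.1).reverse.toFinset = Finset.range σ.1 := by simp [List.toFinset_range]
  have n0 : (List.range σ.1).reverse.Nodup := List.nodup_reverse.2 List.nodup_range
  rw [Finset.sum_eq_single (List.range σ.1).reverse]
  · have e2 : increasingRuns (List.range σ.1).reverse =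
        (List.range σ.1).reverse.map fun a => {a} :=
      runs_of_forall (p0.imp fun h => by simpa using h.le)
    have hl := length_runs (List.range σ.1).reverse n0
      (by rw [Ne, List.reverse_eq_nil_iff, List.range_eq_nil]; omega)
    rw [e2] at hl
    have e1 : decreasingRuns (List.range σ.1).reverse = [Finset.range σ.1] :=
      isPart_singleton_runs t0 (show (decreasingRuns _).length = 1 by simp at hl ⊢; omega) n0
    rw [e1, e2, rightShifts_singleton, leftShifts_map_singleton, Finset.sum_singleton,
      Finset.sum_singleton, evalWord_single σ a hn, wordValue_of_forall_card_one σ [] _ (by simp),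
      pairSgnExp, e1]
    have s := congrArg (Int.cast : ℤ → R) (sgnOneExp_of_decreasing p0)
    push_cast at s
    -- `(-1)^{q(q-1)/2}` with `q = n` and `rsgn(u_x)` have the same exponent and cancel.
    have : (-1 : R) ^ (((List.range σ.1).reverse.map fun a => ({a} : Finset ℕ)).length.choose 2 +
        rsgnExp [Finset.range σ.1]) = 1 := by
      refine (neg_one_pow_congr (R := R) (n := 0) ?_).trans (pow_zero _)
      simp only [rsgnExp, List.length_map, List.length_reverse, List.length_range, List.map_cons,
        List.map_nil, List.sum_cons, List.sum_nil, Finset.card_range, add_zero]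
      push_cast
      linear_combination (σ.1.choose 2 : ZMod 2) * zmod_two_two
    rw [sgnTwoExp_eq, sgnOneExp_singleton, pow_add, pow_add, pow_add, this, s]
    simp
  · intro x hx hne
    rw [Finset.mem_filter] at hx
    have hx' := mem_arrangements.1 hx.1
    refine Finset.sum_eq_zero fun u _ => Finset.sum_eq_zero fun v hv => ?_
    by_contra h0
    have hv' := iR_isPart hx'.1 hv
    rw [hx.2] at hv'
    have := length_eq_of_wordValue_nil subset_rfl hv'
      (right_ne_zero_of_mul (right_ne_zero_of_mul h0))
    rw [(leftShifts_spec hv).1, Finset.card_range] at this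
    exact hne (eq_of_pairwise_of_toFinset_eq (fun a b h h' => absurd h h'.asymm)
      (arrangement_decreasing (by omega) hx.1 hx.2 this) p0 hx'.1 n0 (hx.2.trans t0.symm))
  · intro h
    refine absurd (Finset.mem_filter.2 ⟨mem_arrangements.2 ⟨n0, ?_⟩, t0⟩) h
    simp

/-- Dually only the increasing permutation contributes. Here `u = u_x`, so the two signs `sgn_2`
cancel, and the remaining factors are trivial. -/
theorem hirschCell_singleton_right (a : BarLetter R Q) : hirschCell [] [a] = a.2.eval := by
  funext σ
  rw [hirschCell_of_ne (by simp), hirschValue_eq _ (by simp)]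
  by_cases hn : σ.1 ≤ 1
  · rw [eval_letter a hn]
    obtain h0 | h1 : σ.1 = 0 ∨ σ.1 = 1 := by omega
    · rw [h0, Finset.range_zero]; rw [← h0, pairEval_diagonal_empty]
    · exact pairEval_diagonal_of_isDegenerate σ (OneReduced.isDegenerate_of_dim_one σ h1) _ _
        (by simp)
  rw [not_le] at hn
  have hne : (Finset.range σ.1).Nonempty := Finset.nonempty_range_iff.2 (by omega)
  rw [pairEval_diagonal_eq_sum σ _ _ hne]
  have p0 : (List.range σ.1).Pairwise fun a b => a < b := List.pairwise_lt_range
  have t0 : (List.range σ.1).toFinset = Finset.range σ.1 := by simp [List.toFinset_range]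
  have n0 : (List.range σ.1).Nodup := List.nodup_range
  rw [Finset.sum_eq_single (List.range σ.1)]
  · have e2 : decreasingRuns (List.range σ.1) = (List.range σ.1).map fun a => {a} :=
      runs_of_forall (p0.imp fun h => by simpa using h.le)
    have hl := length_runs (List.range σ.1) n0
      (by rw [Ne, List.range_eq_nil]; omega)
    rw [e2] at hl
    have e1 : increasingRuns (List.range σ.1) = [Finset.range σ.1] :=
      isPart_singleton_runs t0 (show (increasingRuns _).length = 1 by simp at hl ⊢; omega) n0
    rw [e1, e2, leftShifts_singleton, rightShifts_map_singleton, Finset.sum_singleton,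
      Finset.sum_singleton, evalWord_single σ a hn, wordValue_of_forall_card_one σ [] _ (by simp),
      pairSgnExp, e2, rsgnExp_map_singleton, sgnOneExp_singleton, List.length_singleton, add_assoc,
      pow_add, ← two_mul, pow_mul]
    simp
  · intro x hx hne
    rw [Finset.mem_filter] at hx
    have hx' := mem_arrangements.1 hx.1
    refine Finset.sum_eq_zero fun u hu => Finset.sum_eq_zero fun v hv => ?_
    by_contra h0
    have hu' := dR_isPart hx'.1 hu
    rw [hx.2] at hu'
    have := length_eq_of_wordValue_nil subset_rfl hu'
      (left_ne_zero_of_mul (right_ne_zero_of_mul h0))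
    rw [(rightShifts_spec hu).1, Finset.card_range] at this
    exact hne (eq_of_pairwise_of_toFinset_eq (fun a b h h' => absurd h h'.asymm)
      (arrangement_increasing (by omega) hx.1 hx.2 this) p0 hx'.1 n0 (hx.2.trans t0.symm))
  · intro h
    refine absurd (Finset.mem_filter.2 ⟨mem_arrangements.2 ⟨n0, ?_⟩, t0⟩) h
    simp

end Identity

/-! ### The algebra of cochains -/

section CellOperations

variable {R : Type v} [CommRing R] {Q : CubicalSet.{u}}

theorem cellDelta_add (f g : Q.Cell → R) : cellDelta (f + g) = cellDelta f + cellDelta g := by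
  funext τ
  simp only [cellDelta, Pi.add_apply, ← Finset.sum_add_distrib]
  exact Finset.sum_congr rfl fun i _ => by ring

theorem cellDelta_smul (r : R) (f : Q.Cell → R) : cellDelta (r • f) = r • cellDelta f := by
  funext τ
  simp only [cellDelta, Pi.smul_apply, smul_eq_mul, Finset.mul_sum]
  exact Finset.sum_congr rfl fun i _ => by ring

theorem cellCup_add_left (f g h : Q.Cell → R) : cellCup (f + g) h = cellCup f h + cellCup g h := by
  funext τ
  simp only [cellCup, Pi.add_apply, ← Finset.sum_add_distrib]
  exact Finset.sum_congr rfl fun i _ => by ring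

theorem cellCup_add_right (f g h : Q.Cell → R) : cellCup f (g + h) = cellCup f g + cellCup f h := by
  funext τ
  simp only [cellCup, Pi.add_apply, ← Finset.sum_add_distrib]
  exact Finset.sum_congr rfl fun i _ => by ring

theorem cellCup_smul_left (r : R) (f g : Q.Cell → R) : cellCup (r • f) g = r • cellCup f g := by
  funext τ
  simp only [cellCup, Pi.smul_apply, smul_eq_mul, Finset.mul_sum]
  exact Finset.sum_congr rfl fun i _ => by ring

theorem cellCup_smul_right (r : R) (f g : Q.Cell → R) : cellCup f (r • g) = r • cellCup f g := by
  funext τ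
  simp only [cellCup, Pi.smul_apply, smul_eq_mul, Finset.mul_sum]
  exact Finset.sum_congr rfl fun i _ => by ring

theorem Cochain.eval_add {n : ℕ} (a b : Cochain R Q n) : (a + b).eval = a.eval + b.eval := by
  funext τ
  simp only [Cochain.eval, Pi.add_apply]
  split_ifs <;> simp

theorem Cochain.eval_smul {n : ℕ} (r : R) (a : Cochain R Q n) : (r • a).eval = r • a.eval := by
  funext τ
  simp only [Cochain.eval, Pi.smul_apply]
  split_ifs <;> simp

theorem Cochain.eval_injective {n : ℕ} : Function.Injective (Cochain.eval (R := R) (Q := Q) (n := n)) := by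
  intro a b h
  funext τ
  rw [← a.eval_apply, ← b.eval_apply, h]

end CellOperations

/-! ### The direct sums of cochains with their differential, sign and product. -/

section Algebra

variable (R : Type v) [CommRing R] (Q : CubicalSet.{u})

/-- Evaluation of cochains of a fixed degree as a linear map. -/
def evalLinear (n : ℕ) : Cochain R Q n →ₗ[R] (Q.Cell → R) where
  toFun := Cochain.eval
  map_add' := Cochain.eval_add
  map_smul' := Cochain.eval_smul

/-- Cochains as functions on all cells. -/
def toCell : Cochains R Q →ₗ[R] (Q.Cell → R) := DirectSum.toModule R ℕ _ (evalLinear R Q)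

/-- The inclusion of the cochains of positive degree. -/
def susp : BarCochains R Q →ₗ[R] Cochains R Q :=
  DirectSum.toModule R ℕ _ fun n => DirectSum.lof R ℕ (fun k => Cochain R Q k) (n + 1)

variable {R Q}

/-- A homogeneous cochain. -/
def homog {n : ℕ} (a : Cochain R Q n) : Cochains R Q :=
  DirectSum.lof R ℕ (fun k => Cochain R Q k) n a

/-- A letter as an element of the desuspension. -/
def BarLetter.elem (a : BarLetter R Q) : BarCochains R Q :=
  DirectSum.lof R ℕ (fun k => Cochain R Q (k + 1)) a.1 a.2

theorem toCell_homog {n : ℕ} (a : Cochain R Q n) : toCell R Q (homog a) = a.eval :=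
  DirectSum.toModule_lof _ _ _

theorem susp_elem (a : BarLetter R Q) : susp R Q a.elem = homog a.2 := DirectSum.toModule_lof _ _ _

theorem homog_add {n : ℕ} (a b : Cochain R Q n) : homog (a + b) = homog a + homog b := map_add _ _ _

theorem homog_smul {n : ℕ} (r : R) (a : Cochain R Q n) : homog (r • a) = r • homog a :=
  map_smul _ _ _

theorem BarLetter.elem_add {n : ℕ} (a b : Cochain R Q (n + 1)) :
    BarLetter.elem ⟨n, a + b⟩ = BarLetter.elem ⟨n, a⟩ + BarLetter.elem ⟨n, b⟩ := map_add _ _ _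

theorem BarLetter.elem_smul {n : ℕ} (r : R) (a : Cochain R Q (n + 1)) :
    BarLetter.elem ⟨n, r • a⟩ = r • BarLetter.elem ⟨n, a⟩ := map_smul _ _ _

theorem cochains_induction {p : Cochains R Q → Prop} (x : Cochains R Q) (h0 : p 0)
    (h : ∀ (n : ℕ) (a : Cochain R Q n), p (homog a)) (ha : ∀ x y, p x → p y → p (x + y)) : p x :=
  DirectSum.induction_on x h0 h ha

theorem barCochains_induction {p : BarCochains R Q → Prop} (x : BarCochains R Q) (h0 : p 0)
    (h : ∀ a : BarLetter R Q, p a.elem) (ha : ∀ x y, p x → p y → p (x + y)) : p x :=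
  DirectSum.induction_on x h0 (fun n a => h ⟨n, a⟩) ha

theorem toCell_apply (x : Cochains R Q) {n : ℕ} (τ : {τ : Q.Cell // τ.1 = n ∧ ¬ IsDegenerate τ}) :
    toCell R Q x τ.1 = x n τ := by
  induction x using cochains_induction with
  | h0 => simp
  | h m a =>
    rw [toCell_homog]
    by_cases hm : m = n
    · subst hm
      rw [a.eval_apply, homog, DirectSum.lof_eq_of, DirectSum.of_eq_same]
    · rw [a.eval_of_dim (by rw [τ.2.1]; exact Ne.symm hm), homog, DirectSum.lof_eq_of,
        DirectSum.of_eq_of_ne _ _ _ (Ne.symm hm)]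
      rfl
  | ha x y hx hy => rw [map_add, Pi.add_apply, hx, hy]; rfl

theorem toCell_injective : Function.Injective (toCell R Q) := by
  intro x y h
  refine DirectSum.ext_component R fun n => ?_
  funext τ
  change x n τ = y n τ
  rw [← toCell_apply, ← toCell_apply, h]

theorem susp_apply (x : BarCochains R Q) (n : ℕ) : susp R Q x (n + 1) = x n := by
  induction x using barCochains_induction with
  | h0 => simp
  | h a =>
    obtain ⟨m, a⟩ := a
    rw [susp_elem, homog, BarLetter.elem, DirectSum.lof_eq_of, DirectSum.lof_eq_of]
    by_cases hm : m = n
    · subst hm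
      rw [DirectSum.of_eq_same, DirectSum.of_eq_same]
    · rw [DirectSum.of_eq_of_ne _ _ _ (by simpa using Ne.symm hm),
        DirectSum.of_eq_of_ne _ _ _ (Ne.symm hm)]
  | ha x y hx hy => rw [map_add, DirectSum.add_apply, DirectSum.add_apply, hx, hy]

theorem susp_injective : Function.Injective (susp R Q) := by
  intro x y h
  refine DirectSum.ext_component R fun n => ?_
  change x n = y n
  rw [← susp_apply, ← susp_apply, h]

/-- Degrees such as `p + q + 1` often agree only propositionally. Passing through the values on
cells avoids transporting cochains along such equalities. -/
theorem homog_eq_of_eval {n m : ℕ} {a : Cochain R Q n} {b : Cochain R Q m} (h : a.eval = b.eval) :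
    homog a = homog b := toCell_injective (by rw [toCell_homog, toCell_homog, h])

theorem coboundary_add {n : ℕ} (a b : Cochain R Q n) :
    (a + b).coboundary = a.coboundary + b.coboundary :=
  Cochain.eval_injective (by simp only [Cochain.eval_coboundary, Cochain.eval_add, cellDelta_add])

theorem coboundary_smul {n : ℕ} (r : R) (a : Cochain R Q n) :
    (r • a).coboundary = r • a.coboundary :=
  Cochain.eval_injective (by simp only [Cochain.eval_coboundary, Cochain.eval_smul, cellDelta_smul])

theorem cup_add_left {n m : ℕ} (a b : Cochain R Q n) (c : Cochain R Q m) :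
    (a + b).cup c = a.cup c + b.cup c :=
  Cochain.eval_injective (by simp only [Cochain.eval_cup, Cochain.eval_add, cellCup_add_left])

theorem cup_add_right {n m : ℕ} (c : Cochain R Q n) (a b : Cochain R Q m) :
    c.cup (a + b) = c.cup a + c.cup b :=
  Cochain.eval_injective (by simp only [Cochain.eval_cup, Cochain.eval_add, cellCup_add_right])

theorem cup_smul_left {n m : ℕ} (r : R) (a : Cochain R Q n) (c : Cochain R Q m) :
    (r • a).cup c = r • a.cup c :=
  Cochain.eval_injective (by simp only [Cochain.eval_cup, Cochain.eval_smul, cellCup_smul_left])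

theorem cup_smul_right {n m : ℕ} (r : R) (c : Cochain R Q n) (a : Cochain R Q m) :
    c.cup (r • a) = r • c.cup a :=
  Cochain.eval_injective (by simp only [Cochain.eval_cup, Cochain.eval_smul, cellCup_smul_right])

variable (R Q)

/-- The differential of the algebra of cochains. -/
def deltaA : Cochains R Q →ₗ[R] Cochains R Q :=
  DirectSum.toModule R ℕ _ fun n =>
    { toFun := fun a => homog a.coboundary
      map_add' := fun a b => by rw [coboundary_add, homog_add]
      map_smul' := fun r a => by rw [coboundary_smul, homog_smul]; rfl }

/-- The sign `(-1)^n` on cochains of degree `n`. -/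
def signA : Cochains R Q →ₗ[R] Cochains R Q :=
  DirectSum.toModule R ℕ _ fun n => (-1 : R) ^ n • DirectSum.lof R ℕ (fun k => Cochain R Q k) n

/-- The multiplication of cochains. -/
def mulA : Cochains R Q →ₗ[R] Cochains R Q →ₗ[R] Cochains R Q :=
  DirectSum.toModule R ℕ _ fun n =>
    LinearMap.flip <| DirectSum.toModule R ℕ _ fun m => LinearMap.flip <|
      LinearMap.mk₂ R (fun (a : Cochain R Q n) (b : Cochain R Q m) => homog (a.cup b))
        (fun a b c => by rw [cup_add_left, homog_add])
        (fun r a c => by rw [cup_smul_left, homog_smul])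
        (fun c a b => by rw [cup_add_right, homog_add])
        (fun r c a => by rw [cup_smul_right, homog_smul])

/-- The differential of the desuspension, without the sign. -/
def deltaB : BarCochains R Q →ₗ[R] BarCochains R Q :=
  DirectSum.toModule R ℕ _ fun n =>
    { toFun := fun a => BarLetter.elem ⟨n + 1, a.coboundary⟩
      map_add' := fun a b => by rw [coboundary_add, BarLetter.elem, map_add]; rfl
      map_smul' := fun r a => by rw [coboundary_smul, BarLetter.elem, map_smul]; rfl }

/-- The sign `(-1)^n` on the desuspension in degree `n`. -/
def signB : BarCochains R Q →ₗ[R] BarCochains R Q :=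
  DirectSum.toModule R ℕ _ fun n =>
    (-1 : R) ^ n • DirectSum.lof R ℕ (fun k => Cochain R Q (k + 1)) n

/-- The multiplication of cochains of positive degree. -/
def mulB : BarCochains R Q →ₗ[R] BarCochains R Q →ₗ[R] BarCochains R Q :=
  DirectSum.toModule R ℕ _ fun n =>
    LinearMap.flip <| DirectSum.toModule R ℕ _ fun m => LinearMap.flip <|
      LinearMap.mk₂ R (fun (a : Cochain R Q (n + 1)) (b : Cochain R Q (m + 1)) =>
          BarLetter.elem (BarLetter.cup ⟨n, a⟩ ⟨m, b⟩))
        (fun a b c => (congrArg (fun z => BarLetter.elem ⟨n + 1 + m, z⟩) (cup_add_left a b c)).trans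
            (BarLetter.elem_add (n := n + 1 + m) _ _))
        (fun r a c => (congrArg (fun z => BarLetter.elem ⟨n + 1 + m, z⟩) (cup_smul_left r a c)).trans
            (BarLetter.elem_smul (n := n + 1 + m) _ _))
        (fun c a b => (congrArg (fun z => BarLetter.elem ⟨n + 1 + m, z⟩) (cup_add_right c a b)).trans
            (BarLetter.elem_add (n := n + 1 + m) _ _))
        (fun r c a => (congrArg (fun z => BarLetter.elem ⟨n + 1 + m, z⟩) (cup_smul_right r c a)).trans
            (BarLetter.elem_smul (n := n + 1 + m) _ _))

variable {R Q}

theorem deltaA_homog {n : ℕ} (a : Cochain R Q n) : deltaA R Q (homog a) = homog a.coboundary :=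
  DirectSum.toModule_lof _ _ _

theorem signA_homog {n : ℕ} (a : Cochain R Q n) : signA R Q (homog a) = (-1 : R) ^ n • homog a :=
  DirectSum.toModule_lof _ _ _

theorem mulA_homog {n m : ℕ} (a : Cochain R Q n) (b : Cochain R Q m) :
    mulA R Q (homog a) (homog b) = homog (a.cup b) := by
  rw [mulA, homog, homog, DirectSum.toModule_lof, LinearMap.flip_apply, DirectSum.toModule_lof]
  rfl

theorem deltaB_elem (a : BarLetter R Q) : deltaB R Q a.elem = a.coboundary.elem :=
  DirectSum.toModule_lof _ _ _

theorem signB_elem (a : BarLetter R Q) : signB R Q a.elem = (-1 : R) ^ a.1 • a.elem :=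
  DirectSum.toModule_lof _ _ _

theorem mulB_elem (a b : BarLetter R Q) : mulB R Q a.elem b.elem = (a.cup b).elem := by
  rw [mulB, BarLetter.elem, BarLetter.elem, DirectSum.toModule_lof, LinearMap.flip_apply,
    DirectSum.toModule_lof]
  rfl

theorem toCell_deltaA (x : Cochains R Q) : toCell R Q (deltaA R Q x) = cellDelta (toCell R Q x) := by
  induction x using cochains_induction with
  | h0 => simpa using (cellDelta_smul (0 : R) (0 : Q.Cell → R)).symm
  | h n a => rw [deltaA_homog, toCell_homog, toCell_homog, a.eval_coboundary]
  | ha x y hx hy => rw [map_add, map_add, map_add, cellDelta_add, hx, hy]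

theorem toCell_mulA (x y : Cochains R Q) :
    toCell R Q (mulA R Q x y) = cellCup (toCell R Q x) (toCell R Q y) := by
  induction x using cochains_induction with
  | h0 => simpa using (cellCup_smul_left (0 : R) (0 : Q.Cell → R) (toCell R Q y)).symm
  | h n a =>
    induction y using cochains_induction with
    | h0 => simpa using (cellCup_smul_right (0 : R) (toCell R Q (homog a)) (0 : Q.Cell → R)).symm
    | h m b => rw [mulA_homog, toCell_homog, toCell_homog, toCell_homog, a.eval_cup]
    | ha x y hx hy => rw [map_add, map_add, map_add, cellCup_add_right, hx, hy]
  | ha x y hx hy =>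
    rw [map_add, LinearMap.add_apply, map_add, map_add, cellCup_add_left, hx, hy]

theorem toCell_signA (x : Cochains R Q) :
    toCell R Q (signA R Q x) = cellParity (toCell R Q x) := by
  induction x using cochains_induction with
  | h0 => funext τ; simp [cellParity]
  | h n a =>
    funext τ
    rw [signA_homog, map_smul, toCell_homog, cellParity, Pi.smul_apply, smul_eq_mul]
    by_cases h : τ.1 = n
    · rw [h]
    · rw [a.eval_of_dim h]; simp
  | ha x y hx hy => funext τ; rw [map_add, map_add, map_add, hx, hy]; simp [cellParity]; ring

theorem mulA_assoc (x y z : Cochains R Q) :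
    mulA R Q (mulA R Q x y) z = mulA R Q x (mulA R Q y z) :=
  toCell_injective (by simp only [toCell_mulA, cellCup_assoc])

theorem deltaA_mulA (x y : Cochains R Q) : deltaA R Q (mulA R Q x y) =
    mulA R Q (deltaA R Q x) y + mulA R Q (signA R Q x) (deltaA R Q y) :=
  toCell_injective (by
    simp only [toCell_mulA, toCell_deltaA, toCell_signA, map_add, cellDelta_cellCup])

theorem deltaA_deltaA (x : Cochains R Q) : deltaA R Q (deltaA R Q x) = 0 :=
  toCell_injective (by simp only [toCell_deltaA, cellDelta_cellDelta, map_zero])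

theorem signA_signA (x : Cochains R Q) : signA R Q (signA R Q x) = x := by
  induction x using cochains_induction with
  | h0 => simp
  | h n a => rw [signA_homog, map_smul, signA_homog, smul_smul, ← mul_pow]; simp
  | ha x y hx hy => rw [map_add, map_add, hx, hy]

theorem deltaA_signA (x : Cochains R Q) : deltaA R Q (signA R Q x) = -signA R Q (deltaA R Q x) := by
  induction x using cochains_induction with
  | h0 => simp
  | h n a =>
    rw [signA_homog, map_smul, deltaA_homog, signA_homog, pow_succ, mul_neg_one]
    exact neg_eq_iff_eq_neg.1 (neg_smul ((-1 : R) ^ n) (homog a.coboundary)).symm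
  | ha x y hx hy => rw [map_add, map_add, map_add, map_add, hx, hy]; abel

theorem signA_mulA (x y : Cochains R Q) :
    signA R Q (mulA R Q x y) = mulA R Q (signA R Q x) (signA R Q y) := by
  induction x using cochains_induction with
  | h0 => simp
  | h n a =>
    induction y using cochains_induction with
    | h0 => simp
    | h m b =>
      rw [mulA_homog, signA_homog, signA_homog, signA_homog, map_smul, map_smul,
        LinearMap.smul_apply, mulA_homog, smul_smul, pow_add, mul_comm]
    | ha x y hx hy => simp only [map_add, hx, hy]
  | ha x y hx hy => simp only [map_add, LinearMap.add_apply, hx, hy]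

theorem susp_deltaB (x : BarCochains R Q) : susp R Q (deltaB R Q x) = deltaA R Q (susp R Q x) := by
  induction x using barCochains_induction with
  | h0 => simp
  | h a => rw [deltaB_elem, susp_elem, susp_elem, deltaA_homog]; rfl
  | ha x y hx hy => simp only [map_add, hx, hy]

/-- The desuspended degree is one less, hence the minus sign. -/
theorem susp_signB (x : BarCochains R Q) : susp R Q (signB R Q x) = -signA R Q (susp R Q x) := by
  induction x using barCochains_induction with
  | h0 => simp
  | h a =>
    rw [signB_elem, map_smul, susp_elem, signA_homog, pow_succ, mul_neg_one]
    exact neg_eq_iff_eq_neg.1 (neg_smul ((-1 : R) ^ a.1) (homog a.2)).symm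
  | ha x y hx hy => simp only [map_add, hx, hy]; abel

theorem susp_mulB (x y : BarCochains R Q) :
    susp R Q (mulB R Q x y) = mulA R Q (susp R Q x) (susp R Q y) := by
  induction x using barCochains_induction with
  | h0 => simp
  | h a =>
    induction y using barCochains_induction with
    | h0 => simp
    | h b =>
      rw [mulB_elem, susp_elem, susp_elem, susp_elem, mulA_homog]
      exact homog_eq_of_eval (by exact (Cochain.eval_cup (p := a.1 + 1) (q := b.1 + 1) a.2 b.2).trans (Cochain.eval_cup _ _).symm)
    | ha x y hx hy => simp only [map_add, hx, hy]
  | ha x y hx hy => simp only [map_add, LinearMap.add_apply, hx, hy]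

theorem mulB_assoc (x y z : BarCochains R Q) :
    mulB R Q (mulB R Q x y) z = mulB R Q x (mulB R Q y z) :=
  susp_injective (by simp only [susp_mulB, mulA_assoc])

theorem deltaB_mulB (x y : BarCochains R Q) : deltaB R Q (mulB R Q x y) =
    mulB R Q (deltaB R Q x) y - mulB R Q (signB R Q x) (deltaB R Q y) :=
  susp_injective (by
    simp only [susp_mulB, susp_deltaB, susp_signB, map_sub, deltaA_mulA, map_neg,
      LinearMap.neg_apply, sub_neg_eq_add])

theorem deltaB_deltaB (x : BarCochains R Q) : deltaB R Q (deltaB R Q x) = 0 :=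
  susp_injective (by simp only [susp_deltaB, deltaA_deltaA, map_zero])

theorem signB_signB (x : BarCochains R Q) : signB R Q (signB R Q x) = x :=
  susp_injective (by simp only [susp_signB, map_neg, neg_neg, signA_signA])

theorem deltaB_signB (x : BarCochains R Q) : deltaB R Q (signB R Q x) = -signB R Q (deltaB R Q x) :=
  susp_injective (by simp only [susp_signB, susp_deltaB, map_neg, deltaA_signA])

theorem signB_mulB (x y : BarCochains R Q) :
    signB R Q (mulB R Q x y) = -mulB R Q (signB R Q x) (signB R Q y) :=
  susp_injective (by
    simp only [susp_signB, susp_mulB, map_neg, signA_mulA, LinearMap.neg_apply, neg_neg])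

end Algebra

/-! ### Multilinear functions of words -/

section Multilinear

variable {R : Type v} [CommRing R] {Q : CubicalSet.{u}}
variable {M N : Type*} [AddCommGroup M] [Module R M] [AddCommGroup N] [Module R N]

/-- A function of words that is linear in each letter. -/
def IsMultilinear (F : List (BarLetter R Q) → M) : Prop :=
  ∀ (x : List (BarLetter R Q)) (n : ℕ) (r : R) (a b : Cochain R Q (n + 1)) (y : List (BarLetter R Q)),
    F (x ++ ⟨n, a + r • b⟩ :: y) = F (x ++ ⟨n, a⟩ :: y) + r • F (x ++ ⟨n, b⟩ :: y)

variable {F G : List (BarLetter R Q) → M}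

theorem IsMultilinear.cons (hF : IsMultilinear F) (c : BarLetter R Q) :
    IsMultilinear fun l => F (c :: l) := fun x n r a b y => hF (c :: x) n r a b y

theorem IsMultilinear.head (hF : IsMultilinear F) (n : ℕ) (r : R) (a b : Cochain R Q (n + 1))
    (y : List (BarLetter R Q)) : F (⟨n, a + r • b⟩ :: y) = F (⟨n, a⟩ :: y) + r • F (⟨n, b⟩ :: y) :=
  hF [] n r a b y

theorem IsMultilinear.map (hF : IsMultilinear F) (g : M →ₗ[R] N) : IsMultilinear fun l => g (F l) :=
  fun x n r a b y => by beta_reduce; rw [hF, map_add, map_smul]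

theorem IsMultilinear.add (hF : IsMultilinear F) (hG : IsMultilinear G) :
    IsMultilinear fun l => F l + G l := fun x n r a b y => by
  beta_reduce; rw [hF, hG, smul_add]; abel

theorem isMultilinear_zero : IsMultilinear fun _ : List (BarLetter R Q) => (0 : M) :=
  fun x n r a b y => by simp

theorem barDegree_letter (x y : List (BarLetter R Q)) {n : ℕ} (a b : Cochain R Q (n + 1)) :
    barDegree (x ++ ⟨n, a⟩ :: y) = barDegree (x ++ ⟨n, b⟩ :: y) := by
  simp [barDegree_append, barDegree_cons]

theorem IsMultilinear.smul_degree (hF : IsMultilinear F) (e : ℕ → R) :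
    IsMultilinear fun l => e (barDegree l) • F l := fun x n r a b y => by
  beta_reduce
  rw [hF, barDegree_letter x y (a + r • b) a, barDegree_letter x y b a, smul_add, smul_comm r]

theorem IsMultilinear.smul (hF : IsMultilinear F) (e : R) : IsMultilinear fun l => e • F l :=
  hF.smul_degree fun _ => e

theorem isMultilinear_splitSum {F : List (BarLetter R Q) → List (BarLetter R Q) → M}
    (h1 : ∀ y, IsMultilinear fun x => F x y) (h2 : ∀ x, IsMultilinear (F x)) :
    IsMultilinear (splitSum F) := by
  intro x n r a b y
  induction x generalizing F with
  | nil =>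
    simp only [List.nil_append, splitSum]
    have : ∀ x y, F (⟨n, a + r • b⟩ :: x) y = F (⟨n, a⟩ :: x) y + r • F (⟨n, b⟩ :: x) y :=
      fun x y => (h1 y).head n r a b x
    simp only [this, splitSum_add, splitSum_smul, (h2 []).head, smul_add]
    abel
  | cons c x ih =>
    simp only [List.cons_append, splitSum, smul_add]
    rw [ih (fun y => (h1 y).cons c) fun x => h2 (c :: x)]
    have := h2 [] (c :: x) n r a b y
    simp only [List.cons_append] at this
    rw [this]
    abel

theorem BarLetter.coboundary_add_smul {n : ℕ} (r : R) (a b : Cochain R Q (n + 1)) :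
    BarLetter.coboundary ⟨n, a + r • b⟩ = ⟨n + 1, a.coboundary + r • b.coboundary⟩ := by
  rw [BarLetter.coboundary, coboundary_add, coboundary_smul]

theorem BarLetter.cup_add_smul_left {n : ℕ} (r : R) (a b : Cochain R Q (n + 1)) (c : BarLetter R Q) :
    BarLetter.cup ⟨n, a + r • b⟩ c = ⟨n + 1 + c.1,
      Cochain.cup (p := n + 1) (q := c.1 + 1) a c.2 +
        r • Cochain.cup (p := n + 1) (q := c.1 + 1) b c.2⟩ := by
  rw [BarLetter.cup, cup_add_left, cup_smul_left]

theorem BarLetter.cup_add_smul_right {n : ℕ} (r : R) (a b : Cochain R Q (n + 1)) (c : BarLetter R Q) :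
    BarLetter.cup c ⟨n, a + r • b⟩ = ⟨c.1 + 1 + n,
      Cochain.cup (p := c.1 + 1) (q := n + 1) c.2 a +
        r • Cochain.cup (p := c.1 + 1) (q := n + 1) c.2 b⟩ := by
  rw [BarLetter.cup, cup_add_right, cup_smul_right]

theorem IsMultilinear.cup_left (hF : IsMultilinear F) (n : ℕ) (r : R) (a b : Cochain R Q (n + 1))
    (c : BarLetter R Q) (y : List (BarLetter R Q)) : F (BarLetter.cup ⟨n, a + r • b⟩ c :: y) =
      F (BarLetter.cup ⟨n, a⟩ c :: y) + r • F (BarLetter.cup ⟨n, b⟩ c :: y) := by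
  rw [BarLetter.cup_add_smul_left]
  exact hF.head _ _ _ _ _

theorem IsMultilinear.cup_right (hF : IsMultilinear F) (n : ℕ) (r : R) (a b : Cochain R Q (n + 1))
    (c : BarLetter R Q) (y : List (BarLetter R Q)) : F (BarLetter.cup c ⟨n, a + r • b⟩ :: y) =
      F (BarLetter.cup c ⟨n, a⟩ :: y) + r • F (BarLetter.cup c ⟨n, b⟩ :: y) := by
  rw [BarLetter.cup_add_smul_right]
  exact hF.head _ _ _ _ _

theorem IsMultilinear.coboundary (hF : IsMultilinear F) (n : ℕ) (r : R) (a b : Cochain R Q (n + 1))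
    (y : List (BarLetter R Q)) : F (BarLetter.coboundary ⟨n, a + r • b⟩ :: y) =
      F (BarLetter.coboundary ⟨n, a⟩ :: y) + r • F (BarLetter.coboundary ⟨n, b⟩ :: y) := by
  rw [BarLetter.coboundary_add_smul]
  exact hF.head _ _ _ _ _

theorem IsMultilinear.listDiff (hF : IsMultilinear F) : IsMultilinear (listDiff F) := by
  intro x n r a b y
  induction x generalizing F with
  | nil =>
    obtain _ | ⟨c, y⟩ := y
    · simp only [List.nil_append, CubicalBar.listDiff, hF.coboundary, smul_neg]
      abel
    · simp only [List.nil_append, CubicalBar.listDiff, hF.coboundary, hF.cup_left]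
      have : ∀ l, F (⟨n, a + r • b⟩ :: l) = F (⟨n, a⟩ :: l) + r • F (⟨n, b⟩ :: l) :=
        hF.head n r a b
      simp only [this, listDiff_add, listDiff_smul]
      module
  | cons c x ih =>
    obtain _ | ⟨d, x⟩ := x
    · simp only [List.nil_append, List.cons_append, CubicalBar.listDiff, hF.cup_right]
      have h1 := hF [c.coboundary] n r a b y
      have h2 := ih (hF.cons c)
      simp only [List.nil_append, List.cons_append] at h1 h2
      rw [h1, h2]
      module
    · have h1 := hF (c.coboundary :: d :: x) n r a b y
      have h2 := ih (hF.cons c)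
      have h3 := hF (c.cup d :: x) n r a b y
      simp only [List.cons_append, CubicalBar.listDiff] at h1 h2 h3 ⊢
      rw [h1, h2, h3]
      module

theorem barWord_nil : barWord ([] : List (BarLetter R Q)) = 1 := rfl

theorem barWord_cons (a : BarLetter R Q) (l : List (BarLetter R Q)) :
    barWord (a :: l) = TensorAlgebra.ι R a.elem * barWord l := by
  rw [barWord, List.map_cons, List.prod_cons]; rfl

theorem barWord_append (x y : List (BarLetter R Q)) : barWord (x ++ y) = barWord x * barWord y := by
  rw [barWord, List.map_append, List.prod_append]; rfl

theorem isMultilinear_barWord : IsMultilinear (barWord : List (BarLetter R Q) → Bar R Q) := by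
  intro x n r a b y
  rw [barWord_append, barWord_append, barWord_append, barWord_cons, barWord_cons, barWord_cons,
    BarLetter.elem_add, BarLetter.elem_smul, map_add, map_smul, add_mul, mul_add, smul_mul_assoc,
    mul_smul_comm]

theorem span_barWord : Submodule.span R (Set.range (barWord : List (BarLetter R Q) → Bar R Q)) = ⊤ := by
  rw [eq_top_iff]
  rintro z -
  induction z using TensorAlgebra.induction with
  | algebraMap r =>
    rw [Algebra.algebraMap_eq_smul_one]
    exact Submodule.smul_mem _ _ (Submodule.subset_span ⟨[], rfl⟩)
  | ι z =>
    induction z using barCochains_induction with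
    | h0 => simp
    | h a => exact Submodule.subset_span ⟨[a], by rw [barWord_cons, barWord_nil, mul_one]⟩
    | ha x y hx hy => rw [map_add]; exact add_mem hx hy
  | mul a b ha hb =>
    refine Submodule.span_induction₂ (p := fun a b _ _ => a * b ∈ Submodule.span R
      (Set.range (barWord : List (BarLetter R Q) → Bar R Q))) ?_ ?_ ?_ ?_ ?_ ?_ ?_ ha hb
    · rintro _ _ ⟨x, rfl⟩ ⟨y, rfl⟩
      exact Submodule.subset_span ⟨x ++ y, barWord_append x y⟩
    · intro y _; rw [zero_mul]; exact zero_mem _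
    · intro y _; rw [mul_zero]; exact zero_mem _
    · intro x y z _ _ _ h h'; rw [add_mul]; exact add_mem h h'
    · intro x y z _ _ _ h h'; rw [mul_add]; exact add_mem h h'
    · intro r x y _ _ h; rw [smul_mul_assoc]; exact Submodule.smul_mem _ _ h
    · intro r x y _ _ h; rw [mul_smul_comm]; exact Submodule.smul_mem _ _ h
  | add a b ha hb => exact add_mem ha hb

theorem bar_hom_ext {f g : Bar R Q →ₗ[R] M} (h : ∀ l, f (barWord l) = g (barWord l)) : f = g :=
  LinearMap.ext_on_range span_barWord h

theorem bar_induction {p : Bar R Q → Prop} (z : Bar R Q) (h : ∀ l, p (barWord l))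
    (ha : ∀ x y, p x → p y → p (x + y)) (hs : ∀ (r : R) x, p x → p (r • x)) : p z := by
  have hz : z ∈ Submodule.span R (Set.range (barWord : List (BarLetter R Q) → Bar R Q)) := by
    rw [span_barWord]; trivial
  refine Submodule.span_induction (p := fun z _ => p z) ?_ ?_ (fun x y _ _ => ha x y)
    (fun r x _ => hs r x) hz
  · rintro _ ⟨l, rfl⟩; exact h l
  · simpa using hs 0 _ (h [])

variable (R Q M)

/-- The module of multilinear functions of words. -/
def multilinearFunctions : Submodule R (List (BarLetter R Q) → M) where
  carrier := {F | IsMultilinear F}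
  add_mem' := fun h h' => h.add h'
  zero_mem' := isMultilinear_zero
  smul_mem' := fun r _ h => h.smul r

/-- Inserting a first letter. -/
def consOp : BarCochains R Q →ₗ[R] Module.End R (multilinearFunctions R Q M) :=
  DirectSum.toModule R ℕ _ fun n => LinearMap.mk₂ R
    (fun (a : Cochain R Q (n + 1)) (F : multilinearFunctions R Q M) =>
      (⟨fun l => F.1 (⟨n, a⟩ :: l), F.2.cons ⟨n, a⟩⟩ : multilinearFunctions R Q M))
    (fun a b F => Subtype.ext (funext fun l => by
      have := F.2.head n 1 a b l
      simpa using this))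
    (fun r a F => Subtype.ext (funext fun l => by
      -- Applied to `a + (-1) • a`, the combined law shows that the function vanishes at the zero
      -- letter; it then yields homogeneity.
      have h0 := F.2.head n (-1) a a l
      have := F.2.head n r 0 a l
      simp only [neg_smul, one_smul, add_neg_cancel] at h0
      rw [zero_add, h0, zero_add] at this
      exact this))
    (fun a F G => rfl) (fun r a F => rfl)

variable {R Q M}

theorem consOp_elem (a : BarLetter R Q) (F : multilinearFunctions R Q M) (l : List (BarLetter R Q)) :
    (consOp R Q M a.elem F).1 l = F.1 (a :: l) := by
  rw [consOp, BarLetter.elem, DirectSum.toModule_lof]; rfl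

/-- The linear map on the bar construction given by a multilinear function of words. -/
def listLift (F : List (BarLetter R Q) → M) (hF : IsMultilinear F) : Bar R Q →ₗ[R] M :=
  LinearMap.proj [] ∘ₗ (multilinearFunctions R Q M).subtype ∘ₗ
    LinearMap.applyₗ (⟨F, hF⟩ : multilinearFunctions R Q M) ∘ₗ
    (MulOpposite.opLinearEquiv R).symm.toLinearMap ∘ₗ
    (TensorAlgebra.lift R ((MulOpposite.opLinearEquiv R).toLinearMap ∘ₗ consOp R Q M)).toLinearMap

/-- The operator of the first letter has to act first, which reverses composition. This is why the
universal property of the tensor algebra is applied with values in the opposite endomorphism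
algebra. The auxiliary word `m` makes the induction go through. -/
theorem listLift_barWord (F : List (BarLetter R Q) → M) (hF : IsMultilinear F)
    (l : List (BarLetter R Q)) : listLift F hF (barWord l) = F l := by
  let Φ := TensorAlgebra.lift R ((MulOpposite.opLinearEquiv R).toLinearMap ∘ₗ consOp R Q M)
  suffices ∀ (l m : List (BarLetter R Q)) (F : multilinearFunctions R Q M),
      (MulOpposite.unop (Φ (barWord l)) F).1 m = F.1 (l ++ m) by
    have := this l [] ⟨F, hF⟩
    rwa [List.append_nil] at this
  intro l
  induction l with
  | nil => intro m F; rw [barWord_nil, map_one]; rfl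
  | cons a l ih =>
    intro m F
    rw [barWord_cons, map_mul, TensorAlgebra.lift_ι_apply, MulOpposite.unop_mul, Module.End.mul_apply,
      ih]
    exact consOp_elem a F _

end Multilinear

/-! ### The bar construction -/

section BarConstruction

variable (R : Type v) [CommRing R] (Q : CubicalSet.{u})

variable {R Q} in
/-- A word as a first letter and the remaining word. -/
def unconsWord : List (BarLetter R Q) → BarCochains R Q ⊗[R] Bar R Q
  | [] => 0
  | a :: l => a.elem ⊗ₜ[R] barWord l

variable {R Q} in
theorem isMultilinear_unconsWord : IsMultilinear (unconsWord (R := R) (Q := Q)) := by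
  intro x n r a b y
  obtain _ | ⟨c, x⟩ := x
  · simp only [List.nil_append, unconsWord]
    rw [BarLetter.elem_add, BarLetter.elem_smul, TensorProduct.add_tmul, TensorProduct.smul_tmul']
  · simp only [List.cons_append, unconsWord]
    rw [isMultilinear_barWord, TensorProduct.tmul_add, TensorProduct.tmul_smul]

/-- Splitting off the first letter. -/
def uncons : Bar R Q →ₗ[R] BarCochains R Q ⊗[R] Bar R Q := listLift _ isMultilinear_unconsWord

/-- The differential of the bar construction. -/
def diffB : Bar R Q →ₗ[R] Bar R Q := listLift _ (isMultilinear_barWord (R := R) (Q := Q)).listDiff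

variable {R Q}

theorem uncons_one : uncons R Q 1 = 0 := listLift_barWord _ _ []

theorem uncons_mul (x : BarCochains R Q) (w : Bar R Q) :
    uncons R Q (TensorAlgebra.ι R x * w) = x ⊗ₜ[R] w := by
  induction w using bar_induction with
  | h l =>
    induction x using barCochains_induction with
    | h0 => simp
    | h a => rw [← barWord_cons]; exact listLift_barWord _ _ _
    | ha x y hx hy => rw [map_add, add_mul, map_add, hx, hy, TensorProduct.add_tmul]
  | ha x y hx hy => rw [mul_add, map_add, hx, hy, TensorProduct.tmul_add]
  | hs r x hx => rw [mul_smul_comm, map_smul, hx, TensorProduct.tmul_smul]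

variable (R Q) in
/-- The multiplication of the first letter by a cochain of positive degree. -/
def headMul : BarCochains R Q →ₗ[R] Bar R Q →ₗ[R] Bar R Q :=
  LinearMap.mk₂ R (fun x w =>
    TensorProduct.lift ((LinearMap.mul R (Bar R Q)) ∘ₗ TensorAlgebra.ι R ∘ₗ mulB R Q x) (uncons R Q w))
    (fun x y w => by
      rw [← LinearMap.add_apply]; congr 1; ext; simp)
    (fun r x w => by
      rw [← LinearMap.smul_apply]; congr 1; ext; simp)
    (fun x w w' => by rw [map_add, map_add]) (fun r x w => by rw [map_smul, map_smul])

theorem headMul_one (x : BarCochains R Q) : headMul R Q x 1 = 0 := by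
  rw [headMul, LinearMap.mk₂_apply, uncons_one, map_zero]

theorem headMul_mul (x y : BarCochains R Q) (w : Bar R Q) :
    headMul R Q x (TensorAlgebra.ι R y * w) = TensorAlgebra.ι R (mulB R Q x y) * w := by
  rw [headMul, LinearMap.mk₂_apply, uncons_mul]; rfl

theorem diffB_barWord (l : List (BarLetter R Q)) : diffB R Q (barWord l) = listDiff barWord l :=
  listLift_barWord _ _ l

theorem diffB_one : diffB R Q 1 = 0 := diffB_barWord []

/-- The first letter is differentiated, multiplied into the next letter, or passed with its sign.
All later computations with the bar differential use this recursion. -/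
theorem diffB_mul (x : BarCochains R Q) (w : Bar R Q) :
    diffB R Q (TensorAlgebra.ι R x * w) = -(TensorAlgebra.ι R (deltaB R Q x) * w) -
      headMul R Q (signB R Q x) w + TensorAlgebra.ι R (signB R Q x) * diffB R Q w := by
  induction w using bar_induction with
  | h l =>
    induction x using barCochains_induction with
    | h0 => simp
    | h a =>
      rw [← barWord_cons, diffB_barWord, diffB_barWord, deltaB_elem, signB_elem]
      obtain _ | ⟨b, l⟩ := l
      · rw [barWord_nil, map_smul, LinearMap.smul_apply, headMul_one]
        simp [listDiff, barWord_cons, barWord_nil]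
      · rw [listDiff, barWord_cons b, map_smul, LinearMap.smul_apply, headMul_mul, mulB_elem,
          barWord_cons, barWord_cons, barWord_cons, map_smul, smul_mul_assoc]
        have := map_listDiff (LinearMap.mulLeft R (TensorAlgebra.ι R a.elem)) barWord (b :: l)
        rw [LinearMap.mulLeft_apply] at this
        rw [this]
        simp only [barWord_cons, LinearMap.mulLeft_apply]
    | ha x y hx hy => simp only [map_add, add_mul, LinearMap.add_apply, hx, hy]; abel
  | ha x y hx hy => simp only [map_add, mul_add, hx, hy]; abel
  | hs r x hx => simp only [map_smul, mul_smul_comm, hx, smul_add, smul_sub, smul_neg]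

theorem headMul_headMul (x y : BarCochains R Q) (w : Bar R Q) :
    headMul R Q x (headMul R Q y w) = headMul R Q (mulB R Q x y) w := by
  induction w using bar_induction with
  | h l =>
    obtain _ | ⟨c, l⟩ := l
    · rw [barWord_nil, headMul_one, headMul_one, map_zero]
    · rw [barWord_cons, headMul_mul, headMul_mul, headMul_mul, mulB_assoc]
  | ha x y hx hy => simp only [map_add, hx, hy]
  | hs r x hx => simp only [map_smul, hx]

/-- The first two letters are exposed, since two differentials can merge the first three. The terms
then cancel by `δ² = 0`, the Leibniz rule and associativity of the product of cochains. -/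
theorem diffB_diffB (w : Bar R Q) : diffB R Q (diffB R Q w) = 0 := by
  induction w using bar_induction with
  | h l =>
    induction l with
    | nil => rw [barWord_nil, diffB_one, map_zero]
    | cons a l ih =>
      rw [barWord_cons]
      obtain _ | ⟨b, l⟩ := l
      · rw [barWord_nil, diffB_mul, diffB_one, headMul_one, mul_zero, sub_zero, add_zero, map_neg,
          diffB_mul, deltaB_deltaB, diffB_one, headMul_one]
        simp
      · have h := diffB_mul b.elem (barWord l)
        rw [← barWord_cons] at h
        rw [diffB_mul, map_add, map_sub, map_neg, diffB_mul, diffB_mul, ih, deltaB_deltaB,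
          signB_signB, deltaB_signB, h, barWord_cons]
        simp only [headMul_mul, map_add, map_sub, map_neg, diffB_mul, deltaB_mulB, headMul_headMul,
          signB_mulB, signB_signB, deltaB_signB, LinearMap.neg_apply]
        simp only [mul_add, mul_sub, mul_neg, sub_mul, neg_mul, map_zero, zero_mul, mul_zero]
        abel
  | ha x y hx hy => rw [map_add, map_add, hx, hy, add_zero]
  | hs r x hx => rw [map_smul, map_smul, hx, smul_zero]

end BarConstruction

/-! ### Sums over the ways to cut two lists -/

section BiSplit

variable {R : Type v} [CommRing R] {Q : CubicalSet.{u}}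
variable {M N : Type*} [AddCommGroup M] [Module R M] [AddCommGroup N] [Module R N]

/-- The sum of `G x y z w` over all ways to write two lists as `x ++ y` and `z ++ w`. -/
def biSplit {α : Type*} (G : List α → List α → List α → List α → M) (l m : List α) : M :=
  splitSum (fun x y => splitSum (fun z w => G x y z w) m) l

section General

variable {α : Type*} {G H : List α → List α → List α → List α → M} {l m : List α}

theorem biSplit_congr (h : ∀ x y z w, x ++ y = l → z ++ w = m → G x y z w = H x y z w) :
    biSplit G l m = biSplit H l m :=
  splitSum_congr fun x y hx => splitSum_congr fun z w hz => h x y z w hx hz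

theorem biSplit_add (G H : List α → List α → List α → List α → M) (l m : List α) :
    biSplit (fun x y z w => G x y z w + H x y z w) l m = biSplit G l m + biSplit H l m := by
  simp only [biSplit, splitSum_add]

theorem biSplit_neg (G : List α → List α → List α → List α → M) (l m : List α) :
    biSplit (fun x y z w => -G x y z w) l m = -biSplit G l m := by
  simp only [biSplit, splitSum_neg]

theorem biSplit_sub (G H : List α → List α → List α → List α → M) (l m : List α) :
    biSplit (fun x y z w => G x y z w - H x y z w) l m = biSplit G l m - biSplit H l m := by
  simp only [sub_eq_add_neg, biSplit_add, biSplit_neg]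

theorem biSplit_smul (r : R) (G : List α → List α → List α → List α → M) (l m : List α) :
    biSplit (fun x y z w => r • G x y z w) l m = r • biSplit G l m := by
  simp only [biSplit, splitSum_smul]

theorem map_biSplit (g : M →ₗ[R] N) (G : List α → List α → List α → List α → M) (l m : List α) :
    g (biSplit G l m) = biSplit (fun x y z w => g (G x y z w)) l m := by
  simp only [biSplit, map_splitSum]

/-- Both sides cut each of the two lists into three pieces. -/
theorem biSplit_assoc (F : List α → List α → List α → List α → List α → List α → M)
    (l m : List α) :
    biSplit (fun x y z w => biSplit (fun p q r s => F p q y r s w) x z) l m =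
      biSplit (fun x y z w => biSplit (fun p q r s => F x p q z r s) y w) l m := by
  have e1 := fun x y => splitSum_comm (fun z w p q => splitSum (fun r s => F p q y r s w) z) m x
  have e2 := fun x y => splitSum_comm (fun z w p q => splitSum (fun r s => F x p q z r s) w) m y
  simp only [biSplit, e1, e2]
  rw [splitSum_assoc fun p q y => splitSum (fun z w => splitSum (fun r s => F p q y r s w) z) m]
  simp only [splitSum_assoc (l := m)]

end General

theorem isMultilinear_splitSum_param {F : List (BarLetter R Q) → List (BarLetter R Q) →
    List (BarLetter R Q) → M} (h : ∀ z w, IsMultilinear fun x => F x z w)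
    (m : List (BarLetter R Q)) : IsMultilinear fun x => splitSum (F x) m := by
  intro x n r a b y
  have := fun z w => h z w x n r a b y
  beta_reduce at this ⊢
  rw [← splitSum_smul, ← splitSum_add]
  exact splitSum_congr fun z w _ => this z w

theorem isMultilinear_biSplit_left {G : List (BarLetter R Q) → List (BarLetter R Q) →
    List (BarLetter R Q) → List (BarLetter R Q) → M} (h1 : ∀ y z w, IsMultilinear fun x => G x y z w)
    (h2 : ∀ x z w, IsMultilinear fun y => G x y z w) (m : List (BarLetter R Q)) :
    IsMultilinear fun l => biSplit G l m :=
  isMultilinear_splitSum (fun y => isMultilinear_splitSum_param (fun z w => h1 y z w) m)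
    fun x => isMultilinear_splitSum_param (fun z w => h2 x z w) m

theorem isMultilinear_biSplit_right {G : List (BarLetter R Q) → List (BarLetter R Q) →
    List (BarLetter R Q) → List (BarLetter R Q) → M} (h1 : ∀ x y w, IsMultilinear fun z => G x y z w)
    (h2 : ∀ x y z, IsMultilinear fun w => G x y z w) (l : List (BarLetter R Q)) :
    IsMultilinear fun m => biSplit G l m :=
  isMultilinear_splitSum_param (F := fun m x y => splitSum (fun z w => G x y z w) m)
    (fun x y => isMultilinear_splitSum (fun w => h1 x y w) fun z => h2 x y z) l

/-- The bar differential is a coderivation for cutting: it replaces one letter or two neighbours by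
a single letter, which lies in one piece of any cut of the new word. -/
theorem listDiff_splitSum (G : List (BarLetter R Q) → List (BarLetter R Q) → M)
    (l : List (BarLetter R Q)) : listDiff (splitSum G) l =
      splitSum (fun x y => listDiff (fun x' => G x' y) x +
        (-1 : R) ^ barDegree x • listDiff (G x) y) l := by
  induction l generalizing G with
  | nil => simp [listDiff, splitSum]
  | cons a l ih =>
    obtain _ | ⟨b, l⟩ := l
    · simp [listDiff, splitSum]
      abel
    · have e : (fun x => splitSum G (a :: x)) =
          fun x => G [] (a :: x) + splitSum (fun x y => G (a :: x) y) x := rfl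
      rw [listDiff, e, listDiff_add, ih]
      simp only [splitSum, listDiff, splitSum_add, splitSum_smul, splitSum_neg, barDegree_cons,
        pow_add, mul_smul, barDegree_nil, sub_eq_add_neg, pow_zero, one_smul]
      module

theorem splitSum_param_listDiff {α : Type*} (F : List (BarLetter R Q) → List α → List α → M)
    (m : List α) (l : List (BarLetter R Q)) :
    listDiff (fun x => splitSum (F x) m) l =
      splitSum (fun z w => listDiff (fun x => F x z w) l) m := by
  induction m generalizing F with
  | nil => rfl
  | cons a m ih => simp only [splitSum, listDiff_add, ih]

theorem listDiff_biSplit_left (G : List (BarLetter R Q) → List (BarLetter R Q) →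
    List (BarLetter R Q) → List (BarLetter R Q) → M) (l m : List (BarLetter R Q)) :
    listDiff (fun l => biSplit G l m) l =
      biSplit (fun x y z w => listDiff (fun x' => G x' y z w) x +
        (-1 : R) ^ barDegree x • listDiff (fun y' => G x y' z w) y) l m := by
  simp only [biSplit]
  rw [show (fun l => splitSum (fun x y => splitSum (fun z w => G x y z w) m) l) =
    splitSum (fun x y => splitSum (fun z w => G x y z w) m) from rfl, listDiff_splitSum]
  simp only [splitSum_param_listDiff, splitSum_add, splitSum_smul]

theorem listDiff_biSplit_right (G : List (BarLetter R Q) → List (BarLetter R Q) →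
    List (BarLetter R Q) → List (BarLetter R Q) → M) (l m : List (BarLetter R Q)) :
    listDiff (fun m => biSplit G l m) m =
      biSplit (fun x y z w => listDiff (fun z' => G x y z' w) z +
        (-1 : R) ^ barDegree z • listDiff (fun w' => G x y z w') w) l m := by
  simp only [biSplit]
  rw [splitSum_param_listDiff (fun m x y => splitSum (fun z w => G x y z w) m)]
  refine splitSum_congr fun x y _ => ?_
  exact listDiff_splitSum (fun z w => G x y z w) m

/-- Every term of the differential raises the degree of the word by one. -/
theorem listDiff_sign (k : ℕ) (F : List (BarLetter R Q) → M) (l : List (BarLetter R Q)) :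
    listDiff (fun x => (-1 : R) ^ (k * barDegree x) • F x) l =
      (-1 : R) ^ (k * (barDegree l + 1)) • listDiff F l := by
  induction l generalizing F with
  | nil => simp [listDiff]
  | cons a l ih =>
    obtain _ | ⟨b, l⟩ := l
    · simp [listDiff, BarLetter.coboundary, barDegree_cons]
    · have e : (fun x => (-1 : R) ^ (k * barDegree (a :: x)) • F (a :: x)) =
          fun x => (-1 : R) ^ (k * a.1) • ((-1 : R) ^ (k * barDegree x) • F (a :: x)) := by
        funext x
        rw [barDegree_cons, mul_add, pow_add, mul_smul]
      rw [listDiff, e, listDiff_smul, ih, listDiff]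
      have h1 : barDegree (a.coboundary :: b :: l) = barDegree (a :: b :: l) + 1 := by
        simp only [barDegree_cons, BarLetter.coboundary]; ring
      have h2 : barDegree (a.cup b :: l) = barDegree (a :: b :: l) + 1 := by
        simp only [barDegree_cons, BarLetter.cup]; ring
      have h3 : barDegree (a :: b :: l) = a.1 + barDegree (b :: l) := barDegree_cons _ _
      rw [h1, h2, smul_add, smul_sub, smul_neg, smul_comm ((-1 : R) ^ a.1),
        smul_comm ((-1 : R) ^ a.1), h3]
      simp only [mul_add, pow_add, mul_smul]
      module

end BiSplit

/-! ### The Hirsch operations as elements of the desuspension -/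

section Hirsch

variable {R : Type v} [CommRing R] {Q : CubicalSet.{u}}

theorem evalWord_multilinear (x : List (BarLetter R Q)) (n : ℕ) (r : R) (a b : Cochain R Q (n + 1))
    (y : List (BarLetter R Q)) (w : List Q.Cell) : evalWord (x ++ ⟨n, a + r • b⟩ :: y) w =
      evalWord (x ++ ⟨n, a⟩ :: y) w + r * evalWord (x ++ ⟨n, b⟩ :: y) w := by
  induction x generalizing w with
  | nil =>
    obtain _ | ⟨τ, w⟩ := w
    · simp [evalWord]
    · simp only [List.nil_append, evalWord, Cochain.eval_add, Cochain.eval_smul, Pi.add_apply,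
        Pi.smul_apply, smul_eq_mul]
      ring
  | cons c x ih =>
    obtain _ | ⟨τ, w⟩ := w
    · simp [evalWord]
    · simp only [List.cons_append, evalWord, ih]
      ring

/-- The Hirsch operation as an element of the desuspension. -/
def hirschB (as bs : List (BarLetter R Q)) : BarCochains R Q :=
  BarLetter.elem ⟨barDegree as + barDegree bs, hirsch as bs⟩

theorem toCell_susp_hirschB (as bs : List (BarLetter R Q)) :
    toCell R Q (susp R Q (hirschB as bs)) = hirschCell as bs := by
  rw [hirschB, susp_elem, toCell_homog]; rfl

theorem toCell_susp_injective : Function.Injective fun x => toCell R Q (susp R Q x) :=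
  toCell_injective.comp susp_injective

theorem signB_hirschB (as bs : List (BarLetter R Q)) :
    signB R Q (hirschB as bs) = (-1 : R) ^ (barDegree as + barDegree bs) • hirschB as bs :=
  signB_elem _

theorem hirschB_nil_right {as : List (BarLetter R Q)} (h : 1 < as.length) : hirschB as [] = 0 :=
  toCell_susp_injective (by
    beta_reduce
    rw [toCell_susp_hirschB, hirschCell_nil_right h, map_zero, map_zero])

theorem hirschB_nil_left {bs : List (BarLetter R Q)} (h : 1 < bs.length) : hirschB [] bs = 0 :=
  toCell_susp_injective (by
    beta_reduce
    rw [toCell_susp_hirschB, hirschCell_nil_left h, map_zero, map_zero])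

theorem isMultilinear_hirschB_left (bs : List (BarLetter R Q)) :
    IsMultilinear fun as => hirschB as bs := by
  intro x n r a b y
  apply toCell_susp_injective
  simp only [map_add, map_smul, toCell_susp_hirschB]
  rw [hirschCell_of_ne (by simp), hirschCell_of_ne (by simp), hirschCell_of_ne (by simp)]
  funext σ
  simp only [hirschValue, Pi.add_apply, Pi.smul_apply, smul_eq_mul, Finset.mul_sum,
    ← Finset.sum_add_distrib, evalWord_multilinear]
  refine Finset.sum_congr rfl fun p _ => Finset.sum_congr rfl fun u _ =>
    Finset.sum_congr rfl fun v _ => ?_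
  ring

theorem isMultilinear_hirschB_right (as : List (BarLetter R Q)) :
    IsMultilinear fun bs => hirschB as bs := by
  intro x n r a b y
  apply toCell_susp_injective
  simp only [map_add, map_smul, toCell_susp_hirschB]
  rw [hirschCell_of_ne (by simp), hirschCell_of_ne (by simp), hirschCell_of_ne (by simp)]
  funext σ
  simp only [hirschValue, Pi.add_apply, Pi.smul_apply, smul_eq_mul, Finset.mul_sum,
    ← Finset.sum_add_distrib, evalWord_multilinear]
  refine Finset.sum_congr rfl fun p _ => Finset.sum_congr rfl fun u _ =>
    Finset.sum_congr rfl fun v _ => ?_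
  ring

variable [OneReduced Q]

theorem hirschB_nil_nil : hirschB (R := R) (Q := Q) [] [] = 0 := by
  rw [hirschB, hirsch_nil_nil, BarLetter.elem, map_zero]

theorem hirschB_singleton_left (a : BarLetter R Q) : hirschB [a] [] = a.elem :=
  toCell_susp_injective (by
    beta_reduce
    rw [toCell_susp_hirschB, hirschCell_singleton_left, susp_elem, toCell_homog])

theorem hirschB_singleton_right (a : BarLetter R Q) : hirschB [] [a] = a.elem :=
  toCell_susp_injective (by
    beta_reduce
    rw [toCell_susp_hirschB, hirschCell_singleton_right, susp_elem, toCell_homog])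

/-- The structure equation of the Hirsch operations, lifted from functions on cells, which determine
elements of the desuspension. -/
theorem neg_deltaB_hirschB (as bs : List (BarLetter R Q)) :
    -deltaB R Q (hirschB as bs) = listDiff (fun l => hirschB l bs) as +
      (-1 : R) ^ barDegree as • listDiff (fun l => hirschB as l) bs +
      biSplit (fun as₁ as₂ bs₁ bs₂ =>
        (-1 : R) ^ (barDegree as₁ + barDegree bs₁ + barDegree bs₁ * barDegree as₂) •
          mulB R Q (hirschB as₁ bs₁) (hirschB as₂ bs₂)) as bs := by
  apply toCell_susp_injective
  have h := fun (F : List (BarLetter R Q) → BarCochains R Q) l => map_listDiff (M := BarCochains R Q) (toCell R Q ∘ₗ susp R Q) F l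
  have h2 := map_biSplit (M := BarCochains R Q) (α := BarLetter R Q) (toCell R Q ∘ₗ susp R Q)
  simp only [LinearMap.comp_apply] at h h2
  simp only [map_add, map_neg, map_smul, susp_deltaB, toCell_deltaA, h, h2, susp_mulB, toCell_mulA,
    toCell_susp_hirschB]
  have := hirschCell_maurerCartan as bs
  rw [this, biSplit]
  abel

end Hirsch

/-! ### The product of the bar construction -/

section BarProduct

variable {R : Type v} [CommRing R] {Q : CubicalSet.{u}}

/-- The counit of a pair of words. -/
def emptyPair {M : Type*} [Zero M] (e : M) (as bs : List (BarLetter R Q)) : M :=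
  if as = [] ∧ bs = [] then e else 0

theorem isMultilinear_emptyPair_left {M : Type*} [AddCommGroup M] [Module R M] (e : M)
    (bs : List (BarLetter R Q)) : IsMultilinear fun as => emptyPair e as bs :=
  fun x n r a b y => by simp [emptyPair]

theorem isMultilinear_emptyPair_right {M : Type*} [AddCommGroup M] [Module R M] (e : M)
    (as : List (BarLetter R Q)) : IsMultilinear (emptyPair e as) :=
  fun x n r a b y => by simp [emptyPair]

theorem listDiff_emptyPair_left {M : Type*} [AddCommGroup M] [Module R M] (e : M)
    (as bs : List (BarLetter R Q)) : listDiff (fun l => emptyPair e l bs) as = 0 := by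
  rw [listDiff_congr (G := fun _ => 0), listDiff_zero]
  intro l hl
  simp [emptyPair, hl]

theorem listDiff_emptyPair_right {M : Type*} [AddCommGroup M] [Module R M] (e : M)
    (as bs : List (BarLetter R Q)) : listDiff (emptyPair e as) bs = 0 := by
  rw [listDiff_congr (G := fun _ => 0), listDiff_zero]
  intro l hl
  simp [emptyPair, hl]

/-- The operator whose fixed point is the product of the bar construction. -/
def barProdStep (P : List (BarLetter R Q) → List (BarLetter R Q) → Bar R Q)
    (as bs : List (BarLetter R Q)) : Bar R Q :=
  emptyPair 1 as bs + biSplit (fun as₁ as₂ bs₁ bs₂ =>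
    (-1 : R) ^ (barDegree bs₁ * barDegree as₂) •
      (TensorAlgebra.ι R (hirschB as₁ bs₁) * P as₂ bs₂)) as bs

theorem isMultilinear_sign_left {M : Type*} [AddCommGroup M] [Module R M] (k : ℕ)
    {F : List (BarLetter R Q) → M} (hF : IsMultilinear F) :
    IsMultilinear fun l => (-1 : R) ^ (k * barDegree l) • F l :=
  hF.smul_degree fun d => (-1) ^ (k * d)

theorem isMultilinear_sign_right {M : Type*} [AddCommGroup M] [Module R M] (k : ℕ)
    {F : List (BarLetter R Q) → M} (hF : IsMultilinear F) :
    IsMultilinear fun l => (-1 : R) ^ (barDegree l * k) • F l :=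
  hF.smul_degree fun d => (-1) ^ (d * k)

theorem IsMultilinear.ι_mul {F : List (BarLetter R Q) → BarCochains R Q} (hF : IsMultilinear F)
    (w : Bar R Q) : IsMultilinear fun l => TensorAlgebra.ι R (F l) * w :=
  hF.map (LinearMap.mulRight R w ∘ₗ TensorAlgebra.ι R)

theorem IsMultilinear.mul_left {F : List (BarLetter R Q) → Bar R Q} (hF : IsMultilinear F)
    (w : Bar R Q) : IsMultilinear fun l => w * F l := hF.map (LinearMap.mulLeft R w)

theorem isMultilinear_barProdStep_left {P : List (BarLetter R Q) → List (BarLetter R Q) → Bar R Q}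
    (hP : ∀ bs, IsMultilinear fun as => P as bs) (bs : List (BarLetter R Q)) :
    IsMultilinear fun as => barProdStep P as bs :=
  (isMultilinear_emptyPair_left 1 bs).add <| isMultilinear_biSplit_left
    (fun _ z _ => ((isMultilinear_hirschB_left z).ι_mul _).smul _)
    (fun _ _ w => isMultilinear_sign_left _ ((hP w).mul_left _)) bs

theorem isMultilinear_barProdStep_right {P : List (BarLetter R Q) → List (BarLetter R Q) → Bar R Q}
    (hP : ∀ as, IsMultilinear fun bs => P as bs) (as : List (BarLetter R Q)) :
    IsMultilinear fun bs => barProdStep P as bs :=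
  (isMultilinear_emptyPair_right 1 as).add <| isMultilinear_biSplit_right
    (fun x y _ => isMultilinear_sign_right (barDegree y) ((isMultilinear_hirschB_right x).ι_mul _))
    (fun _ y _ => ((hP y).mul_left _).smul _) as

/-- Approximations of the product of the bar construction. -/
def barProdApprox : ℕ → List (BarLetter R Q) → List (BarLetter R Q) → Bar R Q
  | 0 => fun _ _ => 0
  | k + 1 => barProdStep (barProdApprox k)

theorem isMultilinear_barProdApprox (k : ℕ) :
    (∀ bs : List (BarLetter R Q), IsMultilinear fun as => barProdApprox k as bs) ∧
    (∀ as : List (BarLetter R Q), IsMultilinear fun bs => barProdApprox k as bs) := by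
  induction k with
  | zero => exact ⟨fun _ => isMultilinear_zero, fun _ => isMultilinear_zero⟩
  | succ k ih =>
    exact ⟨isMultilinear_barProdStep_left ih.1, isMultilinear_barProdStep_right ih.2⟩

variable [OneReduced Q]

/-- The terms excluded in `barProd`, in which both first pieces are empty, may be added: their
factor is `E_{0,0} = 0`. -/
theorem barProd_eq (as bs : List (BarLetter R Q)) : barProd as bs = barProdStep barProd as bs := by
  rw [barProd, barProdStep, emptyPair]
  split_ifs with h
  · obtain ⟨rfl, rfl⟩ := h
    simp [biSplit, splitSum, hirschB_nil_nil]
  · rw [zero_add, biSplit, splitSum_eq_sum, Finset.sum_range]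
    refine Finset.sum_congr rfl fun i _ => ?_
    rw [splitSum_eq_sum, Finset.sum_range]
    refine Finset.sum_congr rfl fun j _ => ?_
    split_ifs with hij
    · rfl
    · have hi : (i : ℕ) = 0 := by omega
      have hj : (j : ℕ) = 0 := by omega
      rw [hi, hj, List.take_zero, List.take_zero, hirschB_nil_nil]
      simp

theorem barProdStep_congr {P P' : List (BarLetter R Q) → List (BarLetter R Q) → Bar R Q}
    {as bs : List (BarLetter R Q)} (h : ∀ x y, x.length + y.length < as.length + bs.length →
      P x y = P' x y) : barProdStep P as bs = barProdStep P' as bs := by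
  rw [barProdStep, barProdStep]
  congr 1
  refine biSplit_congr fun x y z w hx hz => ?_
  by_cases h0 : x = [] ∧ z = []
  · rw [h0.1, h0.2, hirschB_nil_nil]; simp
  · rw [h y w]
    rw [← hx, ← hz, List.length_append, List.length_append]
    have : 0 < x.length ∨ 0 < z.length := by
      rw [List.length_pos_iff, List.length_pos_iff]
      tauto
    omega

/-- Every nonzero term uses up at least one letter, so a truncation is exact once it allows more
steps than there are letters. Multilinearity, clear for the truncations, passes in this way to the
product. -/
theorem barProd_eq_approx (k : ℕ) (as bs : List (BarLetter R Q)) (h : as.length + bs.length < k) :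
    barProd as bs = barProdApprox k as bs := by
  induction k generalizing as bs with
  | zero => omega
  | succ k ih =>
    rw [barProd_eq, barProdApprox]
    exact barProdStep_congr fun x y hxy => ih x y (by omega)

theorem isMultilinear_barProd_left (bs : List (BarLetter R Q)) :
    IsMultilinear fun as => barProd as bs := by
  intro x n r a b y
  have := (isMultilinear_barProdApprox (x.length + y.length + bs.length + 2)).1 bs x n r a b y
  beta_reduce at this ⊢
  have hl : ∀ c : BarLetter R Q, (x ++ c :: y).length + bs.length <
      x.length + y.length + bs.length + 2 := by
    intro c; rw [List.length_append, List.length_cons]; omega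
  rwa [barProd_eq_approx _ _ _ (hl _), barProd_eq_approx _ _ _ (hl _),
    barProd_eq_approx _ _ _ (hl _)]

theorem isMultilinear_barProd_right (as : List (BarLetter R Q)) :
    IsMultilinear fun bs => barProd as bs := by
  intro x n r a b y
  have := (isMultilinear_barProdApprox (x.length + y.length + as.length + 2)).2 as x n r a b y
  beta_reduce at this ⊢
  have hl : ∀ c : BarLetter R Q, as.length + (x ++ c :: y).length <
      x.length + y.length + as.length + 2 := by
    intro c; rw [List.length_append, List.length_cons]; omega
  rwa [barProd_eq_approx _ _ _ (hl _), barProd_eq_approx _ _ _ (hl _),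
    barProd_eq_approx _ _ _ (hl _)]

/-- `E_{1,0}` is the identity and `E_{p,0}` vanishes for `p > 1`, so the letters are cut off one at
a time. -/
theorem barProd_nil_right (as : List (BarLetter R Q)) : barProd as [] = barWord as := by
  induction as with
  | nil => rw [barProd, if_pos ⟨rfl, rfl⟩, barWord_nil]
  | cons a as ih =>
    rw [barProd_eq, barProdStep, emptyPair, if_neg (by simp), zero_add, biSplit]
    simp only [splitSum, hirschB_nil_nil, map_zero, zero_mul, smul_zero, zero_add]
    rw [splitSum_eq_left]
    · rw [hirschB_singleton_left, ih, barWord_cons]; simp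
    · intro b x y
      rw [hirschB_nil_right (by simp)]; simp

theorem barProd_nil_left (bs : List (BarLetter R Q)) : barProd [] bs = barWord bs := by
  induction bs with
  | nil => rw [barProd, if_pos ⟨rfl, rfl⟩, barWord_nil]
  | cons a bs ih =>
    rw [barProd_eq, barProdStep, emptyPair, if_neg (by simp), zero_add, biSplit]
    simp only [splitSum, hirschB_nil_nil, map_zero, zero_mul, smul_zero, zero_add]
    rw [splitSum_eq_left]
    · rw [hirschB_singleton_right, ih, barWord_cons]; simp
    · intro b x y
      rw [hirschB_nil_left (by simp)]; simp

/-- The empty word has no first letter, so only the recursive part of the product contributes. -/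
theorem headMul_barProd (x : BarCochains R Q) (as bs : List (BarLetter R Q)) :
    headMul R Q x (barProd as bs) = biSplit (fun as₁ as₂ bs₁ bs₂ =>
      (-1 : R) ^ (barDegree bs₁ * barDegree as₂) •
        (TensorAlgebra.ι R (mulB R Q x (hirschB as₁ bs₁)) * barProd as₂ bs₂)) as bs := by
  rw [barProd_eq, barProdStep, map_add, map_biSplit]
  have : headMul R Q x (emptyPair 1 as bs) = 0 := by
    rw [emptyPair]
    split_ifs
    · exact headMul_one x
    · exact map_zero _
  simp only [this, zero_add, map_smul, headMul_mul]

/-- Induction on the number of letters. In a term `[E] · (rest)` the structure equation replaces the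
coboundary of `E`. Its linear terms are the bar differentials of the first pieces. Its quadratic
terms cancel against the terms that multiply `E` into the first letter of the rest, both being sums
over cuts into three pieces. -/
theorem diffB_barProd (as bs : List (BarLetter R Q)) : diffB R Q (barProd as bs) =
    listDiff (fun l => barProd l bs) as +
      (-1 : R) ^ barDegree as • listDiff (fun l => barProd as l) bs := by
  obtain ⟨k, hk⟩ : ∃ k, as.length + bs.length < k := ⟨_, Nat.lt_succ_self _⟩
  induction k generalizing as bs with
  | zero => omega
  | succ k ih =>
    have e1 : (fun l => barProd l bs) = fun l => barProdStep barProd l bs :=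
      funext fun l => barProd_eq l bs
    have e2 : (fun l => barProd as l) = fun l => barProdStep barProd as l :=
      funext fun l => barProd_eq as l
    rw [e1, e2, barProd_eq as bs]
    simp only [barProdStep, listDiff_add, listDiff_emptyPair_left]
    rw [listDiff_emptyPair_right, zero_add, zero_add, map_add]
    have z : diffB R Q (emptyPair 1 as bs) = 0 := by
      rw [emptyPair]
      split_ifs
      · exact diffB_one
      · exact map_zero _
    rw [z, zero_add, map_biSplit, listDiff_biSplit_left, listDiff_biSplit_right]
    have hs := biSplit_smul (R := R) (M := Bar R Q) (α := BarLetter R Q) ((-1 : R) ^ barDegree as)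
    rw [← hs, ← biSplit_add]
    -- Subtracting the two bracketings of this sum, which are equal, makes the required identity
    -- hold term by term in the first cut.
    have triple := biSplit_assoc (fun as₁ as₂ as₃ bs₁ bs₂ bs₃ : List (BarLetter R Q) =>
      (-1 : R) ^ (barDegree as₁ + barDegree bs₁ + barDegree bs₁ * barDegree as₂ +
        (barDegree bs₁ + barDegree bs₂) * barDegree as₃) •
        (TensorAlgebra.ι R (mulB R Q (hirschB as₁ bs₁) (hirschB as₂ bs₂)) * barProd as₃ bs₃)) as bs
    rw [← sub_eq_zero] at triple ⊢
    rw [← biSplit_sub] at triple ⊢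
    rw [← triple]
    refine biSplit_congr fun x y z w hx hz => ?_
    have t1 : biSplit (fun as₁ as₂ bs₁ bs₂ : List (BarLetter R Q) =>
        (-1 : R) ^ (barDegree as₁ + barDegree bs₁ + barDegree bs₁ * barDegree as₂ +
        (barDegree bs₁ + barDegree bs₂) * barDegree y) •
        (TensorAlgebra.ι R (mulB R Q (hirschB as₁ bs₁) (hirschB as₂ bs₂)) * barProd y w)) x z =
        (-1 : R) ^ (barDegree z * barDegree y) • (TensorAlgebra.ι R (biSplit (fun as₁ as₂ bs₁ bs₂ =>
          (-1 : R) ^ (barDegree as₁ + barDegree bs₁ + barDegree bs₁ * barDegree as₂) •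
          mulB R Q (hirschB as₁ bs₁) (hirschB as₂ bs₂)) x z) * barProd y w) := by
      have := map_biSplit (α := BarLetter R Q) ((-1 : R) ^ (barDegree z * barDegree y) •
        (LinearMap.mulRight R (barProd y w) ∘ₗ TensorAlgebra.ι R (M := BarCochains R Q)))
      simp only [LinearMap.smul_apply, LinearMap.comp_apply, LinearMap.mulRight_apply] at this
      rw [this]
      refine biSplit_congr fun x₁ x₂ z₁ z₂ _ hz => ?_
      rw [map_smul, smul_mul_assoc, smul_smul, ← pow_add, ← hz, barDegree_append]
      congr 2
      ring
    have t2 : biSplit (fun as₂ as₃ bs₂ bs₃ : List (BarLetter R Q) =>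
        (-1 : R) ^ (barDegree x + barDegree z + barDegree z * barDegree as₂ +
        (barDegree z + barDegree bs₂) * barDegree as₃) •
        (TensorAlgebra.ι R (mulB R Q (hirschB x z) (hirschB as₂ bs₂)) * barProd as₃ bs₃)) y w =
        (-1 : R) ^ (barDegree x + barDegree z + barDegree z * barDegree y) •
          headMul R Q (hirschB x z) (barProd y w) := by
      have hs := biSplit_smul (R := R) (M := Bar R Q) (α := BarLetter R Q)
        ((-1 : R) ^ (barDegree x + barDegree z + barDegree z * barDegree y))
      rw [headMul_barProd, ← hs]
      refine biSplit_congr fun y₁ y₂ w₁ w₂ hy _ => ?_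
      rw [smul_smul, ← pow_add, ← hy, barDegree_append]
      congr 2
      ring
    rw [t1, t2]
    have L1 : listDiff (fun x' => (-1 : R) ^ (barDegree z * barDegree y) •
        (TensorAlgebra.ι R (hirschB x' z) * barProd y w)) x =
        (-1 : R) ^ (barDegree z * barDegree y) •
        (TensorAlgebra.ι R (listDiff (fun x' => hirschB x' z) x) * barProd y w) :=
      (map_listDiff ((-1 : R) ^ (barDegree z * barDegree y) •
        (LinearMap.mulRight R (barProd y w) ∘ₗ TensorAlgebra.ι R)) (fun x' => hirschB x' z) x).symm
    have L3 : listDiff (fun z' => (-1 : R) ^ (barDegree z' * barDegree y) •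
        (TensorAlgebra.ι R (hirschB x z') * barProd y w)) z =
        (-1 : R) ^ (barDegree y * (barDegree z + 1)) •
        (TensorAlgebra.ι R (listDiff (fun z' => hirschB x z') z) * barProd y w) := by
      simp only [mul_comm _ (barDegree y)]
      rw [listDiff_sign]
      congr 1
      exact (map_listDiff (LinearMap.mulRight R (barProd y w) ∘ₗ TensorAlgebra.ι R)
        (fun z' => hirschB x z') z).symm
    have L2 : listDiff (fun y' => (-1 : R) ^ (barDegree z * barDegree y') •
        (TensorAlgebra.ι R (hirschB x z) * barProd y' w)) y =
        (-1 : R) ^ (barDegree z * (barDegree y + 1)) •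
        (TensorAlgebra.ι R (hirschB x z) * listDiff (fun y' => barProd y' w) y) := by
      rw [listDiff_sign]
      congr 1
      exact (map_listDiff (LinearMap.mulLeft R (TensorAlgebra.ι R (hirschB x z)))
        (fun y' => barProd y' w) y).symm
    have L4 : listDiff (fun w' => (-1 : R) ^ (barDegree z * barDegree y) •
        (TensorAlgebra.ι R (hirschB x z) * barProd y w')) w =
        (-1 : R) ^ (barDegree z * barDegree y) •
        (TensorAlgebra.ι R (hirschB x z) * listDiff (fun w' => barProd y w') w) :=
      (map_listDiff ((-1 : R) ^ (barDegree z * barDegree y) •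
        LinearMap.mulLeft R (TensorAlgebra.ι R (hirschB x z))) (fun w' => barProd y w') w).symm
    rw [L1, L2, L3, L4, map_smul, diffB_mul, ← neg_mul, ← map_neg, neg_deltaB_hirschB, signB_hirschB]
    -- The rest is shorter unless both first pieces are empty, and then the factor `E_{0,0}`
    -- vanishes.
    have IH : TensorAlgebra.ι R (hirschB x z) * diffB R Q (barProd y w) =
        TensorAlgebra.ι R (hirschB x z) * (listDiff (fun l => barProd l w) y +
          (-1 : R) ^ barDegree y • listDiff (fun l => barProd y l) w) := by
      by_cases h0 : x = [] ∧ z = []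
      · rw [h0.1, h0.2, hirschB_nil_nil]; simp
      · rw [ih]
        have : 0 < x.length ∨ 0 < z.length := by
          rw [List.length_pos_iff, List.length_pos_iff]
          tauto
        rw [← hx, ← hz, List.length_append, List.length_append] at hk
        omega
    rw [map_smul (TensorAlgebra.ι R), smul_mul_assoc, IH, ← hx, barDegree_append,
      map_smul (headMul R Q), LinearMap.smul_apply]
    simp only [map_add, map_smul, add_mul, mul_add, smul_mul_assoc, mul_smul_comm, mul_one, pow_add]
    generalize barDegree x = α
    generalize barDegree y = β
    generalize barDegree z = γ
    have hβ : (-1 : R) ^ β * (-1) ^ β = 1 := by rw [← mul_pow]; simp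
    rw [mul_comm β γ]
    match_scalars <;> ring_nf
    linear_combination (-(-1) ^ (γ * β) * (-1) ^ α) * hβ

end BarProduct

/-! ### The acyclic bar construction -/

section Acyclic

variable (R : Type v) [CommRing R] (Q : CubicalSet.{u})

/-- The acyclic bar construction, with its structure of a module made opaque. -/
def Acyclic : Type (max u v) := AcyclicBar R Q

instance : AddCommGroup (Acyclic R Q) :=
  (TensorProduct.addCommGroup : AddCommGroup (AcyclicBar R Q))

instance : Module R (Acyclic R Q) := (TensorProduct.instModule : Module R (AcyclicBar R Q))

/-- The identification of the acyclic bar construction with its opaque version. -/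
def toAcyclic : AcyclicBar R Q ≃ₗ[R] Acyclic R Q where
  toFun x := x
  invFun x := x
  map_add' _ _ := rfl
  map_smul' _ _ := rfl
  left_inv _ := rfl
  right_inv _ := rfl

/-- The elements `a ⊗ w` of the acyclic bar construction. -/
def tens : Cochains R Q →ₗ[R] Bar R Q →ₗ[R] Acyclic R Q :=
  LinearMap.mk₂ R (fun a w => toAcyclic R Q (a ⊗ₜ[R] w))
    (fun a b w => by rw [TensorProduct.add_tmul, map_add])
    (fun r a w => by rw [← TensorProduct.smul_tmul', map_smul])
    (fun a w w' => by rw [TensorProduct.tmul_add, map_add])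
    (fun r a w => by rw [TensorProduct.tmul_smul, map_smul])

/-- The universal property of the acyclic bar construction. -/
def acyclicLift {M : Type*} [AddCommGroup M] [Module R M] (f : Cochains R Q →ₗ[R] Bar R Q →ₗ[R] M) :
    Acyclic R Q →ₗ[R] M := TensorProduct.lift f ∘ₗ (toAcyclic R Q).symm.toLinearMap

variable {R Q} in
theorem acyclicLift_tens {M : Type*} [AddCommGroup M] [Module R M]
    (f : Cochains R Q →ₗ[R] Bar R Q →ₗ[R] M) (a : Cochains R Q) (w : Bar R Q) :
    acyclicLift R Q f (tens R Q a w) = f a w := TensorProduct.lift.tmul a w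

variable {R Q} in
theorem acyclic_induction {p : Acyclic R Q → Prop} (h : ∀ a w, p (tens R Q a w))
    (ha : ∀ x y, p x → p y → p (x + y)) (z : Acyclic R Q) : p z := by
  have : ∀ z : AcyclicBar R Q, p (toAcyclic R Q z) := fun z => by
    induction z using TensorProduct.induction_on with
    | zero => simpa using h 0 0
    | tmul a w => exact h a w
    | add x y hx hy => exact ha _ _ hx hy
  exact this ((toAcyclic R Q).symm z)

/-- The multiplication of the first letter of a word by a cochain from the left. -/
def headMulA : Cochains R Q →ₗ[R] Bar R Q →ₗ[R] Acyclic R Q :=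
  LinearMap.mk₂ R (fun a w =>
      toAcyclic R Q (TensorProduct.map (mulA R Q a ∘ₗ susp R Q) LinearMap.id (uncons R Q w)))
    (fun a b w => by
      rw [map_add, LinearMap.add_comp, TensorProduct.map_add_left, LinearMap.add_apply, map_add])
    (fun r a w => by
      rw [map_smul, LinearMap.smul_comp, TensorProduct.map_smul_left, LinearMap.smul_apply, map_smul])
    (fun a w w' => by rw [map_add, map_add, map_add])
    (fun r a w => by rw [map_smul, map_smul, map_smul])

/-- The differential of the acyclic bar construction. -/
def diffA : Acyclic R Q →ₗ[R] Acyclic R Q :=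
  acyclicLift R Q (tens R Q ∘ₗ deltaA R Q) +
    acyclicLift R Q ((tens R Q ∘ₗ signA R Q).compl₂ (diffB R Q)) -
    acyclicLift R Q (headMulA R Q ∘ₗ signA R Q)

/-- The left multiplication by cochains. -/
def leftMul : Cochains R Q →ₗ[R] Acyclic R Q →ₗ[R] Acyclic R Q :=
  LinearMap.mk₂ R (fun a z =>
      toAcyclic R Q (LinearMap.rTensor (Bar R Q) (mulA R Q a) ((toAcyclic R Q).symm z)))
    (fun a b w => by rw [map_add, LinearMap.rTensor_add, LinearMap.add_apply, map_add])
    (fun r a w => by rw [map_smul, LinearMap.rTensor_smul, LinearMap.smul_apply, map_smul])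
    (fun a w w' => by rw [map_add, map_add, map_add])
    (fun r a w => by rw [map_smul, map_smul, map_smul])

variable {R Q}

theorem headMulA_one (a : Cochains R Q) : headMulA R Q a 1 = 0 := by
  rw [headMulA, LinearMap.mk₂_apply, uncons_one, map_zero, map_zero]

theorem headMulA_mul (a : Cochains R Q) (y : BarCochains R Q) (w : Bar R Q) :
    headMulA R Q a (TensorAlgebra.ι R y * w) = tens R Q (mulA R Q a (susp R Q y)) w := by
  rw [headMulA, LinearMap.mk₂_apply, uncons_mul]; rfl

theorem diffA_tmul (a : Cochains R Q) (w : Bar R Q) : diffA R Q (tens R Q a w) =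
    tens R Q (deltaA R Q a) w + tens R Q (signA R Q a) (diffB R Q w) - headMulA R Q (signA R Q a) w := rfl

theorem leftMul_tmul (a b : Cochains R Q) (w : Bar R Q) :
    leftMul R Q a (tens R Q b w) = tens R Q (mulA R Q a b) w := rfl

theorem leftMul_headMulA (a b : Cochains R Q) (w : Bar R Q) :
    leftMul R Q a (headMulA R Q b w) = headMulA R Q (mulA R Q a b) w := by
  induction w using bar_induction with
  | h l =>
    obtain _ | ⟨c, l⟩ := l
    · rw [barWord_nil, headMulA_one, headMulA_one, map_zero]
    · rw [barWord_cons, headMulA_mul, headMulA_mul, leftMul_tmul, mulA_assoc]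
  | ha x y hx hy => simp only [map_add, hx, hy]
  | hs r x hx => simp only [map_smul, hx]

theorem headMulA_headMul (a : Cochains R Q) (x : BarCochains R Q) (w : Bar R Q) :
    headMulA R Q a (headMul R Q x w) = headMulA R Q (mulA R Q a (susp R Q x)) w := by
  induction w using bar_induction with
  | h l =>
    obtain _ | ⟨c, l⟩ := l
    · rw [barWord_nil, headMulA_one, headMul_one, map_zero]
    · rw [barWord_cons, headMulA_mul, headMul_mul, headMulA_mul, susp_mulB, mulA_assoc]
  | ha x y hx hy => simp only [map_add, hx, hy]
  | hs r x hx => simp only [map_smul, hx]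

/-- The Leibniz rule of cochains on the coefficient; the term that absorbs the first letter is
compatible with left multiplication by associativity. -/
theorem diffA_leftMul (a : Cochains R Q) (z : Acyclic R Q) :
    diffA R Q (leftMul R Q a z) =
      leftMul R Q (deltaA R Q a) z + leftMul R Q (signA R Q a) (diffA R Q z) := by
  induction z using acyclic_induction with
  | h b w =>
    simp only [leftMul_tmul, diffA_tmul, map_add, map_sub, deltaA_mulA, signA_mulA,
      leftMul_headMulA, LinearMap.add_apply]
    abel
  | ha x y hx hy => simp only [map_add, hx, hy]; abel

theorem diffA_diffA (z : Acyclic R Q) : diffA R Q (diffA R Q z) = 0 := by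
  induction z using acyclic_induction with
  | h a w =>
    induction w using bar_induction with
    | h l =>
      simp only [diffA_tmul, map_add, map_sub, deltaA_deltaA, map_zero, signA_signA,
        diffB_diffB, LinearMap.zero_apply]
      obtain _ | ⟨b, l⟩ := l
      · simp only [barWord_nil, headMulA_one, diffB_one, map_zero]
        simp
      · simp only [barWord_cons, headMulA_mul, diffA_tmul, diffB_mul, map_add, map_sub, map_neg,
          headMulA_headMul, deltaA_mulA, signA_mulA, signA_signA, deltaA_signA, susp_deltaB,
          susp_signB, LinearMap.neg_apply, LinearMap.add_apply]
        abel
    | ha x y hx hy => rw [map_add, map_add, map_add, hx, hy, add_zero]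
    | hs r x hx => rw [map_smul, map_smul, map_smul, hx, smul_zero]
  | ha x y hx hy => rw [map_add, map_add, hx, hy, add_zero]

theorem toAcyclic_acyclicBarMk {n : ℕ} (a : Cochain R Q n) (w : Bar R Q) :
    toAcyclic R Q (acyclicBarMk a w) = tens R Q (homog a) w := rfl

theorem diffA_toAcyclic {n : ℕ} (a : Cochain R Q n) (as : List (BarLetter R Q)) :
    diffA R Q (toAcyclic R Q (acyclicBarMk a (barWord as))) = toAcyclic R Q (acyclicBarDiff a as) := by
  rw [toAcyclic_acyclicBarMk, diffA_tmul, acyclicBarDiff.eq_def, barDiff_eq, ← diffB_barWord,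
    deltaA_homog, signA_homog, map_smul, map_smul, LinearMap.smul_apply, LinearMap.smul_apply]
  refine congrArg₂ (fun x y : Acyclic R Q => x - y) rfl ?_
  obtain _ | ⟨b, l⟩ := as
  · rw [barWord_nil, headMulA_one, smul_zero]; rfl
  · rw [barWord_cons, headMulA_mul, susp_elem, mulA_homog]; rfl

end Acyclic

/-! ### The unit -/

section Unit

variable {R : Type v} [CommRing R] {Q : CubicalSet.{u}}

theorem eval_unit (τ : Q.Cell) : (Cochain.unit : Cochain R Q 0).eval τ = if τ.1 = 0 then 1 else 0 := by
  by_cases h : τ.1 = 0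
  · have h' : ¬ IsDegenerate τ := by
      rintro ⟨n, i, ρ, rfl⟩
      simp at h
    rw [Cochain.eval, dif_pos ⟨h, h'⟩, if_pos h]; rfl
  · rw [Cochain.eval_of_dim _ h, if_neg h]

theorem mulA_unit_left (x : Cochains R Q) : mulA R Q (homog Cochain.unit) x = x := by
  apply toCell_injective
  rw [toCell_mulA, toCell_homog]
  funext τ
  have h0 := Finset.disjoint_empty_left (Finset.range τ.1)
  rw [← faceOf_range τ ∅, cellCup_faceOf _ _ _ subset_rfl h0, conv, Finset.sum_eq_single ∅]
  · simp [eval_unit, faceOf_dim τ ∅ (Finset.empty_subset _)]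
  · intro A hA hne
    rw [eval_unit, faceOf_dim _ _ (Finset.mem_powerset.1 hA), if_neg (by simpa using hne)]
    simp
  · simp

theorem mulA_unit_right (x : Cochains R Q) : mulA R Q x (homog Cochain.unit) = x := by
  apply toCell_injective
  rw [toCell_mulA, toCell_homog]
  funext τ
  have h0 := Finset.disjoint_empty_left (Finset.range τ.1)
  rw [← faceOf_range τ ∅, cellCup_faceOf _ _ _ subset_rfl h0, conv,
    Finset.sum_eq_single (Finset.range τ.1)]
  · simp [eval_unit, faceOf_dim τ _ (Finset.empty_subset _)]
  · intro A hA hne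
    rw [eval_unit, faceOf_dim _ _ Finset.sdiff_subset, if_neg]
    · simp
    · intro h
      rw [Finset.card_eq_zero, Finset.sdiff_eq_empty_iff_subset] at h
      exact hne (Finset.Subset.antisymm (Finset.mem_powerset.1 hA) h)
  · simp

variable [OneReduced Q]

/-- A function on at most one nondegenerate vertex is a multiple of the constant function `1`. -/
theorem exists_eq_smul_unit (b : Cochain R Q 0) : ∃ r : R, b = r • Cochain.unit := by
  by_cases h : Nonempty {τ : Q.Cell // τ.1 = 0 ∧ ¬ IsDegenerate τ}
  · obtain ⟨τ⟩ := h
    refine ⟨b τ, funext fun ρ => ?_⟩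
    have : ρ = τ := by
      obtain ⟨⟨n, ρ⟩, h, hρ⟩ := ρ
      obtain ⟨⟨m, τ⟩, h', hτ⟩ := τ
      obtain rfl : n = 0 := h
      obtain rfl : m = 0 := h'
      exact Subtype.ext (congrArg (Sigma.mk 0) (OneReduced.eq_of_dim_zero ρ τ))
    simp [this, Cochain.unit]
  · exact ⟨0, funext fun ρ => absurd ⟨ρ⟩ h⟩

theorem cochain_one_eq_zero (b : Cochain R Q 1) : b = 0 :=
  funext fun τ => absurd (OneReduced.isDegenerate_of_dim_one τ.1 τ.2.1) τ.2.2

theorem BarLetter.ext_of_eval {Q : CubicalSet.{u}} {a b : BarLetter R Q} (h : a.1 = b.1)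
    (he : a.2.eval = b.2.eval) : a = b := by
  obtain ⟨n, a⟩ := a
  obtain ⟨m, b⟩ := b
  obtain rfl : n = m := h
  exact congrArg (Sigma.mk n) (Cochain.eval_injective he)

end Unit

/-! ### Hirsch operations with a distinguished entry -/

section Lead

variable {R : Type v} [CommRing R] {Q : CubicalSet.{u}}

/-- The Hirsch operation with a distinguished first entry in the second argument. -/
def leadA (as : List (BarLetter R Q)) {m : ℕ} (b : Cochain R Q m) (bs : List (BarLetter R Q)) :
    Cochains R Q := homog (hirschLead as b bs)

theorem leadA_zero (as : List (BarLetter R Q)) (b : Cochain R Q 0) (bs : List (BarLetter R Q)) :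
    leadA as b bs = emptyPair (homog b) as bs := by
  rw [leadA, emptyPair]
  apply toCell_injective
  rw [toCell_homog, hirschLead]
  split_ifs with h
  · rw [toCell_homog]
    obtain ⟨rfl, rfl⟩ := h
    exact Cochain.eval_ofFun (fun τ hτ => b.eval_of_dim hτ) fun τ hτ => b.eval_of_isDegenerate hτ
  · rw [map_zero]
    exact Cochain.eval_ofFun (f := fun _ => 0) (fun _ _ => rfl) fun _ _ => rfl

theorem leadA_succ (as : List (BarLetter R Q)) {k : ℕ} (b : Cochain R Q (k + 1))
    (bs : List (BarLetter R Q)) : leadA as b bs = susp R Q (hirschB as (⟨k, b⟩ :: bs)) := by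
  rw [hirschB, susp_elem]
  refine homog_eq_of_eval ?_
  have hab : ¬(as = [] ∧ (⟨k, b⟩ :: bs : List (BarLetter R Q)) = []) := by simp
  rw [eval_hirsch hab, hirschLead]
  refine Cochain.eval_ofFun (fun τ hτ => ?_) fun τ hτ => ?_
  · rw [← eval_hirsch hab, Cochain.eval_of_dim]
    rw [barDegree_cons]
    intro h
    apply hτ
    rw [h]; ring
  · rw [← eval_hirsch hab, Cochain.eval_of_isDegenerate _ hτ]

theorem signA_leadA (as : List (BarLetter R Q)) {m : ℕ} (b : Cochain R Q m)
    (bs : List (BarLetter R Q)) :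
    signA R Q (leadA as b bs) = (-1 : R) ^ (barDegree as + m + barDegree bs) • leadA as b bs :=
  signA_homog _

theorem isMultilinear_leadA_left {m : ℕ} (b : Cochain R Q m) (bs : List (BarLetter R Q)) :
    IsMultilinear fun as => leadA as b bs := by
  obtain _ | k := m
  · simp only [leadA_zero]
    exact isMultilinear_emptyPair_left _ _
  · simp only [leadA_succ]
    exact (isMultilinear_hirschB_left _).map _

theorem isMultilinear_leadA_right (as : List (BarLetter R Q)) {m : ℕ} (b : Cochain R Q m) :
    IsMultilinear fun bs => leadA as b bs := by
  obtain _ | k := m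
  · simp only [leadA_zero]
    exact isMultilinear_emptyPair_right _ _
  · simp only [leadA_succ]
    exact ((isMultilinear_hirschB_right as).cons _).map _

theorem leadA_add_smul (as : List (BarLetter R Q)) {m : ℕ} (r : R) (b c : Cochain R Q m)
    (bs : List (BarLetter R Q)) :
    leadA as (b + r • c) bs = leadA as b bs + r • leadA as c bs := by
  obtain _ | k := m
  · simp only [leadA_zero, emptyPair]
    split_ifs
    · rw [homog_add, homog_smul]
    · simp
  · simp only [leadA_succ]
    rw [(isMultilinear_hirschB_right as).head, map_add, map_smul]

theorem leadA_map_zero (as : List (BarLetter R Q)) {m : ℕ} (bs : List (BarLetter R Q)) :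
    leadA as (0 : Cochain R Q m) bs = 0 := by
  have h := leadA_add_smul as (1 : R) (0 : Cochain R Q m) 0 bs
  rw [smul_zero, add_zero, one_smul] at h
  exact left_eq_add.1 h

theorem leadA_smul (as : List (BarLetter R Q)) {m : ℕ} (r : R) (b : Cochain R Q m)
    (bs : List (BarLetter R Q)) : leadA as (r • b) bs = r • leadA as b bs := by
  have h := leadA_add_smul as r 0 b bs
  rwa [zero_add, leadA_map_zero, zero_add] at h

/-- The cup product of the distinguished entry with the next one. -/
def leadCup (as : List (BarLetter R Q)) {m : ℕ} (b : Cochain R Q m) :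
    List (BarLetter R Q) → Cochains R Q
  | [] => 0
  | c :: bs => leadA as (b.cup c.2) bs

/-- The cup product of the first entry with the Hirsch operation. -/
def leadAct {m : ℕ} (b : Cochain R Q m) (bs : List (BarLetter R Q)) :
    List (BarLetter R Q) → Cochains R Q
  | [] => 0
  | a :: as => (-1 : R) ^ a.1 • mulA R Q (homog a.2) (leadA as b bs)

theorem leadA_smul_unit_cup (r : R) (as : List (BarLetter R Q)) (c : BarLetter R Q)
    (l : List (BarLetter R Q)) :
    leadA as (Cochain.cup (r • Cochain.unit : Cochain R Q 0) c.2) l =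
      r • susp R Q (hirschB as (c :: l)) := by
  -- Multiplication by the unit changes the degree only from `c.1` to `0 + c.1`; as letters both are
  -- equal.
  have hc : (⟨0 + c.1, Cochain.cup (Cochain.unit : Cochain R Q 0) (q := c.1 + 1) c.2⟩ :
      BarLetter R Q) = c := by
    refine BarLetter.ext_of_eval (zero_add _) ?_
    have he : homog (Cochain.cup (Cochain.unit : Cochain R Q 0) c.2) = homog c.2 := by
      rw [← mulA_homog, mulA_unit_left]
    exact (toCell_homog _).symm.trans ((congrArg _ he).trans (toCell_homog _))
  have h2 : leadA as (Cochain.cup (Cochain.unit : Cochain R Q 0) c.2) l =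
      susp R Q (hirschB as (c :: l)) :=
    (leadA_succ (k := 0 + c.1) as _ l).trans (by rw [hc])
  exact (congrArg (fun x => leadA as x l) (cup_smul_left r (Cochain.unit : Cochain R Q 0) c.2)).trans
    ((leadA_smul as r _ l).trans (congrArg (r • ·) h2))

variable [OneReduced Q]

/-- Here `b` is a multiple of the unit, so the operations on it vanish but for the identity, and the
terms with a differential are zero. What remains is `1 · E(as; bs)`. It cancels against the
operation with `1 · b_1` in place of `b_1` if `bs` is nonempty, and against the left action of the
first letter on the unit otherwise. -/
theorem deltaA_leadA_zero (as : List (BarLetter R Q)) (b : Cochain R Q 0)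
    (bs : List (BarLetter R Q)) : deltaA R Q (leadA as b bs) =
      -listDiff (fun l => leadA l b bs) as +
      (-1 : R) ^ barDegree as • (leadA as b.coboundary bs - (-1 : R) ^ 0 • leadCup as b bs +
        (-1 : R) ^ 0 • listDiff (fun l => leadA as b l) bs) - leadAct b bs as -
      biSplit (fun as₁ as₂ bs₁ bs₂ => (-1 : R) ^ (barDegree as₁ + (0 + 1) + barDegree bs₁ +
        (0 + 1 + barDegree bs₁) * barDegree as₂) •
          mulA R Q (leadA as₁ b bs₁) (susp R Q (hirschB as₂ bs₂))) as bs := by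
  obtain ⟨r, rfl⟩ := exists_eq_smul_unit b
  have e0 : leadA as (r • Cochain.unit : Cochain R Q 0).coboundary bs = 0 := by
    rw [cochain_one_eq_zero (r • Cochain.unit : Cochain R Q 0).coboundary]
    have := leadA_add_smul as (-1 : R) (0 : Cochain R Q 1) 0 bs
    simpa using this
  have e1 : deltaA R Q (homog (r • Cochain.unit : Cochain R Q 0)) = 0 := by
    rw [deltaA_homog, cochain_one_eq_zero (Cochain.coboundary _)]
    exact map_zero _
  have e2 : deltaA R Q (leadA as (r • Cochain.unit : Cochain R Q 0) bs) = 0 := by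
    rw [leadA_zero, emptyPair]
    split_ifs
    · exact e1
    · exact map_zero _
  have e3 : listDiff (fun l => leadA l (r • Cochain.unit : Cochain R Q 0) bs) as = 0 := by
    simp only [leadA_zero, listDiff_emptyPair_left]
  have e4 : listDiff (fun l => leadA as (r • Cochain.unit : Cochain R Q 0) l) bs = 0 := by
    simp only [leadA_zero]
    exact listDiff_emptyPair_right _ _ _
  have e5 : biSplit (fun as₁ as₂ bs₁ bs₂ => (-1 : R) ^ (barDegree as₁ + (0 + 1) + barDegree bs₁ +
      (0 + 1 + barDegree bs₁) * barDegree as₂) • mulA R Q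
        (leadA as₁ (r • Cochain.unit : Cochain R Q 0) bs₁) (susp R Q (hirschB as₂ bs₂))) as bs =
      (-1 : R) ^ (1 + barDegree as) • r • susp R Q (hirschB as bs) := by
    simp only [leadA_zero, biSplit]
    rw [splitSum_eq_left, splitSum_eq_left]
    · rw [emptyPair, if_pos ⟨rfl, rfl⟩, homog_smul, map_smul, LinearMap.smul_apply, mulA_unit_left]
      simp
    · intro a x y; simp [emptyPair]
    · intro a x y; simp [emptyPair, splitSum_zero]
  have e6 : leadCup as (r • Cochain.unit : Cochain R Q 0) bs =
      if bs = [] then 0 else r • susp R Q (hirschB as bs) := by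
    obtain _ | ⟨c, l⟩ := bs
    · rfl
    · rw [if_neg (by simp), leadCup]
      exact leadA_smul_unit_cup r as c l
  have e7 : leadAct (r • Cochain.unit : Cochain R Q 0) bs as =
      if bs = [] then (-1 : R) ^ barDegree as • r • susp R Q (hirschB as bs) else 0 := by
    obtain _ | ⟨a, l⟩ := as
    · rw [leadAct]
      split_ifs with h
      · rw [h, hirschB_nil_nil, map_zero, smul_zero, smul_zero]
      · rfl
    · rw [leadAct, leadA_zero]
      split_ifs with h
      · obtain _ | ⟨c, l⟩ := l
        · rw [h, emptyPair, if_pos ⟨rfl, rfl⟩, homog_smul, map_smul, mulA_unit_right,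
            hirschB_singleton_left, susp_elem, barDegree_cons, barDegree_nil, add_zero]
        · rw [h, emptyPair, if_neg (by simp), hirschB_nil_right (by simp)]
          simp
      · rw [emptyPair, if_neg (fun h' => h h'.2), map_zero, smul_zero]
  rw [e0, e2, e3, e4, e5, e6, e7]
  generalize susp R Q (hirschB as bs) = X
  rw [pow_add]
  split_ifs <;> module

/-- The structure equation for `E(as; b, bs)` with the role of `b` made explicit. A quadratic term
in which `b` belongs to the second factor has first factor `E_{p,0}`, so only `p = 1` remains, and
this is the left action of the first letter. -/
theorem deltaA_leadA_succ (as : List (BarLetter R Q)) {k : ℕ} (b : Cochain R Q (k + 1))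
    (bs : List (BarLetter R Q)) : deltaA R Q (leadA as b bs) =
      -listDiff (fun l => leadA l b bs) as +
      (-1 : R) ^ barDegree as • (leadA as b.coboundary bs - (-1 : R) ^ (k + 1) • leadCup as b bs +
        (-1 : R) ^ (k + 1) • listDiff (fun l => leadA as b l) bs) - leadAct b bs as -
      biSplit (fun as₁ as₂ bs₁ bs₂ => (-1 : R) ^ (barDegree as₁ + (k + 1 + 1) + barDegree bs₁ +
        (k + 1 + 1 + barDegree bs₁) * barDegree as₂) •
          mulA R Q (leadA as₁ b bs₁) (susp R Q (hirschB as₂ bs₂))) as bs := by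
  simp only [leadA_succ]
  rw [← susp_deltaB, ← neg_neg (deltaB R Q _), neg_deltaB_hirschB]
  have f1 : listDiff (fun l => susp R Q (hirschB as l)) (⟨k, b⟩ :: bs) =
      -susp R Q (hirschB as (⟨k + 1, b.coboundary⟩ :: bs)) -
      (-1 : R) ^ k • leadCup as b bs +
      (-1 : R) ^ k • listDiff (fun l => susp R Q (hirschB as (⟨k, b⟩ :: l))) bs := by
    obtain _ | ⟨c, l⟩ := bs
    · simp [listDiff, BarLetter.coboundary, leadCup]
    · have h := leadA_succ (k := k + 1 + c.1) as (b.cup c.2) l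
      rw [listDiff, leadCup]
      exact congrArg (fun x => _ - (-1 : R) ^ k • x + _) h.symm
  have f3 : biSplit (fun as₁ as₂ bs₁ bs₂ =>
      (-1 : R) ^ (barDegree as₁ + barDegree bs₁ + barDegree bs₁ * barDegree as₂) •
        mulA R Q (susp R Q (hirschB as₁ bs₁)) (susp R Q (hirschB as₂ bs₂))) as (⟨k, b⟩ :: bs) =
      leadAct b bs as +
      biSplit (fun as₁ as₂ bs₁ bs₂ => (-1 : R) ^ (barDegree as₁ + (k + barDegree bs₁) +
        (k + barDegree bs₁) * barDegree as₂) •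
        mulA R Q (susp R Q (hirschB as₁ (⟨k, b⟩ :: bs₁))) (susp R Q (hirschB as₂ bs₂))) as bs := by
    simp only [biSplit, splitSum, splitSum_add, barDegree_cons, barDegree_nil]
    congr 1
    obtain _ | ⟨a, l⟩ := as
    · simp [splitSum, hirschB_nil_nil, leadAct]
    · simp only [splitSum, hirschB_nil_nil, map_zero, LinearMap.zero_apply, smul_zero, zero_add]
      rw [splitSum_eq_left]
      · rw [hirschB_singleton_left, barDegree_cons, barDegree_nil, susp_elem, leadAct, leadA_succ]
        simp
      · intro c x y
        rw [hirschB_nil_right (by simp)]; simp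
  have f6 : biSplit (fun as₁ as₂ bs₁ bs₂ => (-1 : R) ^ (barDegree as₁ + (k + 1 + 1) +
        barDegree bs₁ + (k + 1 + 1 + barDegree bs₁) * barDegree as₂) •
      mulA R Q (susp R Q (hirschB as₁ (⟨k, b⟩ :: bs₁))) (susp R Q (hirschB as₂ bs₂))) as bs =
      biSplit (fun as₁ as₂ bs₁ bs₂ => (-1 : R) ^ (barDegree as₁ + (k + barDegree bs₁) +
        (k + barDegree bs₁) * barDegree as₂) •
        mulA R Q (susp R Q (hirschB as₁ (⟨k, b⟩ :: bs₁))) (susp R Q (hirschB as₂ bs₂))) as bs := by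
    refine biSplit_congr fun x y z w _ _ => ?_
    congr 1
    apply neg_one_pow_congr
    push_cast
    linear_combination (1 + barDegree y : ZMod 2) * zmod_two_two
  rw [map_neg, map_add, map_add, map_smul, map_listDiff, map_listDiff, map_biSplit]
  simp only [map_smul, susp_mulB]
  rw [f1, f3, f6, pow_succ]
  module

theorem deltaA_leadA (as : List (BarLetter R Q)) {m : ℕ} (b : Cochain R Q m)
    (bs : List (BarLetter R Q)) : deltaA R Q (leadA as b bs) =
      -listDiff (fun l => leadA l b bs) as +
      (-1 : R) ^ barDegree as • (leadA as b.coboundary bs - (-1 : R) ^ m • leadCup as b bs +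
        (-1 : R) ^ m • listDiff (fun l => leadA as b l) bs) - leadAct b bs as -
      biSplit (fun as₁ as₂ bs₁ bs₂ => (-1 : R) ^ (barDegree as₁ + (m + 1) + barDegree bs₁ +
        (m + 1 + barDegree bs₁) * barDegree as₂) •
          mulA R Q (leadA as₁ b bs₁) (susp R Q (hirschB as₂ bs₂))) as bs := by
  obtain _ | k := m
  · exact deltaA_leadA_zero as b bs
  · exact deltaA_leadA_succ as b bs

end Lead

/-! ### The product of a word with an element of the acyclic bar construction -/

section WordProduct

variable {R : Type v} [CommRing R] {Q : CubicalSet.{u}}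

/-- The product of `1 ⊗ [ā_1|…|ā_n]` and `b ⊗ [b̄_1|…|b̄_m]`. -/
def wordProd (as : List (BarLetter R Q)) {m : ℕ} (b : Cochain R Q m) (bs : List (BarLetter R Q)) :
    Acyclic R Q :=
  biSplit (fun x y z w => (-1 : R) ^ (barDegree x + barDegree y * (m + barDegree z)) •
    tens R Q (leadA x b z) (barProd y w)) as bs

/-- The product of the words of which the first entry of the first one acts from the left. -/
def wordProdAct {m : ℕ} (b : Cochain R Q m) (bs : List (BarLetter R Q)) :
    List (BarLetter R Q) → Acyclic R Q
  | [] => 0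
  | a :: as => leftMul R Q (homog a.2) (wordProd as b bs)

/-- The product of the words of which the first entry of the second one multiplies the
distinguished entry. -/
def wordProdCup (as : List (BarLetter R Q)) {m : ℕ} (b : Cochain R Q m) :
    List (BarLetter R Q) → Acyclic R Q
  | [] => 0
  | c :: bs => wordProd as (b.cup c.2) bs

theorem wordProd_add_smul (as : List (BarLetter R Q)) {m : ℕ} (r : R) (b c : Cochain R Q m)
    (bs : List (BarLetter R Q)) :
    wordProd as (b + r • c) bs = wordProd as b bs + r • wordProd as c bs := by
  have hs := biSplit_smul (R := R) (M := Acyclic R Q) (α := BarLetter R Q) r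
  rw [wordProd, wordProd, wordProd, ← hs, ← biSplit_add]
  refine biSplit_congr fun x y z w _ _ => ?_
  rw [leadA_add_smul, map_add, map_smul, LinearMap.add_apply, LinearMap.smul_apply]
  module

/-- Once the first letter acts from the left, the remaining letters are cut exactly as in the
product of the shorter word. -/
theorem biSplit_leadAct (as : List (BarLetter R Q)) {m : ℕ} (b : Cochain R Q m)
    (bs : List (BarLetter R Q)) :
    biSplit (fun x y z w => (-1 : R) ^ (barDegree x + barDegree y * (m + barDegree z)) •
      tens R Q (leadAct b z x) (barProd y w)) as bs = wordProdAct b bs as := by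
  obtain _ | ⟨a, l⟩ := as
  · simp [biSplit, splitSum, leadAct, splitSum_zero, wordProdAct]
  · rw [wordProdAct, wordProd, map_biSplit, biSplit, splitSum]
    simp only [leadAct, map_zero, LinearMap.zero_apply, smul_zero, splitSum_zero, zero_add]
    refine biSplit_congr fun x y z w _ _ => ?_
    rw [map_smul, map_smul, leftMul_tmul, LinearMap.smul_apply, smul_smul, ← pow_add, barDegree_cons]
    congr 1
    apply neg_one_pow_congr
    push_cast
    linear_combination (a.1 : ZMod 2) * zmod_two_two

theorem biSplit_leadCup (as : List (BarLetter R Q)) {m : ℕ} (b : Cochain R Q m)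
    (bs : List (BarLetter R Q)) :
    biSplit (fun x y z w => (-1 : R) ^ (barDegree y * (m + barDegree z)) •
      tens R Q (leadCup x b z) (barProd y w)) as bs =
        (-1 : R) ^ barDegree as • wordProdCup as b bs := by
  obtain _ | ⟨c, l⟩ := bs
  · simp [biSplit, splitSum, leadCup, splitSum_zero, wordProdCup]
  · have hs := biSplit_smul (R := R) (M := Acyclic R Q) (α := BarLetter R Q) ((-1) ^ barDegree as)
    rw [wordProdCup, wordProd, ← hs]
    simp only [biSplit, splitSum, leadCup, map_zero, LinearMap.zero_apply, smul_zero, zero_add]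
    refine biSplit_congr fun x y z w hx _ => ?_
    rw [smul_smul, ← pow_add, barDegree_cons, ← hx, barDegree_append]
    congr 1
    apply neg_one_pow_congr
    push_cast
    linear_combination (-barDegree x - barDegree y : ZMod 2) * zmod_two_two

/-- Bookkeeping: every sign depends only on the parities of the four exponents, and the sixteen
cases are checked separately. -/
theorem wordProd_sign_identity {M : Type*} [AddCommGroup M] [Module R M] (α β γ m : ℕ)
    (X₁ X₂ X₃ X₄ X₅ X₆ Y₁ Y₂ H : M) :
    (-1 : R) ^ (α + β * (m + γ)) • ((-X₁ + (-1 : R) ^ α • (X₂ - (-1 : R) ^ m • X₃ +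
      (-1 : R) ^ m • X₄) - X₅ - X₆) + (-1 : R) ^ (α + m + γ) • (Y₁ + (-1 : R) ^ β • Y₂) -
      (-1 : R) ^ (α + m + γ) • H) -
    (((-1 : R) ^ (α + 1 + β * (m + γ)) • X₁ +
      (-1 : R) ^ α • (-1 : R) ^ (α + (m + γ) * (β + 1)) • Y₁) -
      (-1 : R) ^ (α + β * (m + γ)) • X₅ +
      ((-1 : R) ^ (α + β) • (-1 : R) ^ (α + β * (m + 1 + γ)) • X₂ +
      (-1 : R) ^ (α + β + m) • ((-1 : R) ^ (α + β * m + β * (γ + 1)) • X₄ +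
        (-1 : R) ^ γ • (-1 : R) ^ (α + β * (m + γ)) • Y₂) -
      (-1 : R) ^ m • (-1 : R) ^ (β * (m + γ)) • X₃)) =
    (-1 : R) ^ (α + β * (m + γ) + 1) • X₆ - (-1 : R) ^ (m + γ + β * (m + γ)) • H := by
  simp only [neg_one_pow_eq_ite, Nat.even_add, Nat.even_mul, Nat.even_add_one]
  by_cases hα : Even α <;> by_cases hβ : Even β <;> by_cases hγ : Even γ <;>
    by_cases hm : Even m <;> simp only [hα, hβ, hγ, hm] <;> simp <;> abel

variable [OneReduced Q]

theorem isMultilinear_wordProd_left {m : ℕ} (b : Cochain R Q m) (bs : List (BarLetter R Q)) :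
    IsMultilinear fun as => wordProd as b bs := by
  refine isMultilinear_biSplit_left (fun y z w => ?_) (fun x z w => ?_) bs
  · exact ((isMultilinear_leadA_left b z).map ((tens R Q).flip (barProd y w))).smul_degree
      fun d => (-1) ^ (d + barDegree y * (m + barDegree z))
  · exact ((isMultilinear_barProd_left w).map (tens R Q (leadA x b z))).smul_degree
      fun d => (-1) ^ (barDegree x + d * (m + barDegree z))

theorem isMultilinear_wordProd_right (as : List (BarLetter R Q)) {m : ℕ} (b : Cochain R Q m) :
    IsMultilinear fun bs => wordProd as b bs := by
  refine isMultilinear_biSplit_right (fun x y w => ?_) (fun x y z => ?_) as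
  · exact ((isMultilinear_leadA_right x b).map ((tens R Q).flip (barProd y w))).smul_degree
      fun d => (-1) ^ (barDegree x + barDegree y * (m + d))
  · exact ((isMultilinear_barProd_right y).map (tens R Q (leadA x b z))).smul _

theorem headMulA_barProd (a : Cochains R Q) (as bs : List (BarLetter R Q)) :
    headMulA R Q a (barProd as bs) = biSplit (fun as₁ as₂ bs₁ bs₂ =>
      (-1 : R) ^ (barDegree bs₁ * barDegree as₂) •
        tens R Q (mulA R Q a (susp R Q (hirschB as₁ bs₁))) (barProd as₂ bs₂)) as bs := by
  rw [barProd_eq, barProdStep, map_add, map_biSplit]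
  have : headMulA R Q a (emptyPair 1 as bs) = 0 := by
    rw [emptyPair]
    split_ifs
    · exact headMulA_one a
    · exact map_zero _
  simp only [this, zero_add, map_smul, headMulA_mul]

/-- The argument for the bar construction with a distinguished entry. `deltaA_leadA` gives the
differential of the coefficient and `diffB_barProd` that of the word. The quadratic terms of the
former cancel against the terms in which the coefficient absorbs the first letter of the word. -/
theorem diffA_wordProd (as : List (BarLetter R Q)) {m : ℕ} (b : Cochain R Q m)
    (bs : List (BarLetter R Q)) :
    diffA R Q (wordProd as b bs) = listDiff (fun l => wordProd l b bs) as - wordProdAct b bs as +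
      ((-1 : R) ^ barDegree as • wordProd as b.coboundary bs +
        (-1 : R) ^ (barDegree as + m) • listDiff (fun l => wordProd as b l) bs -
        (-1 : R) ^ m • (-1 : R) ^ barDegree as • wordProdCup as b bs) := by
  rw [← biSplit_leadAct, ← biSplit_leadCup]
  have hs := fun r : R => biSplit_smul (R := R) (M := Acyclic R Q) (α := BarLetter R Q) r
  have e1 : listDiff (fun l => wordProd l b bs) as = _ := listDiff_biSplit_left _ as bs
  have e2 : listDiff (fun l => wordProd as b l) bs = _ := listDiff_biSplit_right _ as bs
  rw [e1, e2, wordProd, wordProd, map_biSplit]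
  rw [← hs, ← hs, ← hs, ← biSplit_add, ← biSplit_sub, ← biSplit_sub, ← biSplit_add]
  -- One bracketing of this sum over cuts into three pieces gives the quadratic terms of the
  -- coefficient, the other gives the absorbed first letters.
  have triple := biSplit_assoc (fun as₁ as₂ as₃ bs₁ bs₂ bs₃ : List (BarLetter R Q) =>
    (-1 : R) ^ (m + barDegree bs₁ + (m + barDegree bs₁) * barDegree as₂ +
      barDegree as₃ * (m + barDegree bs₁ + barDegree bs₂)) •
    tens R Q (mulA R Q (leadA as₁ b bs₁) (susp R Q (hirschB as₂ bs₂))) (barProd as₃ bs₃)) as bs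
  rw [← sub_eq_zero] at triple ⊢
  rw [← biSplit_sub] at triple ⊢
  rw [← triple]
  refine biSplit_congr fun x y z w hx hz => ?_
  have t1 : biSplit (fun as₁ as₂ bs₁ bs₂ : List (BarLetter R Q) =>
      (-1 : R) ^ (m + barDegree bs₁ + (m + barDegree bs₁) * barDegree as₂ +
        barDegree y * (m + barDegree bs₁ + barDegree bs₂)) •
      tens R Q (mulA R Q (leadA as₁ b bs₁) (susp R Q (hirschB as₂ bs₂))) (barProd y w)) x z =
      (-1 : R) ^ (barDegree x + barDegree y * (m + barDegree z) + 1) •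
        tens R Q (biSplit (fun as₁ as₂ bs₁ bs₂ => (-1 : R) ^ (barDegree as₁ + (m + 1) +
          barDegree bs₁ + (m + 1 + barDegree bs₁) * barDegree as₂) •
          mulA R Q (leadA as₁ b bs₁) (susp R Q (hirschB as₂ bs₂))) x z) (barProd y w) := by
    have h := map_biSplit (α := BarLetter R Q)
      ((-1 : R) ^ (barDegree x + barDegree y * (m + barDegree z) + 1) •
        (tens R Q).flip (barProd y w))
    simp only [LinearMap.smul_apply, LinearMap.flip_apply] at h
    rw [h]
    refine biSplit_congr fun x₁ x₂ z₁ z₂ hx hz => ?_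
    rw [map_smul, LinearMap.smul_apply, smul_smul, ← pow_add, ← hz, ← hx, barDegree_append,
      barDegree_append]
    congr 1
    apply neg_one_pow_congr
    push_cast
    linear_combination (-1 - barDegree x₂ - barDegree x₁ : ZMod 2) * zmod_two_two
  have t2 : biSplit (fun as₂ as₃ bs₂ bs₃ : List (BarLetter R Q) =>
      (-1 : R) ^ (m + barDegree z + (m + barDegree z) * barDegree as₂ +
        barDegree as₃ * (m + barDegree z + barDegree bs₂)) •
      tens R Q (mulA R Q (leadA x b z) (susp R Q (hirschB as₂ bs₂))) (barProd as₃ bs₃)) y w =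
      (-1 : R) ^ (m + barDegree z + barDegree y * (m + barDegree z)) •
        headMulA R Q (leadA x b z) (barProd y w) := by
    rw [headMulA_barProd, ← hs]
    refine biSplit_congr fun y₁ y₂ w₁ w₂ hy _ => ?_
    rw [smul_smul, ← pow_add, ← hy, barDegree_append]
    congr 2
    ring
  rw [t1, t2]
  have L1 : listDiff (fun x' => (-1 : R) ^ (barDegree x' + barDegree y * (m + barDegree z)) •
      tens R Q (leadA x' b z) (barProd y w)) x =
      (-1 : R) ^ (barDegree x + 1 + barDegree y * (m + barDegree z)) •
        tens R Q (listDiff (fun x' => leadA x' b z) x) (barProd y w) := by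
    have h := map_listDiff ((-1 : R) ^ (barDegree y * (m + barDegree z)) •
      (tens R Q).flip (barProd y w)) (fun x' => leadA x' b z) x
    simp only [LinearMap.smul_apply, LinearMap.flip_apply] at h
    have h' := listDiff_sign (R := R) 1 (fun x' => (-1 : R) ^ (barDegree y * (m + barDegree z)) •
      tens R Q (leadA x' b z) (barProd y w)) x
    simp only [one_mul, smul_smul, ← pow_add] at h'
    rw [h', ← h, smul_smul, ← pow_add]
  have L2 : listDiff (fun y' => (-1 : R) ^ (barDegree x + barDegree y' * (m + barDegree z)) •
      tens R Q (leadA x b z) (barProd y' w)) y =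
      (-1 : R) ^ (barDegree x + (m + barDegree z) * (barDegree y + 1)) •
        tens R Q (leadA x b z) (listDiff (fun y' => barProd y' w) y) := by
    have h := map_listDiff ((-1 : R) ^ barDegree x • tens R Q (leadA x b z))
      (fun y' => barProd y' w) y
    simp only [LinearMap.smul_apply] at h
    have h' := listDiff_sign (R := R) (m + barDegree z) (fun y' => (-1 : R) ^ barDegree x •
      tens R Q (leadA x b z) (barProd y' w)) y
    rw [← h, smul_smul, ← pow_add] at h'
    rw [add_comm (barDegree x), ← h']
    refine congrArg (fun f => listDiff f y) (funext fun y' => ?_)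
    rw [smul_smul, ← pow_add]
    congr 2
    ring
  have L3 : listDiff (fun z' => (-1 : R) ^ (barDegree x + barDegree y * (m + barDegree z')) •
      tens R Q (leadA x b z') (barProd y w)) z =
      (-1 : R) ^ (barDegree x + barDegree y * m + barDegree y * (barDegree z + 1)) •
        tens R Q (listDiff (fun z' => leadA x b z') z) (barProd y w) := by
    have h := map_listDiff ((-1 : R) ^ (barDegree x + barDegree y * m) •
      (tens R Q).flip (barProd y w)) (fun z' => leadA x b z') z
    simp only [LinearMap.smul_apply, LinearMap.flip_apply] at h
    have h' := listDiff_sign (R := R) (barDegree y) (fun z' =>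
      (-1 : R) ^ (barDegree x + barDegree y * m) • tens R Q (leadA x b z') (barProd y w)) z
    rw [← h, smul_smul, ← pow_add] at h'
    rw [add_comm (barDegree x + barDegree y * m), ← h']
    refine congrArg (fun f => listDiff f z) (funext fun z' => ?_)
    rw [smul_smul, ← pow_add]
    congr 2
    ring
  have L4 : listDiff (fun w' => (-1 : R) ^ (barDegree x + barDegree y * (m + barDegree z)) •
      tens R Q (leadA x b z) (barProd y w')) w =
      (-1 : R) ^ (barDegree x + barDegree y * (m + barDegree z)) •
        tens R Q (leadA x b z) (listDiff (fun w' => barProd y w') w) :=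
    (map_listDiff ((-1 : R) ^ (barDegree x + barDegree y * (m + barDegree z)) •
      tens R Q (leadA x b z)) (fun w' => barProd y w') w).symm
  rw [L1, L2, L3, L4, map_smul, diffA_tmul, deltaA_leadA, signA_leadA, diffB_barProd, ← hx,
    barDegree_append]
  simp only [map_add, map_sub, map_neg, map_smul, LinearMap.add_apply, LinearMap.sub_apply,
    LinearMap.neg_apply, LinearMap.smul_apply]
  have id := wordProd_sign_identity (R := R) (barDegree x) (barDegree y) (barDegree z) m
    (tens R Q (listDiff (fun x' => leadA x' b z) x) (barProd y w))
    (tens R Q (leadA x b.coboundary z) (barProd y w)) (tens R Q (leadCup x b z) (barProd y w))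
    (tens R Q (listDiff (fun z' => leadA x b z') z) (barProd y w))
    (tens R Q (leadAct b z x) (barProd y w))
  rw [← id]
  module

end WordProduct

/-! ### The product of the acyclic bar construction -/

section AcyclicProduct

variable {R : Type v} [CommRing R] {Q : CubicalSet.{u}}

theorem acyclic_generators_induction {p : Acyclic R Q → Prop}
    (h : ∀ (n : ℕ) (a : Cochain R Q n) (l : List (BarLetter R Q)), p (tens R Q (homog a) (barWord l)))
    (ha : ∀ x y, p x → p y → p (x + y)) (hs : ∀ (r : R) x, p x → p (r • x)) (z : Acyclic R Q) :
    p z := by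
  refine acyclic_induction (fun a w => ?_) ha z
  induction w using bar_induction with
  | h l =>
    induction a using cochains_induction with
    | h0 => simpa using hs 0 _ (h 0 0 l)
    | h n a => exact h n a l
    | ha x y hx hy => rw [map_add, LinearMap.add_apply]; exact ha _ _ hx hy
  | ha x y hx hy => rw [map_add]; exact ha _ _ hx hy
  | hs r x hx => rw [map_smul]; exact hs r _ hx

theorem acyclic_hom_ext {M : Type*} [AddCommGroup M] [Module R M] {f g : Acyclic R Q →ₗ[R] M}
    (h : ∀ (n : ℕ) (a : Cochain R Q n) (l : List (BarLetter R Q)),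
      f (tens R Q (homog a) (barWord l)) = g (tens R Q (homog a) (barWord l))) : f = g := by
  ext z
  induction z using acyclic_generators_induction with
  | h n a l => exact h n a l
  | ha x y hx hy => rw [map_add, map_add, hx, hy]
  | hs r x hx => rw [map_smul, map_smul, hx]

theorem wordProd_smul (as : List (BarLetter R Q)) {m : ℕ} (r : R) (b : Cochain R Q m)
    (bs : List (BarLetter R Q)) : wordProd as (r • b) bs = r • wordProd as b bs := by
  have h0 := wordProd_add_smul as (1 : R) (0 : Cochain R Q m) 0 bs
  rw [smul_zero, add_zero, one_smul] at h0
  have h := wordProd_add_smul as r 0 b bs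
  rwa [zero_add, left_eq_add.1 h0, zero_add] at h

/-- The index `q` counts the entry `b_0` as well, so it exceeds the number of letters taken from
`bs` by one. -/
theorem leftMul_wordProd {n m : ℕ} (a : Cochain R Q n) (as : List (BarLetter R Q)) (b : Cochain R Q m)
    (bs : List (BarLetter R Q)) :
    leftMul R Q (homog a) (wordProd as b bs) = toAcyclic R Q (
      ∑ p ∈ Finset.range (as.length + 1), ∑ q ∈ Finset.Icc 1 (bs.length + 1),
        (-1 : R) ^ (barDegree (as.take p) +
            barDegree (as.drop p) * (m + barDegree (bs.take (q - 1)))) •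
          acyclicBarMk (a.cup (hirschLead (as.take p) b (bs.take (q - 1))))
            (barProd (as.drop p) (bs.drop (q - 1)))) := by
  rw [wordProd, map_biSplit, biSplit, splitSum_eq_sum, map_sum]
  refine Finset.sum_congr rfl fun p _ => ?_
  rw [splitSum_eq_sum, map_sum]
  refine Finset.sum_nbij' (· + 1) (· - 1) ?_ ?_ ?_ ?_ ?_
  · intro q hq
    rw [Finset.mem_range] at hq
    exact Finset.mem_Icc.2 ⟨by omega, by omega⟩
  · intro q hq
    rw [Finset.mem_Icc] at hq
    exact Finset.mem_range.2 (by omega)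
  · intro q _
    exact Nat.add_sub_cancel q 1
  · intro q hq
    rw [Finset.mem_Icc] at hq
    exact Nat.sub_add_cancel hq.1
  · intro q _
    rw [Nat.add_sub_cancel, map_smul, map_smul, leftMul_tmul, leadA, mulA_homog]
    rfl

/-- Operations with empty first argument vanish on two or more entries; this is what the left unit
law needs. -/
theorem leadA_nil_cons {m : ℕ} (b : Cochain R Q m) (c : BarLetter R Q) (l : List (BarLetter R Q)) :
    leadA [] b (c :: l) = 0 := by
  obtain _ | k := m
  · rw [leadA_zero, emptyPair, if_neg (by simp)]
  · rw [leadA_succ, hirschB_nil_left (by simp), map_zero]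

variable [OneReduced Q]

theorem leadA_nil_nil {m : ℕ} (b : Cochain R Q m) : leadA [] b [] = homog b := by
  obtain _ | k := m
  · rw [leadA_zero, emptyPair, if_pos ⟨rfl, rfl⟩]
  · rw [leadA_succ, hirschB_singleton_right, susp_elem]

/-- The product of a word with the elements of the acyclic bar construction. -/
def wordMul (as : List (BarLetter R Q)) : Acyclic R Q →ₗ[R] Acyclic R Q :=
  acyclicLift R Q <| DirectSum.toModule R ℕ _ fun _ =>
    { toFun := fun b => listLift (fun bs => wordProd as b bs) (isMultilinear_wordProd_right as b)
      map_add' := fun b c => bar_hom_ext fun l => by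
        rw [LinearMap.add_apply, listLift_barWord, listLift_barWord, listLift_barWord]
        simpa using wordProd_add_smul as (1 : R) b c l
      map_smul' := fun r b => bar_hom_ext fun l => by
        rw [LinearMap.smul_apply, listLift_barWord, listLift_barWord]
        exact wordProd_smul as r b l }

theorem wordMul_tens (as : List (BarLetter R Q)) {m : ℕ} (b : Cochain R Q m)
    (bs : List (BarLetter R Q)) :
    wordMul as (tens R Q (homog b) (barWord bs)) = wordProd as b bs := by
  rw [wordMul, acyclicLift_tens, homog, DirectSum.toModule_lof]
  exact listLift_barWord _ _ _

theorem isMultilinear_wordMul : IsMultilinear (wordMul (R := R) (Q := Q)) := fun x n r a b y =>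
  acyclic_hom_ext fun m c l => by
    rw [LinearMap.add_apply, LinearMap.smul_apply, wordMul_tens, wordMul_tens, wordMul_tens]
    exact isMultilinear_wordProd_left c l x n r a b y

variable (R Q)

/-- The product of elements of the bar construction and of the acyclic bar construction. -/
def barMul : Bar R Q →ₗ[R] Acyclic R Q →ₗ[R] Acyclic R Q := listLift wordMul isMultilinear_wordMul

/-- The product of the acyclic bar construction. -/
def acyclicMul : Acyclic R Q →ₗ[R] Acyclic R Q →ₗ[R] Acyclic R Q :=
  acyclicLift R Q <| LinearMap.mk₂ R (fun a w => leftMul R Q a ∘ₗ barMul R Q w)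
    (fun a b w => by rw [map_add, LinearMap.add_comp])
    (fun r a w => by rw [map_smul, LinearMap.smul_comp])
    (fun a w w' => by rw [map_add, LinearMap.comp_add])
    (fun r a w => by rw [map_smul, LinearMap.comp_smul])

variable {R Q}

theorem barMul_barWord (as : List (BarLetter R Q)) : barMul R Q (barWord as) = wordMul as :=
  listLift_barWord _ _ _

theorem acyclicMul_tens (a : Cochains R Q) (as : List (BarLetter R Q)) (z : Acyclic R Q) :
    acyclicMul R Q (tens R Q a (barWord as)) z = leftMul R Q a (wordMul as z) := by
  rw [acyclicMul, acyclicLift_tens, LinearMap.mk₂_apply, LinearMap.comp_apply, barMul_barWord]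

theorem acyclicMul_tens_tens (a : Cochains R Q) (as : List (BarLetter R Q)) {m : ℕ}
    (b : Cochain R Q m) (bs : List (BarLetter R Q)) :
    acyclicMul R Q (tens R Q a (barWord as)) (tens R Q (homog b) (barWord bs)) =
      leftMul R Q a (wordProd as b bs) := by
  rw [acyclicMul_tens, wordMul_tens]

/-- Linear maps pass through `listDiff`, so the product formula for words extends to differentiated
words. -/
theorem acyclicMul_listDiff_left (a : Cochains R Q) (as : List (BarLetter R Q)) {m : ℕ}
    (b : Cochain R Q m) (bs : List (BarLetter R Q)) :
    acyclicMul R Q (tens R Q a (listDiff barWord as)) (tens R Q (homog b) (barWord bs)) =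
      leftMul R Q a (listDiff (fun l => wordProd l b bs) as) := by
  have h := map_listDiff ((acyclicMul R Q).flip (tens R Q (homog b) (barWord bs)) ∘ₗ tens R Q a)
    barWord as
  simp only [LinearMap.comp_apply, LinearMap.flip_apply, acyclicMul_tens_tens] at h
  rw [h, map_listDiff]

theorem acyclicMul_listDiff_right (a : Cochains R Q) (as : List (BarLetter R Q)) {m : ℕ}
    (b : Cochain R Q m) (bs : List (BarLetter R Q)) :
    acyclicMul R Q (tens R Q a (barWord as)) (tens R Q (homog b) (listDiff barWord bs)) =
      leftMul R Q a (listDiff (fun l => wordProd as b l) bs) := by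
  have h := map_listDiff (acyclicMul R Q (tens R Q a (barWord as)) ∘ₗ tens R Q (homog b))
    barWord bs
  simp only [LinearMap.comp_apply, acyclicMul_tens_tens] at h
  rw [h, map_listDiff]

theorem acyclicMul_headMulA_left (a : Cochains R Q) (as : List (BarLetter R Q)) {m : ℕ}
    (b : Cochain R Q m) (bs : List (BarLetter R Q)) :
    acyclicMul R Q (headMulA R Q a (barWord as)) (tens R Q (homog b) (barWord bs)) =
      leftMul R Q a (wordProdAct b bs as) := by
  obtain _ | ⟨c, l⟩ := as
  · rw [barWord_nil, headMulA_one, map_zero, LinearMap.zero_apply, wordProdAct, map_zero]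
  · rw [barWord_cons, headMulA_mul, acyclicMul_tens_tens, wordProdAct, susp_elem]
    induction wordProd l b bs using acyclic_induction with
    | h x w => rw [leftMul_tmul, leftMul_tmul, leftMul_tmul, mulA_assoc]
    | ha x y hx hy => simp only [map_add, hx, hy]

theorem acyclicMul_headMulA_right (a : Cochains R Q) (as : List (BarLetter R Q)) {m : ℕ}
    (b : Cochain R Q m) (bs : List (BarLetter R Q)) :
    acyclicMul R Q (tens R Q a (barWord as)) (headMulA R Q (homog b) (barWord bs)) =
      leftMul R Q a (wordProdCup as b bs) := by
  obtain _ | ⟨c, l⟩ := bs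
  · rw [barWord_nil, headMulA_one, map_zero, wordProdCup, map_zero]
  · rw [barWord_cons, headMulA_mul, susp_elem, mulA_homog, acyclicMul_tens_tens, wordProdCup]

/-- By linearity `z` is a generator. The Leibniz rule for left multiplication and `diffA_wordProd`
then give all terms. `wordProdAct` and `wordProdCup` match the parts of the two differentials that
absorb the first letter of a word into the coefficient. -/
theorem diffA_acyclicMul_tens {n : ℕ} (a : Cochain R Q n) (as : List (BarLetter R Q))
    (z : Acyclic R Q) :
    diffA R Q (acyclicMul R Q (tens R Q (homog a) (barWord as)) z) =
      acyclicMul R Q (diffA R Q (tens R Q (homog a) (barWord as))) z +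
      (-1 : R) ^ (n + barDegree as) •
        acyclicMul R Q (tens R Q (homog a) (barWord as)) (diffA R Q z) := by
  induction z using acyclic_generators_induction with
  | h m b bs =>
    simp only [diffA_tmul, diffB_barWord, deltaA_homog, signA_homog, map_add, map_sub, map_smul,
      LinearMap.add_apply, LinearMap.sub_apply, LinearMap.smul_apply, acyclicMul_tens_tens,
      acyclicMul_listDiff_left, acyclicMul_listDiff_right, acyclicMul_headMulA_left,
      acyclicMul_headMulA_right, diffA_leftMul, diffA_wordProd, pow_add]
    module
  | ha x y hx hy =>
    rw [map_add, map_add, hx, hy, map_add, map_add, map_add, smul_add]; abel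
  | hs r x hx => rw [map_smul, map_smul, hx, map_smul, map_smul, map_smul, smul_add, smul_comm r]

theorem acyclicMul_one_left (z : Acyclic R Q) :
    acyclicMul R Q (tens R Q (homog Cochain.unit) 1) z = z := by
  induction z using acyclic_generators_induction with
  | h m b bs =>
    rw [← barWord_nil, acyclicMul_tens_tens, wordProd, biSplit, splitSum, splitSum_eq_left]
    · rw [leadA_nil_nil, barProd_nil_left, map_smul, leftMul_tmul, mulA_unit_left]
      simp
    · intro c x y
      rw [leadA_nil_cons, map_zero, LinearMap.zero_apply, smul_zero]
  | ha x y hx hy => rw [map_add, hx, hy]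
  | hs r x hx => rw [map_smul, hx]

theorem acyclicMul_one_right (z : Acyclic R Q) :
    acyclicMul R Q z (tens R Q (homog Cochain.unit) 1) = z := by
  induction z using acyclic_generators_induction with
  | h m b bs =>
    rw [← barWord_nil, acyclicMul_tens_tens, wordProd, biSplit]
    simp only [splitSum]
    rw [splitSum_eq_left]
    · rw [leadA_nil_nil, barProd_nil_right, map_smul, leftMul_tmul, mulA_unit_right]
      simp
    · intro c x y
      rw [leadA_zero, emptyPair, if_neg (by simp), map_zero, LinearMap.zero_apply, smul_zero]
  | ha x y hx hy => rw [map_add, LinearMap.add_apply, hx, hy]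
  | hs r x hx => rw [map_smul, LinearMap.smul_apply, hx]

end AcyclicProduct

/-! ### Degrees -/

section Degree

variable {R : Type v} [CommRing R] {Q : CubicalSet.{u}}

variable (R Q) in
/-- The degree `k` part of the bar construction. -/
def barDegreePart (k : ℕ) : Submodule R (Bar R Q) :=
  Submodule.span R {w | ∃ l : List (BarLetter R Q), barDegree l = k ∧ w = barWord l}

theorem barWord_mem (l : List (BarLetter R Q)) : barWord l ∈ barDegreePart R Q (barDegree l) :=
  Submodule.subset_span ⟨l, rfl, rfl⟩

theorem barι_mul_mem {n k : ℕ} (a : Cochain R Q (n + 1)) {w : Bar R Q}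
    (hw : w ∈ barDegreePart R Q k) : barι a * w ∈ barDegreePart R Q (n + k) := by
  induction hw using Submodule.span_induction with
  | mem w hw =>
    obtain ⟨l, rfl, rfl⟩ := hw
    exact Submodule.subset_span ⟨⟨n, a⟩ :: l, barDegree_cons _ _, (barWord_cons (⟨n, a⟩ : BarLetter R Q) l).symm⟩
  | zero => rw [mul_zero]; exact Submodule.zero_mem _
  | add x y _ _ hx hy => rw [mul_add]; exact Submodule.add_mem _ hx hy
  | smul r x _ hx => rw [mul_smul_comm]; exact Submodule.smul_mem _ r hx

theorem acyclicBarMk_mem {n k : ℕ} (a : Cochain R Q n) {w : Bar R Q}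
    (hw : w ∈ barDegreePart R Q k) : acyclicBarMk a w ∈ acyclicBarDegree R Q (n + k) := by
  induction hw using Submodule.span_induction with
  | mem w hw =>
    obtain ⟨l, rfl, rfl⟩ := hw
    exact Submodule.subset_span ⟨n, a, l, rfl, rfl⟩
  | zero => rw [acyclicBarMk, TensorProduct.tmul_zero]; exact Submodule.zero_mem _
  | add x y _ _ hx hy =>
    rw [acyclicBarMk, TensorProduct.tmul_add]; exact Submodule.add_mem _ hx hy
  | smul r x _ hx => rw [acyclicBarMk, TensorProduct.tmul_smul]; exact Submodule.smul_mem _ r hx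

theorem listDiff_mem {M : Type*} [AddCommGroup M] [Module R M] {S : ℕ → Submodule R M}
    {F : List (BarLetter R Q) → M} (hF : ∀ l, F l ∈ S (barDegree l)) (l : List (BarLetter R Q)) :
    listDiff F l ∈ S (barDegree l + 1) := by
  induction l generalizing F S with
  | nil => exact Submodule.zero_mem _
  | cons a l ih =>
    have h1 : F (a.coboundary :: l) ∈ S (barDegree (a :: l) + 1) := by
      have h := hF (a.coboundary :: l)
      rw [barDegree_cons, BarLetter.coboundary] at h
      rw [barDegree_cons, add_right_comm]
      exact h
    obtain _ | ⟨b, l⟩ := l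
    · exact Submodule.neg_mem _ h1
    · refine Submodule.add_mem _ (Submodule.sub_mem _ (Submodule.neg_mem _ h1)
        (Submodule.smul_mem _ _ ?_)) (Submodule.smul_mem _ _ ?_)
      · have h := hF (a.cup b :: l)
        rw [barDegree_cons] at h
        have e : barDegree (a :: b :: l) + 1 = (a.cup b).1 + barDegree l := by
          rw [barDegree_cons, barDegree_cons, BarLetter.cup]
          ring
        rwa [e]
      -- Fixing the first letter shifts the family of degree parts by its degree.
      · have h := ih (S := fun k => S (a.1 + k)) (F := fun x => F (a :: x)) fun x => by
          rw [← barDegree_cons]; exact hF _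
        rw [barDegree_cons, add_assoc]
        exact h

theorem barDiff_mem (l : List (BarLetter R Q)) :
    barDiff l ∈ barDegreePart R Q (barDegree l + 1) := by
  rw [barDiff_eq]
  exact listDiff_mem barWord_mem l

theorem barProd_mem (as bs : List (BarLetter R Q)) :
    barProd as bs ∈ barDegreePart R Q (barDegree as + barDegree bs) := by
  obtain ⟨k, hk⟩ : ∃ k, as.length + bs.length < k := ⟨_, Nat.lt_succ_self _⟩
  induction k generalizing as bs with
  | zero => omega
  | succ k ih =>
    rw [barProd]
    split_ifs with h
    · rw [h.1, h.2, ← barWord_nil]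
      exact barWord_mem []
    · refine Submodule.sum_mem _ fun i _ => Submodule.sum_mem _ fun j _ => ?_
      split_ifs with h0
      · refine Submodule.smul_mem _ _ ?_
        have hi := i.2
        have hj := j.2
        have h1 := barι_mul_mem (hirsch (as.take i) (bs.take j))
          (ih (as.drop i) (bs.drop j) (by simp only [List.length_drop]; omega))
        have ha := barDegree_append (as.take i) (as.drop i)
        have hb := barDegree_append (bs.take j) (bs.drop j)
        rw [List.take_append_drop] at ha hb
        convert h1 using 2
        omega
      · exact Submodule.zero_mem _

theorem sub_mem_acyclicBarDegree {k : ℕ} {x y : AcyclicBar R Q} (hx : x ∈ acyclicBarDegree R Q k)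
    (hy : y ∈ acyclicBarDegree R Q k) : x - y ∈ acyclicBarDegree R Q k := by
  have h : x - y = x + (-1 : R) • y := by module
  rw [h]
  exact Submodule.add_mem _ hx (Submodule.smul_mem _ _ hy)

theorem acyclicBarDiff_mem {n : ℕ} (a : Cochain R Q n) (as : List (BarLetter R Q)) :
    acyclicBarDiff a as ∈ acyclicBarDegree R Q (n + barDegree as + 1) := by
  rw [acyclicBarDiff.eq_def]
  have h1 := acyclicBarMk_mem a.coboundary (barWord_mem as)
  rw [add_right_comm] at h1
  have h2 := acyclicBarMk_mem a (barDiff_mem as)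
  refine sub_mem_acyclicBarDegree (Submodule.add_mem _ h1
    (Submodule.smul_mem (acyclicBarDegree R Q (n + barDegree as + 1)) ((-1 : R) ^ n) h2)) ?_
  · obtain _ | ⟨c, l⟩ := as
    · exact Submodule.zero_mem _
    · have h := Submodule.smul_mem _ ((-1 : R) ^ n) (acyclicBarMk_mem (a.cup c.2) (barWord_mem l))
      rw [barDegree_cons]
      convert h using 2
      ring

theorem acyclicBarMk_hirschLead_mem {n m : ℕ} (a : Cochain R Q n) (as : List (BarLetter R Q))
    (b : Cochain R Q m) (bs : List (BarLetter R Q)) (p q : ℕ) :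
    acyclicBarMk (a.cup (hirschLead (as.take p) b (bs.take q))) (barProd (as.drop p) (bs.drop q)) ∈
      acyclicBarDegree R Q ((n + barDegree as) + (m + barDegree bs)) := by
  have h := acyclicBarMk_mem (a.cup (hirschLead (as.take p) b (bs.take q)))
    (barProd_mem (as.drop p) (bs.drop q))
  have ha := barDegree_append (as.take p) (as.drop p)
  have hb := barDegree_append (bs.take q) (bs.drop q)
  rw [List.take_append_drop] at ha hb
  convert h using 2
  omega

end Degree

/-! ### Singular cubes -/

section Singular

theorem endpoint_mem_oneSkeleton_one (t : Fin 1 → unitInterval) : t ∈ oneSkeleton 1 :=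
  fun i j h => absurd (Subsingleton.elim i j) h

/-- The `1`-skeleton of `I^0` and of `I^1` is the whole cube, so cubes of these dimensions are
constant, and a constant edge is the degeneracy of its endpoint. -/
instance oneReduced_singOne (Z : Type u) [TopologicalSpace Z] (z₀ : Z) :
    OneReduced (singOne Z z₀) where
  eq_of_dim_zero σ τ := by
    have h : ∀ t : Fin 0 → unitInterval, t ∈ oneSkeleton 0 := fun t i => i.elim0
    refine Subtype.ext (ContinuousMap.ext fun t => ?_)
    exact (σ.2 t (h t)).trans (τ.2 t (h t)).symm
  isDegenerate_of_dim_one := by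
    rintro ⟨n, σ⟩ h
    obtain rfl : n = 1 := h
    refine ⟨0, 0, (singOne Z z₀).face false 0 σ, congrArg (Sigma.mk 1) ?_⟩
    refine Subtype.ext (ContinuousMap.ext fun t => ?_)
    exact (σ.2 t (endpoint_mem_oneSkeleton_one t)).trans
      (σ.2 _ (endpoint_mem_oneSkeleton_one _)).symm

end Singular

end CubicalBar

end

/-! ### The dg algebra structure for singular cubes. -/

open CubicalBar
open scoped TensorProduct
theorem corollary8p3 (R : Type*) [CommRing R] (Z : Type*) [TopologicalSpace Z] (z₀ : Z) :
    ∃ (d : AcyclicBar R (singOne Z z₀) →ₗ[R] AcyclicBar R (singOne Z z₀))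
      (μ : AcyclicBar R (singOne Z z₀) →ₗ[R] AcyclicBar R (singOne Z z₀) →ₗ[R]
        AcyclicBar R (singOne Z z₀)),
      (∀ (n : ℕ) (a₀ : Cochain R (singOne Z z₀) n) (as : List (BarLetter R (singOne Z z₀))),
        d (acyclicBarMk a₀ (barWord as)) = acyclicBarDiff a₀ as) ∧
      (∀ (n m : ℕ) (a₀ : Cochain R (singOne Z z₀) n) (b₀ : Cochain R (singOne Z z₀) m)
        (as bs : List (BarLetter R (singOne Z z₀))),
        μ (acyclicBarMk a₀ (barWord as)) (acyclicBarMk b₀ (barWord bs)) =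
          ∑ p ∈ Finset.range (as.length + 1), ∑ q ∈ Finset.Icc 1 (bs.length + 1),
            (-1 : R) ^ (barDegree (as.take p) +
                barDegree (as.drop p) * (m + barDegree (bs.take (q - 1)))) •
              acyclicBarMk (a₀.cup (hirschLead (as.take p) b₀ (bs.take (q - 1))))
                (barProd (as.drop p) (bs.drop (q - 1)))) ∧
      (∀ k, ∀ x ∈ acyclicBarDegree R (singOne Z z₀) k,
        d x ∈ acyclicBarDegree R (singOne Z z₀) (k + 1)) ∧
      (∀ x, d (d x) = 0) ∧
      (∀ j k, ∀ x ∈ acyclicBarDegree R (singOne Z z₀) j,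
        ∀ y ∈ acyclicBarDegree R (singOne Z z₀) k,
          μ x y ∈ acyclicBarDegree R (singOne Z z₀) (j + k)) ∧
      (∀ x, μ (acyclicBarMk Cochain.unit 1) x = x ∧ μ x (acyclicBarMk Cochain.unit 1) = x) ∧
      (∀ j, ∀ x ∈ acyclicBarDegree R (singOne Z z₀) j, ∀ y,
        d (μ x y) = μ (d x) y + (-1 : R) ^ j • μ x (d y)) := by
  set Q := singOne Z z₀
  -- `toAcyclic` is the identity on elements, so the identities proved on `Acyclic` hold by
  -- definition for the transported maps.
  let μ : AcyclicBar R Q →ₗ[R] AcyclicBar R Q →ₗ[R] AcyclicBar R Q :=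
    LinearMap.mk₂ R (fun x y => (toAcyclic R Q).symm
        (acyclicMul R Q (toAcyclic R Q x) (toAcyclic R Q y)))
      (fun x y z => by rw [map_add, map_add, LinearMap.add_apply, map_add])
      (fun r x y => by rw [map_smul, map_smul, LinearMap.smul_apply, map_smul])
      (fun x y z => by rw [map_add, map_add, map_add])
      (fun r x y => by rw [map_smul, map_smul, map_smul])
  let d : AcyclicBar R Q →ₗ[R] AcyclicBar R Q :=
    (toAcyclic R Q).symm.toLinearMap ∘ₗ diffA R Q ∘ₗ (toAcyclic R Q).toLinearMap
  have hd : ∀ (n : ℕ) (a : Cochain R Q n) (as : List (BarLetter R Q)),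
      d (acyclicBarMk a (barWord as)) = acyclicBarDiff a as := fun n a as =>
    diffA_toAcyclic a as
  have hμ : ∀ (n m : ℕ) (a : Cochain R Q n) (b : Cochain R Q m) (as bs : List (BarLetter R Q)),
      μ (acyclicBarMk a (barWord as)) (acyclicBarMk b (barWord bs)) =
        ∑ p ∈ Finset.range (as.length + 1), ∑ q ∈ Finset.Icc 1 (bs.length + 1),
          (-1 : R) ^ (barDegree (as.take p) +
              barDegree (as.drop p) * (m + barDegree (bs.take (q - 1)))) •
            acyclicBarMk (a.cup (hirschLead (as.take p) b (bs.take (q - 1))))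
              (barProd (as.drop p) (bs.drop (q - 1))) := fun n m a b as bs =>
    (acyclicMul_tens_tens (homog a) as b bs).trans (leftMul_wordProd a as b bs)
  refine ⟨d, μ, hd, hμ, fun k x hx => ?_, fun x => diffA_diffA x, fun j k x hx y hy => ?_,
    fun x => ⟨acyclicMul_one_left x, acyclicMul_one_right x⟩, fun j x hx y => ?_⟩
  -- The statements about degrees and the Leibniz rule are linear in each homogeneous argument, so
  -- it suffices to check them on generators.
  · induction hx using Submodule.span_induction with
    | mem x hx =>
      obtain ⟨n, a, as, rfl, rfl⟩ := hx
      rw [hd]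
      exact acyclicBarDiff_mem a as
    | zero => rw [map_zero]; exact Submodule.zero_mem _
    | add x y _ _ hx hy => rw [map_add]; exact Submodule.add_mem _ hx hy
    | smul r x _ hx => rw [map_smul]; exact Submodule.smul_mem _ r hx
  · induction hx using Submodule.span_induction with
    | mem x hx =>
      obtain ⟨n, a, as, rfl, rfl⟩ := hx
      induction hy using Submodule.span_induction with
      | mem y hy =>
        obtain ⟨m, b, bs, rfl, rfl⟩ := hy
        rw [hμ]
        exact Submodule.sum_mem _ fun p _ => Submodule.sum_mem _ fun q _ =>
          Submodule.smul_mem _ _ (acyclicBarMk_hirschLead_mem a as b bs p (q - 1))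
      | zero => rw [map_zero]; exact Submodule.zero_mem _
      | add x y _ _ hx hy => rw [map_add]; exact Submodule.add_mem _ hx hy
      | smul r x _ hx => rw [map_smul]; exact Submodule.smul_mem _ r hx
    | zero => rw [map_zero, LinearMap.zero_apply]; exact Submodule.zero_mem _
    | add x y _ _ hx hy => rw [map_add, LinearMap.add_apply]; exact Submodule.add_mem _ hx hy
    | smul r x _ hx => rw [map_smul, LinearMap.smul_apply]; exact Submodule.smul_mem _ r hx
  · induction hx using Submodule.span_induction with
    | mem x hx =>
      obtain ⟨n, a, as, rfl, rfl⟩ := hx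
      exact diffA_acyclicMul_tens a as y
    | zero => simp only [map_zero, LinearMap.zero_apply, smul_zero, add_zero]
    | add x z _ _ hx hz =>
      simp only [map_add, LinearMap.add_apply, hx, hz, smul_add]
      abel
    | smul r x _ hx =>
      simp only [map_smul, LinearMap.smul_apply, hx, smul_add]
      rw [smul_comm r]
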